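/- Let $q\in C^2(0,2\pi)\cap L_2(0,2\pi)$ be real-valued, and put $\widetilde q(x)=q(x)$ for $0<x<2\pi$, $\widetilde q(x)=q(x+2\pi)$ for $-2\pi<x<0$ and $\widetilde q(x)=0$ otherwise. *Response matrix.* For $w$ on $[0,2\pi]$ let $\Gamma_0w=\begin{pmatrix}w(0)-w(2\pi)\\ w'(0)-w'(2\pi)\end{pmatrix}$ and $\Gamma_1w=\frac12\begin{pmatrix}w'(0)+w'(2\pi)\\ -w(0)-w(2\pi)\end{pmatrix}$. For $F=(f_1,f_2)^{\top}\in C_0^\infty(0,2\pi;\mathbb R^2)$ let $u^F$ be the solution of $u_{tt}-u_{xx}+qu=0$ for $0<x<2\pi$, $0<t<2\pi$, with $\Gamma_0u=(f_1,f_2')^{\top}$ and $u=u_t=0$ at $t=0$. There is a matrix-valued function $R=(r_{ij})_{i,j=1,2}$, continuous and integrable on $(0,2\pi)$, the response matrix, such that for all such $F$ $$\Gamma_1u^F(t)=-\tfrac12\begin{pmatrix}f_1'(t)\\-f_2(t)\end{pmatrix}+\int_0^tR(t-s)F(s)\,ds,\qquad 0<t<2\pi .$$ *Control and connecting operators.*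 Let $0<T\le\pi$. For $F\in L_2(0,T;\mathbb R^2)$ let $v^F\in C([0,T];L_2(\mathbb R))$ be the generalized solution of $v_{tt}-v_{xx}+\widetilde qv=0$ ($x\ne0$, $0<t<T$) with $v(0+,t)-v(0-,t)=f_1(t)$, $v_x(0+,t)-v_x(0-,t)=f_2'(t)$ and $v=v_t=0$ at $t=0$. It exists, and $v^F(\cdot,T)$ is uniquely determined by $F$ and vanishes outside $(-T,T)$. The control operator $W^T:L_2(0,T;\mathbb R^2)\to L_2(-T,T)$, $W^TF=v^F(\cdot,T)$, is bounded, and the connecting operator $C^T$ is the bounded operator on $L_2(0,T;\mathbb R^2)$ with $(C^TF,G)=(W^TF,W^TG)$ for all $F,G$. It is given explicitly by the response matrix: $$(C^TF)(t)=\tfrac12F(t)+\int_0^TC(t,s)F(s)\,ds,$$ $$C_{11}(t,s)=\tfrac12\big[p_{11}(2T-t-s)-p_{11}(|t-s|)\big],\qquad C_{12}(t,s)=\tfrac12\big[\widetilde p_{12}(2T-t-s)-\widetilde p_{12}(t-s)\big],$$ $$C_{21}(t,s)=\tfrac12\big[\widetilde r_{21}(t-s)+\widetilde r_{21}(2T-t-s)\big],\qquad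 C_{22}(t,s)=\tfrac12\big[r_{22}(|t-s|)+r_{22}(2T-t-s)\big],$$ where $p_{ij}(s)=\int_0^sr_{ij}(\alpha)\,d\alpha$ and a tilde denotes the odd extension of a function from $s>0$. *Krein equation.* Let $y$ be the solution of $-y''+\widetilde qy=0$ on $(-\pi,\pi)$ with $y(0)=0$, $y'(0)=1$ ($y\in C^1(-\pi,\pi)$, the equation holding for $x\neq0$). For every $0<T\le\pi$ there is exactly one control $F\in L_2(0,T;\mathbb R^2)$ with $W^TF=y$ in $L_2(-T,T)$, and this $F$ is the unique solution in $L_2(0,T;\mathbb R^2)$ of the Krein equation $$(C^TF)(t)=(T-t)\begin{pmatrix}1\\0\end{pmatrix},\qquad t\in(0,T).$$ *Recovery.* For $0<T<\pi$ the solution $F=(f_1,f_2)^{\top}$ of the Krein equation has a representative continuous on $[0,T]$, and $y(T)=\frac12f_1(0)-\frac12f_2(0)$, $y(-T)=-\frac12f_1(0)-\frac12f_2(0)$; so solving the Krein equation for all $T\in(0,\pi)$ recovers $y$ on $(-\pi,\pi)$. The zeros of $y$ in $(-\pi,\pi)$ are isolated. For $x\in(-\pi,\pi)$, $x\ne0$,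 one has $\widetilde q(x)=y''(x)/y(x)$ if $y(x)\neq0$, and $\widetilde q(x)=\lim_{z\to x}y''(z)/y(z)$ in every case. Finally $q(x)=\widetilde q(x)$ for $0<x<\pi$ and $q(x)=\widetilde q(x-2\pi)$ for $\pi<x<2\pi$. -/

import Mathlib

open Set Filter Topology MeasureTheory
open scoped Real ContDiff RealInnerProductSpace

noncomputable section

namespace KreinPeriodic

/-! ### The problem with periodic boundary conditions and its response matrix -/

/-- The boundary operator `Γ₀ w = (w(0) - w(2π), w'(0) - w'(2π))`, for `w` of class `C¹` on
`[0, 2π]` (one-sided derivatives at the end points). -/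
def Gamma0 (w : ℝ → ℝ) : Fin 2 → ℝ :=
  ![w 0 - w (2 * π),
    derivWithin w (Icc 0 (2 * π)) 0 - derivWithin w (Icc 0 (2 * π)) (2 * π)]

/-- The boundary operator `Γ₁ w = ½ (w'(0) + w'(2π), -w(0) - w(2π))`. -/
def Gamma1 (w : ℝ → ℝ) : Fin 2 → ℝ :=
  ![(derivWithin w (Icc 0 (2 * π)) 0 + derivWithin w (Icc 0 (2 * π)) (2 * π)) / 2,
    (-w 0 - w (2 * π)) / 2]

/-- `u x t` is the classical solution, for `0 ≤ x ≤ 2π` and `0 ≤ t < 2π`, of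
`u_tt - u_xx + q u = 0`, `Γ₀ u = (f₁, f₂')`, `u = u_t = 0` at `t = 0`.
It is `C¹` up to the boundary and `C²` inside. -/
structure IsClassicalSolution (q f₁ f₂ : ℝ → ℝ) (u : ℝ → ℝ → ℝ) : Prop where
  contDiffOn_one :
    ContDiffOn ℝ 1 (fun p : ℝ × ℝ => u p.1 p.2) (Icc 0 (2 * π) ×ˢ Ico 0 (2 * π))
  contDiffOn_two :
    ContDiffOn ℝ 2 (fun p : ℝ × ℝ => u p.1 p.2) (Ioo 0 (2 * π) ×ˢ Ioo 0 (2 * π))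
  wave : ∀ x ∈ Ioo 0 (2 * π), ∀ t ∈ Ioo 0 (2 * π),
    iteratedDeriv 2 (fun τ => u x τ) t - iteratedDeriv 2 (fun ξ => u ξ t) x + q x * u x t = 0
  boundary : ∀ t ∈ Ioo 0 (2 * π), Gamma0 (fun x => u x t) = ![f₁ t, deriv f₂ t]
  initial : ∀ x ∈ Icc 0 (2 * π), u x 0 = 0
  initial_deriv : ∀ x ∈ Icc 0 (2 * π), derivWithin (fun τ => u x τ) (Ico 0 (2 * π)) 0 = 0

/-- A scalar control in `C₀^∞(0, 2π)`. -/
def IsSmoothControl (f : ℝ → ℝ) : Prop :=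
  ContDiff ℝ ∞ f ∧ HasCompactSupport f ∧ tsupport f ⊆ Ioo 0 (2 * π)

/-- `r` is the response matrix on `(0, 2π)`: the response operator `F ↦ Γ₁ u^F`, defined on
smooth compactly supported controls, equals `-½ (f₁', -f₂) + r * F` (convolution in time). -/
structure IsResponseMatrix (q : ℝ → ℝ) (r : ℝ → Matrix (Fin 2) (Fin 2) ℝ) : Prop where
  continuousOn : ∀ i j, ContinuousOn (fun t => r t i j) (Ioo 0 (2 * π))
  integrableOn : ∀ i j, IntegrableOn (fun t => r t i j) (Ioo 0 (2 * π))
  exists_solution : ∀ f₁ f₂ : ℝ → ℝ, IsSmoothControl f₁ → IsSmoothControl f₂ →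
    ∃ u, IsClassicalSolution q f₁ f₂ u
  response : ∀ f₁ f₂ : ℝ → ℝ, IsSmoothControl f₁ → IsSmoothControl f₂ →
    ∀ u, IsClassicalSolution q f₁ f₂ u → ∀ t ∈ Ioo 0 (2 * π), ∀ i : Fin 2,
      Gamma1 (fun x => u x t) i =
        (![-(deriv f₁ t) / 2, f₂ t / 2] : Fin 2 → ℝ) i
          + ∫ s in (0 : ℝ)..t, (r (t - s) i 0 * f₁ s + r (t - s) i 1 * f₂ s)

/-! ### The auxiliary problem on the line -/

/-- The potential on the line: `q` on `(0, 2π)`, its `2π`-shift on `(-2π, 0)`, zero elsewhere. -/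
def qTilde (q : ℝ → ℝ) (x : ℝ) : ℝ :=
  if 0 < x ∧ x < 2 * π then q x
  else if -(2 * π) < x ∧ x < 0 then q (x + 2 * π)
  else 0

/-- The outer space `L₂(0, T; ℝ²)` of controls. -/
abbrev Controls (T : ℝ) : Type :=
  Lp (EuclideanSpace ℝ (Fin 2)) 2 (volume.restrict (Ioo (0 : ℝ) T))

/-- The inner space `L₂(-T, T)` of states. -/
abbrev States (T : ℝ) : Type :=
  Lp ℝ 2 (volume.restrict (Ioo (-T) T))

/-- `v ∈ C([0, T]; L₂(ℝ))` is the generalized solution of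
`v_tt - v_xx + q̃ v = 0` for `x ≠ 0`, `0 < t < T`, with jumps `v₊ - v₋ = f₁`,
`v'₊ - v'₋ = f₂'` at `x = 0` and `v = v_t = 0` at `t = 0`.
The test functions vanish near `t = T` and beyond, but neither at `t = 0` nor at `x = 0`, so the
initial conditions and the jump conditions are part of the identity. -/
def IsGeneralizedSolution (q : ℝ → ℝ) (T : ℝ) (F : Controls T)
    (v : ℝ → Lp ℝ 2 (volume : Measure ℝ)) : Prop :=
  ContinuousOn v (Icc 0 T) ∧
  ∀ φ : ℝ → ℝ → ℝ, ContDiff ℝ ∞ (fun p : ℝ × ℝ => φ p.1 p.2) →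
    HasCompactSupport (fun p : ℝ × ℝ => φ p.1 p.2) →
    tsupport (fun p : ℝ × ℝ => φ p.1 p.2) ⊆ {p | p.2 < T} →
    ∫ t in (0 : ℝ)..T, ∫ x, v t x *
        (iteratedDeriv 2 (fun τ => φ x τ) t - iteratedDeriv 2 (fun ξ => φ ξ t) x
          + qTilde q x * φ x t)
      = ∫ t in (0 : ℝ)..T,
          (F t 0 * deriv (fun ξ => φ ξ t) 0 + F t 1 * deriv (fun τ => φ 0 τ) t)

/-- `W` is the control operator `F ↦ v^F(·, T)`: for every control a generalized solution exists,
and its state at time `T`, which vanishes outside `(-T, T)`, is `W F`. -/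
def IsControlOperator (q : ℝ → ℝ) (T : ℝ) (W : Controls T →L[ℝ] States T) : Prop :=
  ∀ F : Controls T,
    (∃ v, IsGeneralizedSolution q T F v) ∧
    ∀ v, IsGeneralizedSolution q T F v →
      (v T : ℝ → ℝ) =ᵐ[volume] (Ioo (-T) T).indicator (W F : ℝ → ℝ)

/-- `C` is the connecting operator: `(C F, G) = (W F, W G)`. -/
def IsConnectingOperator {T : ℝ} (W : Controls T →L[ℝ] States T)
    (C : Controls T →L[ℝ] Controls T) : Prop :=
  ∀ F G : Controls T, ⟪C F, G⟫ = ⟪W F, W G⟫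

/-! ### The connecting operator in terms of the response matrix -/

/-- The odd extension of a function on `(0, ∞)`. -/
def oddExt (f : ℝ → ℝ) (s : ℝ) : ℝ :=
  if 0 < s then f s else if s < 0 then -f (-s) else 0

/-- `∫₀ˢ r_{ij}`. -/
def primitive (r : ℝ → Matrix (Fin 2) (Fin 2) ℝ) (i j : Fin 2) (s : ℝ) : ℝ :=
  ∫ α in (0 : ℝ)..s, r α i j

/-- The matrix kernel of the integral part of the connecting operator. -/
def connectingKernel (r : ℝ → Matrix (Fin 2) (Fin 2) ℝ) (T t s : ℝ) :
    Matrix (Fin 2) (Fin 2) ℝ :=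
  (1 / 2 : ℝ) •
    !![primitive r 0 0 (2 * T - t - s) - primitive r 0 0 |t - s|,
        oddExt (primitive r 0 1) (2 * T - t - s) - oddExt (primitive r 0 1) (t - s);
      oddExt (fun α => r α 1 0) (t - s) + oddExt (fun α => r α 1 0) (2 * T - t - s),
        r |t - s| 1 1 + r (2 * T - t - s) 1 1]

/-- `F ↦ ½ F(t) + ∫₀ᵀ C(t, s) F(s) ds`. -/
def explicitConnecting (r : ℝ → Matrix (Fin 2) (Fin 2) ℝ) (T : ℝ)
    (F : ℝ → EuclideanSpace ℝ (Fin 2)) (t : ℝ) : EuclideanSpace ℝ (Fin 2) :=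
  WithLp.toLp 2 fun i => F t i / 2 +
    ∫ s in (0 : ℝ)..T,
      (connectingKernel r T t s i 0 * F s 0 + connectingKernel r T t s i 1 * F s 1)

/-! ### The Cauchy problem -/

/-- `y` solves `-y'' + q̃ y = 0` on `(-π, π)`, `y(0) = 0`, `y'(0) = 1`. As `q̃` may jump at `0`,
`y` is of class `C¹` and the equation is required for `x ≠ 0`. -/
structure IsCauchySolution (q y : ℝ → ℝ) : Prop where
  contDiffOn : ContDiffOn ℝ 1 y (Ioo (-π) π)
  ode : ∀ x ∈ Ioo (-π) π, x ≠ 0 → HasDerivAt (deriv y) (qTilde q x * y x) x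
  value_zero : y 0 = 0
  deriv_zero : deriv y 0 = 1

end KreinPeriodic

end

noncomputable section

namespace KreinPeriodic

/-! ### The kernel of the scattered wave -/

/-! Everything is read off from waves on the line. An incoming wave `c(x) f(t - |x|)` is scattered
by a potential `Q` into a time convolution `∫ k(x, t - s) f(s) ds`. The kernel `k` solves a Volterra
equation, namely Duhamel's formula with the free propagator `½ 1{|x - ξ| ≤ t - τ}`, and it is
obtained by contraction in a weighted sup norm (`exists_isWaveKernel`). The profiles `sgn / 2` and
`-1 / 2` produce at the origin a jump `f₁` of the value and a jump `f₂'` of the slope. Since the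
kernel acts by convolution, time derivatives fall on the control, and space derivatives come from
`IsWaveKernel.duhamel`; no smoothness of `k` is needed.

Response matrix. For `t < 2π` the sum of the line wave at `x` and at `x - 2π` solves the periodic
problem on `(0, 2π)`: both copies see the potential `q` there, and by finite speed neither has
reached the opposite end, so `Γ₀` returns the jumps at the origin and `Γ₁` the means of the
one-sided values. These means are convolutions of the control, which gives the matrix. Classical
solutions are unique by integration along characteristics (`IsClassicalSolution.eq_zero`), hence
every solution has this response, and the matrix itself is unique by the fundamental lemma of the
calculus of variations.

Control operator. Green's identity (`IsKernelPair.green`), followed by density of smooth controls,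
shows that the line wave is a generalized solution (`IsKernelPair.weak_identity`). For uniqueness, a
solution with zero data is tested against time cutoffs of free waves running backwards; this yields
a Duhamel formula in duality and then `‖z(t)‖ ≤ L ∫₀ᵗ ‖z‖` (`eq_zero_of_weak_identity`).

Connecting operator. In Green's identity for the wave of `F` the multiplier is the odd reflection
about `t = T` of the wave whose control is the primitive of `G`. It vanishes at `T`, where minus its
velocity is the wave of `G`, so `(WF, WG)` equals an integral of traces at the origin at times up to
`2T ≤ 2π` (`IsKernelPair.inner_wave`), and these traces are convolutions with the response matrix.
The resulting kernel is not visibly the stated one; symmetry of the inner product forces `p₁₂ = r₂₁`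
(`IsKernelPair.response_symm`), which removes the difference.

Krein equation. Read at `x = ±(T - t)`, the equation `WF = w` is a Volterra equation of the second
kind for the control, because only controls acting before time `t` influence these two points by
scattering. Hence `W` is injective and reaches every continuous state by a continuous control. The
function `(T - t) y(x)` solves the wave equation off the origin, and as a multiplier it gives `W* y
= (T - t, 0)` (`IsKernelPair.inner_controlOp_cauchy`). With `C = W* W` injective, the Krein equation
is equivalent to `WF = y`. At `t = 0` the Volterra term vanishes and the equation gives the recovery
formulas for `y(±T)`.

Finally `y² + y'²` is bounded and never zero (`IsCauchySolution.energy`). The zeros of `y` are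
therefore simple and isolated, and off them `y'' / y` equals the potential, which is continuous away
from the origin. -/

/-- The exponentially weighted time integral `∫ e^{lσ} h(ξ, σ) dσ` over `|ξ| ≤ σ ≤ u`. -/
def coneIntegral (l : ℝ) (h : ℝ × ℝ → ℝ) (p : ℝ × ℝ) : ℝ :=
  ∫ σ in |p.1|..max |p.1| p.2, Real.exp (l * σ) * h (p.1, σ)

theorem continuous_coneIntegral (l : ℝ) {h : ℝ × ℝ → ℝ} (hh : Continuous h) :
    Continuous (coneIntegral l h) := by
  have key : Continuous (Function.uncurry fun (p : ℝ × ℝ) (σ : ℝ) =>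
      Real.exp (l * σ) * h (p.1, σ)) := by fun_prop
  have hi : ∀ p : ℝ × ℝ, ∀ a b : ℝ, IntervalIntegrable
      (fun σ => Real.exp (l * σ) * h (p.1, σ)) volume a b := fun p a b =>
    (by fun_prop : Continuous fun σ => Real.exp (l * σ) * h (p.1, σ)).intervalIntegrable a b
  have h1 := intervalIntegral.continuous_parametric_intervalIntegral_of_continuous
    (μ := volume) (a₀ := 0) key (s := fun p : ℝ × ℝ => max |p.1| p.2) (by fun_prop)
  have h2 := intervalIntegral.continuous_parametric_intervalIntegral_of_continuous
    (μ := volume) (a₀ := 0) key (s := fun p : ℝ × ℝ => |p.1|) (by fun_prop)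
  refine (h1.sub h2).congr fun p => ?_
  simp only [Pi.sub_apply]
  rw [intervalIntegral.integral_interval_sub_left (hi p _ _) (hi p _ _)]
  rfl

/-- Integrating the weight `exp (l σ)` gains a factor `1 / l`. This gain makes the Volterra operator
a contraction once `l` exceeds the `L¹` norm of the potential. -/
theorem abs_coneIntegral_le {l : ℝ} (hl : 0 < l) {h : ℝ × ℝ → ℝ} {K : ℝ}
    (hK : ∀ p, |h p| ≤ K) (p : ℝ × ℝ) {u : ℝ} (hu : p.2 ≤ u) (hu0 : |p.1| ≤ u) :
    |coneIntegral l h p| ≤ K / l * Real.exp (l * u) := by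
  have hK0 : 0 ≤ K := (abs_nonneg _).trans (hK 0)
  have hle : |p.1| ≤ max |p.1| p.2 := le_max_left _ _
  have h1 : |coneIntegral l h p| ≤ ∫ σ in |p.1|..max |p.1| p.2, Real.exp (l * σ) * K := by
    rw [← Real.norm_eq_abs]
    refine intervalIntegral.norm_integral_le_of_norm_le hle ?_
      ((by fun_prop : Continuous fun σ => Real.exp (l * σ) * K).intervalIntegrable _ _)
    refine Eventually.of_forall fun σ _ => ?_
    rw [norm_mul, Real.norm_eq_abs, Real.norm_eq_abs, abs_of_pos (Real.exp_pos _)]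
    exact mul_le_mul_of_nonneg_left (hK _) (Real.exp_pos _).le
  have h2 : ∫ σ in |p.1|..max |p.1| p.2, Real.exp (l * σ) * K
      = K / l * (Real.exp (l * max |p.1| p.2) - Real.exp (l * |p.1|)) := by
    rw [intervalIntegral.integral_mul_const, intervalIntegral.integral_comp_mul_left _ hl.ne',
      integral_exp, smul_eq_mul]
    field_simp
  rw [h2] at h1
  refine h1.trans (mul_le_mul_of_nonneg_left ?_ (by positivity))
  have : Real.exp (l * max |p.1| p.2) ≤ Real.exp (l * u) :=
    Real.exp_le_exp.2 (mul_le_mul_of_nonneg_left (max_le hu0 hu) hl.le)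
  linarith [Real.exp_pos (l * |p.1|)]

theorem coneIntegral_sub (l : ℝ) {h₁ h₂ : ℝ × ℝ → ℝ} (hh₁ : Continuous h₁)
    (hh₂ : Continuous h₂) (p : ℝ × ℝ) :
    coneIntegral l (fun p => h₁ p - h₂ p) p = coneIntegral l h₁ p - coneIntegral l h₂ p := by
  unfold coneIntegral
  rw [← intervalIntegral.integral_sub]
  · congr 1
    ext σ
    ring
  · exact (by fun_prop : Continuous fun σ =>
      Real.exp (l * σ) * h₁ (p.1, σ)).intervalIntegrable _ _
  · exact (by fun_prop : Continuous fun σ =>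
      Real.exp (l * σ) * h₂ (p.1, σ)).intervalIntegrable _ _

/-- The weighted Volterra integrand at the point `(x, t)`, retracted to the cone `|x| ≤ t`. -/
def volterraTerm (Q : ℝ → ℝ) (l : ℝ) (h : ℝ × ℝ → ℝ) (p : ℝ × ℝ) (ξ : ℝ) : ℝ :=
  Q ξ * (Real.exp (-(l * max p.2 |p.1|)) * coneIntegral l h (ξ, max p.2 |p.1| - |p.1 - ξ|))

theorem continuous_volterraTerm (Q : ℝ → ℝ) (l : ℝ) {h : ℝ × ℝ → ℝ} (hh : Continuous h) (ξ : ℝ) :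
    Continuous fun p => volterraTerm Q l h p ξ := by
  have := continuous_coneIntegral l hh
  unfold volterraTerm
  fun_prop

theorem abs_volterraTerm_le (Q : ℝ → ℝ) {l : ℝ} (hl : 0 < l) {h : ℝ × ℝ → ℝ} {K : ℝ}
    (hK : ∀ p, |h p| ≤ K) (p : ℝ × ℝ) (ξ : ℝ) :
    |volterraTerm Q l h p ξ| ≤ |Q ξ| * (K / l) := by
  have hK0 : 0 ≤ K := (abs_nonneg _).trans (hK 0)
  unfold volterraTerm
  rw [abs_mul, abs_mul, abs_of_pos (Real.exp_pos _)]
  refine mul_le_mul_of_nonneg_left ?_ (abs_nonneg _)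
  -- If the retarded point lies below the cone, the `max` in `coneIntegral` collapses the interval
  -- of integration and the term is zero.
  by_cases hξ : |ξ| ≤ max p.2 |p.1| - |p.1 - ξ|
  · have := abs_coneIntegral_le hl hK (ξ, max p.2 |p.1| - |p.1 - ξ|) (u := max p.2 |p.1|)
      (sub_le_self _ (abs_nonneg _)) (hξ.trans (sub_le_self _ (abs_nonneg _)))
    calc _ ≤ Real.exp (-(l * max p.2 |p.1|)) * (K / l * Real.exp (l * max p.2 |p.1|)) :=
          mul_le_mul_of_nonneg_left this (Real.exp_pos _).le
      _ = K / l * (Real.exp (-(l * max p.2 |p.1|)) * Real.exp (l * max p.2 |p.1|)) := by ring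
      _ = K / l := by rw [← Real.exp_add]; simp
  · have : coneIntegral l h (ξ, max p.2 |p.1| - |p.1 - ξ|) = 0 := by
      unfold coneIntegral
      rw [max_eq_left (le_of_not_ge hξ), intervalIntegral.integral_same]
    rw [this]
    simp only [abs_zero, mul_zero]
    positivity

theorem aestronglyMeasurable_volterraTerm {Q : ℝ → ℝ} (hQ : Integrable Q) (l : ℝ)
    {h : ℝ × ℝ → ℝ} (hh : Continuous h) (p : ℝ × ℝ) :
    AEStronglyMeasurable (volterraTerm Q l h p) := by
  have := continuous_coneIntegral l hh
  unfold volterraTerm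
  exact hQ.1.mul (by fun_prop : Continuous fun ξ => Real.exp (-(l * max p.2 |p.1|)) *
    coneIntegral l h (ξ, max p.2 |p.1| - |p.1 - ξ|)).aestronglyMeasurable

theorem integrable_volterraTerm {Q : ℝ → ℝ} (hQ : Integrable Q) {l : ℝ} (hl : 0 < l)
    {h : ℝ × ℝ → ℝ} (hh : Continuous h) {K : ℝ} (hK : ∀ p, |h p| ≤ K) (p : ℝ × ℝ) :
    Integrable (volterraTerm Q l h p) :=
  (hQ.abs.mul_const (K / l)).mono' (aestronglyMeasurable_volterraTerm hQ l hh p)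
    (Eventually.of_forall (abs_volterraTerm_le Q hl hK p))

/-- A continuous solution, on the cone `|x| ≤ t`, of the integral equation of the kernel. -/
theorem exists_coneKernel {Q c : ℝ → ℝ} (hQ : Integrable Q) (hc : Measurable c)
    (hc1 : ∀ x, |c x| ≤ 1) :
    ∃ κ : ℝ × ℝ → ℝ, Continuous κ ∧ ∀ x t, |x| ≤ t →
      κ (x, t) = -(1 / 2) * ((∫ ξ in ((x - t) / 2)..((x + t) / 2), Q ξ * c ξ)
        + ∫ ξ, Q ξ * ∫ σ in |ξ|..max |ξ| (t - |x - ξ|), κ (ξ, σ)) := by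
  -- With this `l` the ratio `‖Q‖₁ / l` is at most `1`, so the factor `½` in front of the integral
  -- is the contraction constant. The added `1` keeps `l` positive when `Q = 0`.
  set l : ℝ := (∫ ξ, |Q ξ|) + 1 with hl_def
  have hI : 0 ≤ ∫ ξ, |Q ξ| := integral_nonneg fun _ => abs_nonneg _
  have hl : 0 < l := by linarith
  have hQc : Integrable fun ξ => Q ξ * c ξ :=
    hQ.mul_bdd (c := 1) hc.aestronglyMeasurable (Eventually.of_forall hc1)
  set P : ℝ → ℝ := fun s => ∫ ξ in (0 : ℝ)..s, Q ξ * c ξ with hP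
  have hPc : Continuous P := intervalIntegral.continuous_primitive
    (fun a b => hQc.intervalIntegrable) 0
  have hPsub : ∀ a b, ∫ ξ in a..b, Q ξ * c ξ = P b - P a := fun a b =>
    (intervalIntegral.integral_interval_sub_left hQc.intervalIntegrable
      hQc.intervalIntegrable).symm
  have hPb : ∀ a b, |P b - P a| ≤ ∫ ξ, |Q ξ| := by
    intro a b
    rw [← hPsub, ← Real.norm_eq_abs]
    refine (intervalIntegral.norm_integral_le_integral_norm_uIoc).trans ?_
    refine (setIntegral_le_integral hQc.norm (Eventually.of_forall fun _ => norm_nonneg _)).trans ?_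
    refine integral_mono hQc.norm hQ.abs fun ξ => ?_
    simp only [norm_mul, Real.norm_eq_abs]
    exact mul_le_of_le_one_right (abs_nonneg _) (hc1 ξ)
  -- The unknown is `h = exp (-l t) κ`; `g` is its free term and `V` the Volterra operator.
  -- Replacing `t` by `max t |x|` extends both to the whole plane as bounded continuous functions,
  -- so the fixed point can be sought there.
  let g : ℝ × ℝ → ℝ := fun p => -(1 / 2) * (Real.exp (-(l * max p.2 |p.1|)) *
    (P ((p.1 + max p.2 |p.1|) / 2) - P ((p.1 - max p.2 |p.1|) / 2)))
  let V : (ℝ × ℝ → ℝ) → ℝ × ℝ → ℝ := fun h p => -(1 / 2) * ∫ ξ, volterraTerm Q l h p ξ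
  have hgc : Continuous g := by fun_prop
  have hgb : ∀ p, |g p| ≤ ∫ ξ, |Q ξ| := by
    intro p
    have h1 : Real.exp (-(l * max p.2 |p.1|)) ≤ 1 := by
      rw [Real.exp_le_one_iff, neg_nonpos]
      exact mul_nonneg hl.le ((abs_nonneg _).trans (le_max_right _ _))
    simp only [g]
    rw [abs_mul, abs_mul, abs_of_pos (Real.exp_pos _)]
    have h2 := hPb ((p.1 - max p.2 |p.1|) / 2) ((p.1 + max p.2 |p.1|) / 2)
    have h3 := mul_le_mul h1 h2 (abs_nonneg _) zero_le_one
    have h4 : |(-(1 / 2) : ℝ)| = 1 / 2 := by norm_num [abs_of_nonneg]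
    rw [h4]
    linarith
  have hVc : ∀ h : BoundedContinuousFunction (ℝ × ℝ) ℝ, Continuous (V h) := by
    intro h
    refine continuous_const.mul (continuous_of_dominated
      (fun p => aestronglyMeasurable_volterraTerm hQ l h.continuous p)
      (fun p => Eventually.of_forall (abs_volterraTerm_le Q hl h.norm_coe_le_norm p))
      (hQ.abs.mul_const _) (Eventually.of_forall fun ξ => continuous_volterraTerm Q l h.continuous ξ))
  have hVb : ∀ (h : ℝ × ℝ → ℝ) (K : ℝ), (∀ p, |h p| ≤ K) → ∀ p, |V h p| ≤ 1 / 2 * K := by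
    intro h K hK p
    have hK0 : 0 ≤ K := (abs_nonneg _).trans (hK 0)
    have h1 : ‖∫ ξ, volterraTerm Q l h p ξ‖ ≤ ∫ ξ, |Q ξ| * (K / l) :=
      norm_integral_le_of_norm_le (hQ.abs.mul_const _)
        (Eventually.of_forall (abs_volterraTerm_le Q hl hK p))
    rw [Real.norm_eq_abs] at h1
    rw [integral_mul_const] at h1
    have h2 : (∫ ξ, |Q ξ|) * (K / l) ≤ K := by
      rw [mul_div_assoc', div_le_iff₀ hl, mul_comm]
      exact mul_le_mul_of_nonneg_left (by linarith) hK0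
    simp only [V]
    rw [abs_mul]
    have h4 : |(-(1 / 2) : ℝ)| = 1 / 2 := by norm_num [abs_of_nonneg]
    rw [h4]
    linarith
  let Φ : BoundedContinuousFunction (ℝ × ℝ) ℝ → BoundedContinuousFunction (ℝ × ℝ) ℝ := fun h =>
    BoundedContinuousFunction.ofNormedAddCommGroup (fun p => g p + V h p) (hgc.add (hVc h))
      ((∫ ξ, |Q ξ|) + 1 / 2 * ‖h‖) fun p =>
        (abs_add_le _ _).trans (add_le_add (hgb p) (hVb h ‖h‖ h.norm_coe_le_norm p))
  have hΦ : ContractingWith (1 / 2) Φ := by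
    refine ⟨by norm_num, LipschitzWith.of_dist_le_mul fun h₁ h₂ => ?_⟩
    rw [BoundedContinuousFunction.dist_le (by positivity)]
    intro p
    have h1 : Φ h₁ p - Φ h₂ p = V (fun p => h₁ p - h₂ p) p := by
      have : (fun ξ => volterraTerm Q l (fun p => h₁ p - h₂ p) p ξ)
          = fun ξ => volterraTerm Q l h₁ p ξ - volterraTerm Q l h₂ p ξ := by
        ext ξ
        simp only [volterraTerm]
        rw [coneIntegral_sub l h₁.continuous h₂.continuous]
        ring
      simp only [Φ, V, BoundedContinuousFunction.coe_ofNormedAddCommGroup]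
      rw [this, integral_sub (integrable_volterraTerm hQ hl h₁.continuous h₁.norm_coe_le_norm p)
        (integrable_volterraTerm hQ hl h₂.continuous h₂.norm_coe_le_norm p)]
      ring
    rw [Real.dist_eq, h1]
    have h2 := hVb (fun p => h₁ p - h₂ p) (dist h₁ h₂)
      (fun p => BoundedContinuousFunction.dist_coe_le_dist (f := h₁) (g := h₂) p) p
    simpa using h2
  set h := ContractingWith.fixedPoint Φ hΦ
  have hfix : Φ h = h := hΦ.fixedPoint_isFixedPt
  refine ⟨fun p => Real.exp (l * p.2) * h p, by fun_prop, fun x t hxt => ?_⟩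
  have h1 : h (x, t) = g (x, t) + V h (x, t) := by
    conv_lhs => rw [← hfix]
    rfl
  have hm : max t |x| = t := max_eq_left hxt
  simp only [g, V, volterraTerm, hm] at h1
  change Real.exp (l * t) * h (x, t) = _
  rw [h1, hPsub]
  have h2 : ∫ ξ, Q ξ * (Real.exp (-(l * t)) * coneIntegral l h (ξ, t - |x - ξ|))
      = Real.exp (-(l * t)) * ∫ ξ, Q ξ * coneIntegral l h (ξ, t - |x - ξ|) := by
    rw [← integral_const_mul]
    congr 1
    ext ξ
    ring
  rw [h2]
  have h3 : Real.exp (l * t) * Real.exp (-(l * t)) = 1 := by rw [← Real.exp_add]; simp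
  have h4 : ∫ ξ, Q ξ * ∫ σ in |ξ|..max |ξ| (t - |x - ξ|), Real.exp (l * σ) * h (ξ, σ)
      = ∫ ξ, Q ξ * coneIntegral l h (ξ, t - |x - ξ|) := rfl
  rw [h4]
  linear_combination (-(1 / 2) * (P ((x + t) / 2) - P ((x - t) / 2)
    + ∫ ξ, Q ξ * coneIntegral l h (ξ, t - |x - ξ|))) * h3

/-- `k` is the kernel of the wave scattered by the potential `Q` when the incoming wave is
`c(x) f(t - |x|)`: the scattered wave is the time convolution of `k x` with `f`. -/
structure IsWaveKernel (Q c : ℝ → ℝ) (k : ℝ → ℝ → ℝ) : Prop where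
  exists_continuous : ∃ κ : ℝ × ℝ → ℝ, Continuous κ ∧ ∀ x t, |x| ≤ t → k x t = κ (x, t)
  support : ∀ x t, t < |x| → k x t = 0
  -- Duhamel's formula for the impulse `f = δ`: the conditional is the contribution of the front,
  -- which passes `ξ` at time `|ξ|`, and the inner integral that of the wave already scattered.
  eq : ∀ x t, k x t = -(1 / 2) * ∫ ξ, Q ξ *
    ((if |ξ| + |x - ξ| ≤ t then c ξ else 0) + ∫ σ in (0 : ℝ)..t - |x - ξ|, k ξ σ)

theorem integral_zero_of_support {k : ℝ → ℝ} {a u : ℝ} (ha : 0 ≤ a)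
    (hk : ∀ t, t < a → k t = 0) (hu : u ≤ a) : ∫ σ in (0 : ℝ)..u, k σ = 0 := by
  refine intervalIntegral.integral_zero_ae ?_
  have : ∀ᵐ σ : ℝ, σ ≠ a := by simp [ae_iff, measure_singleton]
  filter_upwards [this] with σ hσ hmem
  refine hk σ (lt_of_le_of_ne ?_ hσ)
  rcases le_total 0 u with h | h
  · rw [uIoc_of_le h] at hmem
    exact hmem.2.trans hu
  · rw [uIoc_of_ge h] at hmem
    exact hmem.2.trans ha

theorem integral_eq_coneIntegral {k : ℝ → ℝ → ℝ} {κ : ℝ × ℝ → ℝ} (hκ : Continuous κ)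
    (hk : ∀ x t, |x| ≤ t → k x t = κ (x, t)) (hs : ∀ x t, t < |x| → k x t = 0) (ξ u : ℝ) :
    ∫ σ in (0 : ℝ)..u, k ξ σ = coneIntegral 0 κ (ξ, u) := by
  unfold coneIntegral
  have hκ' : Continuous fun σ => Real.exp (0 * σ) * κ (ξ, σ) := by fun_prop
  rcases le_total u |ξ| with h | h
  · rw [integral_zero_of_support (abs_nonneg ξ) (hs ξ) h]
    simp [max_eq_left h]
  · have h2 : ∫ σ in |ξ|..u, k ξ σ = ∫ σ in |ξ|..u, Real.exp (0 * σ) * κ (ξ, σ) := by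
      refine intervalIntegral.integral_congr fun σ hσ => ?_
      rw [uIcc_of_le h] at hσ
      simp [hk ξ σ hσ.1]
    have h3 : IntervalIntegrable (k ξ) volume |ξ| u := by
      refine (hκ'.intervalIntegrable |ξ| u).congr fun σ hσ => ?_
      rw [uIoc_of_le h] at hσ
      simp [hk ξ σ hσ.1.le]
    have h4 : IntervalIntegrable (k ξ) volume 0 |ξ| := by
      refine IntervalIntegrable.congr_ae (f := fun _ => (0 : ℝ)) intervalIntegrable_const ?_
      rw [uIoc_of_le (abs_nonneg ξ)]
      refine (ae_restrict_iff' measurableSet_Ioc).2 ?_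
      have : ∀ᵐ σ : ℝ, σ ≠ |ξ| := by simp [ae_iff, measure_singleton]
      filter_upwards [this] with σ hσ hmem
      exact (hs ξ σ (lt_of_le_of_ne hmem.2 hσ)).symm
    rw [← intervalIntegral.integral_add_adjacent_intervals h4 h3,
      integral_zero_of_support (abs_nonneg ξ) (hs ξ) le_rfl, zero_add, max_eq_right h, h2]

/-- On the line an ellipse with foci `0` and `x` is a segment. This identifies the indicator in
`IsWaveKernel.eq` with the interval integral in `exists_coneKernel`. -/
theorem abs_add_abs_le_iff {x t : ℝ} (hxt : |x| ≤ t) (ξ : ℝ) :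
    |ξ| + |x - ξ| ≤ t ↔ ξ ∈ Icc ((x - t) / 2) ((x + t) / 2) := by
  rw [abs_le] at hxt
  constructor
  · intro h
    constructor <;>
      linarith [neg_abs_le ξ, neg_abs_le (x - ξ), le_abs_self ξ, le_abs_self (x - ξ)]
  · rintro ⟨h1, h2⟩
    rcases abs_cases ξ with h | h <;> rcases abs_cases (x - ξ) with h' | h' <;> linarith

/-- The continuous solution on the cone `|x| ≤ t` is cut off to zero below it. Below the cone the
right-hand side of the equation also vanishes, since `|x| ≤ |ξ| + |x - ξ|`. -/
theorem exists_isWaveKernel {Q c : ℝ → ℝ} (hQ : Integrable Q) (hc : Measurable c)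
    (hc1 : ∀ x, |c x| ≤ 1) : ∃ k, IsWaveKernel Q c k := by
  obtain ⟨κ, hκ, heq⟩ := exists_coneKernel hQ hc hc1
  let k : ℝ → ℝ → ℝ := fun x t => if |x| ≤ t then κ (x, t) else 0
  have hk : ∀ x t, |x| ≤ t → k x t = κ (x, t) := fun x t h => if_pos h
  have hs : ∀ x t, t < |x| → k x t = 0 := fun x t h => if_neg (not_le.2 h)
  have hK := integral_eq_coneIntegral hκ hk hs
  refine ⟨k, ⟨κ, hκ, hk⟩, hs, fun x t => ?_⟩
  rcases lt_or_ge t |x| with h | h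
  · have : ∀ ξ, Q ξ * ((if |ξ| + |x - ξ| ≤ t then c ξ else 0)
        + ∫ σ in (0 : ℝ)..t - |x - ξ|, k ξ σ) = 0 := by
      intro ξ
      have h1 : t < |ξ| + |x - ξ| := h.trans_le (by simpa using abs_add_le ξ (x - ξ))
      rw [if_neg (not_le.2 h1), integral_zero_of_support (abs_nonneg ξ) (hs ξ) (by linarith)]
      simp
    simp only [this]
    rw [hs x t h]
    simp
  · rw [hk x t h, heq x t h]
    have hle : (x - t) / 2 ≤ (x + t) / 2 := by linarith [(abs_nonneg x).trans h]
    have hQc : Integrable fun ξ => Q ξ * c ξ :=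
      hQ.mul_bdd (c := 1) hc.aestronglyMeasurable (Eventually.of_forall hc1)
    have e1 : ∫ ξ in ((x - t) / 2)..((x + t) / 2), Q ξ * c ξ
        = ∫ ξ, Q ξ * (if |ξ| + |x - ξ| ≤ t then c ξ else 0) := by
      rw [intervalIntegral.integral_of_le hle, ← integral_Icc_eq_integral_Ioc,
        ← integral_indicator measurableSet_Icc]
      congr 1
      ext ξ
      simp only [indicator, abs_add_abs_le_iff h, mul_ite, mul_zero]
    have e2 : ∀ ξ, ∫ σ in |ξ|..max |ξ| (t - |x - ξ|), κ (ξ, σ)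
        = ∫ σ in (0 : ℝ)..t - |x - ξ|, k ξ σ := by
      intro ξ
      rw [hK]
      simp [coneIntegral]
    have i1 : Integrable fun ξ => Q ξ * (if |ξ| + |x - ξ| ≤ t then c ξ else 0) := by
      refine (hQc.indicator (measurableSet_Icc (a := (x - t) / 2) (b := (x + t) / 2))).congr ?_
      refine Eventually.of_forall fun ξ => ?_
      simp only [indicator, abs_add_abs_le_iff h, mul_ite, mul_zero]
    have i2 : Integrable fun ξ => Q ξ * ∫ σ in (0 : ℝ)..t - |x - ξ|, k ξ σ := by
      have hc0 := continuous_coneIntegral 0 hκ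
      have hcc : Continuous fun ξ => coneIntegral 0 κ (ξ, t - |x - ξ|) := by fun_prop
      have hsupp : ∀ ξ, ξ ∉ Icc (-t) t → coneIntegral 0 κ (ξ, t - |x - ξ|) = 0 := by
        intro ξ hξ
        rw [← hK, integral_zero_of_support (abs_nonneg ξ) (hs ξ)]
        by_contra hcon
        push Not at hcon
        exact hξ (abs_le.1 (by linarith [abs_nonneg (x - ξ)]))
      obtain ⟨B, hB⟩ := isCompact_Icc.exists_bound_of_continuousOn (hcc.continuousOn (s := Icc (-t) t))
      refine hQ.mul_bdd (c := max B 0) ?_ (Eventually.of_forall fun ξ => ?_)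
      · simp only [hK]
        exact hcc.aestronglyMeasurable
      · rw [hK]
        by_cases hξ : ξ ∈ Icc (-t) t
        · exact (hB ξ hξ).trans (le_max_left _ _)
        · rw [hsupp ξ hξ]
          simp
    simp only [e1, e2, mul_add]
    rw [integral_add i1 i2]
    ring

namespace IsWaveKernel

variable {Q c : ℝ → ℝ} {k : ℝ → ℝ → ℝ}

theorem measurable (hk : IsWaveKernel Q c k) : Measurable (Function.uncurry k) := by
  obtain ⟨κ, hκ, h⟩ := hk.exists_continuous
  have : Function.uncurry k = indicator {p : ℝ × ℝ | |p.1| ≤ p.2} κ := by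
    ext ⟨x, t⟩
    by_cases hx : |x| ≤ t
    · simp [indicator, hx, h x t hx]
    · simp [indicator, hx, hk.support x t (not_le.1 hx)]
  rw [this]
  exact hκ.measurable.indicator (isClosed_le (by fun_prop) (by fun_prop)).measurableSet

theorem zero_of_neg (hk : IsWaveKernel Q c k) (x : ℝ) {t : ℝ} (ht : t < 0) : k x t = 0 :=
  hk.support x t (ht.trans_le (abs_nonneg x))

theorem exists_bound (hk : IsWaveKernel Q c k) (T : ℝ) :
    ∃ B, 0 ≤ B ∧ ∀ x t, t ≤ T → |k x t| ≤ B := by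
  obtain ⟨κ, hκ, h⟩ := hk.exists_continuous
  obtain ⟨B, hB⟩ := (isCompact_Icc.prod isCompact_Icc).exists_bound_of_continuousOn
    (hκ.continuousOn (s := Icc (-T) T ×ˢ Icc 0 T))
  refine ⟨max B 0, le_max_right _ _, fun x t ht => ?_⟩
  rcases lt_or_ge t |x| with hx | hx
  · simp [hk.support x t hx]
  · rw [h x t hx]
    exact (hB (x, t) ⟨abs_le.1 (hx.trans ht), (abs_nonneg x).trans hx, ht⟩).trans (le_max_left _ _)

/-- The cutoff can make the kernel jump only on the light cone. In the convolutions below this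
affects single points, which dominated convergence ignores. -/
theorem continuousAt (hk : IsWaveKernel Q c k) {x t : ℝ} (hx : t ≠ |x|) :
    ContinuousAt (Function.uncurry k) (x, t) := by
  obtain ⟨κ, hκ, h⟩ := hk.exists_continuous
  rcases lt_or_gt_of_ne hx with hx | hx
  · have : ∀ᶠ p in 𝓝 (x, t), (fun _ => (0 : ℝ)) p = Function.uncurry k p := by
      filter_upwards [(isOpen_lt (f := fun p : ℝ × ℝ => p.2) (g := fun p => |p.1|)
        (by fun_prop) (by fun_prop)).mem_nhds hx] with p hp
      exact (hk.support p.1 p.2 hp).symm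
    exact continuousAt_const.congr this
  · have : ∀ᶠ p in 𝓝 (x, t), κ p = Function.uncurry k p := by
      filter_upwards [(isOpen_lt (f := fun p : ℝ × ℝ => |p.1|) (g := fun p => p.2)
        (by fun_prop) (by fun_prop)).mem_nhds hx] with p hp
      exact (h p.1 p.2 hp.le).symm
    exact hκ.continuousAt.congr this

theorem continuous_primitive (hk : IsWaveKernel Q c k) :
    Continuous fun p : ℝ × ℝ => ∫ σ in (0 : ℝ)..p.2, k p.1 σ := by
  obtain ⟨κ, hκ, h⟩ := hk.exists_continuous
  refine (continuous_coneIntegral 0 hκ).congr fun p => ?_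
  rw [integral_eq_coneIntegral hκ h hk.support]

end IsWaveKernel

/-! ### Convolution of causal functions -/

/-- Functions that vanish for nonpositive times. -/
def Causal (f : ℝ → ℝ) : Prop := ∀ t ≤ 0, f t = 0

theorem integrable_indicator_Icc {a : ℝ → ℝ} (ha : LocallyIntegrable a) (s t : ℝ) :
    Integrable (indicator (Icc s t) a) :=
  (integrable_indicator_iff measurableSet_Icc).2 (ha.integrableOn_isCompact isCompact_Icc)

/-- Only the values on `[0, t]` enter, so both factors may be cut off there, and the integrability
of the convolution integrand of two integrable functions applies. -/
theorem integrable_causal_conv {a b : ℝ → ℝ} (ha : LocallyIntegrable a)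
    (hb : LocallyIntegrable b) (ha0 : ∀ t < 0, a t = 0) (hb0 : Causal b) (t : ℝ) :
    Integrable (fun p : ℝ × ℝ => a (p.1 - p.2) * b p.2)
      ((volume.restrict (Iic t)).prod volume) := by
  have h := (integrable_indicator_Icc hb 0 t).convolution_integrand
    (ContinuousLinearMap.mul ℝ ℝ) (μ := volume) (ν := volume) (integrable_indicator_Icc ha 0 t)
  have h2 : Integrable (fun p : ℝ × ℝ => indicator (Icc 0 t) b p.2 *
      indicator (Icc 0 t) a (p.1 - p.2)) ((volume.restrict (Iic t)).prod volume) := by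
    refine h.mono_measure ?_
    exact Measure.prod_mono Measure.restrict_le_self le_rfl
  refine h2.congr ?_
  have hm : ∀ᵐ p : ℝ × ℝ ∂((volume.restrict (Iic t)).prod volume), p.1 ≤ t :=
    Measure.quasiMeasurePreserving_fst.ae (ae_restrict_mem measurableSet_Iic)
  filter_upwards [hm] with p hp
  rcases le_or_gt p.2 0 with h1 | h1
  · simp only [hb0 p.2 h1, mul_zero]
    by_cases h3 : p.2 ∈ Icc 0 t
    · simp [indicator, hb0 p.2 h1]
    · simp [indicator, h3]
  · rcases lt_or_ge (p.1 - p.2) 0 with h3 | h3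
    · rw [ha0 _ h3, indicator_of_notMem (a := p.1 - p.2) (fun h => absurd h.1 (not_le.2 h3))]
      simp
    · have m1 : p.2 ∈ Icc 0 t := ⟨h1.le, by linarith⟩
      have m2 : p.1 - p.2 ∈ Icc 0 t := ⟨h3, by linarith⟩
      rw [indicator_of_mem m1, indicator_of_mem m2]
      ring

/-- Fubini, followed by a shift of the inner variable; causality removes the part of the inner
integral over negative times. For `t < 0` both sides are zero. -/
theorem integral_causal_conv {a b : ℝ → ℝ} (ha : LocallyIntegrable a)
    (hb : LocallyIntegrable b) (ha0 : ∀ t < 0, a t = 0) (hb0 : Causal b) (t : ℝ) :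
    ∫ τ in (0 : ℝ)..t, ∫ s, a (τ - s) * b s = ∫ s, (∫ σ in (0 : ℝ)..t - s, a σ) * b s := by
  have hz : ∀ s u : ℝ, u ≤ 0 → ∫ σ in (0 : ℝ)..u, a σ = 0 := fun s u hu =>
    integral_zero_of_support le_rfl ha0 hu
  rcases le_or_gt 0 t with ht | ht
  · rw [intervalIntegral.integral_of_le ht, integral_integral_swap]
    · congr 1
      ext s
      rw [integral_mul_const]
      rcases le_or_gt s 0 with hs | hs
      · rw [hb0 s hs]
        simp
      congr 1
      rw [← intervalIntegral.integral_of_le ht, intervalIntegral.integral_comp_sub_right]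
      have hi : ∀ u v : ℝ, IntervalIntegrable a volume u v := fun u v =>
        (ha.integrableOn_isCompact isCompact_uIcc).intervalIntegrable
      rw [← intervalIntegral.integral_add_adjacent_intervals (hi (0 - s) 0) (hi 0 (t - s)),
        intervalIntegral.integral_symm, hz s _ (by linarith)]
      simp
    · refine (integrable_causal_conv ha hb ha0 hb0 t).mono_measure ?_
      exact Measure.prod_mono (Measure.restrict_mono Ioc_subset_Iic_self le_rfl) le_rfl
  · have h1 : ∀ s, (∫ σ in (0 : ℝ)..t - s, a σ) * b s = 0 := by
      intro s
      rcases le_or_gt s 0 with hs | hs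
      · rw [hb0 s hs, mul_zero]
      · rw [hz s _ (by linarith), zero_mul]
    have h2 : ∫ τ in (0 : ℝ)..t, ∫ s, a (τ - s) * b s = ∫ τ in (0 : ℝ)..t, (0 : ℝ) := by
      refine intervalIntegral.integral_congr_ae ?_
      have h0 : ∀ᵐ τ : ℝ, τ ≠ 0 := by simp [ae_iff, measure_singleton]
      filter_upwards [h0] with τ hτ0 hτ
      rw [uIoc_of_ge ht.le] at hτ
      have hτ' : τ < 0 := lt_of_le_of_ne hτ.2 hτ0
      have : ∀ s, a (τ - s) * b s = 0 := by
        intro s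
        rcases le_or_gt s 0 with hs | hs
        · rw [hb0 s hs, mul_zero]
        · rw [ha0 _ (by linarith), zero_mul]
      simp [this]
    rw [h2]
    simp [h1]

theorem Causal.primitive {f : ℝ → ℝ} (hf : Causal f) :
    Causal fun t => ∫ s in (0 : ℝ)..t, f s := fun _ ht =>
  integral_zero_of_support le_rfl (fun s hs => hf s hs.le) ht

/-! ### The scattered wave -/

/-- The time convolution of the kernel with the control. -/
def scattered (k : ℝ → ℝ → ℝ) (f : ℝ → ℝ) (x t : ℝ) : ℝ := ∫ s, k x (t - s) * f s

/-- The wave with incoming part `c(x) f(t - |x|)`. -/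
def wave (c : ℝ → ℝ) (k : ℝ → ℝ → ℝ) (f : ℝ → ℝ) (x t : ℝ) : ℝ :=
  c x * f (t - |x|) + scattered k f x t

theorem scattered_eq_zero {Q c : ℝ → ℝ} {k : ℝ → ℝ → ℝ} (hk : IsWaveKernel Q c k) {f : ℝ → ℝ}
    (hf : Causal f) {x t : ℝ} (h : t ≤ |x|) : scattered k f x t = 0 := by
  refine integral_eq_zero_of_ae (Eventually.of_forall fun s => ?_)
  rcases le_or_gt s 0 with hs | hs
  · simp [hf s hs]
  · simp [hk.support x (t - s) (by linarith)]

theorem wave_eq_zero {Q c : ℝ → ℝ} {k : ℝ → ℝ → ℝ} (hk : IsWaveKernel Q c k) {f : ℝ → ℝ}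
    (hf : Causal f) {x t : ℝ} (h : t ≤ |x|) : wave c k f x t = 0 := by
  rw [wave, scattered_eq_zero hk hf h, hf _ (by linarith)]
  simp

namespace IsWaveKernel

variable {Q c : ℝ → ℝ} {k : ℝ → ℝ → ℝ} {f : ℝ → ℝ}

theorem measurable_apply (hk : IsWaveKernel Q c k) (x : ℝ) : Measurable (k x) :=
  hk.measurable.comp (measurable_const.prodMk measurable_id)

theorem locallyIntegrable (hk : IsWaveKernel Q c k) (x : ℝ) : LocallyIntegrable (k x) := by
  intro t
  obtain ⟨B, -, hB⟩ := hk.exists_bound (t + 1)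
  refine ⟨Iic (t + 1), Iic_mem_nhds (by linarith), ?_⟩
  have h1 : IntegrableOn (k x) (Icc 0 (t + 1)) := by
    refine Measure.integrableOn_of_bounded (M := B) measure_Icc_lt_top.ne
      (hk.measurable_apply x).aestronglyMeasurable ?_
    filter_upwards [ae_restrict_mem measurableSet_Icc] with s hs
    exact hB x s hs.2
  have h2 : IntegrableOn (k x) (Iio 0) :=
    (integrableOn_zero (ε' := ℝ)).congr_fun (fun s hs => (hk.zero_of_neg x hs).symm)
      measurableSet_Iio
  refine (h2.union h1).mono_set fun s hs => ?_
  rcases lt_or_ge s 0 with h | h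
  · exact Or.inl h
  · exact Or.inr ⟨h, hs⟩

theorem mul_indicator_eq (hk : IsWaveKernel Q c k) (hf : Causal f) {t T : ℝ} (ht : t ≤ T)
    (x s : ℝ) : k x (t - s) * f s = k x (t - s) * indicator (Icc 0 T) f s := by
  by_cases hs : s ∈ Icc 0 T
  · rw [indicator_of_mem hs]
  · rw [indicator_of_notMem hs]
    rcases lt_or_ge s 0 with h | h
    · rw [hf s h.le]
    · rw [hk.zero_of_neg x (t := t - s) (by
        by_contra hcon
        exact hs ⟨h, by linarith⟩)]
      simp

theorem abs_mul_indicator_le {k : ℝ → ℝ → ℝ} {T B : ℝ}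
    (hB : ∀ x t, t ≤ T → |k x t| ≤ B) {t : ℝ} (ht : t ≤ T) (f : ℝ → ℝ) (x s : ℝ) :
    |k x (t - s) * indicator (Icc 0 T) f s| ≤ B * |indicator (Icc 0 T) f s| := by
  by_cases hs : s ∈ Icc 0 T
  · rw [abs_mul]
    exact mul_le_mul_of_nonneg_right (hB x _ (by linarith [hs.1])) (abs_nonneg _)
  · simp [indicator_of_notMem hs]

theorem integrable_conv (hk : IsWaveKernel Q c k) (hf : Causal f) (hfi : LocallyIntegrable f)
    (x t : ℝ) : Integrable fun s => k x (t - s) * f s := by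
  obtain ⟨B, -, hB⟩ := hk.exists_bound t
  simp only [hk.mul_indicator_eq hf (le_refl t)]
  have hi := integrable_indicator_Icc hfi 0 t
  refine (hi.abs.const_mul B).mono' ?_
    (Eventually.of_forall (abs_mul_indicator_le hB le_rfl f x))
  exact ((hk.measurable_apply x).comp (measurable_const.sub measurable_id)).aestronglyMeasurable.mul
    hi.1

/-- For a given point `(x, t)` the integrand can be discontinuous only at the one time `s = t -
|x|`, and on bounded time ranges it is dominated by a multiple of the control. -/
theorem continuous_scattered (hk : IsWaveKernel Q c k) (hf : Causal f)
    (hfi : LocallyIntegrable f) : Continuous fun p : ℝ × ℝ => scattered k f p.1 p.2 := by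
  refine continuous_iff_continuousAt.2 fun p₀ => ?_
  obtain ⟨B, -, hB⟩ := hk.exists_bound (p₀.2 + 1)
  have hi := integrable_indicator_Icc hfi 0 (p₀.2 + 1)
  have hev : ∀ᶠ p in 𝓝 p₀, p.2 ≤ p₀.2 + 1 :=
    (continuous_snd.tendsto p₀).eventually (Iic_mem_nhds (by simp))
  have hcongr : ∀ᶠ p in 𝓝 p₀, (∫ s, k p.1 (p.2 - s) * indicator (Icc 0 (p₀.2 + 1)) f s)
      = scattered k f p.1 p.2 := by
    filter_upwards [hev] with p hp
    simp only [scattered, hk.mul_indicator_eq hf hp]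
  refine ContinuousAt.congr ?_ hcongr
  refine continuousAt_of_dominated
    (bound := fun s => B * |indicator (Icc 0 (p₀.2 + 1)) f s|) ?_ ?_ (hi.abs.const_mul B) ?_
  · refine Eventually.of_forall fun p => ?_
    exact ((hk.measurable_apply p.1).comp
      (measurable_const.sub measurable_id)).aestronglyMeasurable.mul hi.1
  · filter_upwards [hev] with p hp
    exact Eventually.of_forall (abs_mul_indicator_le hB hp f p.1)
  · have : ∀ᵐ s : ℝ, s ≠ p₀.2 - |p₀.1| := by simp [ae_iff, measure_singleton]
    filter_upwards [this] with s hs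
    refine ContinuousAt.mul ?_ continuousAt_const
    have h1 := hk.continuousAt (x := p₀.1) (t := p₀.2 - s) (fun h => hs (by linarith))
    exact ContinuousAt.comp (f := fun p : ℝ × ℝ => (p.1, p.2 - s)) h1 (by fun_prop)

/-- Convolution commutes with integration in time. The kernel and the control exchange roles first,
because here the primitive has to fall on the control. -/
theorem scattered_primitive (hk : IsWaveKernel Q c k) (hf : Causal f)
    (hfi : LocallyIntegrable f) (x t : ℝ) :
    scattered k (fun t => ∫ s in (0 : ℝ)..t, f s) x t = ∫ τ in (0 : ℝ)..t, scattered k f x τ := by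
  have hcomm : ∀ τ, scattered k f x τ = ∫ s, f (τ - s) * k x s := by
    intro τ
    unfold scattered
    rw [← integral_sub_left_eq_self _ volume τ]
    congr 1
    ext s
    rw [sub_sub_cancel, mul_comm]
  simp only [hcomm]
  -- `Causal` also requires the value at time `0` to vanish, which `support` does not give at `x =
  -- 0`; the kernel is therefore modified at that single time.
  have hk0 : Causal fun s => indicator (Ioi 0) (k x) s := fun s hs =>
    indicator_of_notMem (by simpa using hs) _
  have hae : indicator (Ioi 0) (k x) =ᵐ[volume] k x := by
    have : ∀ᵐ s : ℝ, s ≠ 0 := by simp [ae_iff, measure_singleton]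
    filter_upwards [this] with s hs
    rcases lt_or_gt_of_ne hs with h | h
    · rw [hk.zero_of_neg x h, indicator_of_notMem (by simpa using h.le)]
    · rw [indicator_of_mem (by simpa using h)]
  have hki : LocallyIntegrable (indicator (Ioi 0) (k x)) := fun s => by
    obtain ⟨u, hu, h⟩ := hk.locallyIntegrable x s
    exact ⟨u, hu, h.indicator measurableSet_Ioi⟩
  have h1 : ∀ τ, ∫ s, f (τ - s) * k x s = ∫ s, f (τ - s) * indicator (Ioi 0) (k x) s :=
    fun τ => integral_congr_ae (hae.mono fun s hs => by simp only [hs])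
  simp only [h1]
  rw [integral_causal_conv hfi hki (fun t ht => hf t ht.le) hk0 t]
  unfold scattered
  rw [← integral_sub_left_eq_self _ volume t]
  refine integral_congr_ae (hae.mono fun s hs => ?_)
  simp only [hs]
  rw [sub_sub_cancel, mul_comm]

end IsWaveKernel

theorem Causal.integral_ite {f : ℝ → ℝ} (hf : Causal f) (u : ℝ) :
    ∫ s, (if s ≤ u then f s else 0) = ∫ s in (0 : ℝ)..u, f s := by
  rcases le_or_gt u 0 with hu | hu
  · rw [show ∫ s in (0 : ℝ)..u, f s = 0 from hf.primitive u hu]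
    refine integral_eq_zero_of_ae (Eventually.of_forall fun s => ?_)
    by_cases h : s ≤ u
    · simp [h, hf s (h.trans hu)]
    · simp [h]
  · rw [intervalIntegral.integral_of_le hu.le, ← integral_indicator measurableSet_Ioc]
    congr 1
    ext s
    by_cases h : s ≤ u <;> by_cases h' : 0 < s
    · simp [indicator, h, h']
    · simp [indicator, h, h', hf s (not_lt.1 h')]
    · simp [indicator, h]
    · simp [indicator, h]

namespace IsWaveKernel

variable {Q c : ℝ → ℝ} {k : ℝ → ℝ → ℝ} {f : ℝ → ℝ}

theorem exists_bound_primitive (hk : IsWaveKernel Q c k) (T : ℝ) :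
    ∃ B, 0 ≤ B ∧ ∀ x t, t ≤ T → |∫ σ in (0 : ℝ)..t, k x σ| ≤ B := by
  obtain ⟨B, hB0, hB⟩ := hk.exists_bound T
  refine ⟨B * |T|, by positivity, fun x t ht => ?_⟩
  rcases le_or_gt t 0 with h | h
  · rw [integral_zero_of_support le_rfl (fun s hs => hk.zero_of_neg x hs) h]
    simp only [abs_zero]
    positivity
  · have h1 := intervalIntegral.norm_integral_le_of_norm_le_const (a := 0) (b := t) (f := k x)
      (C := B) fun s hs => by
        rw [uIoc_of_le h.le] at hs
        exact hB x s (hs.2.trans ht)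
    rw [Real.norm_eq_abs] at h1
    refine h1.trans (mul_le_mul_of_nonneg_left ?_ hB0)
    rw [sub_zero, abs_of_pos h]
    exact ht.trans (le_abs_self T)

/-- Duhamel's formula: the scattered wave is generated by the product of the potential and of the
total wave. -/
theorem duhamel (hQ : Integrable Q) (hc : Measurable c) (hc1 : ∀ x, |c x| ≤ 1)
    (hk : IsWaveKernel Q c k) (hf : Causal f) (hfi : LocallyIntegrable f) (x t : ℝ) :
    scattered k f x t = -(1 / 2) * ∫ ξ, Q ξ *
      wave c k (fun t => ∫ s in (0 : ℝ)..t, f s) ξ (t - |x - ξ|) := by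
  obtain ⟨B, hB0, hB⟩ := hk.exists_bound_primitive t
  set F : ℝ → ℝ := indicator (Icc 0 t) f with hF
  have hFi : Integrable F := integrable_indicator_Icc hfi 0 t
  -- `A` is the bracket of `IsWaveKernel.eq` at time `t - s`. Integrated against `f s`, its front
  -- term becomes the primitive of `f` and its second term the wave scattered from that primitive,
  -- which explains why the formula involves the wave of the primitive.
  let A : ℝ → ℝ → ℝ := fun s ξ => (if |ξ| + |x - ξ| ≤ t - s then c ξ else 0)
    + ∫ σ in (0 : ℝ)..t - s - |x - ξ|, k ξ σ
  have hAm : Measurable (Function.uncurry A) := by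
    refine Measurable.add (Measurable.ite ?_ (hc.comp measurable_snd) measurable_const) ?_
    · exact (isClosed_le (by fun_prop) (by fun_prop)).measurableSet
    · exact (hk.continuous_primitive.comp (by fun_prop :
        Continuous fun p : ℝ × ℝ => (p.2, t - p.1 - |x - p.2|))).measurable
  have hAb : ∀ s ξ, 0 ≤ s → |A s ξ| ≤ 1 + B := by
    intro s ξ hs
    refine (abs_add_le _ _).trans (add_le_add ?_ (hB ξ _ (by linarith [abs_nonneg (x - ξ)])))
    split_ifs
    · exact hc1 ξ
    · simp
  have hint : Integrable (Function.uncurry fun s ξ => Q ξ * A s ξ * F s)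
      (volume.prod volume) := by
    have hb : Integrable (fun p : ℝ × ℝ => |F p.1| * (|Q p.2| * (1 + B)))
        (volume.prod volume) := hFi.abs.mul_prod (hQ.abs.mul_const (1 + B))
    refine hb.mono' ((hQ.1.comp_snd.mul hAm.aestronglyMeasurable).mul hFi.1.comp_fst)
      (Eventually.of_forall fun p => ?_)
    simp only [Function.uncurry, norm_mul, Real.norm_eq_abs]
    by_cases hs : p.1 ∈ Icc 0 t
    · have := mul_le_mul_of_nonneg_left (hAb p.1 p.2 hs.1) (abs_nonneg (Q p.2))
      have := mul_le_mul_of_nonneg_right this (abs_nonneg (F p.1))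
      linarith
    · simp [hF, indicator_of_notMem hs]
  have h1 : scattered k f x t = ∫ s, ∫ ξ, -(1 / 2) * (Q ξ * A s ξ * F s) := by
    unfold scattered
    congr 1
    ext s
    rw [hk.mul_indicator_eq hf le_rfl, integral_const_mul, integral_mul_const, hk.eq x (t - s)]
    ring
  have hK : ∀ ξ u, ∫ s, (∫ σ in (0 : ℝ)..u - s, k ξ σ) * f s
      = scattered k (fun t => ∫ s in (0 : ℝ)..t, f s) ξ u := by
    intro ξ u
    rw [← integral_causal_conv (hk.locallyIntegrable ξ) hfi (fun t ht => hk.zero_of_neg ξ ht) hf,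
      hk.scattered_primitive hf hfi]
    rfl
  rw [h1]
  simp only [integral_const_mul]
  rw [integral_integral_swap hint]
  congr 2
  ext ξ
  have h2 : (fun s => Q ξ * A s ξ * F s) = fun s => Q ξ * (A s ξ * F s) := by
    ext s
    ring
  rw [h2, integral_const_mul]
  congr 1
  have h3 : ∀ s, A s ξ * F s = c ξ * (if s ≤ t - |x - ξ| - |ξ| then f s else 0)
      + (∫ σ in (0 : ℝ)..t - |x - ξ| - s, k ξ σ) * f s := by
    intro s
    have e : (|ξ| + |x - ξ| ≤ t - s) ↔ s ≤ t - |x - ξ| - |ξ| := by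
      constructor <;> intro h <;> linarith
    by_cases hs : s ∈ Icc 0 t
    · simp only [A, hF, indicator_of_mem hs, e]
      rw [sub_right_comm t s]
      split_ifs <;> ring
    · rw [hF, indicator_of_notMem hs, mul_zero]
      rcases le_or_gt s 0 with h | h
      · simp [hf s h]
      · have hst : t < s := by
          by_contra hcon
          exact hs ⟨h.le, by linarith⟩
        have a1 := abs_nonneg (x - ξ)
        have a2 := abs_nonneg ξ
        rw [if_neg (by linarith), integral_zero_of_support le_rfl
          (fun s hs => hk.zero_of_neg ξ hs) (by linarith)]
        simp
  have hKc : Continuous fun s => ∫ σ in (0 : ℝ)..t - |x - ξ| - s, k ξ σ :=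
    hk.continuous_primitive.comp (by fun_prop :
      Continuous fun s : ℝ => (ξ, t - |x - ξ| - s))
  simp only [h3]
  rw [integral_add, integral_const_mul, hf.integral_ite, hK]
  · rfl
  · refine Integrable.const_mul ?_ _
    refine (integrable_indicator_Icc hfi 0 (t - |x - ξ| - |ξ|)).congr
      (Eventually.of_forall fun s => ?_)
    simp only [indicator, mem_Icc]
    rcases le_or_gt s 0 with h | h
    · simp [hf s h]
    · simp [h.le]
  · have e : ∀ s, (∫ σ in (0 : ℝ)..t - |x - ξ| - s, k ξ σ) * f s
        = (∫ σ in (0 : ℝ)..t - |x - ξ| - s, k ξ σ) * F s := by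
      intro s
      by_cases hs : s ∈ Icc 0 t
      · rw [hF, indicator_of_mem hs]
      · rw [hF, indicator_of_notMem hs, mul_zero]
        rcases le_or_gt s 0 with h | h
        · simp [hf s h]
        · have hst : t < s := by
            by_contra hcon
            exact hs ⟨h.le, by linarith⟩
          rw [integral_zero_of_support le_rfl (fun s hs => hk.zero_of_neg ξ hs)
            (by linarith [abs_nonneg (x - ξ)]), zero_mul]
    simp only [e]
    refine (hFi.abs.const_mul B).mono' (hKc.aestronglyMeasurable.mul hFi.1)
      (Eventually.of_forall fun s => ?_)
    rw [norm_mul, Real.norm_eq_abs, Real.norm_eq_abs]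
    by_cases hs : s ∈ Icc 0 t
    · exact mul_le_mul_of_nonneg_right (hB ξ _ (by linarith [abs_nonneg (x - ξ), hs.1]))
        (abs_nonneg _)
    · simp [hF, indicator_of_notMem hs]

end IsWaveKernel

/-! ### Calculus of smooth causal controls and time derivatives of waves -/

/-- Smooth functions that vanish for nonpositive times. -/
structure SmoothCausal (f : ℝ → ℝ) : Prop where
  contDiff : ContDiff ℝ ∞ f
  causal : Causal f

namespace SmoothCausal

variable {f : ℝ → ℝ}

theorem continuous (hf : SmoothCausal f) : Continuous f := hf.contDiff.continuous

theorem locallyIntegrable (hf : SmoothCausal f) : LocallyIntegrable f :=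
  hf.continuous.locallyIntegrable

theorem hasDerivAt (hf : SmoothCausal f) (t : ℝ) : HasDerivAt f (deriv f t) t :=
  ((hf.contDiff.differentiable (by simp)) t).hasDerivAt

theorem deriv (hf : SmoothCausal f) : SmoothCausal (deriv f) := by
  have h1 : ContDiff ℝ ∞ (_root_.deriv f) := (contDiff_infty_iff_deriv.1 hf.contDiff).2
  refine ⟨h1, fun t ht => ?_⟩
  have h2 : ∀ s ∈ Iio (0 : ℝ), _root_.deriv f s = 0 := by
    intro s hs
    have : f =ᶠ[𝓝 s] fun _ => 0 := by
      filter_upwards [Iio_mem_nhds hs] with u hu using hf.causal u (le_of_lt hu)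
    rw [this.deriv_eq]
    simp
  have h3 : IsClosed {s | _root_.deriv f s = 0} := isClosed_eq h1.continuous continuous_const
  have h4 : closure (Iio (0 : ℝ)) ⊆ {s | _root_.deriv f s = 0} := closure_minimal h2 h3
  rw [closure_Iio] at h4
  exact h4 ht

theorem primitive (hf : SmoothCausal f) : SmoothCausal fun t => ∫ s in (0 : ℝ)..t, f s := by
  have h : ∀ t, HasDerivAt (fun t => ∫ s in (0 : ℝ)..t, f s) (f t) t := fun t =>
    hf.continuous.integral_hasStrictDerivAt 0 t |>.hasDerivAt
  refine ⟨contDiff_infty_iff_deriv.2 ⟨fun t => (h t).differentiableAt, ?_⟩, hf.causal.primitive⟩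
  rw [show _root_.deriv (fun t => ∫ s in (0 : ℝ)..t, f s) = f from funext fun t => (h t).deriv]
  exact hf.contDiff

theorem deriv_primitive (hf : SmoothCausal f) :
    _root_.deriv (fun t => ∫ s in (0 : ℝ)..t, f s) = f :=
  funext fun t => (hf.continuous.integral_hasStrictDerivAt 0 t |>.hasDerivAt).deriv

theorem primitive_deriv (hf : SmoothCausal f) :
    (fun t => ∫ s in (0 : ℝ)..t, _root_.deriv f s) = f := by
  ext t
  rw [intervalIntegral.integral_deriv_eq_sub (fun s _ => (hf.hasDerivAt s).differentiableAt)
    (hf.deriv.continuous.intervalIntegrable _ _), hf.causal 0 le_rfl, sub_zero]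

end SmoothCausal

namespace IsWaveKernel

variable {Q c : ℝ → ℝ} {k : ℝ → ℝ → ℝ} {f : ℝ → ℝ}

/-- The control is written as the primitive of its derivative, and `scattered_primitive` turns the
claim into the fundamental theorem of calculus. The kernel itself is never differentiated. -/
theorem hasDerivAt_scattered_time (hk : IsWaveKernel Q c k) (hf : SmoothCausal f) (x t : ℝ) :
    HasDerivAt (fun t => scattered k f x t) (scattered k (deriv f) x t) t := by
  have h1 : (fun t => scattered k f x t)
      = fun t => ∫ τ in (0 : ℝ)..t, scattered k (deriv f) x τ := by
    ext t
    conv_lhs => rw [← hf.primitive_deriv]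
    exact hk.scattered_primitive hf.deriv.causal hf.deriv.locallyIntegrable x t
  rw [h1]
  have hcont : Continuous fun τ => scattered k (deriv f) x τ :=
    (hk.continuous_scattered hf.deriv.causal hf.deriv.locallyIntegrable).comp
      (by fun_prop : Continuous fun τ : ℝ => (x, τ))
  exact (hcont.integral_hasStrictDerivAt 0 t).hasDerivAt

theorem hasDerivAt_wave_time (hk : IsWaveKernel Q c k) (hf : SmoothCausal f) (x t : ℝ) :
    HasDerivAt (fun t => wave c k f x t) (wave c k (deriv f) x t) t := by
  refine HasDerivAt.add ?_ (hk.hasDerivAt_scattered_time hf x t)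
  have := (hf.hasDerivAt (t - |x|)).comp t ((hasDerivAt_id t).sub_const |x|)
  simpa using this.const_mul (c x)

theorem exists_bound_wave (hc1 : ∀ x, |c x| ≤ 1) (hk : IsWaveKernel Q c k) (hf : Causal f)
    (hfc : Continuous f) (T : ℝ) : ∃ B, 0 ≤ B ∧ ∀ x t, t ≤ T → |wave c k f x t| ≤ B := by
  have hs := hk.continuous_scattered hf hfc.locallyIntegrable
  obtain ⟨B₁, hB₁⟩ := (isCompact_Icc.prod isCompact_Icc).exists_bound_of_continuousOn
    (hs.continuousOn (s := Icc (-T) T ×ˢ Icc 0 T))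
  obtain ⟨B₂, hB₂⟩ := isCompact_Icc.exists_bound_of_continuousOn
    (hfc.continuousOn (s := Icc 0 T))
  refine ⟨max B₂ 0 + max B₁ 0, by positivity, fun x t ht => ?_⟩
  rcases le_or_gt t |x| with h | h
  · rw [wave_eq_zero hk hf h]
    simp only [abs_zero]
    positivity
  · refine (abs_add_le _ _).trans (add_le_add ?_ ?_)
    · rw [abs_mul]
      have h1 : |f (t - |x|)| ≤ max B₂ 0 :=
        (hB₂ _ ⟨by linarith, by linarith [abs_nonneg x]⟩).trans (le_max_left _ _)
      exact (mul_le_of_le_one_left (abs_nonneg _) (hc1 x)).trans h1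
    · exact (hB₁ (x, t) ⟨abs_le.1 (h.le.trans ht), (abs_nonneg x).trans h.le, ht⟩).trans
        (le_max_left _ _)

theorem measurable_wave (hc : Measurable c) (hk : IsWaveKernel Q c k) (hf : Causal f)
    (hfc : Continuous f) : Measurable fun p : ℝ × ℝ => wave c k f p.1 p.2 := by
  have hs := hk.continuous_scattered hf hfc.locallyIntegrable
  unfold wave
  fun_prop

theorem continuous_wave_time (hk : IsWaveKernel Q c k) (hf : Causal f)
    (hfc : Continuous f) (x : ℝ) : Continuous fun t => wave c k f x t := by
  have hs := hk.continuous_scattered hf hfc.locallyIntegrable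
  unfold wave
  fun_prop

theorem abs_wave_sub_le (hk : IsWaveKernel Q c k) (hf : SmoothCausal f) {T B : ℝ}
    (hB : ∀ x t, t ≤ T → |wave c k (deriv f) x t| ≤ B) (x : ℝ) {s t : ℝ} (hs : s ≤ T)
    (ht : t ≤ T) : |wave c k f x s - wave c k f x t| ≤ B * |s - t| :=
  (convex_Iic T).norm_image_sub_le_of_norm_hasDerivWithin_le (f := fun t => wave c k f x t)
    (fun u _ => (hk.hasDerivAt_wave_time hf x u).hasDerivWithinAt) (fun u hu => hB x u hu) ht hs

end IsWaveKernel

/-! ### Space derivatives of the scattered wave -/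

/-- The sign of a nonzero real number. -/
def sgn (x : ℝ) : ℝ := if 0 < x then 1 else -1

theorem measurable_sgn : Measurable sgn :=
  Measurable.ite measurableSet_Ioi measurable_const measurable_const

theorem abs_sgn (x : ℝ) : |sgn x| = 1 := by
  unfold sgn
  split_ifs <;> simp

theorem sgn_mul_self (x : ℝ) : sgn x * sgn x = 1 := by
  unfold sgn
  split_ifs <;> simp

theorem sgn_eventuallyEq {x : ℝ} (hx : x ≠ 0) : ∀ᶠ y in 𝓝 x, sgn y = sgn x := by
  rcases lt_or_gt_of_ne hx with h | h
  · filter_upwards [Iio_mem_nhds h] with y hy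
    simp [sgn, not_lt.2 h.le, not_lt.2 (mem_Iio.1 hy).le]
  · filter_upwards [Ioi_mem_nhds h] with y hy
    simp only [sgn, if_pos h]
    exact if_pos hy

theorem hasDerivAt_abs_sub {x ξ : ℝ} (hx : x ≠ ξ) :
    HasDerivAt (fun y => |y - ξ|) (sgn (x - ξ)) x := by
  have h := (hasDerivAt_abs (sub_ne_zero.2 hx)).comp x ((hasDerivAt_id x).sub_const ξ)
  have e : (SignType.sign (x - ξ) : ℝ) * 1 = sgn (x - ξ) := by
    rcases lt_or_gt_of_ne (sub_ne_zero.2 hx) with h | h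
    · rw [sign_neg h]
      simp [sgn, not_lt.2 h.le, -sub_pos, -sub_neg]
    · rw [sign_pos h]
      simp [sgn, h, -sub_pos, -sub_neg]
  rw [e] at h
  exact h

theorem dist_const_mul_le {q a b B d : ℝ} (hB : 0 ≤ B) (h : |a - b| ≤ B * d) :
    dist (q * a) (q * b) ≤ (Real.nnabs (|q| * B) : ℝ) * d := by
  rw [Real.coe_nnabs, abs_of_nonneg (mul_nonneg (abs_nonneg q) hB), Real.dist_eq, ← mul_sub,
    abs_mul, mul_assoc]
  exact mul_le_mul_of_nonneg_left h (abs_nonneg q)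

/-- The space derivative of the scattered wave. -/
def flux (Q c : ℝ → ℝ) (k : ℝ → ℝ → ℝ) (f : ℝ → ℝ) (x t : ℝ) : ℝ :=
  1 / 2 * ∫ ξ, Q ξ * (sgn (x - ξ) * wave c k f ξ (t - |x - ξ|))

namespace IsWaveKernel

variable {Q c : ℝ → ℝ} {k : ℝ → ℝ → ℝ} {f : ℝ → ℝ}

theorem flux_eq_zero (hk : IsWaveKernel Q c k) (hf : Causal f) {x t : ℝ} (h : t ≤ |x|) :
    flux Q c k f x t = 0 := by
  unfold flux
  have : ∀ ξ, Q ξ * (sgn (x - ξ) * wave c k f ξ (t - |x - ξ|)) = 0 := by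
    intro ξ
    have := abs_add_le ξ (x - ξ)
    rw [add_sub_cancel] at this
    rw [wave_eq_zero hk hf (by linarith)]
    simp
  simp [this]

theorem aestronglyMeasurable_wave (hc : Measurable c) (hk : IsWaveKernel Q c k) (hf : Causal f)
    (hfc : Continuous f) {u : ℝ → ℝ} (hu : Measurable u) :
    AEStronglyMeasurable fun ξ => wave c k f ξ (u ξ) :=
  ((hk.measurable_wave hc hf hfc).comp (measurable_id.prodMk hu)).aestronglyMeasurable

theorem aestronglyMeasurable_flux (hQ : Integrable Q) (hc : Measurable c)
    (hk : IsWaveKernel Q c k) (hf : Causal f) (hfc : Continuous f) (x t : ℝ) :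
    AEStronglyMeasurable fun ξ => Q ξ * (sgn (x - ξ) * wave c k f ξ (t - |x - ξ|)) :=
  hQ.1.mul (((measurable_sgn.comp (measurable_const.sub measurable_id)).aestronglyMeasurable).mul
    (hk.aestronglyMeasurable_wave hc hf hfc (by fun_prop)))

theorem continuous_flux (hQ : Integrable Q) (hc : Measurable c) (hc1 : ∀ x, |c x| ≤ 1)
    (hk : IsWaveKernel Q c k) (hf : Causal f) (hfc : Continuous f) :
    Continuous fun p : ℝ × ℝ => flux Q c k f p.1 p.2 := by
  refine continuous_const.mul (continuous_iff_continuousAt.2 fun p₀ => ?_)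
  obtain ⟨B, hB0, hB⟩ := hk.exists_bound_wave hc1 hf hfc (p₀.2 + 1)
  have hev : ∀ᶠ p in 𝓝 p₀, p.2 ≤ p₀.2 + 1 :=
    (continuous_snd.tendsto p₀).eventually (Iic_mem_nhds (by simp))
  refine continuousAt_of_dominated (bound := fun ξ => |Q ξ| * B)
    (Eventually.of_forall fun p => hk.aestronglyMeasurable_flux hQ hc hf hfc _ _) ?_
    (hQ.abs.mul_const B) ?_
  · filter_upwards [hev] with p hp
    refine Eventually.of_forall fun ξ => ?_
    rw [norm_mul, norm_mul, Real.norm_eq_abs, Real.norm_eq_abs, Real.norm_eq_abs, abs_sgn, one_mul]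
    exact mul_le_mul_of_nonneg_left (hB _ _ (by linarith [abs_nonneg (p.1 - ξ)])) (abs_nonneg _)
  · have : ∀ᵐ ξ : ℝ, ξ ≠ p₀.1 := by simp [ae_iff, measure_singleton]
    filter_upwards [this] with ξ hξ
    refine continuousAt_const.mul (ContinuousAt.mul ?_ ?_)
    · have h1 : ContinuousAt (fun p : ℝ × ℝ => p.1 - ξ) p₀ := by fun_prop
      exact (continuousAt_const (y := sgn (p₀.1 - ξ))).congr
        ((h1.eventually (sgn_eventuallyEq (sub_ne_zero.2 (Ne.symm hξ)))).mono fun p hp => hp.symm)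
    · exact ((hk.continuous_wave_time hf hfc ξ).comp (by fun_prop :
        Continuous fun p : ℝ × ℝ => p.2 - |p.1 - ξ|)).continuousAt

theorem integrable_flux (hQ : Integrable Q) (hc : Measurable c) (hc1 : ∀ x, |c x| ≤ 1)
    (hk : IsWaveKernel Q c k) (hf : Causal f) (hfc : Continuous f) (x t : ℝ) :
    Integrable fun ξ => Q ξ * (sgn (x - ξ) * wave c k f ξ (t - |x - ξ|)) := by
  obtain ⟨B, hB0, hB⟩ := hk.exists_bound_wave hc1 hf hfc t
  refine (hQ.abs.mul_const B).mono' (hk.aestronglyMeasurable_flux hQ hc hf hfc x t)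
    (Eventually.of_forall fun ξ => ?_)
  rw [norm_mul, norm_mul, Real.norm_eq_abs, Real.norm_eq_abs, Real.norm_eq_abs, abs_sgn, one_mul]
  exact mul_le_mul_of_nonneg_left (hB _ _ (by linarith [abs_nonneg (x - ξ)])) (abs_nonneg _)

theorem integrable_mul_wave (hQ : Integrable Q) (hc : Measurable c) (hc1 : ∀ x, |c x| ≤ 1)
    (hk : IsWaveKernel Q c k) (hf : Causal f) (hfc : Continuous f) {u : ℝ → ℝ} (hu : Measurable u)
    {T : ℝ} (huT : ∀ ξ, u ξ ≤ T) : Integrable fun ξ => Q ξ * wave c k f ξ (u ξ) := by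
  obtain ⟨B, hB0, hB⟩ := hk.exists_bound_wave hc1 hf hfc T
  exact hQ.mul_bdd (c := B) (hk.aestronglyMeasurable_wave hc hf hfc hu)
    (Eventually.of_forall fun ξ => hB ξ _ (huT ξ))

theorem hasDerivAt_flux_time (hQ : Integrable Q) (hc : Measurable c) (hc1 : ∀ x, |c x| ≤ 1)
    (hk : IsWaveKernel Q c k) (hf : SmoothCausal f) (x t : ℝ) :
    HasDerivAt (fun t => flux Q c k f x t) (flux Q c k (deriv f) x t) t := by
  obtain ⟨B, hB0, hB⟩ := hk.exists_bound_wave hc1 hf.deriv.causal hf.deriv.continuous (t + 1)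
  refine HasDerivAt.const_mul _ ?_
  refine (hasDerivAt_integral_of_dominated_loc_of_lip (bound := fun ξ => |Q ξ| * B)
    (Iio_mem_nhds (by linarith : t < t + 1))
    (Eventually.of_forall fun t => hk.aestronglyMeasurable_flux hQ hc hf.causal hf.continuous x t)
    (hk.integrable_flux hQ hc hc1 hf.causal hf.continuous x t)
    (hk.aestronglyMeasurable_flux hQ hc hf.deriv.causal hf.deriv.continuous x t) ?_
    (hQ.abs.mul_const B) ?_).2
  · refine Eventually.of_forall fun ξ => LipschitzOnWith.of_dist_le_mul fun s hs u hu => ?_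
    refine dist_const_mul_le hB0 ?_
    rw [← mul_sub, abs_mul, abs_sgn, one_mul, Real.dist_eq]
    have a := abs_nonneg (x - ξ)
    have h := hk.abs_wave_sub_le hf hB ξ (s := s - |x - ξ|) (t := u - |x - ξ|)
      (by linarith [mem_Iio.1 hs]) (by linarith [mem_Iio.1 hu])
    simpa using h
  · refine Eventually.of_forall fun ξ => HasDerivAt.const_mul _ (HasDerivAt.const_mul _ ?_)
    exact HasDerivAt.comp_sub_const t |x - ξ| (hk.hasDerivAt_wave_time hf ξ _)

/-- Differentiation of Duhamel's formula under the integral sign. The wave of the primitive is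
Lipschitz in time with time derivative the wave of `f`, and the retarded time `t - |x - ξ|` is
differentiable in `x` except at the single point `ξ = x`. -/
theorem hasDerivAt_scattered_space (hQ : Integrable Q) (hc : Measurable c)
    (hc1 : ∀ x, |c x| ≤ 1) (hk : IsWaveKernel Q c k) (hf : SmoothCausal f) (x t : ℝ) :
    HasDerivAt (fun x => scattered k f x t) (flux Q c k f x t) x := by
  set g : ℝ → ℝ := fun t => ∫ s in (0 : ℝ)..t, f s with hg_def
  have hg : SmoothCausal g := hf.primitive
  have hdg : deriv g = f := hf.deriv_primitive
  obtain ⟨B, hB0, hB⟩ := hk.exists_bound_wave hc1 hf.causal hf.continuous t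
  have h1 : (fun x => scattered k f x t)
      = fun x => -(1 / 2) * ∫ ξ, Q ξ * wave c k g ξ (t - |x - ξ|) :=
    funext fun x => hk.duhamel hQ hc hc1 hf.causal hf.locallyIntegrable x t
  have h2 : flux Q c k f x t
      = -(1 / 2) * ∫ ξ, Q ξ * (wave c k f ξ (t - |x - ξ|) * (-sgn (x - ξ))) := by
    unfold flux
    rw [neg_mul, ← mul_neg, ← integral_neg]
    congr 2
    ext ξ
    ring
  rw [h1, h2]
  refine HasDerivAt.const_mul _ ?_
  refine (hasDerivAt_integral_of_dominated_loc_of_lip (bound := fun ξ => |Q ξ| * B)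
    univ_mem (Eventually.of_forall fun x => hQ.1.mul
      (hk.aestronglyMeasurable_wave hc hg.causal hg.continuous (by fun_prop)))
    (hk.integrable_mul_wave hQ hc hc1 hg.causal hg.continuous (by fun_prop) (T := t)
      fun ξ => by linarith [abs_nonneg (x - ξ)]) ?_ ?_ (hQ.abs.mul_const B) ?_).2
  · refine hQ.1.mul ((hk.aestronglyMeasurable_wave hc hf.causal hf.continuous (by fun_prop)).mul ?_)
    exact (measurable_sgn.comp (measurable_const.sub measurable_id)).neg.aestronglyMeasurable
  · refine Eventually.of_forall fun ξ => LipschitzOnWith.of_dist_le_mul fun y _ z _ => ?_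
    refine dist_const_mul_le hB0 ?_
    rw [Real.dist_eq]
    rw [← hdg] at hB
    have h := hk.abs_wave_sub_le hg hB ξ (s := t - |y - ξ|) (t := t - |z - ξ|)
      (by linarith [abs_nonneg (y - ξ)]) (by linarith [abs_nonneg (z - ξ)])
    refine h.trans (mul_le_mul_of_nonneg_left ?_ hB0)
    have := abs_abs_sub_abs_le_abs_sub (z - ξ) (y - ξ)
    rw [sub_sub_sub_cancel_left]
    refine this.trans (le_of_eq ?_)
    rw [abs_sub_comm]
    congr 1
    ring
  · have : ∀ᵐ ξ : ℝ, x ≠ ξ := by simp [ae_iff, measure_singleton]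
    filter_upwards [this] with ξ hξ
    refine HasDerivAt.const_mul _ ?_
    have h := hk.hasDerivAt_wave_time hg ξ (t - |x - ξ|)
    rw [hdg] at h
    exact h.comp x ((hasDerivAt_abs_sub hξ).const_sub t)

/-- The integrand of the flux jumps at `ξ = x`, so the unretarded value is split off. The part `½ ∫
sgn (x - ξ) w(ξ) dξ` has derivative `w(x) = Q(x) v(x, t)` by the fundamental theorem of calculus,
which is where continuity at `x` enters. The remainder vanishes at the jump, hence is Lipschitz in
`x` and can be differentiated under the integral; by Duhamel its derivative is the scattered wave of
`f''`. -/
theorem hasDerivAt_flux_space (hQ : Integrable Q) (hc : Measurable c)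
    (hc1 : ∀ x, |c x| ≤ 1) (hk : IsWaveKernel Q c k) (hf : SmoothCausal f) {x : ℝ}
    (hQx : ContinuousAt Q x) (hcx : ContinuousAt c x) (t : ℝ) :
    HasDerivAt (fun x => flux Q c k f x t)
      (Q x * wave c k f x t + scattered k (deriv (deriv f)) x t) x := by
  obtain ⟨B, hB0, hB⟩ := hk.exists_bound_wave hc1 hf.deriv.causal hf.deriv.continuous t
  set w : ℝ → ℝ := fun ξ => Q ξ * wave c k f ξ t with hw_def
  have hw : Integrable w := hk.integrable_mul_wave hQ hc hc1 hf.causal hf.continuous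
    measurable_const (T := t) fun ξ => le_rfl
  have hwx : ContinuousAt w x := by
    refine hQx.mul ?_
    have h1 := hk.continuous_scattered hf.causal hf.locallyIntegrable
    have h2 : ContinuousAt (fun ξ => scattered k f ξ t) x :=
      (h1.comp (by fun_prop : Continuous fun ξ : ℝ => (ξ, t))).continuousAt
    have h3 : ContinuousAt (fun ξ => f (t - |ξ|)) x :=
      (hf.continuous.comp (by fun_prop : Continuous fun ξ : ℝ => t - |ξ|)).continuousAt
    exact (hcx.mul h3).add h2
  -- the singular part
  have hA : HasDerivAt (fun y => 1 / 2 * ∫ ξ, sgn (y - ξ) * w ξ) (w x) x := by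
    have e : ∀ y, 1 / 2 * ∫ ξ, sgn (y - ξ) * w ξ
        = (∫ ξ in (0 : ℝ)..y, w ξ) + ((∫ ξ in Iic 0, w ξ) - 1 / 2 * ∫ ξ, w ξ) := by
      intro y
      have e1 : (fun ξ => sgn (y - ξ) * w ξ) = fun ξ => 2 * indicator (Iio y) w ξ - w ξ := by
        ext ξ
        by_cases h : ξ < y
        · simp only [sgn, sub_pos, if_pos h, indicator_of_mem (mem_Iio.2 h)]
          ring
        · simp only [sgn, sub_pos, if_neg h, indicator_of_notMem (notMem_Iio.2 (not_lt.1 h))]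
          ring
      rw [e1, integral_sub ((hw.indicator measurableSet_Iio).const_mul 2) hw, integral_const_mul,
        integral_indicator measurableSet_Iio, ← integral_Iic_eq_integral_Iio,
        ← intervalIntegral.integral_Iic_sub_Iic hw.integrableOn hw.integrableOn]
      ring
    simp only [e]
    refine (intervalIntegral.integral_hasDerivAt_right hw.intervalIntegrable ?_ hwx).add_const _
    exact hw.1.stronglyMeasurableAtFilter
  -- the regular part
  have hR : HasDerivAt (fun y => ∫ ξ, Q ξ * (sgn (y - ξ) *
      (wave c k f ξ (t - |y - ξ|) - wave c k f ξ t)))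
      (∫ ξ, Q ξ * (-wave c k (deriv f) ξ (t - |x - ξ|))) x := by
    have hm : ∀ y, AEStronglyMeasurable fun ξ => Q ξ * (sgn (y - ξ) *
        (wave c k f ξ (t - |y - ξ|) - wave c k f ξ t)) := fun y =>
      hQ.1.mul (((measurable_sgn.comp (measurable_const.sub
        measurable_id)).aestronglyMeasurable).mul
        ((hk.aestronglyMeasurable_wave hc hf.causal hf.continuous (by fun_prop)).sub
        (hk.aestronglyMeasurable_wave hc hf.causal hf.continuous measurable_const)))
    refine (hasDerivAt_integral_of_dominated_loc_of_lip (bound := fun ξ => |Q ξ| * B)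
      univ_mem (Eventually.of_forall hm) ?_ ?_ ?_ (hQ.abs.mul_const B) ?_).2
    · have h1 := (hk.integrable_flux hQ hc hc1 hf.causal hf.continuous x t)
      have h2 : Integrable fun ξ => w ξ * sgn (x - ξ) := hw.mul_bdd (c := 1)
        (measurable_sgn.comp (measurable_const.sub measurable_id)).aestronglyMeasurable
        (Eventually.of_forall fun ξ => by simp [abs_sgn])
      refine (h1.sub h2).congr (Eventually.of_forall fun ξ => ?_)
      simp only [hw_def, Pi.sub_apply]
      ring
    · exact hQ.1.mul (hk.aestronglyMeasurable_wave hc hf.deriv.causal hf.deriv.continuous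
        (by fun_prop)).neg
    · refine Eventually.of_forall fun ξ => LipschitzOnWith.of_dist_le_mul fun y _ z _ => ?_
      refine dist_const_mul_le hB0 ?_
      rw [Real.dist_eq]
      have hL : ∀ s u : ℝ, 0 ≤ s → 0 ≤ u →
          |wave c k f ξ (t - s) - wave c k f ξ (t - u)| ≤ B * |s - u| := by
        intro s u hs hu
        have := hk.abs_wave_sub_le hf hB ξ (s := t - s) (t := t - u) (by linarith) (by linarith)
        rwa [sub_sub_sub_cancel_left, abs_sub_comm u s] at this
      have hL0 : ∀ s : ℝ, 0 ≤ s → |wave c k f ξ (t - s) - wave c k f ξ t| ≤ B * s := by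
        intro s hs
        have := hL s 0 hs le_rfl
        rwa [sub_zero, sub_zero, abs_of_nonneg hs] at this
      -- When `y` and `z` lie on different sides of `ξ`, the two terms are each compared with the
      -- unretarded value, and `|y - ξ| + |z - ξ| = |y - z|` restores the Lipschitz bound.
      by_cases hy : 0 < y - ξ <;> by_cases hz : 0 < z - ξ
      · simp only [sgn, if_pos hy, if_pos hz, one_mul, sub_sub_sub_cancel_right]
        refine (hL _ _ (abs_nonneg _) (abs_nonneg _)).trans (mul_le_mul_of_nonneg_left ?_ hB0)
        refine (abs_abs_sub_abs_le_abs_sub _ _).trans (le_of_eq ?_)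
        congr 1
        ring
      · simp only [sgn, if_pos hy, if_neg hz, one_mul, neg_mul, sub_neg_eq_add]
        refine (abs_add_le _ _).trans ?_
        refine (add_le_add (hL0 _ (abs_nonneg _)) (hL0 _ (abs_nonneg _))).trans ?_
        rw [← mul_add, abs_of_pos hy, abs_of_nonpos (not_lt.1 hz)]
        refine mul_le_mul_of_nonneg_left ?_ hB0
        linarith [le_abs_self (y - z)]
      · simp only [sgn, if_neg hy, if_pos hz, one_mul, neg_mul]
        rw [← neg_add', abs_neg]
        refine (abs_add_le _ _).trans ?_
        refine (add_le_add (hL0 _ (abs_nonneg _)) (hL0 _ (abs_nonneg _))).trans ?_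
        rw [← mul_add, abs_of_nonpos (not_lt.1 hy), abs_of_pos hz]
        refine mul_le_mul_of_nonneg_left ?_ hB0
        linarith [neg_abs_le (y - z)]
      · simp only [sgn, if_neg hy, if_neg hz, neg_mul, one_mul]
        rw [neg_sub_neg, sub_sub_sub_cancel_right]
        refine (hL _ _ (abs_nonneg _) (abs_nonneg _)).trans (mul_le_mul_of_nonneg_left ?_ hB0)
        refine (abs_abs_sub_abs_le_abs_sub _ _).trans (le_of_eq ?_)
        rw [abs_sub_comm]
        congr 1
        ring
    · have : ∀ᵐ ξ : ℝ, x ≠ ξ := by simp [ae_iff, measure_singleton]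
      filter_upwards [this] with ξ hξ
      refine HasDerivAt.const_mul _ ?_
      have h := (((hk.hasDerivAt_wave_time hf ξ (t - |x - ξ|)).comp x
        ((hasDerivAt_abs_sub hξ).const_sub t)).sub_const (wave c k f ξ t)).const_mul (sgn (x - ξ))
      have h1 : sgn (x - ξ) * (wave c k (deriv f) ξ (t - |x - ξ|) * -sgn (x - ξ))
          = -wave c k (deriv f) ξ (t - |x - ξ|) := by
        linear_combination (-wave c k (deriv f) ξ (t - |x - ξ|)) * sgn_mul_self (x - ξ)
      rw [h1] at h
      refine h.congr_of_eventuallyEq ?_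
      have h2 : ContinuousAt (fun y : ℝ => y - ξ) x := by fun_prop
      filter_upwards [h2.eventually (sgn_eventuallyEq (sub_ne_zero.2 hξ))] with y hy
      simp only [hy, Function.comp]
  have hD : scattered k (deriv (deriv f)) x t
      = 1 / 2 * ∫ ξ, Q ξ * (-wave c k (deriv f) ξ (t - |x - ξ|)) := by
    rw [hk.duhamel hQ hc hc1 hf.deriv.deriv.causal hf.deriv.deriv.locallyIntegrable,
      hf.deriv.primitive_deriv]
    simp only [mul_neg]
    rw [integral_neg]
    ring
  rw [hD]
  refine (hA.add (hR.const_mul (1 / 2))).congr_of_eventuallyEq (Eventually.of_forall fun y => ?_)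
  have i1 := hk.integrable_flux hQ hc hc1 hf.causal hf.continuous y t
  have i2 : Integrable fun ξ => sgn (y - ξ) * w ξ := hw.bdd_mul (c := 1)
    (measurable_sgn.comp (measurable_const.sub measurable_id)).aestronglyMeasurable
    (Eventually.of_forall fun ξ => by simp [abs_sgn])
  have e : (fun ξ => Q ξ * (sgn (y - ξ) * (wave c k f ξ (t - |y - ξ|) - wave c k f ξ t)))
      = fun ξ => Q ξ * (sgn (y - ξ) * wave c k f ξ (t - |y - ξ|)) - sgn (y - ξ) * w ξ := by
    ext ξ
    simp only [hw_def]
    ring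
  simp only [Pi.add_apply]
  rw [e, integral_sub i1 i2, flux]
  ring

end IsWaveKernel

/-! ### Regularity from partial derivatives -/

theorem hasFDerivAt_of_partial {U : Set (ℝ × ℝ)} (hU : IsOpen U) {g gx gt : ℝ → ℝ → ℝ}
    (hx : ∀ p ∈ U, HasDerivAt (fun x => g x p.2) (gx p.1 p.2) p.1)
    (ht : ∀ p ∈ U, HasDerivAt (fun t => g p.1 t) (gt p.1 p.2) p.2)
    (cx : ContinuousOn (fun p : ℝ × ℝ => gx p.1 p.2) U)
    (ct : ContinuousOn (fun p : ℝ × ℝ => gt p.1 p.2) U) {p : ℝ × ℝ} (hp : p ∈ U) :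
    HasFDerivAt (fun p : ℝ × ℝ => g p.1 p.2)
      (gx p.1 p.2 • ContinuousLinearMap.fst ℝ ℝ ℝ + gt p.1 p.2 • ContinuousLinearMap.snd ℝ ℝ ℝ)
      p := by
  have hUp := hU.mem_nhds hp
  have cL : Continuous fun a : ℝ => ContinuousLinearMap.toSpanSingleton ℝ a :=
    (ContinuousLinearMap.toSpanSingletonCLE (𝕜 := ℝ) (E := ℝ)).continuous
  have h := hasStrictFDerivAt_uncurry_coprod (𝕜 := ℝ) (u := p) (f := g)
    (f₁ := fun x t => ContinuousLinearMap.toSpanSingleton ℝ (gx x t))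
    (f₂ := fun x t => ContinuousLinearMap.toSpanSingleton ℝ (gt x t))
    (Filter.eventually_of_mem hUp fun v hv => (hx v hv).hasFDerivAt)
    (Filter.eventually_of_mem hUp fun v hv => (ht v hv).hasFDerivAt)
    (cL.continuousAt.comp (cx.continuousAt hUp))
    (cL.continuousAt.comp (ct.continuousAt hUp))
  have e : (ContinuousLinearMap.toSpanSingleton ℝ (gx p.1 p.2)).coprod
      (ContinuousLinearMap.toSpanSingleton ℝ (gt p.1 p.2))
      = gx p.1 p.2 • ContinuousLinearMap.fst ℝ ℝ ℝ + gt p.1 p.2 • ContinuousLinearMap.snd ℝ ℝ ℝ := by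
    ext <;> simp
  rw [← e]
  exact h.hasFDerivAt

theorem contDiffOn_one_of_partial {U : Set (ℝ × ℝ)} (hU : IsOpen U) {g gx gt : ℝ → ℝ → ℝ}
    (hx : ∀ p ∈ U, HasDerivAt (fun x => g x p.2) (gx p.1 p.2) p.1)
    (ht : ∀ p ∈ U, HasDerivAt (fun t => g p.1 t) (gt p.1 p.2) p.2)
    (cx : ContinuousOn (fun p : ℝ × ℝ => gx p.1 p.2) U)
    (ct : ContinuousOn (fun p : ℝ × ℝ => gt p.1 p.2) U) :
    ContDiffOn ℝ 1 (fun p : ℝ × ℝ => g p.1 p.2) U := by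
  have h := fun p (hp : p ∈ U) => hasFDerivAt_of_partial hU hx ht cx ct hp
  rw [show (1 : WithTop ℕ∞) = 0 + 1 by norm_num, contDiffOn_succ_iff_fderiv_of_isOpen hU]
  refine ⟨fun p hp => (h p hp).differentiableAt.differentiableWithinAt, by simp, ?_⟩
  rw [contDiffOn_zero]
  exact ((cx.smul continuousOn_const).add (ct.smul continuousOn_const)).congr
    fun p hp => (h p hp).fderiv

theorem contDiffOn_two_of_partial {U : Set (ℝ × ℝ)} (hU : IsOpen U)
    {g gx gt gxx gxt gtt : ℝ → ℝ → ℝ}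
    (hx : ∀ p ∈ U, HasDerivAt (fun x => g x p.2) (gx p.1 p.2) p.1)
    (ht : ∀ p ∈ U, HasDerivAt (fun t => g p.1 t) (gt p.1 p.2) p.2)
    (hxx : ∀ p ∈ U, HasDerivAt (fun x => gx x p.2) (gxx p.1 p.2) p.1)
    (hxt : ∀ p ∈ U, HasDerivAt (fun t => gx p.1 t) (gxt p.1 p.2) p.2)
    (htx : ∀ p ∈ U, HasDerivAt (fun x => gt x p.2) (gxt p.1 p.2) p.1)
    (htt : ∀ p ∈ U, HasDerivAt (fun t => gt p.1 t) (gtt p.1 p.2) p.2)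
    (cxx : ContinuousOn (fun p : ℝ × ℝ => gxx p.1 p.2) U)
    (cxt : ContinuousOn (fun p : ℝ × ℝ => gxt p.1 p.2) U)
    (ctt : ContinuousOn (fun p : ℝ × ℝ => gtt p.1 p.2) U) :
    ContDiffOn ℝ 2 (fun p : ℝ × ℝ => g p.1 p.2) U := by
  have c1 := contDiffOn_one_of_partial hU hxx hxt cxx cxt
  have c2 := contDiffOn_one_of_partial hU htx htt cxt ctt
  have h := fun p (hp : p ∈ U) =>
    hasFDerivAt_of_partial hU hx ht c1.continuousOn c2.continuousOn hp
  rw [show (2 : WithTop ℕ∞) = 1 + 1 by norm_num, contDiffOn_succ_iff_fderiv_of_isOpen hU]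
  refine ⟨fun p hp => (h p hp).differentiableAt.differentiableWithinAt, by simp, ?_⟩
  exact ((c1.smul contDiffOn_const).add (c2.smul contDiffOn_const)).congr
    fun p hp => (h p hp).fderiv

/-! ### The potential on the line -/

theorem qTilde_of_pos (q : ℝ → ℝ) {x : ℝ} (h0 : 0 < x) (h1 : x < 2 * π) : qTilde q x = q x :=
  if_pos ⟨h0, h1⟩

theorem qTilde_of_neg (q : ℝ → ℝ) {x : ℝ} (h0 : -(2 * π) < x) (h1 : x < 0) :
    qTilde q x = q (x + 2 * π) := by
  rw [qTilde, if_neg (fun h => absurd h.1 (not_lt.2 h1.le)), if_pos ⟨h0, h1⟩]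

theorem qTilde_eq_indicator (q : ℝ → ℝ) : qTilde q =
    indicator (Ioo 0 (2 * π)) q + indicator (Ioo (-(2 * π)) 0) fun x => q (x + 2 * π) := by
  ext x
  simp only [qTilde, Pi.add_apply, indicator, mem_Ioo]
  split_ifs with h1 h2 h2
  · exact absurd h1.1 (not_lt.2 h2.2.le)
  · simp
  · simp
  · simp

theorem memLp_qTilde {q : ℝ → ℝ} (hq2 : MemLp q 2 (volume.restrict (Ioo 0 (2 * π)))) :
    MemLp (qTilde q) 2 := by
  rw [qTilde_eq_indicator]
  have h1 : MemLp (indicator (Ioo 0 (2 * π)) q) 2 := (memLp_indicator_iff_restrict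
    measurableSet_Ioo).2 hq2
  refine h1.add ?_
  have h2 := h1.comp_measurePreserving (measurePreserving_add_right volume (2 * π))
  refine h2.ae_eq (Eventually.of_forall fun x => ?_)
  simp only [Function.comp, indicator, mem_Ioo]
  refine if_congr ?_ rfl rfl
  constructor <;> rintro ⟨h1, h2⟩ <;> constructor <;> linarith

theorem integrable_qTilde {q : ℝ → ℝ} (hq2 : MemLp q 2 (volume.restrict (Ioo 0 (2 * π)))) :
    Integrable (qTilde q) := by
  have h := (memLp_qTilde hq2).restrict (Ioo (-(2 * π)) (2 * π))
  have h1 : IntegrableOn (qTilde q) (Ioo (-(2 * π)) (2 * π)) :=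
    h.integrable (by norm_num)
  refine (integrableOn_iff_integrable_of_support_subset fun x hx => ?_).1 h1
  by_contra hcon
  refine hx ?_
  rw [qTilde, if_neg, if_neg]
  · rintro ⟨h1, h2⟩
    exact hcon ⟨h1, by linarith [Real.pi_pos]⟩
  · rintro ⟨h1, h2⟩
    exact hcon ⟨by linarith [Real.pi_pos], h2⟩

theorem continuousAt_qTilde_pos {q : ℝ → ℝ} (hq : ContinuousOn q (Ioo 0 (2 * π))) {x : ℝ}
    (hx : x ∈ Ioo 0 (2 * π)) : ContinuousAt (qTilde q) x := by
  refine (hq.continuousAt (Ioo_mem_nhds hx.1 hx.2)).congr ?_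
  filter_upwards [Ioo_mem_nhds hx.1 hx.2] with y hy
  exact (qTilde_of_pos q hy.1 hy.2).symm

theorem continuousAt_qTilde_neg {q : ℝ → ℝ} (hq : ContinuousOn q (Ioo 0 (2 * π))) {x : ℝ}
    (hx : x ∈ Ioo (-(2 * π)) 0) : ContinuousAt (qTilde q) x := by
  have h1 : ContinuousAt q (x + 2 * π) :=
    hq.continuousAt (Ioo_mem_nhds (by linarith [hx.1]) (by linarith [hx.2]))
  have h2 : ContinuousAt (fun y => q (y + 2 * π)) x :=
    ContinuousAt.comp (f := fun y => y + 2 * π) h1 (by fun_prop)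
  refine h2.congr ?_
  filter_upwards [Ioo_mem_nhds hx.1 hx.2] with y hy
  exact (qTilde_of_neg q hy.1 hy.2).symm

/-! ### Waves generated by a pair of controls -/

/-- The profiles of the waves generated by the jumps of the value and of the derivative. -/
def profile : Fin 2 → ℝ → ℝ := ![fun x => sgn x / 2, fun _ => -(1 / 2)]

theorem measurable_profile (i : Fin 2) : Measurable (profile i) := by
  fin_cases i
  · exact measurable_sgn.div_const 2
  · exact measurable_const

theorem abs_profile_le (i : Fin 2) (x : ℝ) : |profile i x| ≤ 1 := by
  fin_cases i
  · simp only [profile, Fin.zero_eta, Matrix.cons_val_zero]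
    rw [abs_div, abs_sgn]
    norm_num
  · simp only [profile, Fin.mk_one, Matrix.cons_val_one, Matrix.cons_val_fin_one]
    norm_num [abs_of_nonneg]

theorem continuousAt_profile (i : Fin 2) {x : ℝ} (hx : x ≠ 0) : ContinuousAt (profile i) x := by
  fin_cases i
  · exact ((continuousAt_const (y := sgn x)).congr
      ((sgn_eventuallyEq hx).mono fun y hy => hy.symm)).div_const 2
  · exact continuousAt_const

/-- The wave scattered by the potential, for a pair of controls. -/
def pairScattered (k : Fin 2 → ℝ → ℝ → ℝ) (f : Fin 2 → ℝ → ℝ) (x t : ℝ) : ℝ :=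
  ∑ i, scattered (k i) (f i) x t

/-- The wave on the line generated by a pair of controls. -/
def pairWave (k : Fin 2 → ℝ → ℝ → ℝ) (f : Fin 2 → ℝ → ℝ) (x t : ℝ) : ℝ :=
  ∑ i, wave (profile i) (k i) (f i) x t

/-- The space derivative of the scattered wave, for a pair of controls. -/
def pairFlux (Q : ℝ → ℝ) (k : Fin 2 → ℝ → ℝ → ℝ) (f : Fin 2 → ℝ → ℝ) (x t : ℝ) : ℝ :=
  ∑ i, flux Q (profile i) (k i) (f i) x t

/-- The kernels of the waves generated by the two jumps. -/
def IsKernelPair (Q : ℝ → ℝ) (k : Fin 2 → ℝ → ℝ → ℝ) : Prop :=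
  ∀ i, IsWaveKernel Q (profile i) (k i)

theorem exists_isKernelPair {Q : ℝ → ℝ} (hQ : Integrable Q) : ∃ k, IsKernelPair Q k := by
  choose k hk using fun i => exists_isWaveKernel hQ (measurable_profile i) (abs_profile_le i)
  exact ⟨k, hk⟩

/-- Componentwise time derivative of a pair of controls. -/
def pairDeriv (f : Fin 2 → ℝ → ℝ) : Fin 2 → ℝ → ℝ := fun i => deriv (f i)

theorem pairWave_pos (k : Fin 2 → ℝ → ℝ → ℝ) (f : Fin 2 → ℝ → ℝ) {x : ℝ} (hx : 0 < x) (t : ℝ) :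
    pairWave k f x t = (f 0 (t - x) - f 1 (t - x)) / 2 + pairScattered k f x t := by
  simp only [pairWave, pairScattered, wave, Fin.sum_univ_two, profile, abs_of_pos hx,
    Matrix.cons_val_zero, Matrix.cons_val_one, Matrix.cons_val_fin_one, sgn, if_pos hx]
  ring

theorem pairWave_neg (k : Fin 2 → ℝ → ℝ → ℝ) (f : Fin 2 → ℝ → ℝ) {x : ℝ} (hx : x < 0) (t : ℝ) :
    pairWave k f x t = (-f 0 (t + x) - f 1 (t + x)) / 2 + pairScattered k f x t := by
  simp only [pairWave, pairScattered, wave, Fin.sum_univ_two, profile, abs_of_neg hx,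
    Matrix.cons_val_zero, Matrix.cons_val_one, Matrix.cons_val_fin_one, sgn,
    if_neg (not_lt.2 hx.le), sub_neg_eq_add]
  ring

namespace IsKernelPair

variable {Q : ℝ → ℝ} {k : Fin 2 → ℝ → ℝ → ℝ} {f : Fin 2 → ℝ → ℝ}

theorem scattered_eq_zero (hk : IsKernelPair Q k) (hf : ∀ i, Causal (f i)) {x t : ℝ}
    (h : t ≤ |x|) : pairScattered k f x t = 0 :=
  Finset.sum_eq_zero fun i _ => KreinPeriodic.scattered_eq_zero (hk i) (hf i) h

theorem wave_eq_zero (hk : IsKernelPair Q k) (hf : ∀ i, Causal (f i)) {x t : ℝ}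
    (h : t ≤ |x|) : pairWave k f x t = 0 :=
  Finset.sum_eq_zero fun i _ => KreinPeriodic.wave_eq_zero (hk i) (hf i) h

theorem flux_eq_zero (hk : IsKernelPair Q k) (hf : ∀ i, Causal (f i)) {x t : ℝ}
    (h : t ≤ |x|) : pairFlux Q k f x t = 0 :=
  Finset.sum_eq_zero fun i _ => (hk i).flux_eq_zero (hf i) h

theorem continuous_scattered (hk : IsKernelPair Q k) (hf : ∀ i, Causal (f i))
    (hfi : ∀ i, LocallyIntegrable (f i)) :
    Continuous fun p : ℝ × ℝ => pairScattered k f p.1 p.2 :=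
  continuous_finsetSum _ fun i _ => (hk i).continuous_scattered (hf i) (hfi i)

theorem continuous_flux (hQ : Integrable Q) (hk : IsKernelPair Q k)
    (hf : ∀ i, SmoothCausal (f i)) : Continuous fun p : ℝ × ℝ => pairFlux Q k f p.1 p.2 :=
  continuous_finsetSum _ fun i _ => (hk i).continuous_flux hQ (measurable_profile i)
    (abs_profile_le i) (hf i).causal (hf i).continuous

theorem hasDerivAt_scattered_time (hk : IsKernelPair Q k) (hf : ∀ i, SmoothCausal (f i))
    (x t : ℝ) :
    HasDerivAt (fun t => pairScattered k f x t) (pairScattered k (pairDeriv f) x t) t :=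
  HasDerivAt.fun_sum fun i _ => (hk i).hasDerivAt_scattered_time (hf i) x t

theorem hasDerivAt_wave_time (hk : IsKernelPair Q k) (hf : ∀ i, SmoothCausal (f i)) (x t : ℝ) :
    HasDerivAt (fun t => pairWave k f x t) (pairWave k (pairDeriv f) x t) t :=
  HasDerivAt.fun_sum fun i _ => (hk i).hasDerivAt_wave_time (hf i) x t

theorem hasDerivAt_flux_time (hQ : Integrable Q) (hk : IsKernelPair Q k)
    (hf : ∀ i, SmoothCausal (f i)) (x t : ℝ) :
    HasDerivAt (fun t => pairFlux Q k f x t) (pairFlux Q k (pairDeriv f) x t) t :=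
  HasDerivAt.fun_sum fun i _ => (hk i).hasDerivAt_flux_time hQ (measurable_profile i)
    (abs_profile_le i) (hf i) x t

theorem hasDerivAt_scattered_space (hQ : Integrable Q) (hk : IsKernelPair Q k)
    (hf : ∀ i, SmoothCausal (f i)) (x t : ℝ) :
    HasDerivAt (fun x => pairScattered k f x t) (pairFlux Q k f x t) x :=
  HasDerivAt.fun_sum fun i _ => (hk i).hasDerivAt_scattered_space hQ (measurable_profile i)
    (abs_profile_le i) (hf i) x t

theorem hasDerivAt_flux_space (hQ : Integrable Q) (hk : IsKernelPair Q k)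
    (hf : ∀ i, SmoothCausal (f i)) {x : ℝ} (hQx : ContinuousAt Q x) (hx : x ≠ 0) (t : ℝ) :
    HasDerivAt (fun x => pairFlux Q k f x t)
      (Q x * pairWave k f x t + pairScattered k (pairDeriv (pairDeriv f)) x t) x := by
  have h := HasDerivAt.fun_sum (u := (Finset.univ : Finset (Fin 2)))
    fun i _ => (hk i).hasDerivAt_flux_space hQ (measurable_profile i)
      (abs_profile_le i) (hf i) hQx (continuousAt_profile i hx) t
  refine h.congr_deriv ?_
  rw [Finset.sum_add_distrib, ← Finset.mul_sum]
  rfl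

end IsKernelPair

/-! ### The solution of the periodic problem -/

/-- The solution of the problem on `(0, 2π)`. -/
def periodicWave (k : Fin 2 → ℝ → ℝ → ℝ) (f : Fin 2 → ℝ → ℝ) (x t : ℝ) : ℝ :=
  ((f 0 (t - x) - f 1 (t - x)) - (f 0 (t + x - 2 * π) + f 1 (t + x - 2 * π))) / 2
    + (pairScattered k f x t + pairScattered k f (x - 2 * π) t)

/-- The space derivative of the solution of the problem on `(0, 2π)`. -/
def periodicFlux (Q : ℝ → ℝ) (k : Fin 2 → ℝ → ℝ → ℝ) (f : Fin 2 → ℝ → ℝ) (x t : ℝ) : ℝ :=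
  (-(deriv (f 0) (t - x) - deriv (f 1) (t - x))
      - (deriv (f 0) (t + x - 2 * π) + deriv (f 1) (t + x - 2 * π))) / 2
    + (pairFlux Q k f x t + pairFlux Q k f (x - 2 * π) t)

section Periodic

variable {Q q : ℝ → ℝ} {k : Fin 2 → ℝ → ℝ → ℝ} {f : Fin 2 → ℝ → ℝ}

theorem pairDeriv_smooth (hf : ∀ i, SmoothCausal (f i)) (i : Fin 2) :
    SmoothCausal (pairDeriv f i) := (hf i).deriv

theorem hasDerivAt_periodicWave_time (hk : IsKernelPair Q k) (hf : ∀ i, SmoothCausal (f i))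
    (x t : ℝ) :
    HasDerivAt (fun t => periodicWave k f x t) (periodicWave k (pairDeriv f) x t) t := by
  have h1 : ∀ i, HasDerivAt (fun t => f i (t - x)) (pairDeriv f i (t - x)) t := fun i =>
    HasDerivAt.comp_sub_const t x ((hf i).hasDerivAt (t - x))
  have h2 : ∀ i, HasDerivAt (fun t => f i (t + x - 2 * π)) (pairDeriv f i (t + x - 2 * π)) t := by
    intro i
    simp only [add_sub_assoc]
    exact HasDerivAt.comp_add_const t (x - 2 * π) ((hf i).hasDerivAt (t + (x - 2 * π)))
  exact ((((h1 0).sub (h1 1)).sub ((h2 0).add (h2 1))).div_const 2).add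
    ((hk.hasDerivAt_scattered_time hf x t).add (hk.hasDerivAt_scattered_time hf (x - 2 * π) t))

theorem hasDerivAt_shift {g : ℝ → ℝ} (hg : SmoothCausal g) (x t : ℝ) :
    HasDerivAt (fun x => g (t - x)) (-deriv g (t - x)) x := by
  have := (hg.hasDerivAt (t - x)).comp x ((hasDerivAt_id x).const_sub t)
  exact this.congr_deriv (by simp)

theorem hasDerivAt_shift_add {g : ℝ → ℝ} (hg : SmoothCausal g) (x t : ℝ) :
    HasDerivAt (fun x => g (t + x - 2 * π)) (deriv g (t + x - 2 * π)) x := by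
  have := (hg.hasDerivAt (t + x - 2 * π)).comp x (((hasDerivAt_id x).const_add t).sub_const (2 * π))
  exact this.congr_deriv (by simp)

theorem hasDerivAt_periodicWave_space (hQ : Integrable Q) (hk : IsKernelPair Q k)
    (hf : ∀ i, SmoothCausal (f i)) (x t : ℝ) :
    HasDerivAt (fun x => periodicWave k f x t) (periodicFlux Q k f x t) x := by
  have h3 := hk.hasDerivAt_scattered_space hQ hf x t
  have h4 := HasDerivAt.comp_sub_const x (2 * π) (hk.hasDerivAt_scattered_space hQ hf (x - 2 * π) t)
  have h := ((((hasDerivAt_shift (hf 0) x t).sub (hasDerivAt_shift (hf 1) x t)).sub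
    ((hasDerivAt_shift_add (hf 0) x t).add (hasDerivAt_shift_add (hf 1) x t))).div_const 2).add
    (h3.add h4)
  refine h.congr_deriv ?_
  simp only [periodicFlux]
  ring

theorem hasDerivAt_periodicFlux_time (hQ : Integrable Q) (hk : IsKernelPair Q k)
    (hf : ∀ i, SmoothCausal (f i)) (x t : ℝ) :
    HasDerivAt (fun t => periodicFlux Q k f x t) (periodicFlux Q k (pairDeriv f) x t) t := by
  have h1 : ∀ i, HasDerivAt (fun t => deriv (f i) (t - x)) (deriv (pairDeriv f i) (t - x)) t :=
    fun i => HasDerivAt.comp_sub_const t x ((hf i).deriv.hasDerivAt (t - x))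
  have h2 : ∀ i, HasDerivAt (fun t => deriv (f i) (t + x - 2 * π))
      (deriv (pairDeriv f i) (t + x - 2 * π)) t := by
    intro i
    simp only [add_sub_assoc]
    exact HasDerivAt.comp_add_const t (x - 2 * π) ((hf i).deriv.hasDerivAt (t + (x - 2 * π)))
  exact (((((h1 0).sub (h1 1)).neg).sub ((h2 0).add (h2 1))).div_const 2).add
    ((hk.hasDerivAt_flux_time hQ hf x t).add (hk.hasDerivAt_flux_time hQ hf (x - 2 * π) t))

/-- The two copies of the line wave see `q̃(x)` and `q̃(x - 2π)`, and for `0 < x < 2π` both values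
equal `q(x)`. This is the reason for the form of the extension `q̃`. -/
theorem hasDerivAt_periodicFlux_space (hq : ContinuousOn q (Ioo 0 (2 * π)))
    (hQ : Integrable (qTilde q)) (hk : IsKernelPair (qTilde q) k)
    (hf : ∀ i, SmoothCausal (f i)) {x : ℝ} (hx : x ∈ Ioo 0 (2 * π)) (t : ℝ) :
    HasDerivAt (fun x => periodicFlux (qTilde q) k f x t)
      (q x * periodicWave k f x t + periodicWave k (pairDeriv (pairDeriv f)) x t) x := by
  have hx' : x - 2 * π ∈ Ioo (-(2 * π)) 0 := ⟨by linarith [hx.1], by linarith [hx.2]⟩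
  have h3 := hk.hasDerivAt_flux_space hQ hf (continuousAt_qTilde_pos hq hx) hx.1.ne' t
  have h4 := HasDerivAt.comp_sub_const x (2 * π)
    (hk.hasDerivAt_flux_space hQ hf (continuousAt_qTilde_neg hq hx') hx'.2.ne t)
  have h := (((((hasDerivAt_shift (hf 0).deriv x t).sub
    (hasDerivAt_shift (hf 1).deriv x t)).neg).sub
    ((hasDerivAt_shift_add (hf 0).deriv x t).add
      (hasDerivAt_shift_add (hf 1).deriv x t))).div_const 2).add (h3.add h4)
  refine h.congr_deriv ?_
  rw [qTilde_of_pos q hx.1 hx.2, qTilde_of_neg q hx'.1 hx'.2, pairWave_pos k f hx.1,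
    pairWave_neg k f hx'.2, sub_add_cancel]
  simp only [periodicWave, pairDeriv]
  rw [show t + (x - 2 * π) = t + x - 2 * π by ring]
  ring

theorem continuous_periodicWave (hk : IsKernelPair Q k) (hf : ∀ i, SmoothCausal (f i)) :
    Continuous fun p : ℝ × ℝ => periodicWave k f p.1 p.2 := by
  have h := hk.continuous_scattered (fun i => (hf i).causal) fun i => (hf i).locallyIntegrable
  have h0 := (hf 0).continuous
  have h1 := (hf 1).continuous
  have h2 : Continuous fun p : ℝ × ℝ => pairScattered k f (p.1 - 2 * π) p.2 :=
    h.comp (by fun_prop : Continuous fun p : ℝ × ℝ => (p.1 - 2 * π, p.2))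
  unfold periodicWave
  fun_prop

theorem continuous_periodicFlux (hQ : Integrable Q) (hk : IsKernelPair Q k)
    (hf : ∀ i, SmoothCausal (f i)) :
    Continuous fun p : ℝ × ℝ => periodicFlux Q k f p.1 p.2 := by
  have h := hk.continuous_flux hQ hf
  have h0 := (hf 0).deriv.continuous
  have h1 := (hf 1).deriv.continuous
  have h2 : Continuous fun p : ℝ × ℝ => pairFlux Q k f (p.1 - 2 * π) p.2 :=
    h.comp (by fun_prop : Continuous fun p : ℝ × ℝ => (p.1 - 2 * π, p.2))
  unfold periodicFlux
  fun_prop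

theorem IsSmoothControl.smoothCausal {f : ℝ → ℝ} (hf : IsSmoothControl f) : SmoothCausal f :=
  ⟨hf.1, fun _ ht => by
    by_contra h
    exact absurd (hf.2.2 (subset_tsupport f h)).1 (not_lt.2 ht)⟩

theorem derivWithin_periodicWave (hQ : Integrable Q) (hk : IsKernelPair Q k)
    (hf : ∀ i, SmoothCausal (f i)) {x : ℝ} (hx : x ∈ Icc 0 (2 * π)) (t : ℝ) :
    derivWithin (fun x => periodicWave k f x t) (Icc 0 (2 * π)) x = periodicFlux Q k f x t :=
  (hasDerivAt_periodicWave_space hQ hk hf x t).hasDerivWithinAt.derivWithin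
    (uniqueDiffOn_Icc (by positivity) x hx)

/-- Finite speed: up to time `2π` the copy centred at `2π` has not reached `0`, so only the
right-hand limit of the line wave at the origin remains. The three lemmas that follow are the
analogues at the other end and for the slope. -/
theorem periodicWave_zero (hk : IsKernelPair Q k) (hf : ∀ i, SmoothCausal (f i)) {t : ℝ}
    (ht : t ≤ 2 * π) :
    periodicWave k f 0 t = (f 0 t - f 1 t) / 2 + pairScattered k f 0 t := by
  have h2 : t ≤ |0 - 2 * π| := by rwa [zero_sub, abs_neg, abs_of_pos (by positivity)]
  rw [periodicWave, hk.scattered_eq_zero (fun i => (hf i).causal) h2,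
    (hf 0).causal (t + 0 - 2 * π) (by linarith), (hf 1).causal (t + 0 - 2 * π) (by linarith)]
  simp

theorem periodicWave_two_pi (hk : IsKernelPair Q k) (hf : ∀ i, SmoothCausal (f i)) {t : ℝ}
    (ht : t ≤ 2 * π) :
    periodicWave k f (2 * π) t = -(f 0 t + f 1 t) / 2 + pairScattered k f 0 t := by
  have h2 : t ≤ |2 * π| := by rwa [abs_of_pos (by positivity)]
  rw [periodicWave, hk.scattered_eq_zero (fun i => (hf i).causal) h2,
    (hf 0).causal (t - 2 * π) (by linarith), (hf 1).causal (t - 2 * π) (by linarith)]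
  simp

theorem periodicFlux_zero (hk : IsKernelPair Q k) (hf : ∀ i, SmoothCausal (f i)) {t : ℝ}
    (ht : t ≤ 2 * π) :
    periodicFlux Q k f 0 t = -(deriv (f 0) t - deriv (f 1) t) / 2 + pairFlux Q k f 0 t := by
  have h2 : t ≤ |0 - 2 * π| := by rwa [zero_sub, abs_neg, abs_of_pos (by positivity)]
  rw [periodicFlux, hk.flux_eq_zero (fun i => (hf i).causal) h2,
    (hf 0).deriv.causal (t + 0 - 2 * π) (by linarith),
    (hf 1).deriv.causal (t + 0 - 2 * π) (by linarith)]
  simp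

theorem periodicFlux_two_pi (hk : IsKernelPair Q k) (hf : ∀ i, SmoothCausal (f i)) {t : ℝ}
    (ht : t ≤ 2 * π) :
    periodicFlux Q k f (2 * π) t
      = -(deriv (f 0) t + deriv (f 1) t) / 2 + pairFlux Q k f 0 t := by
  have h2 : t ≤ |2 * π| := by rwa [abs_of_pos (by positivity)]
  rw [periodicFlux, hk.flux_eq_zero (fun i => (hf i).causal) h2,
    (hf 0).deriv.causal (t - 2 * π) (by linarith), (hf 1).deriv.causal (t - 2 * π) (by linarith)]
  simp

/-- Inside the interval the equation holds for each copy separately. At the ends the one-sided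
limits at the origin of the line wave appear, so that `Γ₀` yields exactly the prescribed jumps; the
scattered part is `C¹` across the origin and cancels. -/
theorem isClassicalSolution_periodicWave (hq : ContinuousOn q (Ioo 0 (2 * π)))
    (hQ : Integrable (qTilde q)) (hk : IsKernelPair (qTilde q) k)
    (hf : ∀ i, SmoothCausal (f i)) :
    IsClassicalSolution q (f 0) (f 1) (periodicWave k f) where
  contDiffOn_one := by
    refine (contDiffOn_one_of_partial isOpen_univ
      (fun p _ => hasDerivAt_periodicWave_space hQ hk hf p.1 p.2)
      (fun p _ => hasDerivAt_periodicWave_time hk hf p.1 p.2)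
      (continuous_periodicFlux hQ hk hf).continuousOn
      (continuous_periodicWave hk (pairDeriv_smooth hf)).continuousOn).mono (subset_univ _)
  contDiffOn_two := by
    refine contDiffOn_two_of_partial (isOpen_Ioo.prod isOpen_Ioo)
      (gxx := fun x t => q x * periodicWave k f x t + periodicWave k (pairDeriv (pairDeriv f)) x t)
      (fun p _ => hasDerivAt_periodicWave_space hQ hk hf p.1 p.2)
      (fun p _ => hasDerivAt_periodicWave_time hk hf p.1 p.2)
      (fun p hp => hasDerivAt_periodicFlux_space hq hQ hk hf hp.1 p.2)
      (fun p _ => hasDerivAt_periodicFlux_time hQ hk hf p.1 p.2)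
      (fun p _ => hasDerivAt_periodicWave_space hQ hk (pairDeriv_smooth hf) p.1 p.2)
      (fun p _ => hasDerivAt_periodicWave_time hk (pairDeriv_smooth hf) p.1 p.2) ?_
      (continuous_periodicFlux hQ hk (pairDeriv_smooth hf)).continuousOn
      (continuous_periodicWave hk (pairDeriv_smooth (pairDeriv_smooth hf))).continuousOn
    refine ContinuousOn.add (ContinuousOn.mul ?_ (continuous_periodicWave hk hf).continuousOn)
      (continuous_periodicWave hk (pairDeriv_smooth (pairDeriv_smooth hf))).continuousOn
    exact hq.comp continuousOn_fst fun p hp => hp.1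
  wave := fun x hx t _ => by
    have h1 : iteratedDeriv 2 (fun τ => periodicWave k f x τ) t
        = periodicWave k (pairDeriv (pairDeriv f)) x t := by
      rw [iteratedDeriv_succ, iteratedDeriv_one,
        show deriv (fun τ => periodicWave k f x τ) = fun τ => periodicWave k (pairDeriv f) x τ from
          funext fun τ => (hasDerivAt_periodicWave_time hk hf x τ).deriv]
      exact (hasDerivAt_periodicWave_time hk (pairDeriv_smooth hf) x t).deriv
    have h2 : iteratedDeriv 2 (fun ξ => periodicWave k f ξ t) x
        = q x * periodicWave k f x t + periodicWave k (pairDeriv (pairDeriv f)) x t := by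
      rw [iteratedDeriv_succ, iteratedDeriv_one,
        show deriv (fun ξ => periodicWave k f ξ t) = fun ξ => periodicFlux (qTilde q) k f ξ t from
          funext fun ξ => (hasDerivAt_periodicWave_space hQ hk hf ξ t).deriv]
      exact (hasDerivAt_periodicFlux_space hq hQ hk hf hx t).deriv
    rw [h1, h2]
    ring
  boundary := fun t ht => by
    have hp : (0 : ℝ) ≤ 2 * π := by positivity
    rw [Gamma0, derivWithin_periodicWave hQ hk hf ⟨le_rfl, hp⟩,
      derivWithin_periodicWave hQ hk hf ⟨hp, le_rfl⟩, periodicWave_zero hk hf ht.2.le,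
      periodicWave_two_pi hk hf ht.2.le, periodicFlux_zero hk hf ht.2.le,
      periodicFlux_two_pi hk hf ht.2.le]
    congr 1
    · ring
    · congr 1
      ring
  initial := fun x hx => by
    have h1 : ∀ y : ℝ, pairScattered k f y 0 = 0 := fun y =>
      hk.scattered_eq_zero (fun i => (hf i).causal) (abs_nonneg y)
    have h2 : ∀ i, f i (0 - x) = 0 := fun i => (hf i).causal _ (by linarith [hx.1])
    have h3 : ∀ i, f i (0 + x - 2 * π) = 0 := fun i => (hf i).causal _ (by linarith [hx.2])
    simp only [periodicWave, h1, h2, h3, sub_zero, add_zero, zero_div]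
  initial_deriv := fun x hx => by
    have hp : (0 : ℝ) < 2 * π := by positivity
    rw [(hasDerivAt_periodicWave_time hk hf x 0).hasDerivWithinAt.derivWithin
      (uniqueDiffOn_Ico _ _ 0 ⟨le_rfl, hp⟩)]
    have h1 : ∀ y : ℝ, pairScattered k (pairDeriv f) y 0 = 0 := fun y =>
      hk.scattered_eq_zero (fun i => (hf i).deriv.causal) (abs_nonneg y)
    have h2 : ∀ i, pairDeriv f i (0 - x) = 0 := fun i => (hf i).deriv.causal _ (by linarith [hx.1])
    have h3 : ∀ i, pairDeriv f i (0 + x - 2 * π) = 0 := fun i =>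
      (hf i).deriv.causal _ (by linarith [hx.2])
    simp only [periodicWave, h1, h2, h3, sub_zero, add_zero, zero_div]

/-- `Γ₁` takes means of the two one-sided limits. The scattered part, having no jump, enters in
full, while of the incoming part only the terms without a jump survive. -/
theorem Gamma1_periodicWave (hQ : Integrable Q) (hk : IsKernelPair Q k)
    (hf : ∀ i, SmoothCausal (f i)) {t : ℝ} (ht : t ≤ 2 * π) :
    Gamma1 (fun x => periodicWave k f x t)
      = ![-(deriv (f 0) t) / 2 + pairFlux Q k f 0 t, f 1 t / 2 - pairScattered k f 0 t] := by
  have hp : (0 : ℝ) ≤ 2 * π := by positivity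
  rw [Gamma1, derivWithin_periodicWave hQ hk hf ⟨le_rfl, hp⟩,
    derivWithin_periodicWave hQ hk hf ⟨hp, le_rfl⟩, periodicWave_zero hk hf ht,
    periodicWave_two_pi hk hf ht, periodicFlux_zero hk hf ht, periodicFlux_two_pi hk hf ht]
  congr 1
  · ring
  · congr 1
    ring

end Periodic

/-! ### A Volterra-type uniqueness principle -/

/-- A bounded family of functions that satisfies `|φ| ≤ L ∫₀ᵗ m` whenever `|φ| ≤ m`, for monotone
continuous `m`, vanishes. -/
theorem eq_zero_of_volterra_bound {X : Type*} {φ : X → ℝ → ℝ} {T A L : ℝ} (hL : 0 ≤ L)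
    (hA : ∀ x, ∀ t ∈ Icc 0 T, |φ x t| ≤ A)
    (hstep : ∀ m : ℝ → ℝ, Continuous m → MonotoneOn m (Ici 0) → (∀ t, 0 ≤ t → 0 ≤ m t) →
      (∀ x, ∀ t ∈ Icc 0 T, |φ x t| ≤ m t) →
      ∀ x, ∀ t ∈ Icc 0 T, |φ x t| ≤ L * ∫ s in (0 : ℝ)..t, m s)
    (x : X) {t : ℝ} (ht : t ∈ Icc 0 T) : φ x t = 0 := by
  have hA0 : 0 ≤ A := (abs_nonneg _).trans (hA x t ht)
  -- Starting from the constant `A`, the `n`-th iteration of the hypothesis gives the `n`-th term of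
  -- the series of `A exp (L t)`, and these terms tend to zero.
  have key : ∀ n : ℕ, ∀ x, ∀ t ∈ Icc 0 T, |φ x t| ≤ A * ((L * t) ^ n / n.factorial) := by
    intro n
    induction n with
    | zero => simpa using hA
    | succ n ih =>
      have h := hstep (fun t => A * ((L * t) ^ n / n.factorial)) (by fun_prop)
        (fun a ha b hb hab => by
          have ha' : 0 ≤ a := ha
          dsimp only
          gcongr) (fun t ht => by positivity) ih
      intro x t ht
      refine (h x t ht).trans (le_of_eq ?_)
      have e : (fun s : ℝ => A * ((L * s) ^ n / n.factorial))
          = fun s => (A * L ^ n / n.factorial) * s ^ n := by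
        ext s
        rw [mul_pow]
        ring
      rw [e, intervalIntegral.integral_const_mul, integral_pow, Nat.factorial_succ]
      have h1 : (n.factorial : ℝ) ≠ 0 := by positivity
      have h2 : (n : ℝ) + 1 ≠ 0 := by positivity
      push_cast
      rw [mul_pow]
      field_simp
      ring
  have hlim : Tendsto (fun n : ℕ => A * ((L * t) ^ n / n.factorial)) atTop (𝓝 (A * 0)) :=
    (FloorSemiring.tendsto_pow_div_factorial_atTop (L * t)).const_mul A
  rw [mul_zero] at hlim
  exact abs_eq_zero.1 (le_antisymm (ge_of_tendsto' hlim fun n => key n x t ht) (abs_nonneg _))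

/-! ### Uniqueness of the classical solution -/

/-- The closed strip on which classical solutions live. -/
abbrev strip : Set (ℝ × ℝ) := Icc 0 (2 * π) ×ˢ Ico 0 (2 * π)

theorem uniqueDiffOn_strip : UniqueDiffOn ℝ strip :=
  (uniqueDiffOn_Icc (by positivity)).prod (uniqueDiffOn_Ico 0 (2 * π))

namespace IsClassicalSolution

variable {q f₁ f₂ : ℝ → ℝ} {u v : ℝ → ℝ → ℝ}

/-- The derivative, up to the boundary, in the direction `w`. -/
def dirDeriv (u : ℝ → ℝ → ℝ) (w : ℝ × ℝ) (p : ℝ × ℝ) : ℝ :=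
  fderivWithin ℝ (fun p : ℝ × ℝ => u p.1 p.2) strip p w

theorem continuousOn_dirDeriv (hu : IsClassicalSolution q f₁ f₂ u) (w : ℝ × ℝ) :
    ContinuousOn (dirDeriv u w) strip :=
  (hu.contDiffOn_one.continuousOn_fderivWithin uniqueDiffOn_strip (by simp)).clm_apply
    continuousOn_const

theorem hasFDerivWithinAt (hu : IsClassicalSolution q f₁ f₂ u) {p : ℝ × ℝ} (hp : p ∈ strip) :
    HasFDerivWithinAt (fun p : ℝ × ℝ => u p.1 p.2)
      (fderivWithin ℝ (fun p : ℝ × ℝ => u p.1 p.2) strip p) strip p :=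
  ((hu.contDiffOn_one.differentiableOn (by simp)) p hp).hasFDerivWithinAt

theorem hasDerivWithinAt_time (hu : IsClassicalSolution q f₁ f₂ u) {x t : ℝ}
    (hx : x ∈ Icc 0 (2 * π)) (ht : t ∈ Ico 0 (2 * π)) :
    HasDerivWithinAt (fun τ => u x τ) (dirDeriv u (0, 1) (x, t)) (Ico 0 (2 * π)) t :=
  (hu.hasFDerivWithinAt (p := (x, t)) ⟨hx, ht⟩).comp_hasDerivWithinAt t
    ((hasDerivWithinAt_const t _ x).prodMk (hasDerivWithinAt_id t _)) fun _ hτ => ⟨hx, hτ⟩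

theorem hasDerivWithinAt_space (hu : IsClassicalSolution q f₁ f₂ u) {x t : ℝ}
    (hx : x ∈ Icc 0 (2 * π)) (ht : t ∈ Ico 0 (2 * π)) :
    HasDerivWithinAt (fun ξ => u ξ t) (dirDeriv u (1, 0) (x, t)) (Icc 0 (2 * π)) x :=
  HasFDerivWithinAt.comp_hasDerivWithinAt (f := fun ξ => (ξ, t)) x
    (hu.hasFDerivWithinAt (p := (x, t)) ⟨hx, ht⟩) ((hasDerivWithinAt_id x _).prodMk (hasDerivWithinAt_const x _ t)) fun _ hξ => ⟨hξ, ht⟩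

theorem dirDeriv_pair (u : ℝ → ℝ → ℝ) (a b : ℝ) (p : ℝ × ℝ) :
    dirDeriv u (a, b) p = a * dirDeriv u (1, 0) p + b * dirDeriv u (0, 1) p := by
  have : ((a, b) : ℝ × ℝ) = a • (1, 0) + b • (0, 1) := by simp
  rw [dirDeriv, this, map_add, map_smul, map_smul]
  rfl

theorem differentiableAt_fderiv (hu : IsClassicalSolution q f₁ f₂ u) {p : ℝ × ℝ}
    (hp : p ∈ Ioo 0 (2 * π) ×ˢ Ioo 0 (2 * π)) :
    DifferentiableAt ℝ (fderiv ℝ fun p : ℝ × ℝ => u p.1 p.2) p := by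
  have h := hu.contDiffOn_two
  rw [show (2 : WithTop ℕ∞) = 1 + 1 by norm_num,
    contDiffOn_succ_iff_fderiv_of_isOpen (isOpen_Ioo.prod isOpen_Ioo)] at h
  exact (h.2.2.differentiableOn (by simp) p hp).differentiableAt
    ((isOpen_Ioo.prod isOpen_Ioo).mem_nhds hp)

theorem differentiableAt (hu : IsClassicalSolution q f₁ f₂ u) {p : ℝ × ℝ}
    (hp : p ∈ Ioo 0 (2 * π) ×ˢ Ioo 0 (2 * π)) :
    DifferentiableAt ℝ (fun p : ℝ × ℝ => u p.1 p.2) p :=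
  (hu.contDiffOn_two.differentiableOn (by simp) p hp).differentiableAt
    ((isOpen_Ioo.prod isOpen_Ioo).mem_nhds hp)

theorem dirDeriv_eq_fderiv {p : ℝ × ℝ}
    (hp : p ∈ Ioo 0 (2 * π) ×ˢ Ioo 0 (2 * π)) (w : ℝ × ℝ) :
    dirDeriv u w p = fderiv ℝ (fun p : ℝ × ℝ => u p.1 p.2) p w := by
  rw [dirDeriv, fderivWithin_of_mem_nhds]
  exact Filter.mem_of_superset ((isOpen_Ioo.prod isOpen_Ioo).mem_nhds hp)
    (prod_mono Ioo_subset_Icc_self Ioo_subset_Ico_self)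

theorem wave_fderiv (hu : IsClassicalSolution q f₁ f₂ u) {p : ℝ × ℝ}
    (hp : p ∈ Ioo 0 (2 * π) ×ˢ Ioo 0 (2 * π)) :
    fderiv ℝ (fderiv ℝ fun p : ℝ × ℝ => u p.1 p.2) p (0, 1) (0, 1)
      - fderiv ℝ (fderiv ℝ fun p : ℝ × ℝ => u p.1 p.2) p (1, 0) (1, 0) = -(q p.1 * u p.1 p.2) := by
  have hU := (isOpen_Ioo.prod isOpen_Ioo).mem_nhds hp
  have h2 := (hu.differentiableAt_fderiv hp).hasFDerivAt
  -- Along a line of direction `w` the second derivative is `D²u(w, w)`; this is applied to the two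
  -- coordinate axes.
  have slice : ∀ (γ : ℝ → ℝ × ℝ) (w : ℝ × ℝ) (s : ℝ), γ s = p → (∀ s, HasDerivAt γ w s) →
      iteratedDeriv 2 (fun s => u (γ s).1 (γ s).2) s
        = fderiv ℝ (fderiv ℝ fun p : ℝ × ℝ => u p.1 p.2) p w w := by
    intro γ w s hs hγ
    rw [← hs] at hU h2 ⊢
    rw [iteratedDeriv_succ, iteratedDeriv_one]
    have e : deriv (fun s => u (γ s).1 (γ s).2)
        =ᶠ[𝓝 s] fun s => fderiv ℝ (fun p : ℝ × ℝ => u p.1 p.2) (γ s) w := by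
      filter_upwards [(hγ s).continuousAt.preimage_mem_nhds hU] with r hr
      exact ((hu.differentiableAt hr).hasFDerivAt.comp_hasDerivAt r (hγ r)).deriv
    rw [e.deriv_eq]
    have h3 := (h2.comp_hasDerivAt s (hγ s)).clm_apply (hasDerivAt_const s w)
    simpa using h3.deriv
  have ht := slice (fun s => (p.1, s)) (0, 1) p.2 rfl fun s =>
    (hasDerivAt_const s p.1).prodMk (hasDerivAt_id s)
  have hx := slice (fun s => (s, p.2)) (1, 0) p.1 rfl fun s =>
    (hasDerivAt_id s).prodMk (hasDerivAt_const s p.2)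
  rw [← ht, ← hx]
  linarith [hu.wave p.1 hp.1 p.2 hp.2]

/-- Transport along the characteristics. -/
theorem hasDerivAt_characteristic (hu : IsClassicalSolution q f₁ f₂ u) {a σ s : ℝ}
    (hσ : σ * σ = 1) (hp : (a + σ * s, s) ∈ Ioo 0 (2 * π) ×ˢ Ioo 0 (2 * π)) :
    HasDerivAt (fun s => dirDeriv u (-σ, 1) (a + σ * s, s))
      (-(q (a + σ * s) * u (a + σ * s) s)) s := by
  have hU := (isOpen_Ioo.prod isOpen_Ioo).mem_nhds hp
  have hγ : HasDerivAt (fun s : ℝ => (a + σ * s, s)) (σ, 1) s := by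
    refine HasDerivAt.prodMk ?_ (hasDerivAt_id s)
    simpa using ((hasDerivAt_id s).const_mul σ).const_add a
  have h2 := (hu.differentiableAt_fderiv hp).hasFDerivAt
  have h3 := (HasFDerivAt.comp_hasDerivAt (f := fun s => (a + σ * s, s)) s h2 hγ).clm_apply
    (hasDerivAt_const s ((-σ, 1) : ℝ × ℝ))
  -- By symmetry the mixed terms of `D²u (σ, 1) (-σ, 1)` cancel, and `σ² = 1` leaves `u_tt - u_xx =
  -- -q u`.
  have hsym : IsSymmSndFDerivAt ℝ (fun p : ℝ × ℝ => u p.1 p.2) (a + σ * s, s) :=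
    (hu.contDiffOn_two.contDiffAt hU).isSymmSndFDerivAt (by simp)
  have e : (fun s => dirDeriv u (-σ, 1) (a + σ * s, s)) =ᶠ[𝓝 s]
      fun s => fderiv ℝ (fun p : ℝ × ℝ => u p.1 p.2) (a + σ * s, s) (-σ, 1) := by
    filter_upwards [hγ.continuousAt.preimage_mem_nhds hU] with r hr
    exact dirDeriv_eq_fderiv hr _
  refine HasDerivAt.congr_of_eventuallyEq ?_ e
  refine h3.congr_deriv ?_
  have hw := hu.wave_fderiv hp
  have e1 : ((σ, 1) : ℝ × ℝ) = σ • (1, 0) + (0, 1) := by simp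
  have e2 : ((-σ, 1) : ℝ × ℝ) = (-σ) • (1, 0) + (0, 1) := by simp
  have hs := hsym (1, 0) (0, 1)
  simp only [map_zero, add_zero]
  rw [e1, e2]
  simp only [map_add, map_smul, add_apply, smul_apply,
    smul_eq_mul]
  rw [hs]
  simp only at hw
  linear_combination hw - (fderiv ℝ (fderiv ℝ fun p : ℝ × ℝ => u p.1 p.2) (a + σ * s, s) (1, 0)
    (1, 0)) * hσ

theorem sub (hu : IsClassicalSolution q f₁ f₂ u) (hv : IsClassicalSolution q f₁ f₂ v) :
    IsClassicalSolution q 0 0 (fun x t => u x t - v x t) where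
  contDiffOn_one := hu.contDiffOn_one.sub hv.contDiffOn_one
  contDiffOn_two := hu.contDiffOn_two.sub hv.contDiffOn_two
  wave := fun x hx t ht => by
    have hU : Ioo 0 (2 * π) ×ˢ Ioo 0 (2 * π) ∈ 𝓝 (x, t) :=
      (isOpen_Ioo.prod isOpen_Ioo).mem_nhds ⟨hx, ht⟩
    have ct : ∀ {w : ℝ → ℝ → ℝ}, IsClassicalSolution q f₁ f₂ w →
        ContDiffAt ℝ 2 (fun τ => w x τ) t := fun hw =>
      (hw.contDiffOn_two.contDiffAt hU).comp t (contDiffAt_const.prodMk contDiffAt_id)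
    have cx : ∀ {w : ℝ → ℝ → ℝ}, IsClassicalSolution q f₁ f₂ w →
        ContDiffAt ℝ 2 (fun ξ => w ξ t) x := fun {w} hw =>
      ContDiffAt.comp (f := fun ξ => (ξ, t)) (g := fun p : ℝ × ℝ => w p.1 p.2) x
        (hw.contDiffOn_two.contDiffAt hU) (contDiffAt_id.prodMk contDiffAt_const)
    have e1 : iteratedDeriv 2 (fun τ => u x τ - v x τ) t
        = iteratedDeriv 2 (fun τ => u x τ) t - iteratedDeriv 2 (fun τ => v x τ) t :=
      iteratedDeriv_sub (ct hu) (ct hv)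
    have e2 : iteratedDeriv 2 (fun ξ => u ξ t - v ξ t) x
        = iteratedDeriv 2 (fun ξ => u ξ t) x - iteratedDeriv 2 (fun ξ => v ξ t) x :=
      iteratedDeriv_sub (cx hu) (cx hv)
    rw [e1, e2]
    linear_combination hu.wave x hx t ht - hv.wave x hx t ht
  boundary := fun t ht => by
    have hp : (0 : ℝ) < 2 * π := by positivity
    have d : ∀ x ∈ Icc 0 (2 * π), derivWithin (fun x => u x t - v x t) (Icc 0 (2 * π)) x
        = derivWithin (fun x => u x t) (Icc 0 (2 * π)) x
          - derivWithin (fun x => v x t) (Icc 0 (2 * π)) x := fun x hx =>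
      derivWithin_fun_sub (hu.hasDerivWithinAt_space hx ⟨ht.1.le, ht.2⟩).differentiableWithinAt
        (hv.hasDerivWithinAt_space hx ⟨ht.1.le, ht.2⟩).differentiableWithinAt
    have hb := hu.boundary t ht
    rw [← hv.boundary t ht] at hb
    have h0 := congrFun hb 0
    have h1 := congrFun hb 1
    simp only [Gamma0, Matrix.cons_val_zero, Matrix.cons_val_one, Matrix.cons_val_fin_one] at h0 h1
    rw [Gamma0, d 0 ⟨le_rfl, hp.le⟩, d _ ⟨hp.le, le_rfl⟩]
    ext i
    fin_cases i
    · simp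
      linarith
    · simp
      linarith
  initial := fun x hx => by rw [hu.initial x hx, hv.initial x hx, sub_zero]
  initial_deriv := fun x hx => by
    have h0 : (0 : ℝ) ∈ Ico 0 (2 * π) := ⟨le_rfl, by positivity⟩
    rw [derivWithin_fun_sub (hu.hasDerivWithinAt_time hx h0).differentiableWithinAt
      (hv.hasDerivWithinAt_time hx h0).differentiableWithinAt, hu.initial_deriv x hx,
      hv.initial_deriv x hx, sub_zero]

end IsClassicalSolution

/-! ### Estimates along characteristics and vanishing of solutions with zero data -/

theorem intervalIntegrable_comp_affine {g : ℝ → ℝ} (hg : Integrable g) {a σ : ℝ}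
    (hσ : σ * σ = 1) : Integrable fun s => g (a + σ * s) := by
  have h0 : σ ≠ 0 := fun h => by simp [h] at hσ
  exact (hg.comp_add_left a).comp_mul_left' h0

theorem integral_abs_comp_affine (g : ℝ → ℝ) {a σ : ℝ} (hσ : σ * σ = 1) :
    ∫ s, |g (a + σ * s)| = ∫ s, |g s| := by
  have h1 : |σ⁻¹| = 1 := by
    rcases mul_self_eq_one_iff.1 hσ with rfl | rfl <;> norm_num
  rw [Measure.integral_comp_mul_left (fun s => |g (a + s)|) σ, h1, one_smul,
    integral_add_left_eq_self (fun s => |g s|) a]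

namespace IsClassicalSolution

variable {q f₁ f₂ : ℝ → ℝ} {z : ℝ → ℝ → ℝ}

/-- The transport equation is integrated along a characteristic. As `x` moves with unit speed, the
integral of `|q|` along it is at most the `L¹` norm of `q`; no bound on `q` near the ends of the
interval is required. -/
theorem abs_characteristic_sub_le (hz : IsClassicalSolution q f₁ f₂ z)
    (hq : IntegrableOn q (Ioo 0 (2 * π))) {a σ s₀ s₁ M : ℝ} (hσ : σ * σ = 1) (h0 : 0 ≤ s₀)
    (h01 : s₀ ≤ s₁) (h1 : s₁ < 2 * π)
    (hcl : ∀ s ∈ Icc s₀ s₁, a + σ * s ∈ Icc 0 (2 * π))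
    (hop : ∀ s ∈ Ioo s₀ s₁, a + σ * s ∈ Ioo 0 (2 * π))
    (hM : ∀ x ∈ Icc 0 (2 * π), ∀ s ∈ Icc 0 s₁, |z x s| ≤ M) :
    |dirDeriv z (-σ, 1) (a + σ * s₁, s₁) - dirDeriv z (-σ, 1) (a + σ * s₀, s₀)|
      ≤ (∫ x in Ioo 0 (2 * π), |q x|) * M := by
  set g : ℝ → ℝ := indicator (Ioo 0 (2 * π)) q with hg_def
  have hg : Integrable g := (integrable_indicator_iff measurableSet_Ioo).2 hq
  have hM0 : 0 ≤ M := (abs_nonneg _).trans (hM _ (hcl s₀ ⟨le_rfl, h01⟩) s₀ ⟨h0, h01⟩)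
  have hmaps : MapsTo (fun s : ℝ => (a + σ * s, s)) (Icc s₀ s₁) strip := fun s hs =>
    ⟨hcl s hs, h0.trans hs.1, hs.2.trans_lt h1⟩
  have hcont : ContinuousOn (fun s => dirDeriv z (-σ, 1) (a + σ * s, s)) (Icc s₀ s₁) :=
    (hz.continuousOn_dirDeriv _).comp (by fun_prop) hmaps
  have hzc : ContinuousOn (fun s => z (a + σ * s) s) (Icc s₀ s₁) :=
    hz.contDiffOn_one.continuousOn.comp (f := fun s : ℝ => (a + σ * s, s)) (by fun_prop) hmaps
  have hderiv : ∀ s ∈ Ioo s₀ s₁, HasDerivAt (fun s => dirDeriv z (-σ, 1) (a + σ * s, s))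
      (-(g (a + σ * s) * z (a + σ * s) s)) s := by
    intro s hs
    rw [hg_def, indicator_of_mem (hop s hs)]
    exact hz.hasDerivAt_characteristic hσ ⟨hop s hs, h0.trans_lt hs.1, hs.2.trans h1⟩
  have hgi := intervalIntegrable_comp_affine hg (a := a) hσ
  have hbound : ∀ s ∈ Icc s₀ s₁, ‖-(g (a + σ * s) * z (a + σ * s) s)‖ ≤ |g (a + σ * s)| * M := by
    intro s hs
    rw [norm_neg, norm_mul, Real.norm_eq_abs, Real.norm_eq_abs]
    exact mul_le_mul_of_nonneg_left (hM _ (hcl s hs) s ⟨h0.trans hs.1, hs.2⟩) (abs_nonneg _)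
  have hint : IntervalIntegrable (fun s => -(g (a + σ * s) * z (a + σ * s) s)) volume s₀ s₁ := by
    rw [intervalIntegrable_iff_integrableOn_Icc_of_le h01]
    refine ((hgi.abs.mul_const M).integrableOn).mono' ?_
      ((ae_restrict_mem measurableSet_Icc).mono hbound)
    exact (hgi.1.restrict.mul (hzc.aestronglyMeasurable measurableSet_Icc)).neg
  rw [← intervalIntegral.integral_eq_sub_of_hasDerivAt_of_le h01 hcont hderiv hint,
    ← Real.norm_eq_abs]
  refine (intervalIntegral.norm_integral_le_of_norm_le h01
    (Eventually.of_forall fun s hs => hbound s (Ioc_subset_Icc_self hs))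
    (hgi.abs.mul_const M).intervalIntegrable).trans ?_
  rw [intervalIntegral.integral_of_le h01]
  refine (setIntegral_le_integral (hgi.abs.mul_const M)
    (Eventually.of_forall fun s => by positivity)).trans (le_of_eq ?_)
  rw [integral_mul_const, integral_abs_comp_affine g hσ, ← integral_indicator measurableSet_Ioo]
  congr 2
  ext x
  simp only [hg_def, indicator]
  split_ifs <;> simp

/-- With zero boundary data `z` and `z_x` agree at both ends, and differentiating the first relation
in time shows that `z_t` does too. A characteristic that leaves through one end thus continues from
the other with the same derivative. -/
theorem dirDeriv_boundary (hz : IsClassicalSolution q 0 0 z) {t : ℝ} (ht : t ∈ Ioo 0 (2 * π))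
    (σ : ℝ) : dirDeriv z (-σ, 1) (0, t) = dirDeriv z (-σ, 1) (2 * π, t) := by
  have hp : (0 : ℝ) < 2 * π := by positivity
  have m0 : (0 : ℝ) ∈ Icc 0 (2 * π) := ⟨le_rfl, hp.le⟩
  have m1 : 2 * π ∈ Icc 0 (2 * π) := ⟨hp.le, le_rfl⟩
  have ht' : t ∈ Ico 0 (2 * π) := ⟨ht.1.le, ht.2⟩
  have hb : ∀ s ∈ Ioo 0 (2 * π), z 0 s = z (2 * π) s := by
    intro s hs
    have := congrFun (hz.boundary s hs) 0
    simp only [Gamma0, Matrix.cons_val_zero, Pi.zero_apply] at this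
    linarith
  have hb1 := congrFun (hz.boundary t ht) 1
  have hx0 := (hz.hasDerivWithinAt_space m0 ht').derivWithin (uniqueDiffOn_Icc hp 0 m0)
  have hx1 := (hz.hasDerivWithinAt_space m1 ht').derivWithin (uniqueDiffOn_Icc hp _ m1)
  simp only [Gamma0, Matrix.cons_val_one, Matrix.cons_val_fin_one, hx0, hx1, deriv_zero,
    Pi.zero_apply] at hb1
  have hn : Ico 0 (2 * π) ∈ 𝓝 t := Ico_mem_nhds ht.1 ht.2
  have ht0 := (hz.hasDerivWithinAt_time m0 ht').hasDerivAt hn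
  have ht1 := (hz.hasDerivWithinAt_time m1 ht').hasDerivAt hn
  have e : dirDeriv z (0, 1) (0, t) = dirDeriv z (0, 1) (2 * π, t) := by
    refine ht0.unique (ht1.congr_of_eventuallyEq ?_)
    filter_upwards [Ioo_mem_nhds ht.1 ht.2] with s hs using hb s hs
  rw [dirDeriv_pair, dirDeriv_pair z _ _ (2 * π, t), e]
  linear_combination (-σ) * hb1

theorem dirDeriv_initial (hz : IsClassicalSolution q f₁ f₂ z) {x : ℝ} (hx : x ∈ Icc 0 (2 * π))
    (σ : ℝ) : dirDeriv z (-σ, 1) (x, 0) = 0 := by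
  have hp : (0 : ℝ) < 2 * π := by positivity
  have h0 : (0 : ℝ) ∈ Ico 0 (2 * π) := ⟨le_rfl, hp⟩
  have h1 : dirDeriv z (0, 1) (x, 0) = 0 := by
    have h3 := (hz.hasDerivWithinAt_time hx h0).derivWithin (uniqueDiffOn_Ico _ _ 0 h0)
    rw [← h3, hz.initial_deriv x hx]
  have h2 : dirDeriv z (1, 0) (x, 0) = 0 := by
    have h3 := (hz.hasDerivWithinAt_space hx h0).derivWithin (uniqueDiffOn_Icc hp x hx)
    rw [← h3, derivWithin_congr (f := fun _ => (0 : ℝ)) (fun y hy => hz.initial y hy)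
      (hz.initial x hx)]
    simp
  rw [dirDeriv_pair, h1, h2]
  simp

/-- Followed backwards to `t = 0`, a characteristic crosses the boundary at most once, because less
than the time `2π` is available. There are at most two pieces, whence the factor `2`. -/
theorem abs_characteristic_le (hz : IsClassicalSolution q 0 0 z)
    (hq : IntegrableOn q (Ioo 0 (2 * π))) {x t σ M : ℝ} (hσ : σ = 1 ∨ σ = -1)
    (hx : x ∈ Icc 0 (2 * π)) (ht : t ∈ Ico 0 (2 * π))
    (hM : ∀ x ∈ Icc 0 (2 * π), ∀ s ∈ Icc 0 t, |z x s| ≤ M) :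
    |dirDeriv z (-σ, 1) (x, t)| ≤ 2 * (∫ x in Ioo 0 (2 * π), |q x|) * M := by
  have hσ2 : σ * σ = 1 := by rcases hσ with rfl | rfl <;> norm_num
  set N := (∫ x in Ioo 0 (2 * π), |q x|) with hN
  have hN0 : 0 ≤ N := integral_nonneg fun _ => abs_nonneg _
  have hM0 : 0 ≤ M := (abs_nonneg _).trans (hM x hx t ⟨ht.1, le_rfl⟩)
  have hNM : 0 ≤ N * M := mul_nonneg hN0 hM0
  have hp : (0 : ℝ) < 2 * π := by positivity
  have hend : ∀ s, x - σ * s + σ * s = x := fun s => by ring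
  -- the characteristic does not meet the boundary
  have direct : (∀ s ∈ Ico 0 t, x - σ * t + σ * s ∈ Icc 0 (2 * π)) →
      (∀ s ∈ Ioo 0 t, x - σ * t + σ * s ∈ Ioo 0 (2 * π)) →
      |dirDeriv z (-σ, 1) (x, t)| ≤ 2 * N * M := by
    intro hcl hop
    rcases ht.1.eq_or_lt with h | h
    · rw [← h, hz.dirDeriv_initial hx]
      simp only [abs_zero]
      linarith
    have h1 := hz.abs_characteristic_sub_le hq (a := x - σ * t) hσ2 le_rfl ht.1 ht.2
      (fun s hs => by
        rcases hs.2.eq_or_lt with h' | h'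
        · rw [h', hend]
          exact hx
        · exact hcl s ⟨hs.1, h'⟩) hop hM
    rw [hend, hz.dirDeriv_initial (hcl 0 ⟨le_rfl, h⟩), sub_zero] at h1
    linarith
  -- the characteristic crosses the boundary at the time `s₀`
  have crossing : ∀ s₀ ∈ Ioc 0 t, ∀ b b' : ℝ, x - σ * t + σ * s₀ = b → b ∈ Icc 0 (2 * π) →
      b' ∈ Icc 0 (2 * π) → dirDeriv z (-σ, 1) (b, s₀) = dirDeriv z (-σ, 1) (b', s₀) →
      (∀ s ∈ Ioo s₀ t, x - σ * t + σ * s ∈ Ioo 0 (2 * π)) →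
      (∀ s ∈ Ico 0 s₀, b' - σ * s₀ + σ * s ∈ Ioo 0 (2 * π)) →
      |dirDeriv z (-σ, 1) (x, t)| ≤ 2 * N * M := by
    intro s₀ hs₀ b b' hb hbm hbm' hbb hop₁ hop₂
    have h1 := hz.abs_characteristic_sub_le hq (a := x - σ * t) hσ2 hs₀.1.le hs₀.2 ht.2
      (fun s hs => by
        rcases hs.2.eq_or_lt with h' | h'
        · rw [h', hend]
          exact hx
        · rcases hs.1.eq_or_lt with h'' | h''
          · rw [← h'', hb]
            exact hbm
          · exact Ioo_subset_Icc_self (hop₁ s ⟨h'', h'⟩)) hop₁ hM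
    have h2 := hz.abs_characteristic_sub_le hq (a := b' - σ * s₀) hσ2 le_rfl hs₀.1.le
      (hs₀.2.trans_lt ht.2)
      (fun s hs => by
        rcases hs.2.eq_or_lt with h' | h'
        · rw [h']
          simpa using hbm'
        · exact Ioo_subset_Icc_self (hop₂ s ⟨hs.1, h'⟩))
      (fun s hs => hop₂ s ⟨hs.1.le, hs.2⟩)
      (fun y hy s hs => hM y hy s ⟨hs.1, hs.2.trans hs₀.2⟩)
    rw [hend, hb, hbb] at h1
    rw [show b' - σ * s₀ + σ * s₀ = b' by ring,
      hz.dirDeriv_initial (Ioo_subset_Icc_self (hop₂ 0 ⟨le_rfl, hs₀.1⟩)), sub_zero] at h2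
    have h3 := abs_add_le (dirDeriv z (-σ, 1) (x, t) - dirDeriv z (-σ, 1) (b', s₀))
      (dirDeriv z (-σ, 1) (b', s₀))
    rw [sub_add_cancel] at h3
    linarith
  obtain ⟨hx0, hx1⟩ := hx
  obtain ⟨ht0, ht1⟩ := ht
  rcases hσ with rfl | rfl
  · rcases le_or_gt t x with h | h
    · refine direct ?_ ?_ <;> rintro s ⟨h1, h2⟩ <;> constructor <;> linarith
    · refine crossing (t - x) ⟨by linarith, by linarith⟩ 0 (2 * π) (by ring) ⟨le_rfl, hp.le⟩
        ⟨hp.le, le_rfl⟩ (hz.dirDeriv_boundary ⟨by linarith, by linarith⟩ 1) ?_ ?_ <;>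
        rintro s ⟨h1, h2⟩ <;> constructor <;> linarith
  · rcases le_or_gt x (2 * π - t) with h | h
    · refine direct ?_ ?_ <;> rintro s ⟨h1, h2⟩ <;> constructor <;> linarith
    · refine crossing (t - (2 * π - x)) ⟨by linarith, by linarith⟩ (2 * π) 0 (by ring)
        ⟨hp.le, le_rfl⟩ ⟨le_rfl, hp.le⟩
        (hz.dirDeriv_boundary ⟨by linarith, by linarith⟩ (-1)).symm ?_ ?_ <;>
        rintro s ⟨h1, h2⟩ <;> constructor <;> linarith

/-- `z_t` is the mean of the two characteristic derivatives, `σ = 1` and `σ = -1`, each controlled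
by the maximum of `|z|` at earlier times. Integration in time gives the hypothesis of
`eq_zero_of_volterra_bound`. -/
theorem eq_zero (hz : IsClassicalSolution q 0 0 z) (hq : IntegrableOn q (Ioo 0 (2 * π)))
    {x t : ℝ} (hx : x ∈ Icc 0 (2 * π)) (ht : t ∈ Ico 0 (2 * π)) : z x t = 0 := by
  set N := (∫ x in Ioo 0 (2 * π), |q x|) with hN
  have hN0 : 0 ≤ N := integral_nonneg fun _ => abs_nonneg _
  have hsub : Icc 0 (2 * π) ×ˢ Icc 0 t ⊆ strip :=
    prod_mono le_rfl fun s hs => ⟨hs.1, hs.2.trans_lt ht.2⟩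
  obtain ⟨A, hA⟩ := (isCompact_Icc.prod isCompact_Icc).exists_bound_of_continuousOn
    (hz.contDiffOn_one.continuousOn.mono hsub)
  refine eq_zero_of_volterra_bound (X := Icc (0 : ℝ) (2 * π)) (φ := fun x t => z x t) (T := t)
    (A := A) (L := 2 * N) (by positivity) (fun y s hs => hA (y, s) ⟨y.2, hs⟩) ?_ ⟨x, hx⟩
    ⟨ht.1, le_rfl⟩
  intro m hm hmono hm0 hb y s hs
  have hs' : ∀ r ∈ Icc 0 s, r ∈ Ico 0 (2 * π) := fun r hr =>
    ⟨hr.1, (hr.2.trans hs.2).trans_lt ht.2⟩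
  have hcont : ContinuousOn (fun r => z y r) (Icc 0 s) :=
    hz.contDiffOn_one.continuousOn.comp (f := fun r : ℝ => ((y : ℝ), r)) (by fun_prop)
      fun r hr => ⟨y.2, hs' r hr⟩
  have hdc : ContinuousOn (fun r => dirDeriv z (0, 1) ((y : ℝ), r)) (Icc 0 s) :=
    (hz.continuousOn_dirDeriv _).comp (f := fun r : ℝ => ((y : ℝ), r)) (by fun_prop)
      fun r hr => ⟨y.2, hs' r hr⟩
  have hbd : ∀ r ∈ Icc 0 s, ‖dirDeriv z (0, 1) ((y : ℝ), r)‖ ≤ 2 * N * m r := by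
    intro r hr
    have hM : ∀ x ∈ Icc 0 (2 * π), ∀ s ∈ Icc 0 r, |z x s| ≤ m r := fun x hx u hu =>
      (hb ⟨x, hx⟩ u ⟨hu.1, hu.2.trans (hr.2.trans hs.2)⟩).trans
        (hmono hu.1 (hu.1.trans hu.2) hu.2)
    have h1 := hz.abs_characteristic_le hq (Or.inl rfl) y.2 (hs' r hr) hM
    have h2 := hz.abs_characteristic_le hq (Or.inr rfl) y.2 (hs' r hr) hM
    rw [dirDeriv_pair] at h1 h2
    rw [Real.norm_eq_abs]
    rw [abs_le] at *
    constructor <;> linarith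
  have hft := intervalIntegral.integral_eq_sub_of_hasDerivAt_of_le hs.1 hcont
    (fun r hr => (hz.hasDerivWithinAt_time y.2 (hs' r (Ioo_subset_Icc_self hr))).hasDerivAt
      (Ico_mem_nhds hr.1 (hs' r (Ioo_subset_Icc_self hr)).2))
    (hdc.intervalIntegrable_of_Icc hs.1)
  rw [hz.initial y y.2, sub_zero] at hft
  rw [← hft, ← Real.norm_eq_abs, ← intervalIntegral.integral_const_mul]
  exact intervalIntegral.norm_integral_le_of_norm_le hs.1
    (Eventually.of_forall fun r hr => hbd r (Ioc_subset_Icc_self hr))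
    ((continuous_const.mul hm).intervalIntegrable _ _)

theorem Gamma1_eq {u v : ℝ → ℝ → ℝ} (hu : IsClassicalSolution q f₁ f₂ u)
    (hv : IsClassicalSolution q f₁ f₂ v) (hq : IntegrableOn q (Ioo 0 (2 * π))) {t : ℝ}
    (ht : t ∈ Ico 0 (2 * π)) : Gamma1 (fun x => u x t) = Gamma1 (fun x => v x t) := by
  have hp : (0 : ℝ) ≤ 2 * π := by positivity
  have h : ∀ x ∈ Icc 0 (2 * π), u x t = v x t := fun x hx =>
    sub_eq_zero.1 ((hu.sub hv).eq_zero hq hx ht)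
  have m0 : (0 : ℝ) ∈ Icc 0 (2 * π) := ⟨le_rfl, hp⟩
  have m1 : 2 * π ∈ Icc 0 (2 * π) := ⟨hp, le_rfl⟩
  rw [Gamma1, Gamma1, derivWithin_congr h (h 0 m0), derivWithin_congr h (h _ m1), h 0 m0, h _ m1]

end IsClassicalSolution

/-! ### The response matrix -/

/-- The kernel of the map from the control to the flux of the scattered wave at the origin. -/
def fluxKernel (Q c : ℝ → ℝ) (k : ℝ → ℝ → ℝ) (s : ℝ) : ℝ :=
  (Q (s / 2) * (sgn (-(s / 2)) * c (s / 2)) + Q (-(s / 2)) * (sgn (s / 2) * c (-(s / 2)))) / 4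
    + 1 / 2 * ∫ ξ, Q ξ * (sgn (-ξ) * k ξ (s - |ξ|))

theorem integral_eq_intervalIntegral_of_causal {g : ℝ → ℝ} {t : ℝ} (ht : 0 ≤ t)
    (h0 : ∀ s ≤ 0, g s = 0) (h1 : ∀ s, t < s → g s = 0) : ∫ s, g s = ∫ s in (0 : ℝ)..t, g s := by
  rw [intervalIntegral.integral_of_le ht, setIntegral_eq_integral_of_forall_compl_eq_zero]
  intro s hs
  rcases le_or_gt s 0 with h | h
  · exact h0 s h
  · exact h1 s (by
      by_contra hcon
      exact hs ⟨h, not_lt.1 hcon⟩)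

/-- The substitution `s = t - 2|ξ|` on the two half-lines. Physically, the front reflected at `ξ` is
back at the origin after the time `2|ξ|`, so each delay collects contributions from `ξ` and `-ξ`. -/
theorem integral_comp_two_mul_abs {G f : ℝ → ℝ} (hG : Integrable G) {t B : ℝ} (ht : 0 ≤ t)
    (hf : Causal f) (hfc : Continuous f) (hB : ∀ s ≤ t, |f s| ≤ B) :
    ∫ ξ, G ξ * f (t - 2 * |ξ|)
      = 1 / 2 * ∫ s in (0 : ℝ)..t, (G ((t - s) / 2) + G (-((t - s) / 2))) * f s := by
  have hi : Integrable fun ξ => G ξ * f (t - 2 * |ξ|) := by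
    refine hG.mul_bdd (c := B) (by fun_prop) (Eventually.of_forall fun ξ => ?_)
    exact hB _ (by linarith [abs_nonneg ξ])
  have e1 : ∫ ξ in Iic (0 : ℝ), G ξ * f (t - 2 * |ξ|)
      = ∫ ξ in Ioi (0 : ℝ), G (-ξ) * f (t - 2 * |ξ|) := by
    have := integral_comp_neg_Ioi (0 : ℝ) fun ξ => G ξ * f (t - 2 * |ξ|)
    simp only [abs_neg, neg_zero] at this
    exact this.symm
  have e2 : ∫ ξ, G ξ * f (t - 2 * |ξ|)
      = ∫ ξ in Ioi (0 : ℝ), (G ξ + G (-ξ)) * f (t - 2 * |ξ|) := by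
    rw [← integral_add_compl (measurableSet_Iic (a := (0 : ℝ))) hi, compl_Iic, e1, ← integral_add]
    · congr 1
      ext ξ
      ring
    · have := hi.comp_neg
      simp only [abs_neg] at this
      exact this.integrableOn
    · exact hi.integrableOn
  have e3 : ∫ ξ in Ioi (0 : ℝ), (G ξ + G (-ξ)) * f (t - 2 * |ξ|)
      = ∫ ξ in Ioi (0 : ℝ), (fun σ => (G (σ / 2) + G (-(σ / 2))) * f (t - σ)) (2 * ξ) := by
    refine setIntegral_congr_fun measurableSet_Ioi fun ξ hξ => ?_
    have : |ξ| = ξ := abs_of_pos hξ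
    simp only [this]
    rw [mul_div_cancel_left₀ ξ (two_ne_zero)]
  rw [e2, e3, integral_comp_mul_left_Ioi (fun σ => (G (σ / 2) + G (-(σ / 2))) * f (t - σ)) 0
      (by norm_num : (0 : ℝ) < 2), mul_zero, smul_eq_mul,
    ← integral_indicator measurableSet_Ioi, integral_eq_intervalIntegral_of_causal ht]
  · have h := intervalIntegral.integral_comp_sub_left (a := 0) (b := t)
      (fun σ => (G (σ / 2) + G (-(σ / 2))) * f (t - σ)) t
    simp only [sub_sub_cancel, sub_self, sub_zero] at h
    rw [h]
    norm_num
    rw [intervalIntegral.integral_of_le ht, intervalIntegral.integral_of_le ht]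
    refine setIntegral_congr_fun measurableSet_Ioc fun σ hσ => ?_
    rw [indicator_of_mem (mem_Ioi.2 hσ.1)]
  · intro s hs
    exact indicator_of_notMem (by simpa using hs) _
  · intro s hs
    simp only [indicator]
    rw [hf (t - s) (by linarith)]
    simp

namespace IsWaveKernel

variable {Q c : ℝ → ℝ} {k : ℝ → ℝ → ℝ} {f : ℝ → ℝ}

theorem scattered_eq_interval (hk : IsWaveKernel Q c k) (hf : Causal f) {t : ℝ} (ht : 0 ≤ t)
    (x : ℝ) : scattered k f x t = ∫ s in (0 : ℝ)..t, k x (t - s) * f s := by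
  refine integral_eq_intervalIntegral_of_causal ht (fun s hs => ?_) fun s hs => ?_
  · rw [hf s hs, mul_zero]
  · rw [hk.zero_of_neg x (by linarith), zero_mul]

theorem measurable_retarded (hk : IsWaveKernel Q c k) :
    Measurable fun p : ℝ × ℝ => k p.2 (p.1 - |p.2|) :=
  hk.measurable.comp (by fun_prop : Measurable fun p : ℝ × ℝ => (p.2, p.1 - |p.2|))

/-- At a given `s` the integrand can be discontinuous only where `2|ξ| = s`, which is a null set of
`ξ`. -/
theorem continuous_fluxKernel_tail (hQ : Integrable Q) (hk : IsWaveKernel Q c k) :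
    Continuous fun s => ∫ ξ, Q ξ * (sgn (-ξ) * k ξ (s - |ξ|)) := by
  refine continuous_iff_continuousAt.2 fun s₀ => ?_
  obtain ⟨B, hB0, hB⟩ := hk.exists_bound (s₀ + 1)
  refine continuousAt_of_dominated (bound := fun ξ => |Q ξ| * B) ?_ ?_ (hQ.abs.mul_const B) ?_
  · refine Eventually.of_forall fun s => hQ.1.mul ?_
    exact ((measurable_sgn.comp measurable_neg).mul (hk.measurable_retarded.comp
      (measurable_const.prodMk measurable_id))).aestronglyMeasurable
  · filter_upwards [Iio_mem_nhds (lt_add_one s₀)] with s hs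
    refine Eventually.of_forall fun ξ => ?_
    rw [norm_mul, norm_mul, Real.norm_eq_abs, Real.norm_eq_abs, Real.norm_eq_abs, abs_sgn, one_mul]
    exact mul_le_mul_of_nonneg_left (hB ξ _ (by linarith [abs_nonneg ξ, mem_Iio.1 hs]))
      (abs_nonneg _)
  · have h1 : ∀ᵐ ξ : ℝ, ξ ≠ s₀ / 2 := by simp [ae_iff, measure_singleton]
    have h2 : ∀ᵐ ξ : ℝ, ξ ≠ -(s₀ / 2) := by simp [ae_iff, measure_singleton]
    filter_upwards [h1, h2] with ξ hξ1 hξ2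
    refine continuousAt_const.mul (continuousAt_const.mul ?_)
    have h3 : s₀ - |ξ| ≠ |ξ| := by
      intro h
      rcases abs_cases ξ with h' | h'
      · exact hξ1 (by linarith [h'.1])
      · exact hξ2 (by linarith [h'.1])
    exact ContinuousAt.comp (f := fun s : ℝ => (ξ, s - |ξ|)) (hk.continuousAt h3) (by fun_prop)

/-- The total wave at the retarded time `t - |ξ|` is a front, with value `f(t - 2|ξ|)` up to the
profile, plus a scattered part. The front gives the pointwise terms of `fluxKernel`, containing the
values of the potential at `±s / 2`; Fubini turns the scattered part into the integral term. -/
theorem flux_zero_eq (hQ : Integrable Q) (hc : Measurable c) (hc1 : ∀ x, |c x| ≤ 1)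
    (hk : IsWaveKernel Q c k) (hf : Causal f) (hfc : Continuous f) {t : ℝ} (ht : 0 ≤ t) :
    flux Q c k f 0 t = ∫ s in (0 : ℝ)..t, fluxKernel Q c k (t - s) * f s := by
  obtain ⟨B₁, hB₁⟩ := isCompact_Icc.exists_bound_of_continuousOn (hfc.continuousOn (s := Icc 0 t))
  have hfB : ∀ s ≤ t, |f s| ≤ max B₁ 0 := by
    intro s hs
    rcases le_or_gt s 0 with h | h
    · simp [hf s h]
    · exact (hB₁ s ⟨h.le, hs⟩).trans (le_max_left _ _)
  obtain ⟨B, hB0, hB⟩ := hk.exists_bound t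
  set G : ℝ → ℝ := fun ξ => Q ξ * (sgn (-ξ) * c ξ) with hG_def
  have hsm : Measurable fun ξ : ℝ => sgn (-ξ) := measurable_sgn.comp measurable_neg
  have hG : Integrable G := hQ.mul_bdd (c := 1) (hsm.mul hc).aestronglyMeasurable
    (Eventually.of_forall fun ξ => by
      rw [norm_mul, Real.norm_eq_abs, Real.norm_eq_abs, abs_sgn, one_mul]
      exact hc1 ξ)
  have hN := hk.continuous_scattered hf hfc.locallyIntegrable
  set F : ℝ → ℝ := indicator (Icc 0 t) f with hF
  have hFi : Integrable F := integrable_indicator_Icc hfc.locallyIntegrable 0 t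
  have hint : Integrable (Function.uncurry fun ξ s => Q ξ * (sgn (-ξ) * k ξ (t - s - |ξ|)) * F s)
      (volume.prod volume) := by
    have hb : Integrable (fun p : ℝ × ℝ => |Q p.1| * B * |F p.2|) (volume.prod volume) :=
      (hQ.abs.mul_const B).mul_prod hFi.abs
    refine hb.mono' ((hQ.1.comp_fst.mul ?_).mul hFi.1.comp_snd) (Eventually.of_forall fun p => ?_)
    · refine ((hsm.comp measurable_fst).mul ?_).aestronglyMeasurable
      exact hk.measurable.comp (by fun_prop : Measurable fun p : ℝ × ℝ => (p.1, t - p.2 - |p.1|))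
    · simp only [Function.uncurry, norm_mul, Real.norm_eq_abs, abs_sgn, one_mul]
      by_cases hs : p.2 ∈ Icc 0 t
      · have h1 := hB p.1 (t - p.2 - |p.1|) (by linarith [hs.1, abs_nonneg p.1])
        gcongr
      · simp [hF, indicator_of_notMem hs]
  have hN1 : ∀ ξ, scattered k f ξ (t - |ξ|) = ∫ s, k ξ (t - s - |ξ|) * F s := by
    intro ξ
    unfold scattered
    congr 1
    ext s
    rw [hk.mul_indicator_eq hf (by linarith [abs_nonneg ξ] : t - |ξ| ≤ t), sub_right_comm]
  have e2 : ∫ ξ, Q ξ * (sgn (-ξ) * scattered k f ξ (t - |ξ|))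
      = ∫ s in (0 : ℝ)..t, (∫ ξ, Q ξ * (sgn (-ξ) * k ξ (t - s - |ξ|))) * f s := by
    have h1 : ∀ ξ, Q ξ * (sgn (-ξ) * scattered k f ξ (t - |ξ|))
        = ∫ s, Q ξ * (sgn (-ξ) * k ξ (t - s - |ξ|)) * F s := by
      intro ξ
      rw [hN1, ← mul_assoc, ← integral_const_mul]
      congr 1
      ext s
      ring
    simp only [h1]
    rw [integral_integral_swap hint, integral_eq_intervalIntegral_of_causal ht]
    · rw [intervalIntegral.integral_of_le ht, intervalIntegral.integral_of_le ht]
      refine setIntegral_congr_fun measurableSet_Ioc fun s hs => ?_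
      simp only [hF, indicator_of_mem (Ioc_subset_Icc_self hs)]
      rw [integral_mul_const]
    · intro s hs
      have : F s = 0 := by
        rw [hF]
        simp only [indicator]
        split_ifs
        · exact hf s hs
        · rfl
      simp [this]
    · intro s hs
      have : F s = 0 := indicator_of_notMem (fun h => absurd h.2 (not_le.2 hs)) _
      simp [this]
  have i1 : Integrable fun ξ => G ξ * f (t - 2 * |ξ|) :=
    hG.mul_bdd (c := max B₁ 0) (by fun_prop) (Eventually.of_forall fun ξ =>
      hfB _ (by linarith [abs_nonneg ξ]))
  have i0 := hk.integrable_flux hQ hc hc1 hf hfc 0 t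
  have e0 : ∀ ξ, Q ξ * (sgn (0 - ξ) * wave c k f ξ (t - |0 - ξ|))
      = G ξ * f (t - 2 * |ξ|) + Q ξ * (sgn (-ξ) * scattered k f ξ (t - |ξ|)) := by
    intro ξ
    rw [zero_sub, abs_neg, wave, show t - |ξ| - |ξ| = t - 2 * |ξ| by ring]
    ring
  have i2 : Integrable fun ξ => Q ξ * (sgn (-ξ) * scattered k f ξ (t - |ξ|)) := by
    refine (i0.sub i1).congr (Eventually.of_forall fun ξ => ?_)
    simp only [Pi.sub_apply, e0]
    ring
  have hGi : IntervalIntegrable (fun s => (G ((t - s) / 2) + G (-((t - s) / 2))) * f s)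
      volume 0 t := by
    have hG' : Integrable fun s => G (s / 2) + G (-(s / 2)) :=
      (hG.comp_div two_ne_zero).add (hG.comp_neg.comp_div two_ne_zero)
    exact ((hG'.comp_sub_left t).intervalIntegrable).mul_continuousOn hfc.continuousOn
  have hTc := hk.continuous_fluxKernel_tail hQ
  have hTi : IntervalIntegrable (fun s => (∫ ξ, Q ξ * (sgn (-ξ) * k ξ (t - s - |ξ|))) * f s)
      volume 0 t :=
    (Continuous.mul (hTc.comp (by fun_prop : Continuous fun s => t - s)) hfc).intervalIntegrable
      _ _
  rw [flux]
  simp only [e0]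
  rw [integral_add i1 i2, e2, integral_comp_two_mul_abs hG ht hf hfc hfB, mul_add, ← mul_assoc,
    ← intervalIntegral.integral_const_mul, ← intervalIntegral.integral_const_mul,
    ← intervalIntegral.integral_add (hGi.const_mul _) (hTi.const_mul _)]
  congr 1
  ext s
  simp only [fluxKernel, hG_def, neg_neg]
  ring

end IsWaveKernel

/-- The response matrix in terms of the wave kernels. -/
def responseMatrix (Q : ℝ → ℝ) (k : Fin 2 → ℝ → ℝ → ℝ) (s : ℝ) : Matrix (Fin 2) (Fin 2) ℝ :=
  !![fluxKernel Q (profile 0) (k 0) s, fluxKernel Q (profile 1) (k 1) s;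
    -k 0 0 s, -k 1 0 s]

namespace IsKernelPair

variable {Q q : ℝ → ℝ} {k : Fin 2 → ℝ → ℝ → ℝ} {f : Fin 2 → ℝ → ℝ}

theorem continuousOn_fluxKernel (hq : ContinuousOn q (Ioo 0 (2 * π)))
    (hQ : Integrable (qTilde q)) (hk : IsKernelPair (qTilde q) k) (i : Fin 2) :
    ContinuousOn (fluxKernel (qTilde q) (profile i) (k i)) (Ioo 0 (2 * π)) := by
  intro s hs
  refine ContinuousAt.continuousWithinAt ?_
  have h1 : s / 2 ∈ Ioo 0 (2 * π) := ⟨by linarith [hs.1], by linarith [hs.2, Real.pi_pos]⟩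
  have h2 : -(s / 2) ∈ Ioo (-(2 * π)) 0 := ⟨by linarith [h1.2], by linarith [h1.1]⟩
  have cs : ∀ {y : ℝ}, y ≠ 0 → ContinuousAt sgn y := fun hy =>
    (continuousAt_const (y := sgn _)).congr ((sgn_eventuallyEq hy).mono fun y hy => hy.symm)
  have hd : ContinuousAt (fun s : ℝ => s / 2) s := by fun_prop
  have hd' : ContinuousAt (fun s : ℝ => -(s / 2)) s := by fun_prop
  have a1 := ContinuousAt.comp (f := fun s : ℝ => s / 2) (continuousAt_qTilde_pos hq h1) hd
  have a2 := ContinuousAt.comp (f := fun s : ℝ => -(s / 2)) (continuousAt_qTilde_neg hq h2) hd'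
  have a3 := ContinuousAt.comp (f := fun s : ℝ => s / 2) (cs h1.1.ne') hd
  have a4 := ContinuousAt.comp (f := fun s : ℝ => -(s / 2)) (cs h2.2.ne) hd'
  have a5 := ContinuousAt.comp (f := fun s : ℝ => s / 2) (continuousAt_profile i h1.1.ne') hd
  have a6 := ContinuousAt.comp (f := fun s : ℝ => -(s / 2)) (continuousAt_profile i h2.2.ne) hd'
  exact (((a1.mul (a4.mul a5)).add (a2.mul (a3.mul a6))).div_const 4).add
    (continuousAt_const.mul ((hk i).continuous_fluxKernel_tail hQ).continuousAt)

theorem integrableOn_fluxKernel (hQ : Integrable Q) (hk : IsKernelPair Q k) (i : Fin 2) :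
    IntegrableOn (fluxKernel Q (profile i) (k i)) (Ioo 0 (2 * π)) := by
  have hG : Integrable fun ξ => Q ξ * (sgn (-ξ) * profile i ξ) :=
    hQ.mul_bdd (c := 1) ((measurable_sgn.comp measurable_neg).mul
      (measurable_profile i)).aestronglyMeasurable (Eventually.of_forall fun ξ => by
      rw [norm_mul, Real.norm_eq_abs, Real.norm_eq_abs, abs_sgn, one_mul]
      exact abs_profile_le i ξ)
  have hG' := ((hG.comp_div two_ne_zero).add (hG.comp_neg.comp_div two_ne_zero)).div_const 4
  have hT := ((hk i).continuous_fluxKernel_tail hQ).const_mul (1 / 2)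
  refine (hG'.integrableOn.add ((hT.integrableOn_Icc (a := 0) (b := 2 * π)).mono_set
    Ioo_subset_Icc_self)).congr (Eventually.of_forall fun s => ?_)
  simp only [fluxKernel, Pi.add_apply, neg_neg]

theorem continuousOn_kernel_zero (hk : IsKernelPair Q k) (i : Fin 2) :
    ContinuousOn (k i 0) (Ioi 0) := by
  intro s hs
  have h : s ≠ |(0 : ℝ)| := by simpa using (ne_of_gt (mem_Ioi.1 hs))
  exact (ContinuousAt.comp (f := fun s : ℝ => ((0 : ℝ), s)) ((hk i).continuousAt h)
    (by fun_prop)).continuousWithinAt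

theorem flux_zero_eq (hQ : Integrable Q) (hk : IsKernelPair Q k) (hf : ∀ i, SmoothCausal (f i))
    {t : ℝ} (ht : 0 ≤ t) : pairFlux Q k f 0 t
      = ∑ i, ∫ s in (0 : ℝ)..t, fluxKernel Q (profile i) (k i) (t - s) * f i s :=
  Finset.sum_congr rfl fun i _ => (hk i).flux_zero_eq hQ (measurable_profile i) (abs_profile_le i)
    (hf i).causal (hf i).continuous ht

theorem scattered_zero_eq (hk : IsKernelPair Q k) (hf : ∀ i, SmoothCausal (f i))
    {t : ℝ} (ht : 0 ≤ t) : pairScattered k f 0 t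
      = ∑ i, ∫ s in (0 : ℝ)..t, k i 0 (t - s) * f i s :=
  Finset.sum_congr rfl fun i _ => (hk i).scattered_eq_interval (hf i).causal ht 0

theorem intervalIntegrable_response (hQ : Integrable Q) (hk : IsKernelPair Q k) (i j : Fin 2)
    {t : ℝ} (ht : t ∈ Icc 0 (2 * π)) :
    IntervalIntegrable (fun s => responseMatrix Q k s i j) volume 0 t := by
  rw [intervalIntegrable_iff_integrableOn_Ioo_of_le ht.1]
  have hsub : Ioo 0 t ⊆ Ioo 0 (2 * π) := Ioo_subset_Ioo_right ht.2
  have h2 : ∀ j, IntegrableOn (fun s => -k j 0 s) (Ioo 0 t) := fun j =>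
    ((((hk j).locallyIntegrable 0).integrableOn_isCompact isCompact_Icc).mono_set
      Ioo_subset_Icc_self).neg
  fin_cases i <;> fin_cases j
  · exact (hk.integrableOn_fluxKernel hQ 0).mono_set hsub
  · exact (hk.integrableOn_fluxKernel hQ 1).mono_set hsub
  · exact h2 0
  · exact h2 1

theorem integrableOn_response (hQ : Integrable Q) (hk : IsKernelPair Q k) (i j : Fin 2) :
    IntegrableOn (fun s => responseMatrix Q k s i j) (Ioo 0 (2 * π)) := by
  have h := hk.intervalIntegrable_response hQ i j (t := 2 * π) ⟨by positivity, le_rfl⟩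
  rwa [intervalIntegrable_iff_integrableOn_Ioo_of_le (by positivity)] at h

theorem continuousOn_response (hq : ContinuousOn q (Ioo 0 (2 * π)))
    (hQ : Integrable (qTilde q)) (hk : IsKernelPair (qTilde q) k) (i j : Fin 2) :
    ContinuousOn (fun s => responseMatrix (qTilde q) k s i j) (Ioo 0 (2 * π)) := by
  have h2 : ∀ j, ContinuousOn (fun s => -k j 0 s) (Ioo 0 (2 * π)) := fun j =>
    ((hk.continuousOn_kernel_zero j).mono fun s hs => hs.1).neg
  fin_cases i <;> fin_cases j
  · exact hk.continuousOn_fluxKernel hq hQ 0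
  · exact hk.continuousOn_fluxKernel hq hQ 1
  · exact h2 0
  · exact h2 1

theorem response_eq (hQ : Integrable Q) (hk : IsKernelPair Q k) (hf : ∀ i, SmoothCausal (f i))
    {t : ℝ} (ht : t ∈ Icc 0 (2 * π)) (i : Fin 2) :
    ∫ s in (0 : ℝ)..t, (responseMatrix Q k (t - s) i 0 * f 0 s
      + responseMatrix Q k (t - s) i 1 * f 1 s)
      = (![pairFlux Q k f 0 t, -pairScattered k f 0 t] : Fin 2 → ℝ) i := by
  have hi : ∀ j, IntervalIntegrable (fun s => responseMatrix Q k (t - s) i j * f j s)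
      volume 0 t := by
    intro j
    have h := ((hk.intervalIntegrable_response hQ i j ht).comp_sub_left t).symm
    simp only [sub_zero, sub_self] at h
    exact h.mul_continuousOn (hf j).continuous.continuousOn
  rw [intervalIntegral.integral_add (hi 0) (hi 1)]
  fin_cases i
  · simp [hk.flux_zero_eq hQ hf ht.1, responseMatrix]
  · simp [hk.scattered_zero_eq hf ht.1, responseMatrix]
    ring

/-- Existence is `isClassicalSolution_periodicWave`; for an arbitrary classical solution, uniqueness
transfers the computation of `Γ₁` from the constructed one. -/
theorem isResponseMatrix (hq : ContinuousOn q (Ioo 0 (2 * π)))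
    (hqi : IntegrableOn q (Ioo 0 (2 * π))) (hQ : Integrable (qTilde q))
    (hk : IsKernelPair (qTilde q) k) : IsResponseMatrix q (responseMatrix (qTilde q) k) where
  continuousOn := hk.continuousOn_response hq hQ
  integrableOn := hk.integrableOn_response hQ
  exists_solution := fun f₁ f₂ h₁ h₂ => by
    have hf : ∀ i, SmoothCausal ((![f₁, f₂] : Fin 2 → ℝ → ℝ) i) := by
      intro i
      fin_cases i
      · exact h₁.smoothCausal
      · exact h₂.smoothCausal
    exact ⟨_, isClassicalSolution_periodicWave hq hQ hk hf⟩
  response := fun f₁ f₂ h₁ h₂ u hu t ht i => by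
    have hf : ∀ i, SmoothCausal ((![f₁, f₂] : Fin 2 → ℝ → ℝ) i) := by
      intro i
      fin_cases i
      · exact h₁.smoothCausal
      · exact h₂.smoothCausal
    have hr := hk.response_eq hQ hf ⟨ht.1.le, ht.2.le⟩ i
    simp only [Matrix.cons_val_zero, Matrix.cons_val_one, Matrix.cons_val_fin_one] at hr
    rw [hu.Gamma1_eq (isClassicalSolution_periodicWave hq hQ hk hf) hqi ⟨ht.1.le, ht.2⟩,
      Gamma1_periodicWave hQ hk hf ht.2.le, hr]
    fin_cases i
    · simp
    · simp
      ring

end IsKernelPair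

/-- The response matrix is unique. -/
theorem IsResponseMatrix.eqOn {q : ℝ → ℝ} {r r' : ℝ → Matrix (Fin 2) (Fin 2) ℝ}
    (hr : IsResponseMatrix q r) (hr' : IsResponseMatrix q r') : EqOn r r' (Ioo 0 (2 * π)) := by
  intro s hs
  ext i j
  -- Observation at one time `t` in `(s, 2π)` suffices: controls supported in `(0, t)` determine
  -- `r(t - ·)` there almost everywhere, hence everywhere by continuity, and `t - s` lies in that
  -- interval.
  obtain ⟨t, hst, ht⟩ := exists_between hs.2
  have ht0 : 0 < t := hs.1.trans hst
  set d : ℝ → ℝ := fun σ => r (t - σ) i j - r' (t - σ) i j with hd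
  have hmaps : MapsTo (fun σ => t - σ) (Ioo 0 t) (Ioo 0 (2 * π)) := fun σ hσ =>
    ⟨by linarith [hσ.2], by linarith [hσ.1]⟩
  have hdc : ContinuousOn d (Ioo 0 t) :=
    ((hr.continuousOn i j).comp (f := fun σ => t - σ) (by fun_prop) hmaps).sub
      ((hr'.continuousOn i j).comp (f := fun σ => t - σ) (by fun_prop) hmaps)
  have key : ∀ g : ℝ → ℝ, ContDiff ℝ ∞ g → HasCompactSupport g → tsupport g ⊆ Ioo 0 t →
      ∫ σ, g σ • d σ = 0 := by
    intro g hg hgc hgs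
    have hgS : IsSmoothControl g := ⟨hg, hgc, hgs.trans (Ioo_subset_Ioo_right ht.le)⟩
    have h0S : IsSmoothControl 0 := ⟨contDiff_const, HasCompactSupport.zero, by
      rw [tsupport_eq_empty_iff.2 rfl]
      exact empty_subset _⟩
    have hint : ∀ {r : ℝ → Matrix (Fin 2) (Fin 2) ℝ}, IsResponseMatrix q r →
        IntervalIntegrable (fun σ => r (t - σ) i j * g σ) volume 0 t := by
      intro r hr
      have h1 : IntervalIntegrable (fun s => r s i j) volume 0 t := by
        rw [intervalIntegrable_iff_integrableOn_Ioo_of_le ht0.le]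
        exact (hr.integrableOn i j).mono_set (Ioo_subset_Ioo_right ht.le)
      have h2 := (h1.comp_sub_left t).symm
      simp only [sub_zero, sub_self] at h2
      exact h2.mul_continuousOn hg.continuous.continuousOn
    have hresp : ∫ σ in (0 : ℝ)..t, r (t - σ) i j * g σ
        = ∫ σ in (0 : ℝ)..t, r' (t - σ) i j * g σ := by
      have main : ∀ f₁ f₂ : ℝ → ℝ, IsSmoothControl f₁ → IsSmoothControl f₂ →
          ∫ s in (0 : ℝ)..t, (r (t - s) i 0 * f₁ s + r (t - s) i 1 * f₂ s)
            = ∫ s in (0 : ℝ)..t, (r' (t - s) i 0 * f₁ s + r' (t - s) i 1 * f₂ s) := by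
        intro f₁ f₂ h₁ h₂
        obtain ⟨u, hu⟩ := hr.exists_solution f₁ f₂ h₁ h₂
        have e := (hr.response f₁ f₂ h₁ h₂ u hu t ⟨ht0, ht⟩ i).symm.trans
          (hr'.response f₁ f₂ h₁ h₂ u hu t ⟨ht0, ht⟩ i)
        exact add_left_cancel e
      fin_cases j
      · simpa using main g 0 hgS h0S
      · simpa using main 0 g h0S hgS
    have hz : ∫ σ in (0 : ℝ)..t, g σ • d σ = 0 := by
      have : (fun σ => g σ • d σ) = fun σ => r (t - σ) i j * g σ - r' (t - σ) i j * g σ := by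
        ext σ
        simp only [hd, smul_eq_mul]
        ring
      rw [this, intervalIntegral.integral_sub (hint hr) (hint hr'), hresp, sub_self]
    rw [← hz, integral_eq_intervalIntegral_of_causal ht0.le]
    · intro σ hσ
      rw [image_eq_zero_of_notMem_tsupport fun h => absurd (hgs h).1 (not_lt.2 hσ), zero_smul]
    · intro σ hσ
      rw [image_eq_zero_of_notMem_tsupport fun h => absurd (hgs h).2 (not_lt.2 hσ.le), zero_smul]
  have hae := isOpen_Ioo.ae_eq_zero_of_integral_contDiff_smul_eq_zero
    (hdc.locallyIntegrableOn measurableSet_Ioo) key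
  have hEq : EqOn d 0 (Ioo 0 t) := Measure.eqOn_open_of_ae_eq (μ := volume)
    ((ae_restrict_iff' measurableSet_Ioo).2 hae) isOpen_Ioo hdc continuousOn_const
  have := hEq (x := t - s) ⟨by linarith, by linarith [hs.1]⟩
  simp only [hd, sub_sub_cancel, Pi.zero_apply] at this
  linarith

/-! ### Green's identity for the wave on the line -/

/-- The extension of the wave from the right half-line. -/
def waveRight (k : Fin 2 → ℝ → ℝ → ℝ) (f : Fin 2 → ℝ → ℝ) (x t : ℝ) : ℝ :=
  (f 0 (t - x) - f 1 (t - x)) / 2 + pairScattered k f x t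

/-- The extension of the wave from the left half-line. -/
def waveLeft (k : Fin 2 → ℝ → ℝ → ℝ) (f : Fin 2 → ℝ → ℝ) (x t : ℝ) : ℝ :=
  (-f 0 (t + x) - f 1 (t + x)) / 2 + pairScattered k f x t

/-- The space derivative of the wave on the right half-line. -/
def slopeRight (Q : ℝ → ℝ) (k : Fin 2 → ℝ → ℝ → ℝ) (f : Fin 2 → ℝ → ℝ) (x t : ℝ) : ℝ :=
  (-deriv (f 0) (t - x) + deriv (f 1) (t - x)) / 2 + pairFlux Q k f x t

/-- The space derivative of the wave on the left half-line. -/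
def slopeLeft (Q : ℝ → ℝ) (k : Fin 2 → ℝ → ℝ → ℝ) (f : Fin 2 → ℝ → ℝ) (x t : ℝ) : ℝ :=
  (-deriv (f 0) (t + x) - deriv (f 1) (t + x)) / 2 + pairFlux Q k f x t

namespace IsKernelPair

variable {Q : ℝ → ℝ} {k : Fin 2 → ℝ → ℝ → ℝ} {f : Fin 2 → ℝ → ℝ}

theorem hasDerivAt_shift_add_left {g : ℝ → ℝ} (hg : SmoothCausal g) (x t : ℝ) :
    HasDerivAt (fun x => g (t + x)) (deriv g (t + x)) x :=
  HasDerivAt.comp_const_add t x (hg.hasDerivAt (t + x))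

theorem hasDerivAt_waveRight (hQ : Integrable Q) (hk : IsKernelPair Q k)
    (hf : ∀ i, SmoothCausal (f i)) (x t : ℝ) :
    HasDerivAt (fun x => waveRight k f x t) (slopeRight Q k f x t) x :=
  ((((hasDerivAt_shift (hf 0) x t).sub (hasDerivAt_shift (hf 1) x t)).div_const 2).add
    (hk.hasDerivAt_scattered_space hQ hf x t)).congr_deriv (by unfold slopeRight; ring)

theorem hasDerivAt_waveLeft (hQ : Integrable Q) (hk : IsKernelPair Q k)
    (hf : ∀ i, SmoothCausal (f i)) (x t : ℝ) :
    HasDerivAt (fun x => waveLeft k f x t) (slopeLeft Q k f x t) x :=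
  ((((hasDerivAt_shift_add_left (hf 0) x t).neg.sub
    (hasDerivAt_shift_add_left (hf 1) x t)).div_const 2).add
    (hk.hasDerivAt_scattered_space hQ hf x t)).congr_deriv (by unfold slopeLeft; ring)

theorem hasDerivAt_slopeRight (hQ : Integrable Q) (hk : IsKernelPair Q k)
    (hf : ∀ i, SmoothCausal (f i)) {x : ℝ} (hQx : ContinuousAt Q x) (hx : 0 < x) (t : ℝ) :
    HasDerivAt (fun x => slopeRight Q k f x t)
      (Q x * pairWave k f x t + pairWave k (pairDeriv (pairDeriv f)) x t) x := by
  refine ((((hasDerivAt_shift (hf 0).deriv x t).neg.add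
    (hasDerivAt_shift (hf 1).deriv x t)).div_const 2).add
    (hk.hasDerivAt_flux_space hQ hf hQx hx.ne' t)).congr_deriv ?_
  rw [pairWave_pos k (pairDeriv (pairDeriv f)) hx]
  simp only [pairDeriv]
  ring

theorem hasDerivAt_slopeLeft (hQ : Integrable Q) (hk : IsKernelPair Q k)
    (hf : ∀ i, SmoothCausal (f i)) {x : ℝ} (hQx : ContinuousAt Q x) (hx : x < 0) (t : ℝ) :
    HasDerivAt (fun x => slopeLeft Q k f x t)
      (Q x * pairWave k f x t + pairWave k (pairDeriv (pairDeriv f)) x t) x := by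
  refine ((((hasDerivAt_shift_add_left (hf 0).deriv x t).neg.sub
    (hasDerivAt_shift_add_left (hf 1).deriv x t)).div_const 2).add
    (hk.hasDerivAt_flux_space hQ hf hQx hx.ne t)).congr_deriv ?_
  rw [pairWave_neg k (pairDeriv (pairDeriv f)) hx]
  simp only [pairDeriv]
  ring

theorem continuous_slopeRight (hQ : Integrable Q) (hk : IsKernelPair Q k)
    (hf : ∀ i, SmoothCausal (f i)) : Continuous fun p : ℝ × ℝ => slopeRight Q k f p.1 p.2 := by
  have h := hk.continuous_flux hQ hf
  have h0 := (hf 0).deriv.continuous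
  have h1 := (hf 1).deriv.continuous
  unfold slopeRight
  fun_prop

theorem continuous_slopeLeft (hQ : Integrable Q) (hk : IsKernelPair Q k)
    (hf : ∀ i, SmoothCausal (f i)) : Continuous fun p : ℝ × ℝ => slopeLeft Q k f p.1 p.2 := by
  have h := hk.continuous_flux hQ hf
  have h0 := (hf 0).deriv.continuous
  have h1 := (hf 1).deriv.continuous
  unfold slopeLeft
  fun_prop

theorem continuous_waveRight (hk : IsKernelPair Q k) (hf : ∀ i, SmoothCausal (f i)) :
    Continuous fun p : ℝ × ℝ => waveRight k f p.1 p.2 := by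
  have h := hk.continuous_scattered (fun i => (hf i).causal) (fun i => (hf i).locallyIntegrable)
  have h0 := (hf 0).continuous
  have h1 := (hf 1).continuous
  unfold waveRight
  fun_prop

theorem continuous_waveLeft (hk : IsKernelPair Q k) (hf : ∀ i, SmoothCausal (f i)) :
    Continuous fun p : ℝ × ℝ => waveLeft k f p.1 p.2 := by
  have h := hk.continuous_scattered (fun i => (hf i).causal) (fun i => (hf i).locallyIntegrable)
  have h0 := (hf 0).continuous
  have h1 := (hf 1).continuous
  unfold waveLeft
  fun_prop

theorem exists_bound_wave (hk : IsKernelPair Q k) (hf : ∀ i, SmoothCausal (f i)) (T : ℝ) :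
    ∃ B, 0 ≤ B ∧ ∀ x t, t ≤ T → |pairWave k f x t| ≤ B := by
  choose B hB0 hB using fun i => (hk i).exists_bound_wave (abs_profile_le i) (hf i).causal
    (hf i).continuous T
  refine ⟨∑ i, B i, Finset.sum_nonneg fun i _ => hB0 i, fun x t ht => ?_⟩
  exact (Finset.abs_sum_le_sum_abs _ _).trans (Finset.sum_le_sum fun i _ => hB i x t ht)

theorem measurable_wave (hk : IsKernelPair Q k) (hf : ∀ i, SmoothCausal (f i)) :
    Measurable fun p : ℝ × ℝ => pairWave k f p.1 p.2 :=
  Finset.measurable_fun_sum _ fun i _ => (hk i).measurable_wave (measurable_profile i)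
    (hf i).causal (hf i).continuous

theorem continuous_wave_time (hk : IsKernelPair Q k) (hf : ∀ i, SmoothCausal (f i)) (x : ℝ) :
    Continuous fun t => pairWave k f x t :=
  continuous_finsetSum _ fun i _ => (hk i).continuous_wave_time (hf i).causal (hf i).continuous x

end IsKernelPair

/-- A function, smooth in time and piecewise smooth in space, to be paired with a wave. -/
structure IsMultiplier (T : ℝ) (φ φt φtt φx φxx : ℝ → ℝ → ℝ) (φr φl φxr φxl : ℝ → ℝ) : Prop where
  time : ∀ x t, HasDerivAt (φ x) (φt x t) t
  time_two : ∀ x t, HasDerivAt (φt x) (φtt x t) t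
  continuous : ∀ x, Continuous (φtt x)
  measurable : Measurable fun p : ℝ × ℝ => φ p.1 p.2
  measurable_two : Measurable fun p : ℝ × ℝ => φtt p.1 p.2
  bound : ∃ B, 0 ≤ B ∧ ∀ x, ∀ t ∈ Icc 0 T, |φ x t| ≤ B ∧ |φtt x t| ≤ B
  space : ∀ t ∈ Ioo 0 T, ∀ x, x ≠ 0 → |x| < T → HasDerivAt (fun x => φ x t) (φx x t) x
  space_two : ∀ t ∈ Ioo 0 T, ∀ x, x ≠ 0 → |x| < T → HasDerivAt (fun x => φx x t) (φxx x t) x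
  integrable : ∀ t ∈ Ioo 0 T, IntegrableOn (fun x => φxx x t) (Ioo (-t) t)
  right : ∀ t ∈ Ioo 0 T, Tendsto (fun x => φ x t) (𝓝[>] 0) (𝓝 (φr t))
  left : ∀ t ∈ Ioo 0 T, Tendsto (fun x => φ x t) (𝓝[<] 0) (𝓝 (φl t))
  slope_right : ∀ t ∈ Ioo 0 T, Tendsto (fun x => φx x t) (𝓝[>] 0) (𝓝 (φxr t))
  slope_left : ∀ t ∈ Ioo 0 T, Tendsto (fun x => φx x t) (𝓝[<] 0) (𝓝 (φxl t))

/-- The jump at the origin of the Wronskian of a wave and a multiplier. -/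
def wronskianJump (Q : ℝ → ℝ) (k : Fin 2 → ℝ → ℝ → ℝ) (f : Fin 2 → ℝ → ℝ) (φr φl φxr φxl : ℝ → ℝ)
    (t : ℝ) : ℝ :=
  (slopeRight Q k f 0 t * φr t - waveRight k f 0 t * φxr t)
    - (slopeLeft Q k f 0 t * φl t - waveLeft k f 0 t * φxl t)

section Green

variable {Q : ℝ → ℝ} {k : Fin 2 → ℝ → ℝ → ℝ} {f : Fin 2 → ℝ → ℝ} {T : ℝ}
  {φ φt φtt φx φxx : ℝ → ℝ → ℝ} {φr φl φxr φxl : ℝ → ℝ}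

theorem IsMultiplier.integrable_mul (hφ : IsMultiplier T φ φt φtt φx φxx φr φl φxr φxl)
    {w : ℝ → ℝ} (hw : Measurable w) {B : ℝ} (hB : ∀ x, |w x| ≤ B) {t : ℝ} (ht : t ∈ Ioo 0 T) :
    IntegrableOn (fun x => w x * φxx x t) (Ioo (-t) t) :=
  (hφ.integrable t ht).bdd_mul (c := B) hw.aestronglyMeasurable (Eventually.of_forall hB)

/-- Green's identity in space, on the right half-line. -/
theorem IsKernelPair.green_space (hQ : Integrable Q) (hk : IsKernelPair Q k)
    (hQc : ∀ x, x ≠ 0 → |x| < T → ContinuousAt Q x) (hf : ∀ i, SmoothCausal (f i))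
    (hφ : IsMultiplier T φ φt φtt φx φxx φr φl φxr φxl) {t : ℝ} (ht : t ∈ Ioo 0 T) :
    IntegrableOn (fun x => (Q x * pairWave k f x t + pairWave k (pairDeriv (pairDeriv f)) x t)
      * φ x t - pairWave k f x t * φxx x t) (Ioo (-t) t) ∧
    ∫ x in Ioo (-t) t, ((Q x * pairWave k f x t + pairWave k (pairDeriv (pairDeriv f)) x t)
      * φ x t - pairWave k f x t * φxx x t) = -wronskianJump Q k f φr φl φxr φxl t := by
  have ht0 := ht.1
  have hf2 := pairDeriv_smooth (pairDeriv_smooth hf)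
  obtain ⟨B, hB0, hB⟩ := hk.exists_bound_wave hf t
  obtain ⟨B₂, hB₂0, hB₂⟩ := hk.exists_bound_wave hf2 t
  obtain ⟨C, hC0, hC⟩ := hφ.bound
  have hm : ∀ {g : Fin 2 → ℝ → ℝ}, (∀ i, SmoothCausal (g i)) →
      Measurable fun x => pairWave k g x t := fun hg =>
    (hk.measurable_wave hg).comp (measurable_id.prodMk measurable_const)
  have hmφ : Measurable fun x => φ x t := hφ.measurable.comp (measurable_id.prodMk measurable_const)
  have htT : t ∈ Icc 0 T := ⟨ht0.le, ht.2.le⟩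
  set D : ℝ → ℝ := fun x => (Q x * pairWave k f x t + pairWave k (pairDeriv (pairDeriv f)) x t)
      * φ x t - pairWave k f x t * φxx x t with hD
  have hDi : IntegrableOn D (Ioo (-t) t) := by
    refine Integrable.sub (Integrable.mul_bdd (c := C) (Integrable.add ?_ ?_)
      hmφ.aestronglyMeasurable (Eventually.of_forall fun x => (hC x t htT).1))
      (hφ.integrable_mul (hm hf) (fun x => hB x t le_rfl) ht)
    · exact hQ.integrableOn.mul_bdd (c := B) (hm hf).aestronglyMeasurable
        (Eventually.of_forall fun x => hB x t le_rfl)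
    · exact Measure.integrableOn_of_bounded (M := B₂) measure_Ioo_lt_top.ne
        (hm hf2).aestronglyMeasurable (Eventually.of_forall fun x => hB₂ x t le_rfl)
  refine ⟨hDi, ?_⟩
  have i1 : IntervalIntegrable D volume 0 t :=
    (intervalIntegrable_iff_integrableOn_Ioo_of_le ht0.le).2
      (hDi.mono_set (Ioo_subset_Ioo_left (by linarith)))
  have i2 : IntervalIntegrable D volume (-t) 0 :=
    (intervalIntegrable_iff_integrableOn_Ioo_of_le (by linarith)).2
      (hDi.mono_set (Ioo_subset_Ioo_right (by linarith)))
  have hzero : ∀ {x : ℝ}, t = |x| → pairScattered k f x t = 0 ∧ pairFlux Q k f x t = 0 :=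
    fun hx => ⟨hk.scattered_eq_zero (fun i => (hf i).causal) hx.le,
      hk.flux_eq_zero (fun i => (hf i).causal) hx.le⟩
  have hz : ∀ i, f i 0 = 0 ∧ deriv (f i) 0 = 0 := fun i =>
    ⟨(hf i).causal 0 le_rfl, (hf i).deriv.causal 0 le_rfl⟩
  -- `D` is the space derivative of the Wronskian of the wave and the multiplier. At the front `x =
  -- t` the wave and its slope vanish, so only the one-sided limit at the origin contributes; the
  -- same holds on the left.
  have hr : ∫ x in (0 : ℝ)..t, D x
      = 0 - (slopeRight Q k f 0 t * φr t - waveRight k f 0 t * φxr t) := by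
    refine intervalIntegral.integral_eq_sub_of_hasDerivAt_of_tendsto
      (f := fun x => slopeRight Q k f x t * φ x t - waveRight k f x t * φx x t) ht0 ?_ i1 ?_ ?_
    · intro x hx
      have hxT : |x| < T := by rw [abs_of_pos hx.1]; exact hx.2.trans ht.2
      refine (((hk.hasDerivAt_slopeRight hQ hf (hQc x hx.1.ne' hxT) hx.1 t).mul
        (hφ.space t ht x hx.1.ne' hxT)).sub ((hk.hasDerivAt_waveRight hQ hf x t).mul
        (hφ.space_two t ht x hx.1.ne' hxT))).congr_deriv ?_
      have e : waveRight k f x t = pairWave k f x t := (pairWave_pos k f hx.1 t).symm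
      rw [e]
      simp only [hD]
      ring
    · have h1 := (((hk.hasDerivAt_waveRight hQ hf 0 t).continuousAt).tendsto).mono_left
        (nhdsWithin_le_nhds (s := Ioi 0))
      have h2 : Tendsto (fun x => slopeRight Q k f x t) (𝓝[>] 0) (𝓝 (slopeRight Q k f 0 t)) :=
        ((hk.continuous_slopeRight hQ hf).comp (by fun_prop : Continuous fun x : ℝ =>
          (x, t))).continuousAt.tendsto.mono_left nhdsWithin_le_nhds
      exact (h2.mul (hφ.right t ht)).sub (h1.mul (hφ.slope_right t ht))
    · have hxT : |t| < T := by rw [abs_of_pos ht0]; exact ht.2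
      have hta : t = |t| := (abs_of_pos ht0).symm
      have h : Tendsto (fun x => slopeRight Q k f x t * φ x t - waveRight k f x t * φx x t) (𝓝[<] t)
          (𝓝 (slopeRight Q k f t t * φ t t - waveRight k f t t * φx t t)) :=
        (((hk.hasDerivAt_slopeRight hQ hf (hQc t ht0.ne' hxT) ht0 t).continuousAt.mul
        (hφ.space t ht t ht0.ne' hxT).continuousAt).sub
        ((hk.hasDerivAt_waveRight hQ hf t t).continuousAt.mul
        (hφ.space_two t ht t ht0.ne' hxT).continuousAt)).tendsto.mono_left
        (nhdsWithin_le_nhds (s := Iio t))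
      have e1 : slopeRight Q k f t t = 0 := by
        simp [slopeRight, (hzero hta).2, (hz 0).2, (hz 1).2]
      have e2 : waveRight k f t t = 0 := by
        simp [waveRight, (hzero hta).1, (hz 0).1, (hz 1).1]
      simpa [e1, e2] using h
  have hl : ∫ x in (-t)..0, D x
      = (slopeLeft Q k f 0 t * φl t - waveLeft k f 0 t * φxl t) - 0 := by
    have ht0' : -t < 0 := by linarith
    refine intervalIntegral.integral_eq_sub_of_hasDerivAt_of_tendsto
      (f := fun x => slopeLeft Q k f x t * φ x t - waveLeft k f x t * φx x t)
      ht0' ?_ i2 ?_ ?_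
    · intro x hx
      have hxT : |x| < T := by rw [abs_of_neg hx.2]; linarith [hx.1, ht.2]
      refine (((hk.hasDerivAt_slopeLeft hQ hf (hQc x hx.2.ne hxT) hx.2 t).mul
        (hφ.space t ht x hx.2.ne hxT)).sub ((hk.hasDerivAt_waveLeft hQ hf x t).mul
        (hφ.space_two t ht x hx.2.ne hxT))).congr_deriv ?_
      have e : waveLeft k f x t = pairWave k f x t := (pairWave_neg k f hx.2 t).symm
      rw [e]
      simp only [hD]
      ring
    · have hxT : |(-t)| < T := by rw [abs_neg, abs_of_pos ht0]; exact ht.2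
      have hta : t = |(-t)| := by rw [abs_neg, abs_of_pos ht0]
      have h : Tendsto (fun x => slopeLeft Q k f x t * φ x t - waveLeft k f x t * φx x t)
          (𝓝[>] (-t)) (𝓝 (slopeLeft Q k f (-t) t * φ (-t) t - waveLeft k f (-t) t * φx (-t) t)) :=
        (((hk.hasDerivAt_slopeLeft hQ hf (hQc (-t) ht0'.ne hxT) ht0' t).continuousAt.mul
        (hφ.space t ht (-t) ht0'.ne hxT).continuousAt).sub
        ((hk.hasDerivAt_waveLeft hQ hf (-t) t).continuousAt.mul
        (hφ.space_two t ht (-t) ht0'.ne hxT).continuousAt)).tendsto.mono_left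
        (nhdsWithin_le_nhds (s := Ioi (-t)))
      have e1 : slopeLeft Q k f (-t) t = 0 := by
        simp [slopeLeft, (hzero hta).2, (hz 0).2, (hz 1).2]
      have e2 : waveLeft k f (-t) t = 0 := by
        simp [waveLeft, (hzero hta).1, (hz 0).1, (hz 1).1]
      simpa [e1, e2] using h
    · have h1 := (((hk.hasDerivAt_waveLeft hQ hf 0 t).continuousAt).tendsto).mono_left
        (nhdsWithin_le_nhds (s := Iio 0))
      have h2 : Tendsto (fun x => slopeLeft Q k f x t) (𝓝[<] 0) (𝓝 (slopeLeft Q k f 0 t)) :=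
        ((hk.continuous_slopeLeft hQ hf).comp (by fun_prop : Continuous fun x : ℝ =>
          (x, t))).continuousAt.tendsto.mono_left nhdsWithin_le_nhds
      exact (h2.mul (hφ.left t ht)).sub (h1.mul (hφ.slope_left t ht))
  rw [← integral_Ioc_eq_integral_Ioo, ← intervalIntegral.integral_of_le (by linarith),
    ← intervalIntegral.integral_add_adjacent_intervals i2 i1, hr, hl, wronskianJump]
  ring

/-- Green's identity in time, at a fixed point. -/
theorem IsKernelPair.green_time (hk : IsKernelPair Q k) (hf : ∀ i, SmoothCausal (f i))
    (hφ : IsMultiplier T φ φt φtt φx φxx φr φl φxr φxl) (x : ℝ) :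
    ∫ t in (0 : ℝ)..T, (pairWave k f x t * φtt x t
      - pairWave k (pairDeriv (pairDeriv f)) x t * φ x t)
      = pairWave k f x T * φt x T - pairWave k (pairDeriv f) x T * φ x T := by
  have hf1 := pairDeriv_smooth hf
  have hc : Continuous (φ x) := continuous_iff_continuousAt.2 fun t => (hφ.time x t).continuousAt
  rw [intervalIntegral.integral_eq_sub_of_hasDerivAt
    (f := fun t => pairWave k f x t * φt x t - pairWave k (pairDeriv f) x t * φ x t),
    hk.wave_eq_zero (fun i => (hf i).causal) (abs_nonneg x),
    hk.wave_eq_zero (fun i => (hf1 i).causal) (abs_nonneg x)]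
  · ring
  · intro t _
    refine (((hk.hasDerivAt_wave_time hf x t).mul (hφ.time_two x t)).sub
      ((hk.hasDerivAt_wave_time hf1 x t).mul (hφ.time x t))).congr_deriv ?_
    ring
  · exact (((hk.continuous_wave_time hf x).mul (hφ.continuous x)).sub
      ((hk.continuous_wave_time (pairDeriv_smooth hf1) x).mul hc)).intervalIntegrable _ _

/-- Green's identity for a wave and a multiplier in the space-time strip. -/
theorem IsKernelPair.green (hQ : Integrable Q) (hk : IsKernelPair Q k) (hT : 0 < T)
    (hQc : ∀ x, x ≠ 0 → |x| < T → ContinuousAt Q x) (hf : ∀ i, SmoothCausal (f i))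
    (hφ : IsMultiplier T φ φt φtt φx φxx φr φl φxr φxl) :
    ∫ x in Ioo (-T) T, (pairWave k f x T * φt x T - pairWave k (pairDeriv f) x T * φ x T)
      = ∫ t in (0 : ℝ)..T, ((∫ x, pairWave k f x t * (φtt x t - φxx x t + Q x * φ x t))
          + wronskianJump Q k f φr φl φxr φxl t) := by
  have hf2 := pairDeriv_smooth (pairDeriv_smooth hf)
  obtain ⟨B, hB0, hB⟩ := hk.exists_bound_wave hf T
  obtain ⟨B₂, hB₂0, hB₂⟩ := hk.exists_bound_wave hf2 T
  obtain ⟨C, hC0, hC⟩ := hφ.bound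
  -- The terms at time `T` are, for each `x`, a time integral of `v φ_tt - v_tt φ`. After exchanging
  -- the order of integration, the space identity at each `t` converts `v_tt` into `v_xx - Q v` and
  -- leaves the jump at the origin.
  simp only [← hk.green_time hf hφ]
  simp only [intervalIntegral.integral_of_le hT.le, integral_Ioc_eq_integral_Ioo]
  rw [integral_integral_swap]
  · refine setIntegral_congr_fun measurableSet_Ioo fun t ht => ?_
    obtain ⟨hDi, hD⟩ := hk.green_space hQ hQc hf hφ ht
    have htT : t ∈ Icc 0 T := ⟨ht.1.le, ht.2.le⟩
    have hz : ∀ {g : Fin 2 → ℝ → ℝ}, (∀ i, SmoothCausal (g i)) → ∀ x, x ∉ Ioo (-t) t →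
        pairWave k g x t = 0 := fun hg x hx => hk.wave_eq_zero (fun i => (hg i).causal) (by
      by_contra hcon
      exact hx (abs_lt.1 (not_le.1 hcon)))
    have hm : ∀ {g : Fin 2 → ℝ → ℝ}, (∀ i, SmoothCausal (g i)) →
        Measurable fun x => pairWave k g x t := fun hg =>
      (hk.measurable_wave hg).comp (measurable_id.prodMk measurable_const)
    have hmφ : Measurable fun x => φ x t :=
      hφ.measurable.comp (measurable_id.prodMk measurable_const)
    have hmφ2 : Measurable fun x => φtt x t :=
      hφ.measurable_two.comp (measurable_id.prodMk measurable_const)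
    have hsub : Ioo (-t) t ⊆ Ioo (-T) T := Ioo_subset_Ioo (by linarith [ht.2]) ht.2.le
    have e1 : ∫ x in Ioo (-T) T, (pairWave k f x t * φtt x t
        - pairWave k (pairDeriv (pairDeriv f)) x t * φ x t)
        = ∫ x in Ioo (-t) t, (pairWave k f x t * φtt x t
        - pairWave k (pairDeriv (pairDeriv f)) x t * φ x t) :=
      setIntegral_eq_of_subset_of_forall_sdiff_eq_zero measurableSet_Ioo hsub fun x hx => by
        rw [hz hf x hx.2, hz hf2 x hx.2]
        simp
    have e2 : ∫ x, pairWave k f x t * (φtt x t - φxx x t + Q x * φ x t)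
        = ∫ x in Ioo (-t) t, pairWave k f x t * (φtt x t - φxx x t + Q x * φ x t) :=
      (setIntegral_eq_integral_of_forall_compl_eq_zero fun x hx => by
        rw [hz hf x hx, zero_mul]).symm
    have hi : IntegrableOn (fun x => pairWave k f x t * φtt x t
        - pairWave k (pairDeriv (pairDeriv f)) x t * φ x t) (Ioo (-t) t) := by
      refine Measure.integrableOn_of_bounded (M := B * C + B₂ * C) measure_Ioo_lt_top.ne
        (((hm hf).mul hmφ2).sub ((hm hf2).mul hmφ)).aestronglyMeasurable
        (Eventually.of_forall fun x => (norm_sub_le _ _).trans (add_le_add ?_ ?_))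
      · rw [norm_mul]
        exact mul_le_mul (hB x t ht.2.le) (hC x t htT).2 (norm_nonneg _) hB0
      · rw [norm_mul]
        exact mul_le_mul (hB₂ x t ht.2.le) (hC x t htT).1 (norm_nonneg _) hB₂0
    have hJ : wronskianJump Q k f φr φl φxr φxl t = -∫ x in Ioo (-t) t, ((Q x * pairWave k f x t
        + pairWave k (pairDeriv (pairDeriv f)) x t) * φ x t - pairWave k f x t * φxx x t) := by
      rw [hD, neg_neg]
    rw [e1, e2, hJ, ← sub_eq_add_neg, eq_sub_iff_add_eq, ← integral_add hi hDi]
    refine setIntegral_congr_fun measurableSet_Ioo fun x _ => ?_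
    ring
  · have hfin : IsFiniteMeasure ((volume.restrict (Ioo (-T) T)).prod
        (volume.restrict (Ioo 0 T))) := by infer_instance
    refine Integrable.of_bound (C := B * C + B₂ * C)
      (((hk.measurable_wave hf).mul hφ.measurable_two).sub
        ((hk.measurable_wave hf2).mul hφ.measurable)).aestronglyMeasurable ?_
    rw [Measure.prod_restrict]
    filter_upwards [ae_restrict_mem (measurableSet_Ioo.prod measurableSet_Ioo)] with p hp
    have hpT : p.2 ∈ Icc 0 T := ⟨hp.2.1.le, hp.2.2.le⟩
    refine (norm_sub_le _ _).trans (add_le_add ?_ ?_)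
    · rw [norm_mul]
      exact mul_le_mul (hB _ _ hp.2.2.le) (hC _ _ hpT).2 (norm_nonneg _) hB0
    · rw [norm_mul]
      exact mul_le_mul (hB₂ _ _ hp.2.2.le) (hC _ _ hpT).1 (norm_nonneg _) hB₂0

end Green

/-! ### Square integrable controls -/

/-- The components of a control, extended by zero to the line. -/
def controlFun {T : ℝ} (F : Controls T) (i : Fin 2) : ℝ → ℝ :=
  indicator (Ioo 0 T) fun s => F s i

section ControlFun

variable {T : ℝ}

theorem causal_controlFun (F : Controls T) (i : Fin 2) : Causal (controlFun F i) := fun _ ht =>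
  indicator_of_notMem (fun h => absurd h.1 (not_lt.2 ht)) _

theorem abs_apply_le_norm (v : EuclideanSpace ℝ (Fin 2)) (i : Fin 2) : |v i| ≤ ‖v‖ :=
  PiLp.norm_apply_le v i

theorem memLp_apply (F : Controls T) (i : Fin 2) :
    MemLp (fun s => F s i) 2 (volume.restrict (Ioo 0 T)) :=
  (Lp.memLp F).of_le ((EuclideanSpace.proj (𝕜 := ℝ) i).continuous.comp_aestronglyMeasurable
    (Lp.aestronglyMeasurable F)) (Eventually.of_forall fun s => abs_apply_le_norm (F s) i)

theorem memLp_controlFun (F : Controls T) (i : Fin 2) : MemLp (controlFun F i) 2 :=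
  (memLp_indicator_iff_restrict measurableSet_Ioo).2 (memLp_apply F i)

theorem integrable_controlFun (F : Controls T) (i : Fin 2) : Integrable (controlFun F i) :=
  (integrable_indicator_iff measurableSet_Ioo).2 ((memLp_apply F i).integrable (by norm_num))

theorem eLpNorm_controlFun_le (F : Controls T) (i : Fin 2) :
    eLpNorm (controlFun F i) 2 volume ≤ ENNReal.ofReal ‖F‖ := by
  rw [controlFun, eLpNorm_indicator_eq_eLpNorm_restrict measurableSet_Ioo, Lp.norm_def,
    ENNReal.ofReal_toReal (Lp.eLpNorm_ne_top F)]
  exact eLpNorm_mono fun s => abs_apply_le_norm (F s) i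

theorem integral_abs_controlFun_le (F : Controls T) (i : Fin 2) :
    ∫ s, |controlFun F i s| ≤ √T * ‖F‖ := by
  have h1 := integral_norm_eq_lintegral_enorm (integrable_controlFun F i).aestronglyMeasurable
  simp only [Real.norm_eq_abs] at h1
  rw [h1, ← eLpNorm_one_eq_lintegral_enorm, controlFun,
    eLpNorm_indicator_eq_eLpNorm_restrict measurableSet_Ioo]
  have h2 := eLpNorm_le_eLpNorm_mul_rpow_measure_univ (p := 1) (q := 2)
    (μ := volume.restrict (Ioo 0 T)) (by norm_num) (memLp_apply F i).aestronglyMeasurable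
  have h3 := eLpNorm_controlFun_le F i
  rw [controlFun, eLpNorm_indicator_eq_eLpNorm_restrict measurableSet_Ioo] at h3
  have h4 : eLpNorm (fun s => F s i) 1 (volume.restrict (Ioo 0 T)) ≤ ENNReal.ofReal (√T * ‖F‖) := by
    refine h2.trans ?_
    rw [mul_comm √T, ENNReal.ofReal_mul (norm_nonneg _)]
    refine mul_le_mul' h3 (le_of_eq ?_)
    rw [Measure.restrict_apply_univ, Real.volume_Ioo, sub_zero, Real.sqrt_eq_rpow]
    rcases le_or_gt 0 T with hT | hT
    · rw [ENNReal.ofReal_rpow_of_nonneg hT (by norm_num)]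
      norm_num
    · rw [ENNReal.ofReal_of_nonpos hT.le, ← Real.sqrt_eq_rpow, Real.sqrt_eq_zero_of_nonpos hT.le]
      norm_num
  exact ENNReal.toReal_le_of_le_ofReal (by positivity) h4

theorem controlFun_eq_of_mem (F : Controls T) (i : Fin 2) {s : ℝ} (hs : s ∈ Ioo 0 T) :
    controlFun F i s = F s i := indicator_of_mem hs _

theorem controlFun_add (F G : Controls T) (i : Fin 2) :
    controlFun (F + G) i =ᵐ[volume] controlFun F i + controlFun G i := by
  have h := (ae_restrict_iff' measurableSet_Ioo).1 (Lp.coeFn_add F G)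
  filter_upwards [h] with s hs
  by_cases hm : s ∈ Ioo 0 T
  · rw [Pi.add_apply, controlFun_eq_of_mem _ _ hm, controlFun_eq_of_mem _ _ hm,
      controlFun_eq_of_mem _ _ hm, hs hm]
    rfl
  · simp [controlFun, hm]

theorem controlFun_smul (a : ℝ) (F : Controls T) (i : Fin 2) :
    controlFun (a • F) i =ᵐ[volume] a • controlFun F i := by
  have h := (ae_restrict_iff' measurableSet_Ioo).1 (Lp.coeFn_smul a F)
  filter_upwards [h] with s hs
  by_cases hm : s ∈ Ioo 0 T
  · simp [controlFun, hm, hs hm]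
  · simp [controlFun, hm]

theorem inner_controls (F G : Controls T) :
    ⟪F, G⟫ = (∫ s, controlFun F 0 s * controlFun G 0 s)
      + ∫ s, controlFun F 1 s * controlFun G 1 s := by
  have hi : ∀ i, Integrable fun s => controlFun F i s * controlFun G i s := fun i =>
    (memLp_controlFun F i).integrable_mul (memLp_controlFun G i)
  rw [L2.inner_def, ← integral_add (hi 0) (hi 1), ← integral_indicator measurableSet_Ioo]
  congr 1
  ext s
  by_cases hs : s ∈ Ioo 0 T
  · simp [controlFun, hs, PiLp.inner_apply, Fin.sum_univ_two, mul_comm]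
  · simp [controlFun, hs]

theorem inner_controls_of_ae {F G : Controls T} {f : Fin 2 → ℝ → ℝ}
    (hF : ∀ i, controlFun F i =ᵐ[volume] f i) :
    ⟪F, G⟫ = (∫ s, f 0 s * controlFun G 0 s) + ∫ s, f 1 s * controlFun G 1 s := by
  rw [inner_controls]
  congr 1
  · exact integral_congr_ae ((hF 0).mul (ae_eq_refl (controlFun G 0)))
  · exact integral_congr_ae ((hF 1).mul (ae_eq_refl (controlFun G 1)))

end ControlFun

/-! ### Smooth controls are dense -/

/-- Pairs of smooth controls with compact support in `(0, T)`. -/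
def IsTestControl (T : ℝ) (f : Fin 2 → ℝ → ℝ) : Prop :=
  ∀ i, ContDiff ℝ ∞ (f i) ∧ HasCompactSupport (f i) ∧ tsupport (f i) ⊆ Ioo 0 T

namespace IsTestControl

variable {T : ℝ} {f g : Fin 2 → ℝ → ℝ}

theorem eq_zero (hf : IsTestControl T f) (i : Fin 2) {t : ℝ} (ht : t ∉ Ioo 0 T) : f i t = 0 := by
  by_contra h
  exact ht ((hf i).2.2 (subset_tsupport _ h))

theorem smoothCausal (hf : IsTestControl T f) (i : Fin 2) : SmoothCausal (f i) :=
  ⟨(hf i).1, fun _ ht => hf.eq_zero i fun h => absurd h.1 (not_lt.2 ht)⟩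

theorem add (hf : IsTestControl T f) (hg : IsTestControl T g) :
    IsTestControl T (fun i => f i + g i) := fun i =>
  ⟨(hf i).1.add (hg i).1, (hf i).2.1.add (hg i).2.1,
    (tsupport_add _ _).trans (union_subset (hf i).2.2 (hg i).2.2)⟩

theorem smul (a : ℝ) (hf : IsTestControl T f) : IsTestControl T (fun i => a • f i) := fun i =>
  ⟨contDiff_const.smul (hf i).1, (hf i).2.1.smul_left (f := fun _ => a),
    (tsupport_smul_subset_right (fun _ => a) (f i)).trans (hf i).2.2⟩

theorem memLp (hf : IsTestControl T f) :
    MemLp (fun s => WithLp.toLp 2 fun i => f i s : ℝ → EuclideanSpace ℝ (Fin 2)) 2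
      (volume.restrict (Ioo 0 T)) := by
  have h : ∀ i, MemLp (f i) 2 (volume.restrict (Ioo 0 T)) := fun i =>
    ((hf i).1.continuous.memLp_of_hasCompactSupport (hf i).2.1).restrict _
  exact (memLp_pi_iff.2 h).continuousLinearMap_comp
    ((EuclideanSpace.equiv (Fin 2) ℝ).symm : (Fin 2 → ℝ) →L[ℝ] EuclideanSpace ℝ (Fin 2))

/-- The class of a pair of smooth controls. -/
def toControl (hf : IsTestControl T f) : Controls T := hf.memLp.toLp _

theorem controlFun_toControl (hf : IsTestControl T f) (i : Fin 2) :
    controlFun hf.toControl i =ᵐ[volume] f i := by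
  have h := (ae_restrict_iff' measurableSet_Ioo).1 hf.memLp.coeFn_toLp
  filter_upwards [h] with s hs
  by_cases hm : s ∈ Ioo 0 T
  · rw [controlFun_eq_of_mem _ _ hm, toControl, hs hm]
  · rw [controlFun, indicator_of_notMem hm, hf.eq_zero i hm]

end IsTestControl

/-- The classes of the smooth controls. -/
def smoothControls (T : ℝ) : Submodule ℝ (Controls T) where
  carrier := {F | ∃ f, IsTestControl T f ∧ ∀ i, controlFun F i =ᵐ[volume] f i}
  add_mem' := by
    rintro F G ⟨f, hf, hF⟩ ⟨g, hg, hG⟩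
    exact ⟨_, hf.add hg, fun i => (controlFun_add F G i).trans ((hF i).add (hG i))⟩
  zero_mem' := by
    refine ⟨fun _ => 0, fun i => ⟨contDiff_const, HasCompactSupport.zero, by
      simp [tsupport]⟩, fun i => ?_⟩
    have := controlFun_smul (0 : ℝ) (0 : Controls T) i
    simpa using this
  smul_mem' := by
    rintro a F ⟨f, hf, hF⟩
    exact ⟨_, hf.smul a, fun i => (controlFun_smul a F i).trans ((hF i).const_smul a)⟩

theorem IsTestControl.toControl_mem {T : ℝ} {f : Fin 2 → ℝ → ℝ} (hf : IsTestControl T f) :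
    hf.toControl ∈ smoothControls T := ⟨f, hf, hf.controlFun_toControl⟩

theorem isTestControl_single {T : ℝ} {h : ℝ → ℝ} (h1 : ContDiff ℝ ∞ h) (h2 : HasCompactSupport h)
    (h3 : tsupport h ⊆ Ioo 0 T) (i : Fin 2) :
    IsTestControl T (fun j => if j = i then h else 0) := fun j => by
  dsimp only
  split_ifs
  · exact ⟨h1, h2, h3⟩
  · exact ⟨contDiff_const, HasCompactSupport.zero, by simp [tsupport]⟩

/-- A control orthogonal to all test controls with a single nonzero component has vanishing
components, by the fundamental lemma of the calculus of variations. -/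
theorem dense_smoothControls (T : ℝ) : Dense (smoothControls T : Set (Controls T)) := by
  rw [Submodule.dense_iff_topologicalClosure_eq_top, Submodule.topologicalClosure_eq_top_iff,
    Submodule.eq_bot_iff]
  intro G hG
  have key : ∀ i, ∀ᵐ s, s ∈ Ioo 0 T → controlFun G i s = 0 := by
    intro i
    refine isOpen_Ioo.ae_eq_zero_of_integral_contDiff_smul_eq_zero
      ((integrable_controlFun G i).locallyIntegrable.locallyIntegrableOn _) fun h h1 h2 h3 => ?_
    have hf := isTestControl_single h1 h2 h3 i
    have h0 := (Submodule.mem_orthogonal _ G).1 hG _ hf.toControl_mem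
    rw [inner_controls_of_ae hf.controlFun_toControl] at h0
    fin_cases i
    · simpa using h0
    · simpa using h0
  refine Lp.ext ?_
  have h : ∀ᵐ s, s ∈ Ioo 0 T → G s = 0 := by
    filter_upwards [key 0, key 1] with s h0 h1 hs
    ext i
    fin_cases i
    · simpa [controlFun_eq_of_mem _ _ hs] using h0 hs
    · simpa [controlFun_eq_of_mem _ _ hs] using h1 hs
  refine EventuallyEq.trans ?_ (Lp.coeFn_zero _ _ _).symm
  exact (ae_restrict_iff' measurableSet_Ioo).2 h

/-- The classes of the smooth states with compact support. -/
def smoothStates : Submodule ℝ (Lp ℝ 2 (volume : Measure ℝ)) where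
  carrier := {z | ∃ η : ℝ → ℝ, ContDiff ℝ ∞ η ∧ HasCompactSupport η ∧ z =ᵐ[volume] η}
  add_mem' := by
    rintro z w ⟨η, h1, h2, h3⟩ ⟨θ, k1, k2, k3⟩
    exact ⟨_, h1.add k1, h2.add k2, (Lp.coeFn_add z w).trans (h3.add k3)⟩
  zero_mem' := ⟨0, contDiff_const, HasCompactSupport.zero, Lp.coeFn_zero _ _ _⟩
  smul_mem' := by
    rintro a z ⟨η, h1, h2, h3⟩
    exact ⟨_, contDiff_const.smul h1, h2.smul_left (f := fun _ => a),
      (Lp.coeFn_smul a z).trans (h3.const_smul a)⟩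

theorem dense_smoothStates : Dense (smoothStates : Set (Lp ℝ 2 (volume : Measure ℝ))) := by
  rw [Submodule.dense_iff_topologicalClosure_eq_top, Submodule.topologicalClosure_eq_top_iff,
    Submodule.eq_bot_iff]
  intro z hz
  refine Lp.ext (EventuallyEq.trans ?_ (Lp.coeFn_zero _ _ _).symm)
  refine ae_eq_zero_of_integral_contDiff_smul_eq_zero
    ((Lp.memLp z).locallyIntegrable (by norm_num)) fun η h1 h2 => ?_
  have hη : MemLp η 2 := h1.continuous.memLp_of_hasCompactSupport h2
  have h0 := (Submodule.mem_orthogonal _ z).1 hz (hη.toLp η) ⟨η, h1, h2, hη.coeFn_toLp⟩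
  rw [L2.inner_def] at h0
  rw [← h0]
  refine integral_congr_ae ?_
  filter_upwards [hη.coeFn_toLp] with x hx
  simp [hx, mul_comm]

/-! ### The wave as a square integrable state -/

/-- This makes the incoming front `f(t - |x|)` depend only on the almost-everywhere class of `f`, so
that waves of `L²` controls are well defined. -/
theorem quasiMeasurePreserving_sub_abs (t : ℝ) :
    Measure.QuasiMeasurePreserving (fun x : ℝ => t - |x|) := by
  refine ⟨by fun_prop, Measure.AbsolutelyContinuous.mk fun s hs h0 => ?_⟩
  rw [Measure.map_apply (by fun_prop) hs]
  have h1 := (Measure.measurePreserving_sub_left volume t).measure_preimage hs.nullMeasurableSet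
  have h2 := (measurePreserving_add_left volume t).measure_preimage hs.nullMeasurableSet
  rw [h0] at h1 h2
  refine measure_mono_null (fun x hx => ?_) (measure_union_null h1 h2)
  rcases le_total 0 x with h | h
  · left
    simpa [abs_of_nonneg h] using hx
  · right
    simpa [abs_of_nonpos h] using hx

theorem eLpNorm_comp_sub_abs_le {f : ℝ → ℝ} (hf : AEStronglyMeasurable f) (t : ℝ) :
    eLpNorm (fun x => f (t - |x|)) 2 volume ≤ 2 * eLpNorm f 2 volume := by
  have p1 := Measure.measurePreserving_sub_left (volume : Measure ℝ) t
  have p2 := measurePreserving_add_left (volume : Measure ℝ) t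
  have h1 := eLpNorm_comp_measurePreserving (p := 2) hf p1
  have h2 := eLpNorm_comp_measurePreserving (p := 2) hf p2
  have m1 := hf.comp_measurePreserving p1
  have m2 := hf.comp_measurePreserving p2
  have h3 : eLpNorm (fun x => f (t - |x|)) 2 volume ≤
      eLpNorm ((fun x => ‖(f ∘ fun x => t - x) x‖) + fun x => ‖(f ∘ fun x => t + x) x‖) 2 volume := by
    refine eLpNorm_mono_real fun x => ?_
    rcases le_total 0 x with h | h
    · simp [abs_of_nonneg h]
    · simp [abs_of_nonpos h]
  refine h3.trans ((eLpNorm_add_le m1.norm m2.norm (by norm_num)).trans (le_of_eq ?_))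
  rw [eLpNorm_norm, eLpNorm_norm, h1, h2, two_mul]

theorem abs_scattered_le {k : ℝ → ℝ → ℝ} {f : ℝ → ℝ} (hf : Causal f) (hfi : Integrable f)
    {B S : ℝ} (hB : ∀ x t, t ≤ S → |k x t| ≤ B) (x : ℝ) {t : ℝ} (ht : t ≤ S) :
    |scattered k f x t| ≤ B * ∫ s, |f s| := by
  rw [← integral_const_mul]
  refine norm_integral_le_of_norm_le (f := fun s => k x (t - s) * f s) (hfi.abs.const_mul B) (Eventually.of_forall fun s => ?_)
  rw [norm_mul]
  rcases le_or_gt s 0 with h | h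
  · simp [hf s h]
  · exact mul_le_mul_of_nonneg_right (hB x _ (by linarith)) (norm_nonneg _)

theorem wave_congr_ae (c : ℝ → ℝ) (k : ℝ → ℝ → ℝ) {f g : ℝ → ℝ} (h : f =ᵐ[volume] g) (t : ℝ) :
    (fun x => wave c k f x t) =ᵐ[volume] fun x => wave c k g x t := by
  have h1 : ∀ x, scattered k f x t = scattered k g x t := fun x =>
    integral_congr_ae (h.mono fun s hs => by simp only [hs])
  filter_upwards [(quasiMeasurePreserving_sub_abs t).ae_eq_comp h] with x hx
  have hx' : f (t - |x|) = g (t - |x|) := hx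
  rw [wave, wave, h1, hx']

theorem pairWave_congr_ae (k : Fin 2 → ℝ → ℝ → ℝ) {f g : Fin 2 → ℝ → ℝ}
    (h : ∀ i, f i =ᵐ[volume] g i) (t : ℝ) :
    (fun x => pairWave k f x t) =ᵐ[volume] fun x => pairWave k g x t := by
  filter_upwards [wave_congr_ae (profile 0) (k 0) (h 0) t,
    wave_congr_ae (profile 1) (k 1) (h 1) t] with x h0 h1
  simp only [pairWave, Fin.sum_univ_two, h0, h1]

namespace IsWaveKernel

variable {Q c : ℝ → ℝ} {k : ℝ → ℝ → ℝ} {f g : ℝ → ℝ}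

theorem wave_add (hk : IsWaveKernel Q c k) (hf : Causal f) (hfi : LocallyIntegrable f)
    (hg : Causal g) (hgi : LocallyIntegrable g) (x t : ℝ) :
    wave c k (f + g) x t = wave c k f x t + wave c k g x t := by
  have : scattered k (f + g) x t = scattered k f x t + scattered k g x t := by
    rw [scattered, scattered, scattered,
      ← integral_add (hk.integrable_conv hf hfi x t) (hk.integrable_conv hg hgi x t)]
    congr 1
    ext s
    simp only [Pi.add_apply]
    ring
  rw [wave, this, wave, wave, Pi.add_apply]
  ring

theorem _root_.KreinPeriodic.wave_smul (c : ℝ → ℝ) (k : ℝ → ℝ → ℝ) (f : ℝ → ℝ) (a x t : ℝ) :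
    wave c k (a • f) x t = a * wave c k f x t := by
  have : scattered k (a • f) x t = a * scattered k f x t := by
    rw [scattered, scattered, ← integral_const_mul]
    congr 1
    ext s
    simp only [Pi.smul_apply, smul_eq_mul]
    ring
  rw [wave, this, wave, Pi.smul_apply, smul_eq_mul]
  ring

/-- The front costs at most twice the norm of the control, once for each half-line. The scattered
part is bounded by Cauchy–Schwarz and is supported in `[-S, S]`. The constant is uniform in `t ≤ S`,
as needed for continuity in time. -/
theorem exists_eLpNorm_wave_le (hc : Measurable c) (hc1 : ∀ x, |c x| ≤ 1)
    (hk : IsWaveKernel Q c k) (S T : ℝ) : ∃ K, 0 ≤ K ∧ ∀ t ≤ S, ∀ (F : Controls T) (i : Fin 2),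
      MemLp (fun x => wave c k (controlFun F i) x t) 2 ∧
      eLpNorm (fun x => wave c k (controlFun F i) x t) 2 volume ≤ ENNReal.ofReal (K * ‖F‖) := by
  obtain ⟨B, hB0, hB⟩ := hk.exists_bound S
  set G : ℝ → ℝ := indicator (Icc (-S) S) fun _ => 1 with hG
  have hGm : MemLp G 2 := memLp_indicator_const 2 measurableSet_Icc 1 (Or.inr
    measure_Icc_lt_top.ne)
  set M := (eLpNorm G 2 volume).toReal with hM
  refine ⟨2 + B * √T * M, by positivity, fun t ht F i => ?_⟩
  set f := controlFun F i with hf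
  have hfc : Causal f := causal_controlFun F i
  have hfi : Integrable f := integrable_controlFun F i
  have m1 : AEStronglyMeasurable fun x => c x * f (t - |x|) :=
    hc.aestronglyMeasurable.mul ((memLp_controlFun F i).1.comp_quasiMeasurePreserving
      (quasiMeasurePreserving_sub_abs t))
  have m2 : AEStronglyMeasurable fun x => scattered k f x t :=
    ((hk.continuous_scattered hfc hfi.locallyIntegrable).comp
      (by fun_prop : Continuous fun x : ℝ => (x, t))).aestronglyMeasurable
  have e1 : eLpNorm (fun x => c x * f (t - |x|)) 2 volume ≤ ENNReal.ofReal (2 * ‖F‖) := by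
    refine (eLpNorm_mono fun x => ?_).trans ((eLpNorm_comp_sub_abs_le (memLp_controlFun F i).1
      t).trans ?_)
    · rw [norm_mul]
      exact mul_le_of_le_one_left (norm_nonneg _) (hc1 x)
    · rw [ENNReal.ofReal_mul zero_le_two, ENNReal.ofReal_ofNat]
      exact mul_le_mul_right (eLpNorm_controlFun_le F i) _
  have e2 : eLpNorm (fun x => scattered k f x t) 2 volume
      ≤ ENNReal.ofReal (B * √T * M * ‖F‖) := by
    have h := eLpNorm_le_mul_eLpNorm_of_ae_le_mul (p := 2) (μ := volume)
      (f := fun x => scattered k f x t) (g := G) (c := B * (√T * ‖F‖))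
      (Eventually.of_forall fun x => by
        by_cases hx : x ∈ Icc (-S) S
        · rw [hG, indicator_of_mem hx, norm_one, mul_one]
          exact (abs_scattered_le hfc hfi hB x ht).trans
            (mul_le_mul_of_nonneg_left (integral_abs_controlFun_le F i) hB0)
        · rw [scattered_eq_zero hk hfc, norm_zero]
          · positivity
          · by_contra hcon
            exact hx (abs_le.1 ((not_le.1 hcon).le.trans ht)))
    refine h.trans (le_of_eq ?_)
    rw [← ENNReal.ofReal_toReal hGm.2.ne, ← hM, ← ENNReal.ofReal_mul (by positivity)]
    congr 1
    ring
  have e3 : eLpNorm (fun x => wave c k f x t) 2 volume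
      ≤ ENNReal.ofReal ((2 + B * √T * M) * ‖F‖) := by
    refine (eLpNorm_add_le m1 m2 (by norm_num)).trans ((add_le_add e1 e2).trans (le_of_eq ?_))
    rw [← ENNReal.ofReal_add (by positivity) (by positivity), ← add_mul]
  exact ⟨⟨m1.add m2, e3.trans_lt ENNReal.ofReal_lt_top⟩, e3⟩

end IsWaveKernel

namespace IsKernelPair

variable {Q : ℝ → ℝ} {k : Fin 2 → ℝ → ℝ → ℝ}

theorem exists_eLpNorm_wave_le (hk : IsKernelPair Q k) (S T : ℝ) :
    ∃ K, 0 ≤ K ∧ ∀ t ≤ S, ∀ F : Controls T,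
      MemLp (fun x => pairWave k (controlFun F) x t) 2 ∧
      eLpNorm (fun x => pairWave k (controlFun F) x t) 2 volume ≤ ENNReal.ofReal (K * ‖F‖) := by
  choose K hK0 hK using fun i =>
    (hk i).exists_eLpNorm_wave_le (measurable_profile i) (abs_profile_le i) S T
  refine ⟨K 0 + K 1, add_nonneg (hK0 0) (hK0 1), fun t ht F => ?_⟩
  have h0 := hK 0 t ht F 0
  have h1 := hK 1 t ht F 1
  have e : (fun x => pairWave k (controlFun F) x t)
      = (fun x => wave (profile 0) (k 0) (controlFun F 0) x t)
        + fun x => wave (profile 1) (k 1) (controlFun F 1) x t := by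
    ext x
    simp [pairWave, Fin.sum_univ_two]
  rw [e]
  refine ⟨h0.1.add h1.1, (eLpNorm_add_le h0.1.1 h1.1.1 (by norm_num)).trans
    ((add_le_add h0.2 h1.2).trans (le_of_eq ?_))⟩
  rw [← ENNReal.ofReal_add (mul_nonneg (hK0 0) (norm_nonneg _))
    (mul_nonneg (hK0 1) (norm_nonneg _)), ← add_mul]

theorem memLp_wave (hk : IsKernelPair Q k) {T : ℝ} (F : Controls T) (t : ℝ) :
    MemLp (fun x => pairWave k (controlFun F) x t) 2 :=
  ((hk.exists_eLpNorm_wave_le t T).choose_spec.2 t le_rfl F).1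

/-- The state at time `t` of the wave generated by a control. -/
def waveState (hk : IsKernelPair Q k) (T t : ℝ) : Controls T →L[ℝ] Lp ℝ 2 (volume : Measure ℝ) :=
  LinearMap.mkContinuousOfExistsBound
    { toFun := fun F => (hk.memLp_wave F t).toLp _
      map_add' := fun F G => by
        rw [← MemLp.toLp_add]
        refine MemLp.toLp_congr _ _ ((pairWave_congr_ae k (controlFun_add F G) t).trans
          (Eventually.of_forall fun x => ?_))
        simp only [pairWave, Pi.add_apply, Fin.sum_univ_two]
        rw [(hk 0).wave_add (causal_controlFun F 0) (integrable_controlFun F 0).locallyIntegrable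
          (causal_controlFun G 0) (integrable_controlFun G 0).locallyIntegrable,
          (hk 1).wave_add (causal_controlFun F 1) (integrable_controlFun F 1).locallyIntegrable
          (causal_controlFun G 1) (integrable_controlFun G 1).locallyIntegrable]
        ring
      map_smul' := fun a F => by
        rw [RingHom.id_apply, ← MemLp.toLp_const_smul]
        refine MemLp.toLp_congr _ _ ((pairWave_congr_ae k (controlFun_smul a F) t).trans
          (Eventually.of_forall fun x => ?_))
        simp only [pairWave, Pi.smul_apply, Fin.sum_univ_two, wave_smul, smul_eq_mul]
        ring }
    (by
      obtain ⟨K, hK0, hK⟩ := hk.exists_eLpNorm_wave_le t T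
      refine ⟨K, fun F => ?_⟩
      simp only [LinearMap.coe_mk, AddHom.coe_mk]
      rw [Lp.norm_toLp]
      exact ENNReal.toReal_le_of_le_ofReal (by positivity) (hK t le_rfl F).2)

theorem coeFn_waveState (hk : IsKernelPair Q k) {T : ℝ} (t : ℝ) (F : Controls T) :
    hk.waveState T t F =ᵐ[volume] fun x => pairWave k (controlFun F) x t :=
  (hk.memLp_wave F t).coeFn_toLp

theorem coeFn_waveState_of_ae (hk : IsKernelPair Q k) {T : ℝ} (t : ℝ) {F : Controls T}
    {f : Fin 2 → ℝ → ℝ} (hF : ∀ i, controlFun F i =ᵐ[volume] f i) :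
    hk.waveState T t F =ᵐ[volume] fun x => pairWave k f x t :=
  (hk.coeFn_waveState t F).trans (pairWave_congr_ae k hF t)

theorem exists_norm_waveState_le (hk : IsKernelPair Q k) (S T : ℝ) :
    ∃ K, 0 ≤ K ∧ ∀ t ≤ S, ∀ F : Controls T, ‖hk.waveState T t F‖ ≤ K * ‖F‖ := by
  obtain ⟨K, hK0, hK⟩ := hk.exists_eLpNorm_wave_le S T
  refine ⟨K, hK0, fun t ht F => ?_⟩
  rw [show hk.waveState T t F = (hk.memLp_wave F t).toLp _ from rfl, Lp.norm_toLp]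
  exact ENNReal.toReal_le_of_le_ofReal (by positivity) (hK t ht F).2

theorem waveState_eq_zero_of_abs_ge (hk : IsKernelPair Q k) {T : ℝ} (t : ℝ) (F : Controls T) :
    ∀ᵐ x, t ≤ |x| → hk.waveState T t F x = 0 := by
  filter_upwards [hk.coeFn_waveState t F] with x hx h
  rw [hx, hk.wave_eq_zero (causal_controlFun F) h]

theorem abs_wave_sub_le (hk : IsKernelPair Q k) {f : Fin 2 → ℝ → ℝ}
    (hf : ∀ i, SmoothCausal (f i)) {S B : ℝ}
    (hB : ∀ x t, t ≤ S → |pairWave k (pairDeriv f) x t| ≤ B) (x : ℝ) {s t : ℝ} (hs : s ≤ S)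
    (ht : t ≤ S) : |pairWave k f x s - pairWave k f x t| ≤ B * |s - t| :=
  (convex_Iic S).norm_image_sub_le_of_norm_hasDerivWithin_le (f := fun t => pairWave k f x t)
    (fun u _ => (hk.hasDerivAt_wave_time hf x u).hasDerivWithinAt) (fun u hu => hB x u hu) ht hs

/-- For smooth controls the state is Lipschitz in time, with support in a fixed compact set. In
general it is a uniform limit of such functions, by density and the uniform operator bound. -/
theorem continuousOn_waveState (hk : IsKernelPair Q k) {T : ℝ} (F : Controls T) (S : ℝ) :
    ContinuousOn (fun t => hk.waveState T t F) (Iic S) := by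
  obtain ⟨K, hK0, hK⟩ := hk.exists_norm_waveState_le S T
  have smooth : ∀ G ∈ smoothControls T, ContinuousOn (fun t => hk.waveState T t G) (Iic S) := by
    rintro G ⟨g, hg, hG⟩
    obtain ⟨B, hB0, hB⟩ := hk.exists_bound_wave (pairDeriv_smooth hg.smoothCausal) S
    set H : ℝ → ℝ := indicator (Icc (-S) S) fun _ => 1 with hH
    have hHm : MemLp H 2 := memLp_indicator_const 2 measurableSet_Icc 1 (Or.inr
      measure_Icc_lt_top.ne)
    have hlip : LipschitzOnWith (Real.toNNReal (B * ‖hHm.toLp H‖))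
        (fun t => hk.waveState T t G) (Iic S) := by
      refine LipschitzOnWith.of_dist_le_mul fun s hs t ht => ?_
      rw [dist_eq_norm, Real.dist_eq, Real.coe_toNNReal _ (by positivity)]
      have h := Lp.norm_le_mul_norm_of_ae_le_mul (c := B * |s - t|)
        (f := hk.waveState T s G - hk.waveState T t G) (g := hHm.toLp H) (by
          filter_upwards [Lp.coeFn_sub (hk.waveState T s G) (hk.waveState T t G),
            hk.coeFn_waveState_of_ae s hG, hk.coeFn_waveState_of_ae t hG, hHm.coeFn_toLp]
            with x h1 h2 h3 h4
          rw [h1, Pi.sub_apply, h2, h3, h4]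
          by_cases hx : x ∈ Icc (-S) S
          · rw [hH, indicator_of_mem hx, norm_one, mul_one]
            exact hk.abs_wave_sub_le hg.smoothCausal hB x hs ht
          · have hx' : S ≤ |x| := by
              by_contra hcon
              exact hx (abs_le.1 (not_le.1 hcon).le)
            rw [hk.wave_eq_zero (fun i => (hg.smoothCausal i).causal) (le_trans hs hx'),
              hk.wave_eq_zero (fun i => (hg.smoothCausal i).causal) (le_trans ht hx')]
            simp only [sub_zero, norm_zero]
            positivity)
      linarith
    exact hlip.continuousOn
  refine continuousOn_of_uniform_approx_of_continuousOn fun u hu => ?_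
  obtain ⟨ε, hε, hεu⟩ := Metric.mem_uniformity_dist.1 hu
  obtain ⟨G, hG, hFG⟩ := Metric.dense_iff.1 (dense_smoothControls T) F (ε / (K + 1))
    (by positivity)
  refine ⟨fun t => hk.waveState T t G, smooth G hFG, fun t ht => hεu ?_⟩
  rw [dist_eq_norm, ← map_sub]
  refine (hK t ht _).trans_lt ?_
  have h1 : ‖F - G‖ < ε / (K + 1) := by
    rw [← dist_eq_norm, dist_comm]
    exact hG
  have h2 : ‖F - G‖ * (K + 1) < ε := (lt_div_iff₀ (by positivity)).1 h1
  nlinarith [norm_nonneg (F - G)]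

end IsKernelPair

/-! ### Test functions -/

/-- The admissible test functions. -/
structure IsTest (T : ℝ) (φ : ℝ → ℝ → ℝ) : Prop where
  contDiff : ContDiff ℝ ∞ fun p : ℝ × ℝ => φ p.1 p.2
  compact : HasCompactSupport fun p : ℝ × ℝ => φ p.1 p.2
  support : tsupport (fun p : ℝ × ℝ => φ p.1 p.2) ⊆ {p | p.2 < T}

/-- The space derivative of a function of two variables. -/
def dx (φ : ℝ → ℝ → ℝ) (x t : ℝ) : ℝ := deriv (fun ξ => φ ξ t) x

/-- The time derivative of a function of two variables. -/
def dt (φ : ℝ → ℝ → ℝ) (x t : ℝ) : ℝ := deriv (fun τ => φ x τ) t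

/-- The second space derivative of a function of two variables. -/
def dxx (φ : ℝ → ℝ → ℝ) (x t : ℝ) : ℝ := iteratedDeriv 2 (fun ξ => φ ξ t) x

/-- The second time derivative of a function of two variables. -/
def dtt (φ : ℝ → ℝ → ℝ) (x t : ℝ) : ℝ := iteratedDeriv 2 (fun τ => φ x τ) t

theorem iteratedDeriv_sub_eq (φ : ℝ → ℝ → ℝ) (x t : ℝ) :
    iteratedDeriv 2 (fun τ => φ x τ) t - iteratedDeriv 2 (fun ξ => φ ξ t) x
      = dtt φ x t - dxx φ x t := rfl

section Slices

variable {φ : ℝ → ℝ → ℝ}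

theorem hasDerivAt_line (hφ : ContDiff ℝ ∞ fun p : ℝ × ℝ => φ p.1 p.2) {γ : ℝ → ℝ × ℝ}
    {w : ℝ × ℝ} (hγ : ∀ s, HasDerivAt γ w s) (s : ℝ) :
    HasDerivAt (fun s => φ (γ s).1 (γ s).2)
      (fderiv ℝ (fun p : ℝ × ℝ => φ p.1 p.2) (γ s) w) s :=
  ((hφ.differentiable (by simp)) (γ s)).hasFDerivAt.comp_hasDerivAt s (hγ s)

theorem contDiff_fderiv (hφ : ContDiff ℝ ∞ fun p : ℝ × ℝ => φ p.1 p.2) :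
    ContDiff ℝ ∞ (fderiv ℝ fun p : ℝ × ℝ => φ p.1 p.2) :=
  hφ.fderiv_right (by simp)

theorem hasDerivAt_fderiv_line (hφ : ContDiff ℝ ∞ fun p : ℝ × ℝ => φ p.1 p.2) {γ : ℝ → ℝ × ℝ}
    {w : ℝ × ℝ} (hγ : ∀ s, HasDerivAt γ w s) (v : ℝ × ℝ) (s : ℝ) :
    HasDerivAt (fun s => fderiv ℝ (fun p : ℝ × ℝ => φ p.1 p.2) (γ s) v)
      (fderiv ℝ (fderiv ℝ fun p : ℝ × ℝ => φ p.1 p.2) (γ s) w v) s := by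
  have h := (((contDiff_fderiv hφ).differentiable (by simp)) (γ s)).hasFDerivAt.comp_hasDerivAt s
    (hγ s)
  simpa using h.clm_apply (hasDerivAt_const s v)

theorem hasDerivAt_prodMk_right (x s : ℝ) : HasDerivAt (fun s : ℝ => (x, s)) ((0 : ℝ), (1 : ℝ)) s :=
  (hasDerivAt_const s x).prodMk (hasDerivAt_id s)

theorem hasDerivAt_prodMk_left (t s : ℝ) : HasDerivAt (fun s : ℝ => (s, t)) ((1 : ℝ), (0 : ℝ)) s :=
  (hasDerivAt_id s).prodMk (hasDerivAt_const s t)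

theorem dt_eq (hφ : ContDiff ℝ ∞ fun p : ℝ × ℝ => φ p.1 p.2) (x t : ℝ) :
    dt φ x t = fderiv ℝ (fun p : ℝ × ℝ => φ p.1 p.2) (x, t) (0, 1) :=
  (hasDerivAt_line hφ (hasDerivAt_prodMk_right x) t).deriv

theorem dx_eq (hφ : ContDiff ℝ ∞ fun p : ℝ × ℝ => φ p.1 p.2) (x t : ℝ) :
    dx φ x t = fderiv ℝ (fun p : ℝ × ℝ => φ p.1 p.2) (x, t) (1, 0) :=
  (hasDerivAt_line hφ (hasDerivAt_prodMk_left t) x).deriv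

theorem dtt_eq (hφ : ContDiff ℝ ∞ fun p : ℝ × ℝ => φ p.1 p.2) (x t : ℝ) :
    dtt φ x t = fderiv ℝ (fderiv ℝ fun p : ℝ × ℝ => φ p.1 p.2) (x, t) (0, 1) (0, 1) := by
  have h1 : deriv (fun τ => φ x τ) = fun τ => fderiv ℝ (fun p : ℝ × ℝ => φ p.1 p.2) (x, τ) (0, 1) :=
    funext fun τ => dt_eq hφ x τ
  rw [dtt, iteratedDeriv_succ, iteratedDeriv_one, h1,
    (hasDerivAt_fderiv_line hφ (hasDerivAt_prodMk_right x) (0, 1) t).deriv]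

theorem dxx_eq (hφ : ContDiff ℝ ∞ fun p : ℝ × ℝ => φ p.1 p.2) (x t : ℝ) :
    dxx φ x t = fderiv ℝ (fderiv ℝ fun p : ℝ × ℝ => φ p.1 p.2) (x, t) (1, 0) (1, 0) := by
  have h2 : deriv (fun ξ => φ ξ t) = fun ξ => fderiv ℝ (fun p : ℝ × ℝ => φ p.1 p.2) (ξ, t) (1, 0) :=
    funext fun ξ => dx_eq hφ ξ t
  rw [dxx, iteratedDeriv_succ, iteratedDeriv_one, h2,
    (hasDerivAt_fderiv_line hφ (hasDerivAt_prodMk_left t) (1, 0) x).deriv]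

attribute [irreducible] dtt dxx

theorem hasDerivAt_dt (hφ : ContDiff ℝ ∞ fun p : ℝ × ℝ => φ p.1 p.2) (x t : ℝ) :
    HasDerivAt (φ x) (dt φ x t) t := by
  rw [dt_eq hφ]
  exact hasDerivAt_line hφ (hasDerivAt_prodMk_right x) t

theorem hasDerivAt_dx (hφ : ContDiff ℝ ∞ fun p : ℝ × ℝ => φ p.1 p.2) (x t : ℝ) :
    HasDerivAt (fun x => φ x t) (dx φ x t) x := by
  rw [dx_eq hφ]
  exact hasDerivAt_line hφ (hasDerivAt_prodMk_left t) x

theorem hasDerivAt_dtt (hφ : ContDiff ℝ ∞ fun p : ℝ × ℝ => φ p.1 p.2) (x t : ℝ) :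
    HasDerivAt (dt φ x) (dtt φ x t) t := by
  rw [dtt_eq hφ, show dt φ x = _ from funext fun t => dt_eq hφ x t]
  exact hasDerivAt_fderiv_line hφ (hasDerivAt_prodMk_right x) (0, 1) t

theorem hasDerivAt_dxx (hφ : ContDiff ℝ ∞ fun p : ℝ × ℝ => φ p.1 p.2) (x t : ℝ) :
    HasDerivAt (fun x => dx φ x t) (dxx φ x t) x := by
  rw [dxx_eq hφ, show (fun x => dx φ x t) = _ from funext fun x => dx_eq hφ x t]
  exact hasDerivAt_fderiv_line hφ (hasDerivAt_prodMk_left t) (1, 0) x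

theorem continuous_dt (hφ : ContDiff ℝ ∞ fun p : ℝ × ℝ => φ p.1 p.2) :
    Continuous fun p : ℝ × ℝ => dt φ p.1 p.2 := by
  simp only [dt_eq hφ]
  exact (contDiff_fderiv hφ).continuous.clm_apply continuous_const

theorem continuous_dx (hφ : ContDiff ℝ ∞ fun p : ℝ × ℝ => φ p.1 p.2) :
    Continuous fun p : ℝ × ℝ => dx φ p.1 p.2 := by
  simp only [dx_eq hφ]
  exact (contDiff_fderiv hφ).continuous.clm_apply continuous_const

theorem continuous_dtt (hφ : ContDiff ℝ ∞ fun p : ℝ × ℝ => φ p.1 p.2) :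
    Continuous fun p : ℝ × ℝ => dtt φ p.1 p.2 := by
  simp only [dtt_eq hφ]
  exact (((contDiff_fderiv hφ).continuous_fderiv (by simp)).clm_apply
    continuous_const).clm_apply continuous_const

theorem continuous_dxx (hφ : ContDiff ℝ ∞ fun p : ℝ × ℝ => φ p.1 p.2) :
    Continuous fun p : ℝ × ℝ => dxx φ p.1 p.2 := by
  simp only [dxx_eq hφ]
  exact (((contDiff_fderiv hφ).continuous_fderiv (by simp)).clm_apply
    continuous_const).clm_apply continuous_const

end Slices

namespace IsTest

variable {T : ℝ} {φ : ℝ → ℝ → ℝ}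

theorem eventually_zero (hφ : IsTest T φ) {x t : ℝ} (ht : T ≤ t) :
    (fun p : ℝ × ℝ => φ p.1 p.2) =ᶠ[𝓝 (x, t)] 0 :=
  notMem_tsupport_iff_eventuallyEq.1 fun h => absurd (hφ.support h) (not_lt.2 ht)

theorem eq_zero (hφ : IsTest T φ) (x : ℝ) {t : ℝ} (ht : T ≤ t) : φ x t = 0 :=
  (hφ.eventually_zero ht).self_of_nhds

theorem dt_eq_zero (hφ : IsTest T φ) (x : ℝ) {t : ℝ} (ht : T ≤ t) : dt φ x t = 0 := by
  rw [dt_eq hφ.contDiff, (hφ.eventually_zero ht).fderiv_eq]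
  simp

theorem exists_bound (hφ : IsTest T φ) : ∃ C, 0 ≤ C ∧ ∀ x t, |φ x t| ≤ C := by
  obtain ⟨C, hC⟩ := hφ.compact.exists_bound_of_continuous hφ.contDiff.continuous
  exact ⟨C, (norm_nonneg _).trans (hC 0), fun x t => hC (x, t)⟩

theorem hasCompactSupport_fderiv_two (hφ : IsTest T φ) : HasCompactSupport
    (fderiv ℝ (fderiv ℝ fun p : ℝ × ℝ => φ p.1 p.2)) :=
  (hφ.compact.fderiv (𝕜 := ℝ)).fderiv (𝕜 := ℝ)

theorem hasCompactSupport_dtt (hφ : IsTest T φ) :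
    HasCompactSupport fun p : ℝ × ℝ => dtt φ p.1 p.2 := by
  simp only [dtt_eq hφ.contDiff]
  exact hφ.hasCompactSupport_fderiv_two.comp_left (g := fun L => L (0, 1) (0, 1)) rfl

theorem hasCompactSupport_dxx (hφ : IsTest T φ) :
    HasCompactSupport fun p : ℝ × ℝ => dxx φ p.1 p.2 := by
  simp only [dxx_eq hφ.contDiff]
  exact hφ.hasCompactSupport_fderiv_two.comp_left (g := fun L => L (1, 0) (1, 0)) rfl

theorem exists_bound_dtt (hφ : IsTest T φ) : ∃ C, 0 ≤ C ∧ ∀ x t, |dtt φ x t| ≤ C := by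
  obtain ⟨C, hC⟩ := hφ.hasCompactSupport_dtt.exists_bound_of_continuous
    (continuous_dtt hφ.contDiff)
  simp only [Real.norm_eq_abs] at hC
  exact ⟨C, (abs_nonneg _).trans (hC (0, 0)), fun x t => hC (x, t)⟩

theorem isMultiplier (hφ : IsTest T φ) : IsMultiplier T φ (dt φ) (dtt φ) (dx φ) (dxx φ)
    (φ 0) (φ 0) (dx φ 0) (dx φ 0) := by
  have c0 := hφ.contDiff.continuous
  have c1 := continuous_dx hφ.contDiff
  have c2 := continuous_dtt hφ.contDiff
  have c3 := continuous_dxx hφ.contDiff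
  have line : ∀ {g : ℝ → ℝ → ℝ}, (Continuous fun p : ℝ × ℝ => g p.1 p.2) → ∀ t,
      Continuous fun x => g x t := fun hg t =>
    hg.comp (by fun_prop : Continuous fun x : ℝ => (x, t))
  obtain ⟨C, hC0, hC⟩ := hφ.exists_bound
  obtain ⟨D, hD0, hD⟩ := hφ.exists_bound_dtt
  exact
  { time := hasDerivAt_dt hφ.contDiff
    time_two := hasDerivAt_dtt hφ.contDiff
    continuous := fun x => c2.comp (by fun_prop : Continuous fun t : ℝ => (x, t))
    measurable := c0.measurable
    measurable_two := c2.measurable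
    bound := ⟨max C D, le_max_of_le_left hC0, fun x t _ =>
      ⟨(hC x t).trans (le_max_left _ _), (hD x t).trans (le_max_right _ _)⟩⟩
    space := fun t _ x _ _ => hasDerivAt_dx hφ.contDiff x t
    space_two := fun t _ x _ _ => hasDerivAt_dxx hφ.contDiff x t
    integrable := fun t _ =>
      ((line c3 t).continuousOn.integrableOn_Icc).mono_set Ioo_subset_Icc_self
    right := fun t _ => ((line c0 t).tendsto 0).mono_left nhdsWithin_le_nhds
    left := fun t _ => ((line c0 t).tendsto 0).mono_left nhdsWithin_le_nhds
    slope_right := fun t _ => ((line c1 t).tendsto 0).mono_left nhdsWithin_le_nhds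
    slope_left := fun t _ => ((line c1 t).tendsto 0).mono_left nhdsWithin_le_nhds }

end IsTest

/-! ### Pairings with a continuous family of states -/

theorem integral_mul_eq_inner {g : ℝ → ℝ} (hg : MemLp g 2) (z : Lp ℝ 2 (volume : Measure ℝ)) :
    ∫ x, z x * g x = ⟪hg.toLp g, z⟫ := by
  rw [L2.inner_def]
  refine integral_congr_ae ?_
  filter_upwards [hg.coeFn_toLp] with x hx
  simp [hx]

theorem abs_integral_mul_le {g w : ℝ → ℝ} (hg : AEStronglyMeasurable g) (hw : MemLp w 2) {C : ℝ}
    (h : ∀ x, |g x| ≤ C * |w x|) (z : Lp ℝ 2 (volume : Measure ℝ)) :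
    |∫ x, z x * g x| ≤ C * ‖hw.toLp w‖ * ‖z‖ := by
  have hg2 : MemLp g 2 := (hw.const_mul C).of_le hg (Eventually.of_forall fun x => by
    rw [norm_mul]
    exact (h x).trans (mul_le_mul_of_nonneg_right (le_abs_self C) (abs_nonneg _)))
  rw [integral_mul_eq_inner hg2]
  refine (abs_real_inner_le_norm _ _).trans (mul_le_mul_of_nonneg_right ?_ (norm_nonneg _))
  refine Lp.norm_le_mul_norm_of_ae_le_mul ?_
  filter_upwards [hg2.coeFn_toLp, hw.coeFn_toLp] with x h1 h2
  rw [h1, h2]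
  exact h x

theorem memLp_mul_bounded {w ψ : ℝ → ℝ} (hw : MemLp w 2) (hψ : AEStronglyMeasurable ψ) {C : ℝ}
    (h : ∀ x, |ψ x| ≤ C) : MemLp (fun x => w x * ψ x) 2 :=
  (hw.const_mul C).of_le (hw.1.mul hψ) (Eventually.of_forall fun x => by
    rw [norm_mul, norm_mul, mul_comm]
    exact mul_le_mul_of_nonneg_right ((h x).trans (le_abs_self C)) (norm_nonneg _))

/-- The change of the state is handled by Cauchy–Schwarz, and the change of `ψ`, with the state
frozen at `t₀`, by dominated convergence. Merely square integrable weights `w` are allowed so that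
`w` can be the potential. -/
theorem continuousOn_pairing {s : Set ℝ} {z : ℝ → Lp ℝ 2 (volume : Measure ℝ)}
    (hz : ContinuousOn z s) {w : ℝ → ℝ} (hw : MemLp w 2) {ψ : ℝ → ℝ → ℝ}
    (hψ : Continuous fun p : ℝ × ℝ => ψ p.1 p.2) {C : ℝ} (hC : ∀ t ∈ s, ∀ x, |ψ x t| ≤ C) :
    ContinuousOn (fun t => ∫ x, z t x * (w x * ψ x t)) s := by
  intro t₀ ht₀
  have hm : ∀ t, AEStronglyMeasurable fun x => ψ x t := fun t =>
    (hψ.comp (by fun_prop : Continuous fun x : ℝ => (x, t))).aestronglyMeasurable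
  have h1 : ContinuousWithinAt (fun t => ∫ x, z t₀ x * (w x * ψ x t)) s t₀ := by
    refine continuousWithinAt_of_dominated (bound := fun x => C * |z t₀ x * w x|)
      (Eventually.of_forall fun t => (Lp.aestronglyMeasurable (z t₀)).mul (hw.1.mul (hm t))) ?_
      (((Lp.memLp (z t₀)).integrable_mul hw).abs.const_mul C) ?_
    · filter_upwards [self_mem_nhdsWithin] with t ht
      refine Eventually.of_forall fun x => ?_
      rw [← mul_assoc, norm_mul, mul_comm]
      exact mul_le_mul_of_nonneg_right (hC t ht x) (norm_nonneg _)
    · refine Eventually.of_forall fun x => Continuous.continuousWithinAt ?_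
      have : Continuous fun t => ψ x t := hψ.comp (by fun_prop : Continuous fun t : ℝ => (x, t))
      fun_prop
  have h2 : Tendsto (fun t => ∫ x, (z t - z t₀) x * (w x * ψ x t)) (𝓝[s] t₀) (𝓝 0) := by
    have hlim : Tendsto (fun t => C * ‖hw.toLp w‖ * ‖z t - z t₀‖) (𝓝[s] t₀) (𝓝 0) := by
      have h3 : ContinuousWithinAt (fun t => C * ‖hw.toLp w‖ * ‖z t - z t₀‖) s t₀ :=
        continuousWithinAt_const.mul ((hz t₀ ht₀).sub continuousWithinAt_const).norm
      simpa using h3.tendsto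
    refine squeeze_zero_norm' ?_ hlim
    filter_upwards [self_mem_nhdsWithin] with t ht
    refine abs_integral_mul_le (hw.1.mul (hm t)) hw (fun x => ?_) _
    rw [Pi.mul_apply, abs_mul, mul_comm]
    exact mul_le_mul_of_nonneg_right (hC t ht x) (abs_nonneg _)
  have h3 := h2.add h1.tendsto
  rw [zero_add] at h3
  refine Tendsto.congr' ?_ h3
  filter_upwards [self_mem_nhdsWithin] with t ht
  have hi : ∀ u, Integrable fun x => z u x * (w x * ψ x t) := fun u =>
    (Lp.memLp (z u)).integrable_mul (memLp_mul_bounded hw (hm t) (hC t ht))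
  have hs : ∫ x, (z t - z t₀) x * (w x * ψ x t)
      = (∫ x, z t x * (w x * ψ x t)) - ∫ x, z t₀ x * (w x * ψ x t) := by
    rw [← integral_sub (hi t) (hi t₀)]
    refine integral_congr_ae ?_
    filter_upwards [Lp.coeFn_sub (z t) (z t₀)] with x hx
    rw [hx, Pi.sub_apply, sub_mul]
  rw [hs, sub_add_cancel]

/-! ### Controls given by functions -/

theorem memLp_pair {T : ℝ} {g : Fin 2 → ℝ → ℝ}
    (hg : ∀ i, MemLp (g i) 2 (volume.restrict (Ioo 0 T))) :
    MemLp (fun s => WithLp.toLp 2 fun i => g i s : ℝ → EuclideanSpace ℝ (Fin 2)) 2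
      (volume.restrict (Ioo 0 T)) :=
  (memLp_pi_iff.2 hg).continuousLinearMap_comp
    ((EuclideanSpace.equiv (Fin 2) ℝ).symm : (Fin 2 → ℝ) →L[ℝ] EuclideanSpace ℝ (Fin 2))

theorem memLp_of_continuousOn_Icc {T : ℝ} {g : ℝ → ℝ} (hg : ContinuousOn g (Icc 0 T)) :
    MemLp g 2 (volume.restrict (Ioo 0 T)) := by
  obtain ⟨C, hC⟩ := isCompact_Icc.exists_bound_of_continuousOn hg
  refine MemLp.of_bound ((hg.mono Ioo_subset_Icc_self).aestronglyMeasurable measurableSet_Ioo) C ?_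
  filter_upwards [ae_restrict_mem measurableSet_Ioo] with s hs using hC s (Ioo_subset_Icc_self hs)

theorem inner_toLp_pair {T : ℝ} (hT : 0 ≤ T) {g : Fin 2 → ℝ → ℝ}
    (hg : ∀ i, MemLp (g i) 2 (volume.restrict (Ioo 0 T))) (F : Controls T) :
    ⟪F, (memLp_pair hg).toLp _⟫ = ∫ t in (0 : ℝ)..T, (F t 0 * g 0 t + F t 1 * g 1 t) := by
  rw [L2.inner_def, intervalIntegral.integral_of_le hT, integral_Ioc_eq_integral_Ioo]
  refine integral_congr_ae ?_
  filter_upwards [(memLp_pair hg).coeFn_toLp] with s hs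
  rw [hs]
  simp [PiLp.inner_apply, Fin.sum_univ_two, mul_comm]

theorem intervalIntegral_control {T : ℝ} (hT : 0 ≤ T) {F : Controls T} {f : Fin 2 → ℝ → ℝ}
    (hF : ∀ i, controlFun F i =ᵐ[volume] f i) (g : Fin 2 → ℝ → ℝ) :
    ∫ t in (0 : ℝ)..T, (F t 0 * g 0 t + F t 1 * g 1 t)
      = ∫ t in (0 : ℝ)..T, (f 0 t * g 0 t + f 1 t * g 1 t) := by
  rw [intervalIntegral.integral_of_le hT, intervalIntegral.integral_of_le hT,
    integral_Ioc_eq_integral_Ioo, integral_Ioc_eq_integral_Ioo]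
  refine integral_congr_ae ?_
  filter_upwards [ae_restrict_mem measurableSet_Ioo, ae_restrict_of_ae (hF 0),
    ae_restrict_of_ae (hF 1)] with s hs h0 h1
  rw [← h0, ← h1, controlFun_eq_of_mem F 0 hs, controlFun_eq_of_mem F 1 hs]

/-! ### Existence of the generalized solution -/

section Existence

variable {Q : ℝ → ℝ} {k : Fin 2 → ℝ → ℝ → ℝ} {T : ℝ} {φ : ℝ → ℝ → ℝ}

/-- The wave equation applied to a test function. -/
def waveOp (Q : ℝ → ℝ) (φ : ℝ → ℝ → ℝ) (x t : ℝ) : ℝ := dtt φ x t - dxx φ x t + Q x * φ x t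

theorem IsTest.exists_radius (hφ : IsTest T φ) : ∃ R, 0 ≤ R ∧ ∀ x t, x ∉ Icc (-R) R →
    dtt φ x t - dxx φ x t = 0 := by
  have h : HasCompactSupport fun p : ℝ × ℝ => dtt φ p.1 p.2 - dxx φ p.1 p.2 :=
    hφ.hasCompactSupport_dtt.sub hφ.hasCompactSupport_dxx
  obtain ⟨R, hR⟩ := h.isCompact.isBounded.subset_closedBall 0
  refine ⟨max R 0, le_max_right _ _, fun x t hx => ?_⟩
  by_contra hcon
  refine hx ?_
  have h1 := hR (subset_tsupport _ (show (x, t) ∈ Function.support fun p : ℝ × ℝ =>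
    dtt φ p.1 p.2 - dxx φ p.1 p.2 from hcon))
  rw [mem_closedBall_zero_iff] at h1
  have h2 : |x| ≤ R := (norm_fst_le (x, t)).trans h1
  exact abs_le.1 (h2.trans (le_max_left _ _))

/-- The wave operator on a test function is a sum of two bounded continuous multiples of square
integrable weights. -/
theorem IsTest.exists_waveOp_eq (hφ : IsTest T φ) :
    ∃ (w : ℝ → ℝ) (ψ : ℝ → ℝ → ℝ) (C : ℝ), MemLp w 2 ∧ (Continuous fun p : ℝ × ℝ => ψ p.1 p.2) ∧
      (∀ x t, |ψ x t| ≤ C) ∧ (∀ x t, |φ x t| ≤ C) ∧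
      ∀ x t, waveOp Q φ x t = w x * ψ x t + Q x * φ x t := by
  obtain ⟨R, hR0, hR⟩ := hφ.exists_radius
  have h : HasCompactSupport fun p : ℝ × ℝ => dtt φ p.1 p.2 - dxx φ p.1 p.2 :=
    hφ.hasCompactSupport_dtt.sub hφ.hasCompactSupport_dxx
  have hc : Continuous fun p : ℝ × ℝ => dtt φ p.1 p.2 - dxx φ p.1 p.2 :=
    (continuous_dtt hφ.contDiff).sub (continuous_dxx hφ.contDiff)
  obtain ⟨C, hC⟩ := h.exists_bound_of_continuous hc
  obtain ⟨D, hD0, hD⟩ := hφ.exists_bound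
  refine ⟨indicator (Icc (-R) R) fun _ => 1, fun x t => dtt φ x t - dxx φ x t, max C D,
    memLp_indicator_const 2 measurableSet_Icc 1 (Or.inr measure_Icc_lt_top.ne), hc,
    fun x t => (hC (x, t)).trans (le_max_left _ _), fun x t => (hD x t).trans (le_max_right _ _),
    fun x t => ?_⟩
  rw [waveOp]
  by_cases hx : x ∈ Icc (-R) R
  · rw [indicator_of_mem hx, one_mul]
  · rw [hR x t hx, indicator_of_notMem hx, zero_mul]

theorem IsTest.memLp_waveOp (hφ : IsTest T φ) (hQ2 : MemLp Q 2) (t : ℝ) :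
    MemLp (fun x => waveOp Q φ x t) 2 := by
  obtain ⟨w, ψ, C, hw, hψ, hψC, hφC, he⟩ := hφ.exists_waveOp_eq (Q := Q)
  simp only [he]
  have hl : Continuous fun x : ℝ => (x, t) := by fun_prop
  exact (memLp_mul_bounded hw (hψ.comp hl).aestronglyMeasurable fun x => hψC x t).add
    (memLp_mul_bounded hQ2 (hφ.contDiff.continuous.comp hl).aestronglyMeasurable fun x => hφC x t)

theorem IsTest.continuousOn_pairing (hφ : IsTest T φ) (hQ2 : MemLp Q 2) {s : Set ℝ}
    {z : ℝ → Lp ℝ 2 (volume : Measure ℝ)} (hz : ContinuousOn z s) :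
    ContinuousOn (fun t => ∫ x, z t x * waveOp Q φ x t) s := by
  obtain ⟨w, ψ, C, hw, hψ, hψC, hφC, he⟩ := hφ.exists_waveOp_eq (Q := Q)
  refine ((KreinPeriodic.continuousOn_pairing hz hw hψ fun t _ x => hψC x t).add
    (KreinPeriodic.continuousOn_pairing hz hQ2 hφ.contDiff.continuous fun t _ x => hφC x t)).congr
    fun t _ => ?_
  have hl : Continuous fun x : ℝ => (x, t) := by fun_prop
  rw [Pi.add_apply, ← integral_add]
  · refine integral_congr_ae (Eventually.of_forall fun x => ?_)
    simp only [he]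
    ring
  · exact (Lp.memLp (z t)).integrable_mul
      (memLp_mul_bounded hw (hψ.comp hl).aestronglyMeasurable fun x => hψC x t)
  · exact (Lp.memLp (z t)).integrable_mul (memLp_mul_bounded hQ2
      (hφ.contDiff.continuous.comp hl).aestronglyMeasurable fun x => hφC x t)

theorem IsTest.exists_pairing_le (hφ : IsTest T φ) (hQ2 : MemLp Q 2) :
    ∃ M, 0 ≤ M ∧ ∀ (z : Lp ℝ 2 (volume : Measure ℝ)) (t : ℝ),
      |∫ x, z x * waveOp Q φ x t| ≤ M * ‖z‖ := by
  obtain ⟨w, ψ, C, hw, hψ, hψC, hφC, he⟩ := hφ.exists_waveOp_eq (Q := Q)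
  have hC0 : 0 ≤ C := (abs_nonneg _).trans (hφC 0 0)
  refine ⟨C * ‖(hw.norm.add hQ2.norm).toLp _‖, by positivity, fun z t => ?_⟩
  refine abs_integral_mul_le (hφ.memLp_waveOp hQ2 t).1 (hw.norm.add hQ2.norm) (fun x => ?_) z
  rw [he, Pi.add_apply, abs_of_nonneg (add_nonneg (norm_nonneg _) (norm_nonneg _)), mul_add]
  refine (abs_add_le _ _).trans (add_le_add ?_ ?_)
  · rw [abs_mul, mul_comm]
    exact mul_le_mul_of_nonneg_right (hψC x t) (abs_nonneg _)
  · rw [abs_mul, mul_comm]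
    exact mul_le_mul_of_nonneg_right (hφC x t) (abs_nonneg _)

theorem wronskianJump_self (Q : ℝ → ℝ) (k : Fin 2 → ℝ → ℝ → ℝ) {f : Fin 2 → ℝ → ℝ} (a b : ℝ → ℝ) (t : ℝ) :
    wronskianJump Q k f a a b b t = deriv (f 1) t * a t - f 0 t * b t := by
  simp only [wronskianJump, slopeRight, slopeLeft, waveRight, waveLeft, sub_zero, add_zero]
  ring

/-- Green's identity with the test function as multiplier; the terms at `T` drop out since `φ`
vanishes there. The jump term is `f₂' φ - f₁ φ_x`, and integrating `f₂' φ` by parts gives the stated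
right-hand side. -/
theorem IsKernelPair.weak_identity_smooth (hQ : Integrable Q) (hQ2 : MemLp Q 2)
    (hk : IsKernelPair Q k) (hT : 0 < T) (hQc : ∀ x, x ≠ 0 → |x| < T → ContinuousAt Q x)
    (hφ : IsTest T φ) {F : Controls T} (hF : F ∈ smoothControls T) :
    ∫ t in (0 : ℝ)..T, ∫ x, hk.waveState T t F x * waveOp Q φ x t
      = ∫ t in (0 : ℝ)..T, (F t 0 * dx φ 0 t + F t 1 * dt φ 0 t) := by
  obtain ⟨f, hf, hFf⟩ := hF
  have hfs := hf.smoothCausal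
  have h := hk.green hQ hT hQc hfs hφ.isMultiplier
  simp only [hφ.eq_zero _ le_rfl, hφ.dt_eq_zero _ le_rfl, mul_zero, sub_zero, integral_zero] at h
  have c0 : Continuous fun t => φ 0 t :=
    hφ.contDiff.continuous.comp (by fun_prop : Continuous fun t : ℝ => ((0 : ℝ), t))
  have c1 : Continuous fun t => dx φ 0 t :=
    (continuous_dx hφ.contDiff).comp (by fun_prop : Continuous fun t : ℝ => ((0 : ℝ), t))
  have c2 : Continuous fun t => dt φ 0 t :=
    (continuous_dt hφ.contDiff).comp (by fun_prop : Continuous fun t : ℝ => ((0 : ℝ), t))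
  have d0 := (hfs 0).continuous
  have d1 := (hfs 1).continuous
  have d2 := (hfs 1).deriv.continuous
  have hA : ∀ t, ∫ x, hk.waveState T t F x * waveOp Q φ x t
      = ∫ x, pairWave k f x t * (dtt φ x t - dxx φ x t + Q x * φ x t) := fun t =>
    integral_congr_ae (by
      filter_upwards [hk.coeFn_waveState_of_ae t hFf] with x hx
      rw [hx, waveOp])
  have hAi : IntervalIntegrable (fun t => ∫ x, hk.waveState T t F x * waveOp Q φ x t)
      volume 0 T := by
    refine ContinuousOn.intervalIntegrable ?_
    rw [uIcc_of_le hT.le]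
    exact hφ.continuousOn_pairing hQ2 ((hk.continuousOn_waveState F T).mono Icc_subset_Iic_self)
  simp only [← hA, wronskianJump_self Q k] at h
  rw [intervalIntegral.integral_add hAi (Continuous.intervalIntegrable (by fun_prop) _ _),
    eq_comm, add_eq_zero_iff_eq_neg, ← intervalIntegral.integral_neg] at h
  have hc := intervalIntegral_control hT.le hFf ![fun t => dx φ 0 t, fun t => dt φ 0 t]
  simp only [Matrix.cons_val_zero, Matrix.cons_val_one, Matrix.cons_val_fin_one] at hc
  rw [h, hc, ← sub_eq_zero,
    ← intervalIntegral.integral_sub (Continuous.intervalIntegrable (by fun_prop) _ _)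
      (Continuous.intervalIntegrable (by fun_prop) _ _)]
  have hd : ∀ t ∈ uIcc 0 T, HasDerivAt (fun t => -(f 1 t * φ 0 t))
      (-(deriv (f 1) t * φ 0 t - f 0 t * dx φ 0 t)
        - (f 0 t * dx φ 0 t + f 1 t * dt φ 0 t)) t :=
    fun t _ => ((((hfs 1).hasDerivAt t).mul (hasDerivAt_dt hφ.contDiff 0 t)).neg).congr_deriv
      (by ring)
  rw [intervalIntegral.integral_eq_sub_of_hasDerivAt hd (Continuous.intervalIntegrable (by
        fun_prop) _ _), hφ.eq_zero 0 le_rfl, (hfs 1).causal 0 le_rfl]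
  simp

/-- Both sides are continuous in the control: the right one is an inner product, the left one is
Lipschitz by the uniform bound on the states. Density of smooth controls concludes. -/
theorem IsKernelPair.weak_identity (hQ : Integrable Q) (hQ2 : MemLp Q 2)
    (hk : IsKernelPair Q k) (hT : 0 < T) (hQc : ∀ x, x ≠ 0 → |x| < T → ContinuousAt Q x)
    (hφ : IsTest T φ) (F : Controls T) :
    ∫ t in (0 : ℝ)..T, ∫ x, hk.waveState T t F x * waveOp Q φ x t
      = ∫ t in (0 : ℝ)..T, (F t 0 * dx φ 0 t + F t 1 * dt φ 0 t) := by
  have c1 : Continuous fun t => dx φ 0 t :=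
    (continuous_dx hφ.contDiff).comp (by fun_prop : Continuous fun t : ℝ => ((0 : ℝ), t))
  have c2 : Continuous fun t => dt φ 0 t :=
    (continuous_dt hφ.contDiff).comp (by fun_prop : Continuous fun t : ℝ => ((0 : ℝ), t))
  have hg : ∀ i, MemLp ((![fun t => dx φ 0 t, fun t => dt φ 0 t] : Fin 2 → ℝ → ℝ) i) 2
      (volume.restrict (Ioo 0 T)) := by
    intro i
    fin_cases i
    · exact memLp_of_continuousOn_Icc c1.continuousOn
    · exact memLp_of_continuousOn_Icc c2.continuousOn
  have hr : ∀ F : Controls T, ∫ t in (0 : ℝ)..T, (F t 0 * dx φ 0 t + F t 1 * dt φ 0 t)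
      = ⟪F, (memLp_pair hg).toLp _⟫ := fun F => (inner_toLp_pair hT.le hg F).symm
  obtain ⟨M, hM0, hM⟩ := hφ.exists_pairing_le hQ2
  obtain ⟨K, hK0, hK⟩ := hk.exists_norm_waveState_le T T
  have hcont : ∀ F, ContinuousOn (fun t => ∫ x, hk.waveState T t F x * waveOp Q φ x t)
      (Icc 0 T) := fun F =>
    hφ.continuousOn_pairing hQ2 ((hk.continuousOn_waveState F T).mono Icc_subset_Iic_self)
  have hint : ∀ F, IntervalIntegrable (fun t => ∫ x, hk.waveState T t F x * waveOp Q φ x t)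
      volume 0 T := fun F =>
    ContinuousOn.intervalIntegrable (by rw [uIcc_of_le hT.le]; exact hcont F)
  have hl : Continuous fun F : Controls T =>
      ∫ t in (0 : ℝ)..T, ∫ x, hk.waveState T t F x * waveOp Q φ x t := by
    refine (LipschitzWith.of_dist_le_mul (K := Real.toNNReal (M * K * T)) fun F G => ?_).continuous
    rw [Real.dist_eq, dist_eq_norm, Real.coe_toNNReal _ (by positivity),
      ← intervalIntegral.integral_sub (hint F) (hint G), ← Real.norm_eq_abs]
    have h := intervalIntegral.norm_integral_le_of_norm_le_const (a := 0) (b := T)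
      (C := M * (K * ‖F - G‖)) (f := fun t => (∫ x, hk.waveState T t F x * waveOp Q φ x t)
        - ∫ x, hk.waveState T t G x * waveOp Q φ x t) fun t ht => by
      rw [uIoc_of_le hT.le] at ht
      have hi : ∀ F, Integrable fun x => hk.waveState T t F x * waveOp Q φ x t := fun F =>
        (Lp.memLp _).integrable_mul (hφ.memLp_waveOp hQ2 t)
      rw [← integral_sub (hi F) (hi G)]
      have e : ∫ x, (hk.waveState T t F x * waveOp Q φ x t
          - hk.waveState T t G x * waveOp Q φ x t)
          = ∫ x, hk.waveState T t (F - G) x * waveOp Q φ x t := by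
        refine integral_congr_ae ?_
        rw [map_sub]
        filter_upwards [Lp.coeFn_sub (hk.waveState T t F) (hk.waveState T t G)] with x hx
        rw [hx, Pi.sub_apply, sub_mul]
      rw [e]
      exact (hM _ t).trans (mul_le_mul_of_nonneg_left (hK t ht.2 _) hM0)
    rw [sub_zero, abs_of_pos hT] at h
    linarith
  have hr' : Continuous fun F : Controls T =>
      ∫ t in (0 : ℝ)..T, (F t 0 * dx φ 0 t + F t 1 * dt φ 0 t) := by
    simp only [hr]
    exact continuous_id.inner continuous_const
  exact (dense_smoothControls T).induction (P := fun F : Controls T =>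
    ∫ t in (0 : ℝ)..T, ∫ x, hk.waveState T t F x * waveOp Q φ x t
      = ∫ t in (0 : ℝ)..T, (F t 0 * dx φ 0 t + F t 1 * dt φ 0 t))
    (fun F hF => hk.weak_identity_smooth hQ hQ2 hT hQc hφ hF) (isClosed_eq hl hr') F

theorem continuousAt_qTilde {q : ℝ → ℝ} (hq : ContinuousOn q (Ioo 0 (2 * π))) {x : ℝ}
    (hx0 : x ≠ 0) (hx : |x| < 2 * π) : ContinuousAt (qTilde q) x := by
  rw [abs_lt] at hx
  rcases lt_or_gt_of_ne hx0 with h | h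
  · exact continuousAt_qTilde_neg hq ⟨hx.1, h⟩
  · exact continuousAt_qTilde_pos hq ⟨h, hx.2⟩

theorem IsKernelPair.isGeneralizedSolution {q : ℝ → ℝ} (hq : ContinuousOn q (Ioo 0 (2 * π)))
    (hq2 : MemLp q 2 (volume.restrict (Ioo 0 (2 * π)))) (hk : IsKernelPair (qTilde q) k)
    (hT : 0 < T) (hTπ : T ≤ π) (F : Controls T) :
    IsGeneralizedSolution q T F fun t => hk.waveState T t F := by
  refine ⟨(hk.continuousOn_waveState F T).mono Icc_subset_Iic_self, fun φ h1 h2 h3 => ?_⟩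
  have h := hk.weak_identity (integrable_qTilde hq2) (memLp_qTilde hq2) hT
    (fun x hx hxT => continuousAt_qTilde hq hx (by linarith [Real.pi_pos])) ⟨h1, h2, h3⟩ F
  simp only [waveOp, ← iteratedDeriv_sub_eq, dx, dt] at h
  exact h

end Existence

/-! ### A second order identity in the sense of distributions -/

theorem integral_eq_zero_of_hasDerivAt {g g' : ℝ → ℝ} {a b : ℝ} (hg : ∀ t, HasDerivAt g (g' t) t)
    (hg' : Continuous g') (ha : g a = 0) (hb : g b = 0) : ∫ t in a..b, g' t = 0 := by
  rw [intervalIntegral.integral_eq_sub_of_hasDerivAt (fun t _ => hg t)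
    (hg'.intervalIntegrable _ _), ha, hb, sub_zero]

/-- Every smooth function with compact support in `(0, T)` is on that interval the second derivative
of a smooth function which vanishes near `T`. -/
theorem exists_second_primitive {T : ℝ} {θ : ℝ → ℝ} (h1 : ContDiff ℝ ∞ θ)
    (h3 : tsupport θ ⊆ Ioo 0 T) :
    ∃ χ : ℝ → ℝ, ContDiff ℝ ∞ χ ∧ (∃ a b, b < T ∧ ∀ t ∉ Icc a b, χ t = 0) ∧
      ∀ t ∈ Ioo 0 T, deriv (deriv χ) t = θ t := by
  have hT : T ∈ (tsupport θ)ᶜ := fun h => absurd (h3 h).2 (lt_irrefl T)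
  obtain ⟨δ, hδ, hball⟩ := Metric.isOpen_iff.1 (isClosed_tsupport θ).isOpen_compl T hT
  have hθ0 : ∀ t, T - δ < t → θ t = 0 := by
    intro t ht
    refine image_eq_zero_of_notMem_tsupport fun hmem => ?_
    refine hball (?_ : t ∈ Metric.ball T δ) hmem
    rw [Metric.mem_ball, Real.dist_eq, abs_lt]
    constructor <;> linarith [(h3 hmem).2]
  -- Read backwards from `T` the function is causal and even vanishes on an initial interval, so two
  -- primitives from `0` vanish near `T`. The factor `smoothTransition (t + 1)` is `1` for `t ≥ 0`
  -- and `0` for `t ≤ -1`; it cuts the result off without changing it on `(0, T)`.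
  have hs : SmoothCausal fun s => θ (T - s) := by
    refine ⟨h1.comp (contDiff_const.sub contDiff_id), fun s hs => hθ0 _ (by linarith)⟩
  have hp := hs.primitive
  have hpp := hp.primitive
  set P : ℝ → ℝ := fun t => ∫ s in (0 : ℝ)..t, θ (T - s) with hP
  set W : ℝ → ℝ := fun t => ∫ s in (0 : ℝ)..t, P s with hW
  have hP0 : ∀ u ≤ δ, P u = 0 := fun u hu =>
    integral_zero_of_support hδ.le (fun s hs => hθ0 _ (by linarith)) hu
  have hW0 : ∀ u ≤ δ, W u = 0 := fun u hu =>
    integral_zero_of_support hδ.le (fun s hs => hP0 s hs.le) hu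
  have hWs : ContDiff ℝ ∞ fun t => W (T - t) := hpp.contDiff.comp (contDiff_const.sub contDiff_id)
  have hρ : ContDiff ℝ ∞ fun t : ℝ => Real.smoothTransition (t + 1) :=
    Real.smoothTransition.contDiff.comp (contDiff_id.add contDiff_const)
  refine ⟨fun t => Real.smoothTransition (t + 1) * W (T - t), hρ.mul hWs,
    ⟨-1, T - δ, by linarith, fun t ht => ?_⟩, fun t ht => ?_⟩
  · rw [mem_Icc, not_and_or, not_le, not_le] at ht
    change Real.smoothTransition (t + 1) * W (T - t) = 0
    rcases ht with ht | ht
    · rw [Real.smoothTransition.zero_of_nonpos (by linarith), zero_mul]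
    · rw [hW0 _ (by linarith), mul_zero]
  · have e : (fun t => Real.smoothTransition (t + 1) * W (T - t))
        =ᶠ[𝓝 t] fun t => W (T - t) := by
      filter_upwards [Ioi_mem_nhds ht.1] with u hu
      rw [Real.smoothTransition.one_of_one_le (by linarith [mem_Ioi.1 hu]), one_mul]
    have hd1 : ∀ t, HasDerivAt (fun t => W (T - t)) (-P (T - t)) t := fun t =>
      hasDerivAt_of_comp hpp hp t
    rw [e.deriv.deriv_eq, show deriv (fun t => W (T - t)) = fun t => -P (T - t) from
      funext fun t => (hd1 t).deriv]
    have h2 := ((hp.hasDerivAt (T - t)).comp t ((hasDerivAt_id t).const_sub T)).neg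
    have h4 : deriv P = fun s => θ (T - s) := hs.deriv_primitive
    have h5 := h2.deriv
    rw [h4] at h5
    simpa [Function.comp_def] using h5
where
  hasDerivAt_of_comp {T : ℝ} {P : ℝ → ℝ} (h : SmoothCausal fun t => ∫ s in (0 : ℝ)..t, P s)
      (hP : SmoothCausal P) (t : ℝ) :
      HasDerivAt (fun t => ∫ s in (0 : ℝ)..(T - t), P s) (-P (T - t)) t := by
    have h1 := (h.hasDerivAt (T - t)).comp t ((hasDerivAt_id t).const_sub T)
    rw [hP.deriv_primitive] at h1
    exact h1.congr_deriv (by simp)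

/-- The hypothesis is `A'' + 2 B' + D = 0` in the weak sense, together with zero initial data since
`χ` is unrestricted at `0`. Two integrations in time give the conclusion, carried out on the test
side with `χ''` ranging over all test functions on `(0, T)`. -/
theorem eq_zero_of_distribution_identity {A B D : ℝ → ℝ} {T : ℝ} (hT : 0 < T) (hA : Continuous A)
    (hB : Continuous B) (hD : Continuous D)
    (h : ∀ χ : ℝ → ℝ, ContDiff ℝ ∞ χ → (∃ a b, b < T ∧ ∀ t ∉ Icc a b, χ t = 0) →
      ∫ t in (0 : ℝ)..T, (deriv (deriv χ) t * A t - 2 * deriv χ t * B t + χ t * D t) = 0)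
    {τ : ℝ} (hτ : τ ∈ Ioo 0 T) :
    A τ + ∫ s in (0 : ℝ)..τ, (2 * B s + ∫ u in (0 : ℝ)..s, D u) = 0 := by
  set D₁ : ℝ → ℝ := fun s => ∫ u in (0 : ℝ)..s, D u with hD₁
  have dD : ∀ s, HasDerivAt D₁ (D s) s := fun s => (hD.integral_hasStrictDerivAt 0 s).hasDerivAt
  have cD : Continuous D₁ := continuous_iff_continuousAt.2 fun s => (dD s).continuousAt
  set K : ℝ → ℝ := fun τ => ∫ s in (0 : ℝ)..τ, (2 * B s + D₁ s) with hK
  have cK' : Continuous fun s => 2 * B s + D₁ s := by fun_prop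
  have dK : ∀ s, HasDerivAt K (2 * B s + D₁ s) s := fun s =>
    (cK'.integral_hasStrictDerivAt 0 s).hasDerivAt
  have cK : Continuous K := continuous_iff_continuousAt.2 fun s => (dK s).continuousAt
  have hD0 : D₁ 0 = 0 := intervalIntegral.integral_same
  have hK0 : K 0 = 0 := intervalIntegral.integral_same
  have key : ∀ θ : ℝ → ℝ, ContDiff ℝ ∞ θ → HasCompactSupport θ → tsupport θ ⊆ Ioo 0 T →
      ∫ t, θ t • (A t + K t) = 0 := by
    intro θ h1 _ h3
    obtain ⟨χ, hχ, ⟨a, b, hb, hχ0⟩, hχ2⟩ := exists_second_primitive h1 h3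
    have hχ1 : ContDiff ℝ ∞ (deriv χ) := (contDiff_infty_iff_deriv.1 hχ).2
    have hχ2' : ContDiff ℝ ∞ (deriv (deriv χ)) := (contDiff_infty_iff_deriv.1 hχ1).2
    have d0 : ∀ t, HasDerivAt χ (deriv χ t) t := fun t =>
      ((hχ.differentiable (by simp)) t).hasDerivAt
    have d1 : ∀ t, HasDerivAt (deriv χ) (deriv (deriv χ) t) t := fun t =>
      ((hχ1.differentiable (by simp)) t).hasDerivAt
    have c0 := hχ.continuous
    have c1 := hχ1.continuous
    have c2 := hχ2'.continuous
    have hev : χ =ᶠ[𝓝 T] fun _ => 0 := by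
      filter_upwards [Ioi_mem_nhds hb] with t ht
      exact hχ0 t fun hmem => absurd hmem.2 (not_le.2 ht)
    have hχT : χ T = 0 := hev.self_of_nhds
    have hχT' : deriv χ T = 0 := by rw [hev.deriv_eq]; simp
    -- The products `χ' K` and `χ D₁` vanish at both ends: `K` and `D₁` at `0`, `χ` and `χ'` at `T`.
    -- Their derivatives account for the two integrations by parts.
    have i1 := integral_eq_zero_of_hasDerivAt (a := 0) (b := T)
      (fun t => (d1 t).mul (dK t)) (by fun_prop) (by simp [hK0]) (by simp [hχT'])
    have i2 := integral_eq_zero_of_hasDerivAt (a := 0) (b := T)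
      (fun t => (d0 t).mul (dD t)) (by fun_prop) (by simp [hD0]) (by simp [hχT])
    have i3 := h χ hχ ⟨a, b, hb, hχ0⟩
    have e : ∫ t, θ t • (A t + K t) = ∫ t in (0 : ℝ)..T, deriv (deriv χ) t * (A t + K t) := by
      rw [intervalIntegral.integral_of_le hT.le, integral_Ioc_eq_integral_Ioo,
        ← setIntegral_eq_integral_of_forall_compl_eq_zero (s := Ioo 0 T)]
      · exact setIntegral_congr_fun measurableSet_Ioo fun t ht => by
          simp only [smul_eq_mul, hχ2 t ht]
      · intro t ht
        rw [image_eq_zero_of_notMem_tsupport fun hmem => ht (h3 hmem), zero_smul]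
    have e2 : ∫ t in (0 : ℝ)..T, deriv (deriv χ) t * (A t + K t)
        = (∫ t in (0 : ℝ)..T, (deriv (deriv χ) t * A t - 2 * deriv χ t * B t + χ t * D t))
          + (∫ t in (0 : ℝ)..T, (deriv (deriv χ) t * K t + deriv χ t * (2 * B t + D₁ t)))
          - ∫ t in (0 : ℝ)..T, (deriv χ t * D₁ t + χ t * D t) := by
      rw [← intervalIntegral.integral_add (Continuous.intervalIntegrable (by fun_prop) _ _)
        (Continuous.intervalIntegrable (by fun_prop) _ _),
        ← intervalIntegral.integral_sub (Continuous.intervalIntegrable (by fun_prop) _ _)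
        (Continuous.intervalIntegrable (by fun_prop) _ _)]
      congr 1
      ext t
      ring
    rw [e, e2, i1, i2, i3]
    simp
  have hae := isOpen_Ioo.ae_eq_zero_of_integral_contDiff_smul_eq_zero (μ := volume)
    ((hA.add cK).locallyIntegrable.locallyIntegrableOn _) key
  have heq : EqOn (fun t => A t + K t) (fun _ => 0) (Ioo 0 T) := by
    refine Measure.eqOn_open_of_ae_eq (μ := volume) ?_ isOpen_Ioo (hA.add cK).continuousOn
      continuousOn_const
    exact (ae_restrict_iff' measurableSet_Ioo).2 hae
  exact heq hτ

/-! ### The free wave with a given initial velocity -/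

section FreeWave

variable {η : ℝ → ℝ}

/-- The solution of the free wave equation with zero initial value and initial velocity `η`. -/
def freeWave (η : ℝ → ℝ) (x s : ℝ) : ℝ :=
  ((∫ u in (0 : ℝ)..(x + s), η u) - ∫ u in (0 : ℝ)..(x - s), η u) / 2

theorem freeWave_eq (hη : Continuous η) (x s : ℝ) :
    freeWave η x s = (∫ u in (x - s)..(x + s), η u) / 2 := by
  rw [freeWave, intervalIntegral.integral_interval_sub_left (hη.intervalIntegrable _ _)
    (hη.intervalIntegrable _ _)]

/-- Exhibits the factor `s` with a continuous cofactor, so that the time derivative of a pairing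
with the free wave can be computed at `s = 0` without differentiability of the state. -/
theorem freeWave_eq_mul (hη : Continuous η) (x s : ℝ) :
    freeWave η x s = s * ((∫ σ in (-1 : ℝ)..1, η (x + s * σ)) / 2) := by
  rw [freeWave_eq hη, ← mul_div_assoc, intervalIntegral.mul_integral_comp_add_mul]
  simp [sub_eq_add_neg]

theorem contDiff_freeWave (hη : ContDiff ℝ ∞ η) :
    ContDiff ℝ ∞ fun p : ℝ × ℝ => freeWave η p.1 p.2 := by
  have h : ∀ t, HasDerivAt (fun t => ∫ s in (0 : ℝ)..t, η s) (η t) t := fun t =>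
    (hη.continuous.integral_hasStrictDerivAt 0 t).hasDerivAt
  have hH : ContDiff ℝ ∞ fun t => ∫ s in (0 : ℝ)..t, η s := by
    refine contDiff_infty_iff_deriv.2 ⟨fun t => (h t).differentiableAt, ?_⟩
    rwa [show deriv (fun t => ∫ s in (0 : ℝ)..t, η s) = η from funext fun t => (h t).deriv]
  exact ((hH.comp (contDiff_fst.add contDiff_snd)).sub
    (hH.comp (contDiff_fst.sub contDiff_snd))).div_const 2

theorem hasDerivAt_freeWave_time (hη : Continuous η) (x s : ℝ) :
    HasDerivAt (freeWave η x) ((η (x + s) + η (x - s)) / 2) s := by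
  have h : ∀ t, HasDerivAt (fun t => ∫ s in (0 : ℝ)..t, η s) (η t) t := fun t =>
    (hη.integral_hasStrictDerivAt 0 t).hasDerivAt
  have h1 := (h (x + s)).comp s ((hasDerivAt_id s).const_add x)
  have h2 := (h (x - s)).comp s ((hasDerivAt_id s).const_sub x)
  exact ((h1.sub h2).div_const 2).congr_deriv (by ring)

theorem hasDerivAt_freeWave_space (hη : Continuous η) (x s : ℝ) :
    HasDerivAt (fun x => freeWave η x s) ((η (x + s) - η (x - s)) / 2) x := by
  have h : ∀ t, HasDerivAt (fun t => ∫ s in (0 : ℝ)..t, η s) (η t) t := fun t =>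
    (hη.integral_hasStrictDerivAt 0 t).hasDerivAt
  have h1 := (h (x + s)).comp x ((hasDerivAt_id x).add_const s)
  have h2 := (h (x - s)).comp x ((hasDerivAt_id x).sub_const s)
  exact ((h1.sub h2).div_const 2).congr_deriv (by ring)

theorem freeWave_eq_zero (hη : Continuous η) {R : ℝ} (hR : ∀ x, R < |x| → η x = 0) {x s S : ℝ}
    (hs : |s| ≤ S) (hx : R + S < |x|) : freeWave η x s = 0 := by
  rw [freeWave_eq hη, intervalIntegral.integral_zero_ae, zero_div]
  refine Eventually.of_forall fun u hu => hR u ?_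
  rw [mem_uIoc] at hu
  have h1 : |u - x| ≤ S := by
    refine le_trans ?_ hs
    rw [abs_le]
    rcases hu with hu | hu
    · rw [abs_of_nonneg (by linarith)]
      constructor <;> linarith
    · rw [abs_of_nonpos (by linarith)]
      constructor <;> linarith
  have h2 := abs_sub_abs_le_abs_sub x u
  rw [abs_sub_comm] at h2
  linarith

/-- Cauchy–Schwarz on an interval of length `2s`. A bound by the `L²` norm of `η` is what the later
argument by duality requires. -/
theorem abs_freeWave_le (hη : Continuous η) (hη2 : MemLp η 2) {s S : ℝ} (hs : 0 ≤ s) (hS : s ≤ S)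
    (x : ℝ) : |freeWave η x s| ≤ √(2 * S) / 2 * ‖hη2.toLp η‖ := by
  have hv : volume (Ioc (x - s) (x + s)) ≠ ⊤ := measure_Ioc_lt_top.ne
  have h1 := L2.inner_indicatorConstLp_one (𝕜 := ℝ) measurableSet_Ioc hv (hη2.toLp η)
  have h2 := abs_real_inner_le_norm (indicatorConstLp 2 measurableSet_Ioc hv (1 : ℝ)) (hη2.toLp η)
  rw [h1, integral_congr_ae (ae_restrict_of_ae hη2.coeFn_toLp), norm_indicatorConstLp (by norm_num)
    (by norm_num)] at h2
  rw [freeWave_eq hη, intervalIntegral.integral_of_le (by linarith), abs_div, abs_two]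
  have h3 : ‖(1 : ℝ)‖ * volume.real (Ioc (x - s) (x + s)) ^ (1 / ENNReal.toReal 2) ≤ √(2 * S) := by
    rw [norm_one, one_mul, Real.volume_real_Ioc_of_le (by linarith), Real.sqrt_eq_rpow]
    norm_num
    exact Real.rpow_le_rpow (by linarith) (by linarith) (by norm_num)
  have h4 := mul_le_mul_of_nonneg_right h3 (norm_nonneg (hη2.toLp η))
  linarith

end FreeWave

/-! ### Uniqueness of the generalized solution -/

section Uniqueness

variable {Q : ℝ → ℝ} {T : ℝ} {z : ℝ → Lp ℝ 2 (volume : Measure ℝ)} {η : ℝ → ℝ}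

theorem exists_radius_of_hasCompactSupport (hη : HasCompactSupport η) :
    ∃ R, 0 ≤ R ∧ ∀ x, R < |x| → η x = 0 := by
  obtain ⟨R, hR⟩ := hη.isCompact.isBounded.subset_closedBall 0
  refine ⟨max R 0, le_max_right _ _, fun x hx => ?_⟩
  refine image_eq_zero_of_notMem_tsupport fun hmem => ?_
  have h1 := hR hmem
  rw [mem_closedBall_zero_iff, Real.norm_eq_abs] at h1
  exact absurd ((le_max_left R 0).trans_lt hx) (not_lt.2 h1)

theorem abs_freeWave_le_integral (hη : Continuous η) (hc : HasCompactSupport η) (x s : ℝ) :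
    |freeWave η x s| ≤ ∫ u, |η u| := by
  have hi := (hη.integrable_of_hasCompactSupport (μ := volume) hc).abs
  have h0 : 0 ≤ ∫ u, |η u| := integral_nonneg fun u => abs_nonneg _
  rw [freeWave_eq hη, abs_div, abs_two]
  have h := intervalIntegral.norm_integral_le_integral_norm_uIoc (f := η) (a := x - s)
    (b := x + s) (μ := volume)
  have h2 : ∫ u in uIoc (x - s) (x + s), ‖η u‖ ≤ ∫ u, |η u| :=
    setIntegral_le_integral hi (Eventually.of_forall fun u => abs_nonneg _)
  rw [Real.norm_eq_abs] at h
  linarith [abs_nonneg (∫ u in (x - s)..(x + s), η u)]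

/-- A test function built from a cutoff in time and a free wave running backwards. -/
def cutoffWave (χ η : ℝ → ℝ) (t₀ x t : ℝ) : ℝ := χ t * freeWave η x (t₀ - t)

theorem isTest_cutoffWave (hη : ContDiff ℝ ∞ η) (hc : HasCompactSupport η) {χ : ℝ → ℝ}
    (hχ : ContDiff ℝ ∞ χ) (hχ0 : ∃ a b, b < T ∧ ∀ t ∉ Icc a b, χ t = 0) (t₀ : ℝ) :
    IsTest T (cutoffWave χ η t₀) := by
  obtain ⟨a, b, hb, hab⟩ := hχ0
  obtain ⟨R, hR0, hR⟩ := exists_radius_of_hasCompactSupport hc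
  set S := |t₀| + |a| + |b| with hS
  have hz : ∀ p : ℝ × ℝ, p ∉ Icc (-(R + S)) (R + S) ×ˢ Icc a b →
      cutoffWave χ η t₀ p.1 p.2 = 0 := by
    intro p hp
    rw [cutoffWave]
    by_cases h2 : p.2 ∈ Icc a b
    · have h1 : R + S < |p.1| := by
        by_contra hcon
        exact hp ⟨abs_le.1 (not_lt.1 hcon), h2⟩
      have h3 : |t₀ - p.2| ≤ S := by
        rw [abs_le]
        constructor <;> linarith [neg_abs_le t₀, le_abs_self t₀, neg_abs_le a, le_abs_self a,
          neg_abs_le b, le_abs_self b, abs_nonneg a, abs_nonneg b, h2.1, h2.2]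
      rw [freeWave_eq_zero hη.continuous hR h3 h1, mul_zero]
    · rw [hab _ h2, zero_mul]
  have hK : IsCompact (Icc (-(R + S)) (R + S) ×ˢ Icc a b) := isCompact_Icc.prod isCompact_Icc
  refine ⟨?_, HasCompactSupport.intro hK fun p hp => hz p hp, ?_⟩
  · exact (hχ.comp contDiff_snd).mul ((contDiff_freeWave hη).comp
      (contDiff_fst.prodMk (contDiff_const.sub contDiff_snd)))
  · refine (closure_minimal (fun p hp => ?_) hK.isClosed).trans fun p hp => hp.2.2.trans_lt hb
    by_contra hcon
    exact hp (hz p hcon)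

/-- The free wave solves the free equation, so only terms with a derivative on `χ` and the potential
term remain. The sign of the middle term is due to the reversal of time. -/
theorem waveOp_cutoffWave (hη : ContDiff ℝ ∞ η) (hc : HasCompactSupport η) {χ : ℝ → ℝ}
    (hχ : ContDiff ℝ ∞ χ) (hχ0 : ∃ a b, b < T ∧ ∀ t ∉ Icc a b, χ t = 0) (t₀ x t : ℝ) :
    waveOp Q (cutoffWave χ η t₀) x t = deriv (deriv χ) t * freeWave η x (t₀ - t)
      - 2 * deriv χ t * ((η (x + (t₀ - t)) + η (x - (t₀ - t))) / 2)
      + χ t * (Q x * freeWave η x (t₀ - t)) := by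
  have hφ := isTest_cutoffWave hη hc hχ hχ0 t₀
  have hχ1 : ContDiff ℝ ∞ (deriv χ) := (contDiff_infty_iff_deriv.1 hχ).2
  have d0 : ∀ t, HasDerivAt χ (deriv χ t) t := fun t =>
    ((hχ.differentiable (by simp)) t).hasDerivAt
  have d1 : ∀ t, HasDerivAt (deriv χ) (deriv (deriv χ) t) t := fun t =>
    ((hχ1.differentiable (by simp)) t).hasDerivAt
  have e0 : ∀ u, HasDerivAt η (deriv η u) u := fun u =>
    ((hη.differentiable (by simp)) u).hasDerivAt
  have f0 : ∀ t, HasDerivAt (fun t => freeWave η x (t₀ - t))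
      (-((η (x + (t₀ - t)) + η (x - (t₀ - t))) / 2)) t := fun t =>
    ((hasDerivAt_freeWave_time hη.continuous x (t₀ - t)).comp t
      ((hasDerivAt_id t).const_sub t₀)).congr_deriv (by ring)
  have hdt : ∀ t, dt (cutoffWave χ η t₀) x t = deriv χ t * freeWave η x (t₀ - t)
      + χ t * (-((η (x + (t₀ - t)) + η (x - (t₀ - t))) / 2)) := fun t =>
    (hasDerivAt_dt hφ.contDiff x t).unique ((d0 t).mul (f0 t))
  have g1 : HasDerivAt (fun t => η (x + (t₀ - t))) (-deriv η (x + (t₀ - t))) t :=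
    ((e0 (x + (t₀ - t))).comp t (((hasDerivAt_id t).const_sub t₀).const_add x)).congr_deriv
      (by ring)
  have g2 : HasDerivAt (fun t => η (x - (t₀ - t))) (deriv η (x - (t₀ - t))) t :=
    ((e0 (x - (t₀ - t))).comp t (((hasDerivAt_id t).const_sub t₀).const_sub x)).congr_deriv
      (by ring)
  have hdtt : dtt (cutoffWave χ η t₀) x t = _ :=
    (hasDerivAt_dtt hφ.contDiff x t).unique ((((d1 t).mul (f0 t)).add
      ((d0 t).mul ((g1.add g2).div_const 2).neg)).congr_of_eventuallyEq
      (Eventually.of_forall fun t => hdt t))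
  have hdx : ∀ x, dx (cutoffWave χ η t₀) x t
      = χ t * ((η (x + (t₀ - t)) - η (x - (t₀ - t))) / 2) := fun x =>
    (hasDerivAt_dx hφ.contDiff x t).unique
      ((hasDerivAt_freeWave_space hη.continuous x (t₀ - t)).const_mul (χ t))
  have k1 : HasDerivAt (fun x => η (x + (t₀ - t))) (deriv η (x + (t₀ - t))) x :=
    HasDerivAt.comp_add_const x _ (e0 (x + (t₀ - t)))
  have k2 : HasDerivAt (fun x => η (x - (t₀ - t))) (deriv η (x - (t₀ - t))) x :=
    HasDerivAt.comp_sub_const x _ (e0 (x - (t₀ - t)))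
  have hdxx : dxx (cutoffWave χ η t₀) x t = _ :=
    (hasDerivAt_dxx hφ.contDiff x t).unique ((((k1.sub k2).div_const 2).const_mul
      (χ t)).congr_of_eventuallyEq (Eventually.of_forall fun x => hdx x))
  rw [waveOp, hdtt, hdxx, cutoffWave]
  simp only [Pi.add_apply, Pi.neg_apply]
  ring

/-- The test function is a time cutoff of the free wave with velocity `η` at `t₀`, run backwards.
With `A`, `B`, `D` the pairings of `z` with the free wave, its velocity and its product with `Q`,
the weak identity yields `A' = -2B - ∫ D`. At `t₀` both `-A'` and `B` are the pairing of `z(t₀)`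
with `η`; substituting gives the formula. -/
theorem pairing_eq_of_weak_identity (hQ2 : MemLp Q 2) (hT : 0 < T) (hz : Continuous z)
    (h : ∀ φ, IsTest T φ → ∫ t in (0 : ℝ)..T, ∫ x, z t x * waveOp Q φ x t = 0)
    (hη : ContDiff ℝ ∞ η) (hc : HasCompactSupport η) {t₀ : ℝ} (ht₀ : t₀ ∈ Ioo 0 T) :
    ∫ x, z t₀ x * η x
      = -∫ t in (0 : ℝ)..t₀, ∫ x, z t x * (Q x * freeWave η x (t₀ - t)) := by
  obtain ⟨R, hR0, hR⟩ := exists_radius_of_hasCompactSupport hc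
  obtain ⟨C, hC⟩ := hc.exists_bound_of_continuous hη.continuous
  have hηc := hη.continuous
  -- All functions built from `η` are supported here for the relevant times. As an explicit `L²`
  -- weight the indicator makes `continuousOn_pairing` applicable to them.
  set w : ℝ → ℝ := indicator (Icc (-(R + T)) (R + T)) fun _ => 1 with hw
  have hwm : MemLp w 2 := memLp_indicator_const 2 measurableSet_Icc 1 (Or.inr
    measure_Icc_lt_top.ne)
  have hwz : ∀ {g : ℝ → ℝ}, (∀ x, R + T < |x| → g x = 0) → ∀ x, w x * g x = g x := by
    intro g hg x
    by_cases hx : x ∈ Icc (-(R + T)) (R + T)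
    · rw [hw, indicator_of_mem hx, one_mul]
    · rw [hg x, mul_zero]
      by_contra hcon
      exact hx (abs_le.1 (not_lt.1 hcon))
  have cΦ : Continuous fun p : ℝ × ℝ => freeWave η p.1 (t₀ - p.2) :=
    (contDiff_freeWave hη).continuous.comp (by fun_prop : Continuous fun p : ℝ × ℝ =>
      (p.1, t₀ - p.2))
  have cB : Continuous fun p : ℝ × ℝ => (η (p.1 + (t₀ - p.2)) + η (p.1 - (t₀ - p.2))) / 2 := by
    fun_prop
  have cM : Continuous fun p : ℝ × ℝ => (∫ σ in (-1 : ℝ)..1, η (p.1 + (t₀ - p.2) * σ)) / 2 := by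
    refine Continuous.div_const ?_ 2
    exact intervalIntegral.continuous_parametric_intervalIntegral_of_continuous'
      (f := fun (p : ℝ × ℝ) (σ : ℝ) => η (p.1 + (t₀ - p.2) * σ))
      (by unfold Function.uncurry; fun_prop) _ _
  have bΦ : ∀ t ∈ (univ : Set ℝ), ∀ x, |freeWave η x (t₀ - t)| ≤ ∫ u, |η u| := fun t _ x =>
    abs_freeWave_le_integral hηc hc x _
  have bB : ∀ t ∈ (univ : Set ℝ), ∀ x, |(η (x + (t₀ - t)) + η (x - (t₀ - t))) / 2| ≤ C := by
    intro t _ x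
    rw [abs_div, abs_two]
    have h1 := abs_add_le (η (x + (t₀ - t))) (η (x - (t₀ - t)))
    have h2 : |η (x + (t₀ - t))| ≤ C := hC _
    have h3 : |η (x - (t₀ - t))| ≤ C := hC _
    linarith
  have bM : ∀ t ∈ (univ : Set ℝ), ∀ x,
      |(∫ σ in (-1 : ℝ)..1, η (x + (t₀ - t) * σ)) / 2| ≤ C := by
    intro t _ x
    have h1 := intervalIntegral.norm_integral_le_of_norm_le_const (a := -1) (b := 1) (C := C)
      (f := fun σ => η (x + (t₀ - t) * σ)) fun σ _ => hC _
    rw [Real.norm_eq_abs] at h1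
    rw [abs_div, abs_two]
    norm_num at h1
    linarith
  have hzu : ContinuousOn z univ := hz.continuousOn
  set A : ℝ → ℝ := fun t => ∫ x, z t x * (w x * freeWave η x (t₀ - t)) with hA
  set B : ℝ → ℝ := fun t => ∫ x, z t x * (w x * ((η (x + (t₀ - t)) + η (x - (t₀ - t))) / 2)) with hB
  set D : ℝ → ℝ := fun t => ∫ x, z t x * (Q x * freeWave η x (t₀ - t)) with hD
  set E : ℝ → ℝ := fun t => ∫ x, z t x * (w x * ((∫ σ in (-1 : ℝ)..1, η (x + (t₀ - t) * σ)) / 2))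
    with hE
  have cA : Continuous A := continuousOn_univ.1 (continuousOn_pairing hzu hwm cΦ bΦ)
  have cB' : Continuous B := continuousOn_univ.1 (continuousOn_pairing hzu hwm cB bB)
  have cD : Continuous D := continuousOn_univ.1 (continuousOn_pairing hzu hQ2 cΦ bΦ)
  have cE : Continuous E := continuousOn_univ.1 (continuousOn_pairing hzu hwm cM bM)
  have hAE : ∀ t, A t = (t₀ - t) * E t := by
    intro t
    rw [hA, hE, ← integral_const_mul]
    refine integral_congr_ae (Eventually.of_forall fun x => ?_)
    simp only [freeWave_eq_mul hηc]
    ring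
  have hE0 : E t₀ = ∫ x, z t₀ x * η x := by
    refine integral_congr_ae (Eventually.of_forall fun x => ?_)
    have h1 : ∀ x, w x * η x = η x := hwz fun x hx => hR x (by linarith)
    simp only [sub_self, zero_mul, add_zero, intervalIntegral.integral_const, smul_eq_mul]
    linear_combination (z t₀ x) * h1 x
  have hB0 : B t₀ = ∫ x, z t₀ x * η x := by
    refine integral_congr_ae (Eventually.of_forall fun x => ?_)
    have h1 : ∀ x, w x * η x = η x := hwz fun x hx => hR x (by linarith)
    simp only [sub_self, add_zero, sub_zero]
    linear_combination (z t₀ x) * h1 x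
  have hid := fun τ (hτ : τ ∈ Ioo 0 T) => eq_zero_of_distribution_identity hT cA cB' cD
    (fun χ hχ hχ0 => by
      refine Eq.trans ?_ (h _ (isTest_cutoffWave hη hc hχ hχ0 t₀))
      refine intervalIntegral.integral_congr fun t ht => ?_
      rw [uIcc_of_le hT.le] at ht
      have ht' : |t₀ - t| ≤ T := by
        rw [abs_le]
        constructor <;> linarith [ht.1, ht.2, ht₀.1, ht₀.2]
      have m : ∀ {ψ : ℝ → ℝ → ℝ}, (Continuous fun p : ℝ × ℝ => ψ p.1 p.2) →
          AEStronglyMeasurable fun x => ψ x t := fun hψ =>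
        (hψ.comp (by fun_prop : Continuous fun x : ℝ => (x, t))).aestronglyMeasurable
      have i1 : Integrable fun x => z t x * (w x * freeWave η x (t₀ - t)) :=
        (Lp.memLp (z t)).integrable_mul (memLp_mul_bounded hwm (m (ψ := fun x t => freeWave η x (t₀ - t)) cΦ) (bΦ t trivial))
      have i2 : Integrable fun x =>
          z t x * (w x * ((η (x + (t₀ - t)) + η (x - (t₀ - t))) / 2)) :=
        (Lp.memLp (z t)).integrable_mul (memLp_mul_bounded hwm (m (ψ := fun x t =>
          (η (x + (t₀ - t)) + η (x - (t₀ - t))) / 2) cB) (bB t trivial))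
      have i3 : Integrable fun x => z t x * (Q x * freeWave η x (t₀ - t)) :=
        (Lp.memLp (z t)).integrable_mul (memLp_mul_bounded hQ2 (m (ψ := fun x t => freeWave η x (t₀ - t)) cΦ) (bΦ t trivial))
      simp only [hA, hB, hD]
      rw [← integral_const_mul, ← integral_const_mul, ← integral_const_mul,
        ← integral_sub (i1.const_mul _) (i2.const_mul _),
        ← integral_add (f := fun x => deriv (deriv χ) t * (z t x * (w x * freeWave η x (t₀ - t)))
          - 2 * deriv χ t * (z t x * (w x * ((η (x + (t₀ - t)) + η (x - (t₀ - t))) / 2))))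
          ((i1.const_mul _).sub (i2.const_mul _)) (i3.const_mul _)]
      refine integral_congr_ae (Eventually.of_forall fun x => ?_)
      have h1 : ∀ x, w x * freeWave η x (t₀ - t) = freeWave η x (t₀ - t) :=
        hwz fun x hx => freeWave_eq_zero hηc hR ht' hx
      have h2 : ∀ x, w x * ((η (x + (t₀ - t)) + η (x - (t₀ - t))) / 2)
          = (η (x + (t₀ - t)) + η (x - (t₀ - t))) / 2 := hwz fun x hx => by
        have a1 := abs_sub_abs_le_abs_sub x (-(t₀ - t))
        have a2 := abs_sub_abs_le_abs_sub x (t₀ - t)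
        rw [sub_neg_eq_add, abs_neg] at a1
        rw [hR _ (by linarith), hR _ (by linarith)]
        simp
      simp only [waveOp_cutoffWave hη hc hχ hχ0, h1, h2]
      ring) hτ
  -- From `A t = (t₀ - t) E t` the difference quotient at `t₀` is exactly `-E t`, so continuity of
  -- `E` is enough.
  have hder1 : HasDerivAt A (-E t₀) t₀ := by
    rw [hasDerivAt_iff_tendsto_slope]
    have h1 : Tendsto (fun t => -E t) (𝓝[≠] t₀) (𝓝 (-E t₀)) :=
      (cE.neg.tendsto t₀).mono_left nhdsWithin_le_nhds
    refine h1.congr' ?_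
    filter_upwards [self_mem_nhdsWithin] with t ht
    have ht' : t - t₀ ≠ 0 := sub_ne_zero.2 ht
    rw [slope_def_field, hAE t, hAE t₀]
    field_simp
    ring
  have cD1 : Continuous fun s => ∫ u in (0 : ℝ)..s, D u :=
    continuous_iff_continuousAt.2 fun s =>
      ((cD.integral_hasStrictDerivAt 0 s).hasDerivAt).continuousAt
  have cK : Continuous fun s => 2 * B s + ∫ u in (0 : ℝ)..s, D u := by fun_prop
  have hder2 : HasDerivAt A (-(2 * B t₀ + ∫ u in (0 : ℝ)..t₀, D u)) t₀ := by
    refine ((cK.integral_hasStrictDerivAt 0 t₀).hasDerivAt.neg).congr_of_eventuallyEq ?_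
    filter_upwards [Ioo_mem_nhds ht₀.1 ht₀.2] with τ hτ
    have := hid τ hτ
    simp only [Pi.neg_apply]
    linarith
  have huniq := hder1.unique hder2
  rw [hE0, hB0] at huniq
  linarith

/-- The duality formula, with the pairing on its right side bounded by a multiple of `‖η‖ ‖z(t)‖`,
gives `‖z(t₀)‖ ≤ L ∫ ‖z‖` because smooth `η` are dense; the Volterra principle then applies. -/
theorem eq_zero_of_weak_identity (hQ2 : MemLp Q 2) (hT : 0 < T) (hz : ContinuousOn z (Icc 0 T))
    (h : ∀ φ, IsTest T φ → ∫ t in (0 : ℝ)..T, ∫ x, z t x * waveOp Q φ x t = 0) :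
    ∀ t ∈ Icc 0 T, z t = 0 := by
  -- Extension by constants beyond `[0, T]`, so that the pairings are continuous functions of all
  -- real times.
  set z' : ℝ → Lp ℝ 2 (volume : Measure ℝ) := IccExtend hT.le ((Icc 0 T).domRestrict z) with hz'
  have cz' : Continuous z' := (continuousOn_iff_continuous_domRestrict.1 hz).Icc_extend'
  have hzz : ∀ t ∈ Icc 0 T, z' t = z t := fun t ht => IccExtend_of_mem _ _ ht
  have h' : ∀ φ, IsTest T φ → ∫ t in (0 : ℝ)..T, ∫ x, z' t x * waveOp Q φ x t = 0 := by
    intro φ hφ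
    refine Eq.trans ?_ (h φ hφ)
    refine intervalIntegral.integral_congr fun t ht => ?_
    rw [uIcc_of_le hT.le] at ht
    simp only [hzz t ht]
  set L := √(2 * T) / 2 * ‖hQ2.toLp Q‖ with hL
  have hL0 : 0 ≤ L := by positivity
  have cI : Continuous fun t => ∫ s in (0 : ℝ)..t, ‖z' s‖ := continuous_iff_continuousAt.2 fun s =>
    ((cz'.norm.integral_hasStrictDerivAt 0 s).hasDerivAt).continuousAt
  have key : ∀ t₀ ∈ Ioo 0 T, ‖z' t₀‖ ≤ L * ∫ s in (0 : ℝ)..t₀, ‖z' s‖ := by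
    intro t₀ ht₀
    have hin : ∀ e : Lp ℝ 2 (volume : Measure ℝ),
        |⟪e, z' t₀⟫| ≤ (L * ∫ s in (0 : ℝ)..t₀, ‖z' s‖) * ‖e‖ := by
      intro e
      refine dense_smoothStates.induction (P := fun e : Lp ℝ 2 (volume : Measure ℝ) =>
        |⟪e, z' t₀⟫| ≤ (L * ∫ s in (0 : ℝ)..t₀, ‖z' s‖) * ‖e‖) ?_ (isClosed_le
        (continuous_id.inner continuous_const).abs (continuous_const.mul continuous_norm)) e
      rintro e ⟨η, hη, hc, heη⟩
      have hη2 : MemLp η 2 := hη.continuous.memLp_of_hasCompactSupport hc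
      have hee : e = hη2.toLp η := Lp.ext (heη.trans hη2.coeFn_toLp.symm)
      rw [hee, ← integral_mul_eq_inner hη2,
        pairing_eq_of_weak_identity hQ2 hT cz' h' hη hc ht₀, abs_neg]
      have hb := intervalIntegral.norm_integral_le_of_norm_le (a := 0) (b := t₀) ht₀.1.le
        (f := fun t => ∫ x, z' t x * (Q x * freeWave η x (t₀ - t)))
        (g := fun t => L * ‖hη2.toLp η‖ * ‖z' t‖) (μ := volume) (Eventually.of_forall fun t ht => by
          have cΦ : Continuous fun x => freeWave η x (t₀ - t) :=
            (contDiff_freeWave hη).continuous.comp (by fun_prop : Continuous fun x : ℝ =>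
              (x, t₀ - t))
          have := abs_integral_mul_le (g := fun x => Q x * freeWave η x (t₀ - t))
            (hQ2.1.mul cΦ.aestronglyMeasurable) hQ2 (C := √(2 * T) / 2 * ‖hη2.toLp η‖)
            (fun x => by
              rw [abs_mul, mul_comm]
              exact mul_le_mul_of_nonneg_right (abs_freeWave_le hη.continuous hη2
                (by linarith [ht.2]) (by linarith [ht.1, ht₀.2]) x) (abs_nonneg _)) (z' t)
          rw [Real.norm_eq_abs]
          refine this.trans (le_of_eq ?_)
          rw [hL]
          ring) ((continuous_const.mul cz'.norm).intervalIntegrable _ _)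
      rw [intervalIntegral.integral_const_mul] at hb
      rw [Real.norm_eq_abs] at hb
      linarith
    have h1 := hin (z' t₀)
    rw [real_inner_self_eq_norm_sq, abs_of_nonneg (by positivity), sq] at h1
    rcases (norm_nonneg (z' t₀)).eq_or_lt with h0 | h0
    · rw [← h0]
      exact mul_nonneg hL0 (intervalIntegral.integral_nonneg ht₀.1.le fun s _ => norm_nonneg _)
    · exact le_of_mul_le_mul_right h1 h0
  have key' : ∀ t₀ ∈ Icc 0 T, ‖z' t₀‖ ≤ L * ∫ s in (0 : ℝ)..t₀, ‖z' s‖ := by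
    have hcl : IsClosed {t₀ | ‖z' t₀‖ ≤ L * ∫ s in (0 : ℝ)..t₀, ‖z' s‖} :=
      isClosed_le cz'.norm (continuous_const.mul cI)
    intro t₀ ht₀
    rw [← closure_Ioo hT.ne] at ht₀
    exact closure_minimal key hcl ht₀
  obtain ⟨A, hA⟩ := isCompact_Icc.exists_bound_of_continuousOn (cz'.continuousOn (s := Icc 0 T))
  intro t ht
  have := eq_zero_of_volterra_bound (X := Unit) (φ := fun _ t => ‖z' t‖) (A := A) (T := T) hL0
    (fun _ t ht => by rw [abs_norm]; exact hA t ht) (fun m hm _ _ hle _ t ht => by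
      rw [abs_norm]
      refine (key' t ht).trans (mul_le_mul_of_nonneg_left ?_ hL0)
      refine intervalIntegral.integral_mono_on ht.1 (cz'.norm.intervalIntegrable _ _)
        (hm.intervalIntegrable _ _) fun s hs => ?_
      have := hle () s ⟨hs.1, hs.2.trans ht.2⟩
      rwa [abs_norm] at this) () ht
  rw [← hzz t ht]
  exact norm_eq_zero.1 this

theorem IsGeneralizedSolution.unique {q : ℝ → ℝ}
    (hq2 : MemLp q 2 (volume.restrict (Ioo 0 (2 * π)))) (hT : 0 < T) {F : Controls T}
    {v v' : ℝ → Lp ℝ 2 (volume : Measure ℝ)} (hv : IsGeneralizedSolution q T F v)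
    (hv' : IsGeneralizedSolution q T F v') {t : ℝ} (ht : t ∈ Icc 0 T) : v t = v' t := by
  have hQ2 := memLp_qTilde hq2
  rw [← sub_eq_zero]
  refine eq_zero_of_weak_identity (z := fun t => v t - v' t) hQ2 hT (hv.1.sub hv'.1)
    (fun φ hφ => ?_) t ht
  have h1 := hv.2 φ hφ.contDiff hφ.compact hφ.support
  have h2 := hv'.2 φ hφ.contDiff hφ.compact hφ.support
  simp only [iteratedDeriv_sub_eq] at h1 h2
  have hi : ∀ {u : ℝ → Lp ℝ 2 (volume : Measure ℝ)}, ContinuousOn u (Icc 0 T) →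
      IntervalIntegrable (fun t => ∫ x, u t x * waveOp (qTilde q) φ x t) volume 0 T := fun hu =>
    ContinuousOn.intervalIntegrable (by
      rw [uIcc_of_le hT.le]
      exact hφ.continuousOn_pairing hQ2 hu)
  have e : ∀ t, ∫ x, (v t - v' t) x * waveOp (qTilde q) φ x t
      = (∫ x, v t x * waveOp (qTilde q) φ x t) - ∫ x, v' t x * waveOp (qTilde q) φ x t := by
    intro t
    have i : ∀ u : Lp ℝ 2 (volume : Measure ℝ),
        Integrable fun x => u x * waveOp (qTilde q) φ x t := fun u =>
      (Lp.memLp u).integrable_mul (hφ.memLp_waveOp hQ2 t)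
    rw [← integral_sub (i (v t)) (i (v' t))]
    refine integral_congr_ae ?_
    filter_upwards [Lp.coeFn_sub (v t) (v' t)] with x hx
    rw [hx, Pi.sub_apply, sub_mul]
  simp only [e]
  rw [intervalIntegral.integral_sub (hi hv.1) (hi hv'.1)]
  exact sub_eq_zero.2 (h1.trans h2.symm)

end Uniqueness

/-! ### The inner product of two waves -/

/-- Componentwise primitive of a pair of controls. -/
def pairPrimitive (g : Fin 2 → ℝ → ℝ) : Fin 2 → ℝ → ℝ := fun i t => ∫ s in (0 : ℝ)..t, g i s

section InnerProduct

variable {Q : ℝ → ℝ} {k : Fin 2 → ℝ → ℝ → ℝ} {f g : Fin 2 → ℝ → ℝ} {T : ℝ}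

theorem pairPrimitive_smooth (hg : ∀ i, SmoothCausal (g i)) (i : Fin 2) :
    SmoothCausal (pairPrimitive g i) := (hg i).primitive

theorem pairDeriv_pairPrimitive (hg : ∀ i, SmoothCausal (g i)) :
    pairDeriv (pairPrimitive g) = g := funext fun i => (hg i).deriv_primitive

theorem hasDerivAt_reflected {h h' : ℝ → ℝ} (hh : ∀ t, HasDerivAt h (h' t) t) (T t : ℝ) :
    HasDerivAt (fun s => (h (2 * T - s) - h s) / 2) (-(h' (2 * T - t) + h' t) / 2) t := by
  have h1 := (hh (2 * T - t)).comp t ((hasDerivAt_id t).const_sub (2 * T))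
  exact ((h1.sub (hh t)).div_const 2).congr_deriv (by ring)

theorem hasDerivAt_reflected_add {h h' : ℝ → ℝ} (hh : ∀ t, HasDerivAt h (h' t) t) (T t : ℝ) :
    HasDerivAt (fun s => -(h (2 * T - s) + h s) / 2) ((h' (2 * T - t) - h' t) / 2) t := by
  have h1 := (hh (2 * T - t)).comp t ((hasDerivAt_id t).const_sub (2 * T))
  exact ((h1.add (hh t)).neg.div_const 2).congr_deriv (by ring)

/-- The odd reflection in time, about `T`, of a function of space and time. -/
def reflected (T : ℝ) (u : ℝ → ℝ → ℝ) (x t : ℝ) : ℝ := (u x (2 * T - t) - u x t) / 2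

theorem tendsto_reflected {u w : ℝ → ℝ → ℝ} {l : Filter ℝ}
    (h : ∀ t, Tendsto (fun x => u x t) l (𝓝 (w 0 t))) (T t : ℝ) :
    Tendsto (fun x => reflected T u x t) l (𝓝 (reflected T w 0 t)) :=
  ((h (2 * T - t)).sub (h t)).div_const 2

theorem hasDerivAt_reflected_space {u w : ℝ → ℝ → ℝ} {x : ℝ}
    (h : ∀ t, HasDerivAt (fun x => u x t) (w x t) x) (T t : ℝ) :
    HasDerivAt (fun x => reflected T u x t) (reflected T w x t) x :=
  ((h (2 * T - t)).sub (h t)).div_const 2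

theorem continuous_reflected {u : ℝ → ℝ → ℝ} {x : ℝ} (h : Continuous (u x)) (T : ℝ) :
    Continuous (reflected T u x) := by
  unfold reflected
  fun_prop

theorem measurable_reflected {u : ℝ → ℝ → ℝ} (h : Measurable fun p : ℝ × ℝ => u p.1 p.2) (T : ℝ) :
    Measurable fun p : ℝ × ℝ => reflected T u p.1 p.2 :=
  ((h.comp (by fun_prop : Measurable fun p : ℝ × ℝ => (p.1, 2 * T - p.2))).sub h).div_const 2

/-- The space derivative of a wave off the origin. -/
def slope (Q : ℝ → ℝ) (k : Fin 2 → ℝ → ℝ → ℝ) (f : Fin 2 → ℝ → ℝ) (x t : ℝ) : ℝ :=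
  if 0 < x then slopeRight Q k f x t else slopeLeft Q k f x t

theorem IsKernelPair.hasDerivAt_wave_space (hQ : Integrable Q) (hk : IsKernelPair Q k)
    (hf : ∀ i, SmoothCausal (f i)) {x : ℝ} (hx : x ≠ 0) (t : ℝ) :
    HasDerivAt (fun x => pairWave k f x t) (slope Q k f x t) x := by
  rcases lt_or_gt_of_ne hx with h | h
  · rw [slope, if_neg (not_lt.2 h.le)]
    refine (hk.hasDerivAt_waveLeft hQ hf x t).congr_of_eventuallyEq ?_
    filter_upwards [Iio_mem_nhds h] with y hy using pairWave_neg k f hy t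
  · rw [slope, if_pos h]
    refine (hk.hasDerivAt_waveRight hQ hf x t).congr_of_eventuallyEq ?_
    filter_upwards [Ioi_mem_nhds h] with y hy using pairWave_pos k f hy t

theorem IsKernelPair.hasDerivAt_slope (hQ : Integrable Q) (hk : IsKernelPair Q k)
    (hf : ∀ i, SmoothCausal (f i)) {x : ℝ} (hQx : ContinuousAt Q x) (hx : x ≠ 0) (t : ℝ) :
    HasDerivAt (fun x => slope Q k f x t)
      (Q x * pairWave k f x t + pairWave k (pairDeriv (pairDeriv f)) x t) x := by
  rcases lt_or_gt_of_ne hx with h | h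
  · refine (hk.hasDerivAt_slopeLeft hQ hf hQx h t).congr_of_eventuallyEq ?_
    filter_upwards [Iio_mem_nhds h] with y hy using if_neg (not_lt.2 (le_of_lt hy))
  · refine (hk.hasDerivAt_slopeRight hQ hf hQx h t).congr_of_eventuallyEq ?_
    filter_upwards [Ioi_mem_nhds h] with y hy using if_pos hy

theorem IsKernelPair.tendsto_wave (hk : IsKernelPair Q k) (hf : ∀ i, SmoothCausal (f i)) (t : ℝ) :
    Tendsto (fun x => pairWave k f x t) (𝓝[>] 0) (𝓝 (waveRight k f 0 t)) ∧
    Tendsto (fun x => pairWave k f x t) (𝓝[<] 0) (𝓝 (waveLeft k f 0 t)) := by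
  have c1 : Continuous fun x => waveRight k f x t :=
    (hk.continuous_waveRight hf).comp (by fun_prop : Continuous fun x : ℝ => (x, t))
  have c2 : Continuous fun x => waveLeft k f x t :=
    (hk.continuous_waveLeft hf).comp (by fun_prop : Continuous fun x : ℝ => (x, t))
  constructor
  · refine ((c1.tendsto 0).mono_left nhdsWithin_le_nhds).congr' ?_
    filter_upwards [self_mem_nhdsWithin] with x hx using (pairWave_pos k f hx t).symm
  · refine ((c2.tendsto 0).mono_left nhdsWithin_le_nhds).congr' ?_
    filter_upwards [self_mem_nhdsWithin] with x hx using (pairWave_neg k f hx t).symm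

theorem IsKernelPair.tendsto_slope (hQ : Integrable Q) (hk : IsKernelPair Q k)
    (hf : ∀ i, SmoothCausal (f i)) (t : ℝ) :
    Tendsto (fun x => slope Q k f x t) (𝓝[>] 0) (𝓝 (slopeRight Q k f 0 t)) ∧
    Tendsto (fun x => slope Q k f x t) (𝓝[<] 0) (𝓝 (slopeLeft Q k f 0 t)) := by
  have c1 : Continuous fun x => slopeRight Q k f x t :=
    (hk.continuous_slopeRight hQ hf).comp (by fun_prop : Continuous fun x : ℝ => (x, t))
  have c2 : Continuous fun x => slopeLeft Q k f x t :=
    (hk.continuous_slopeLeft hQ hf).comp (by fun_prop : Continuous fun x : ℝ => (x, t))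
  constructor
  · refine ((c1.tendsto 0).mono_left nhdsWithin_le_nhds).congr' ?_
    filter_upwards [self_mem_nhdsWithin] with x hx using (if_pos hx).symm
  · refine ((c2.tendsto 0).mono_left nhdsWithin_le_nhds).congr' ?_
    filter_upwards [self_mem_nhdsWithin] with x hx using (if_neg (not_lt.2 (le_of_lt hx))).symm

/-- The potential does not depend on time, so the odd reflection about `T` solves the same equation
off the origin. It vanishes at `t = T`, where its velocity is minus the wave of the differentiated
control. -/
theorem IsKernelPair.isMultiplier_reflected (hQ : Integrable Q) (hk : IsKernelPair Q k)
    (hQc : ∀ x, x ≠ 0 → |x| < T → ContinuousAt Q x) (hg : ∀ i, SmoothCausal (g i)) :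
    IsMultiplier T (reflected T (pairWave k g))
      (fun x t => -(pairWave k (pairDeriv g) x (2 * T - t) + pairWave k (pairDeriv g) x t) / 2)
      (reflected T (pairWave k (pairDeriv (pairDeriv g))))
      (reflected T (slope Q k g))
      (fun x t => Q x * reflected T (pairWave k g) x t
        + reflected T (pairWave k (pairDeriv (pairDeriv g))) x t)
      (reflected T (waveRight k g) 0) (reflected T (waveLeft k g) 0)
      (reflected T (slopeRight Q k g) 0) (reflected T (slopeLeft Q k g) 0) := by
  have hg1 := pairDeriv_smooth hg
  have hg2 := pairDeriv_smooth hg1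
  have meas : ∀ {h : Fin 2 → ℝ → ℝ}, (∀ i, SmoothCausal (h i)) →
      Measurable fun p : ℝ × ℝ => reflected T (pairWave k h) p.1 p.2 := fun hh =>
    measurable_reflected (hk.measurable_wave hh) T
  obtain ⟨B, hB0, hB⟩ := hk.exists_bound_wave hg (2 * T)
  obtain ⟨C, hC0, hC⟩ := hk.exists_bound_wave hg2 (2 * T)
  have bd : ∀ {h : Fin 2 → ℝ → ℝ} {B : ℝ}, (∀ x t, t ≤ 2 * T → |pairWave k h x t| ≤ B) →
      ∀ x, ∀ t ∈ Icc 0 T, |reflected T (pairWave k h) x t| ≤ B := by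
    intro h B hB x t ht
    have h1 := hB x (2 * T - t) (by linarith [ht.1])
    have h2 := hB x t (by linarith [ht.1, ht.2])
    rw [reflected, abs_div, abs_two]
    have := abs_sub (pairWave k h x (2 * T - t)) (pairWave k h x t)
    linarith
  have st : ∀ t ∈ Ioo 0 T, ∀ x, x ≠ 0 → |x| < T → HasDerivAt
      (fun x => reflected T (slope Q k g) x t) (Q x * reflected T (pairWave k g) x t
        + reflected T (pairWave k (pairDeriv (pairDeriv g))) x t) x := fun t _ x hx hxT => by
    refine (hasDerivAt_reflected_space (w := fun x t => Q x * pairWave k g x t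
      + pairWave k (pairDeriv (pairDeriv g)) x t)
      (hk.hasDerivAt_slope hQ hg (hQc x hx hxT) hx) T t).congr_deriv ?_
    simp only [reflected]
    ring
  have int : ∀ t ∈ Ioo 0 T, IntegrableOn (fun x => Q x * reflected T (pairWave k g) x t
        + reflected T (pairWave k (pairDeriv (pairDeriv g))) x t) (Ioo (-t) t) := fun t ht => by
    have htT : t ∈ Icc 0 T := ⟨ht.1.le, ht.2.le⟩
    have m : ∀ h : Fin 2 → ℝ → ℝ, (∀ i, SmoothCausal (h i)) →
        AEStronglyMeasurable (fun x => reflected T (pairWave k h) x t) := fun h hh =>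
      ((meas hh).comp (by fun_prop : Measurable fun x : ℝ => (x, t))).aestronglyMeasurable
    have i1 : IntegrableOn (fun x => Q x * reflected T (pairWave k g) x t) (Ioo (-t) t) :=
      hQ.integrableOn.mul_bdd (c := B) (m _ hg).restrict (Eventually.of_forall fun x => bd hB x t htT)
    have i2 : IntegrableOn (fun x => reflected T (pairWave k (pairDeriv (pairDeriv g))) x t)
        (Ioo (-t) t) :=
      Measure.integrableOn_of_bounded (M := C) measure_Ioo_lt_top.ne (m _ hg2)
        (Eventually.of_forall fun x => bd hC x t htT)
    exact Integrable.add i1 i2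
  have ti : ∀ x t, HasDerivAt (reflected T (pairWave k g) x)
      (-(pairWave k (pairDeriv g) x (2 * T - t) + pairWave k (pairDeriv g) x t) / 2) t :=
    fun x t => hasDerivAt_reflected (fun t => hk.hasDerivAt_wave_time hg x t) T t
  have ti2 : ∀ x t, HasDerivAt
      (fun t => -(pairWave k (pairDeriv g) x (2 * T - t) + pairWave k (pairDeriv g) x t) / 2)
      (reflected T (pairWave k (pairDeriv (pairDeriv g))) x t) t :=
    fun x t => hasDerivAt_reflected_add (fun t => hk.hasDerivAt_wave_time hg1 x t) T t
  have r1 : ∀ t, Tendsto (fun x => reflected T (pairWave k g) x t) (𝓝[>] 0)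
      (𝓝 (reflected T (waveRight k g) 0 t)) :=
    tendsto_reflected (fun t => (hk.tendsto_wave hg t).1) T
  have r2 : ∀ t, Tendsto (fun x => reflected T (pairWave k g) x t) (𝓝[<] 0)
      (𝓝 (reflected T (waveLeft k g) 0 t)) :=
    tendsto_reflected (fun t => (hk.tendsto_wave hg t).2) T
  have r3 : ∀ t, Tendsto (fun x => reflected T (slope Q k g) x t) (𝓝[>] 0)
      (𝓝 (reflected T (slopeRight Q k g) 0 t)) :=
    tendsto_reflected (fun t => (hk.tendsto_slope hQ hg t).1) T
  have r4 : ∀ t, Tendsto (fun x => reflected T (slope Q k g) x t) (𝓝[<] 0)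
      (𝓝 (reflected T (slopeLeft Q k g) 0 t)) :=
    tendsto_reflected (fun t => (hk.tendsto_slope hQ hg t).2) T
  exact
  { time := ti
    time_two := ti2
    continuous := fun x => continuous_reflected (hk.continuous_wave_time hg2 x) T
    measurable := meas hg
    measurable_two := meas hg2
    bound := ⟨max B C, le_max_of_le_left hB0, fun x t ht =>
      ⟨(bd hB x t ht).trans (le_max_left _ _), (bd hC x t ht).trans (le_max_right _ _)⟩⟩
    space := fun t _ x hx _ => hasDerivAt_reflected_space (hk.hasDerivAt_wave_space hQ hg hx) T t
    space_two := st
    integrable := int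
    right := fun t _ => r1 t
    left := fun t _ => r2 t
    slope_right := fun t _ => r3 t
    slope_left := fun t _ => r4 t }

/-- The inner product of two waves at time `T` in terms of their boundary values. -/
theorem IsKernelPair.inner_wave (hQ : Integrable Q) (hk : IsKernelPair Q k) (hT : 0 < T)
    (hQc : ∀ x, x ≠ 0 → |x| < T → ContinuousAt Q x) (hf : IsTestControl T f)
    (hg : IsTestControl T g) :
    ∫ x in Ioo (-T) T, pairWave k f x T * pairWave k g x T
      = 1 / 2 * ∫ s in (0 : ℝ)..T, (f 0 s * g 0 s + f 1 s * g 1 s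
        - f 1 s * (pairScattered k g 0 (2 * T - s) + pairScattered k g 0 s)
        - g 0 s * pairFlux Q k (pairPrimitive f) 0 s
        + f 0 s * (pairFlux Q k (pairPrimitive g) 0 (2 * T - s)
          - pairFlux Q k (pairPrimitive g) 0 s)
        - g 1 s * pairScattered k f 0 s) := by
  have hfs := hf.smoothCausal
  have hgs := hg.smoothCausal
  have hpg := pairPrimitive_smooth hgs
  have hpf := pairPrimitive_smooth hfs
  have h := hk.green hQ hT hQc hfs (hk.isMultiplier_reflected hQ hQc hpg)
  -- At `t = T` the reflected wave is zero, and its control being the primitive of `g`, its velocity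
  -- is minus the wave of `g`: the left side of Green's identity is minus the inner product.
  have e1 : ∀ x, pairWave k f x T * (-(pairWave k (pairDeriv (pairPrimitive g)) x (2 * T - T)
      + pairWave k (pairDeriv (pairPrimitive g)) x T) / 2)
      - pairWave k (pairDeriv f) x T * reflected T (pairWave k (pairPrimitive g)) x T
      = -(pairWave k f x T * pairWave k g x T) := by
    intro x
    rw [pairDeriv_pairPrimitive hgs, reflected, two_mul, add_sub_cancel_right]
    ring
  have e2 : ∀ x t, pairWave k f x t * (reflected T
      (pairWave k (pairDeriv (pairDeriv (pairPrimitive g)))) x t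
      - (Q x * reflected T (pairWave k (pairPrimitive g)) x t
        + reflected T (pairWave k (pairDeriv (pairDeriv (pairPrimitive g)))) x t)
      + Q x * reflected T (pairWave k (pairPrimitive g)) x t) = 0 := by
    intro x t
    ring
  simp only [e1, e2, integral_zero, zero_add, integral_neg] at h
  -- the antiderivative which accounts for the integrations by parts
  set a : Fin 2 → ℝ → ℝ := fun i t => (pairPrimitive g i (2 * T - t) - pairPrimitive g i t) / 2
    with ha
  set n : ℝ → ℝ := fun t => (pairScattered k (pairPrimitive g) 0 (2 * T - t)
    - pairScattered k (pairPrimitive g) 0 t) / 2 with hn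
  set Z : ℝ → ℝ := fun t => f 1 t * (-(a 1 t) / 2 + n t) - f 0 t * a 0 t / 2
    + pairFlux Q k (pairPrimitive f) 0 t * a 0 t with hZ
  have dp : ∀ i t, HasDerivAt (pairPrimitive g i) (g i t) t := fun i t => by
    have := (hpg i).hasDerivAt t
    rwa [show deriv (pairPrimitive g i) = g i from (hgs i).deriv_primitive] at this
  have da : ∀ i t, HasDerivAt (a i) (-(g i (2 * T - t) + g i t) / 2) t := fun i t =>
    hasDerivAt_reflected (dp i) T t
  have dn : ∀ t, HasDerivAt n (-(pairScattered k g 0 (2 * T - t) + pairScattered k g 0 t) / 2) t :=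
    fun t => hasDerivAt_reflected (fun t => by
      have := hk.hasDerivAt_scattered_time hpg 0 t
      rwa [pairDeriv_pairPrimitive hgs] at this) T t
  have dm : ∀ t, HasDerivAt (fun t => pairFlux Q k (pairPrimitive f) 0 t) (pairFlux Q k f 0 t) t :=
    fun t => by
      have := hk.hasDerivAt_flux_time hQ hpf 0 t
      rwa [pairDeriv_pairPrimitive hfs] at this
  have dZ := fun t => (((((hfs 1).hasDerivAt t).mul (((da 1 t).neg.div_const 2).add (dn t))).sub
    ((((hfs 0).hasDerivAt t).mul (da 0 t)).div_const 2)).add ((dm t).mul (da 0 t)))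
  have cs : ∀ {h : Fin 2 → ℝ → ℝ}, (∀ i, SmoothCausal (h i)) →
      Continuous fun t => pairScattered k h 0 t := fun hh =>
    (hk.continuous_scattered (fun i => (hh i).causal) fun i => (hh i).locallyIntegrable).comp
      (by fun_prop : Continuous fun t : ℝ => ((0 : ℝ), t))
  have cm : ∀ {h : Fin 2 → ℝ → ℝ}, (∀ i, SmoothCausal (h i)) →
      Continuous fun t => pairFlux Q k h 0 t := fun hh =>
    (hk.continuous_flux hQ hh).comp (by fun_prop : Continuous fun t : ℝ => ((0 : ℝ), t))
  have c1 := cs hfs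
  have c2 := cs hgs
  have c3 := cs hpg
  have c4 := cm hfs
  have c5 := cm hpf
  have c6 := cm hpg
  have cf := fun i => (hfs i).continuous
  have cf' := fun i => (hfs i).deriv.continuous
  have cg := fun i => (hgs i).continuous
  have cp := fun i => (hpg i).continuous
  have cf0 := cf 0
  have cf1 := cf 1
  have cf0' := cf' 0
  have cf1' := cf' 1
  have cg0 := cg 0
  have cg1 := cg 1
  have cp0 := cp 0
  have cp1 := cp 1
  have iZ := integral_eq_zero_of_hasDerivAt (a := 0) (b := T) dZ (by
      simp only [ha, hn, Pi.neg_apply]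
      fun_prop) (by
      have z1 : f 1 0 = 0 := (hfs 1).causal 0 le_rfl
      have z0 : f 0 0 = 0 := (hfs 0).causal 0 le_rfl
      have z2 : pairFlux Q k (pairPrimitive f) 0 0 = 0 :=
        hk.flux_eq_zero (fun i => (hpf i).causal) (by simp)
      simp [z0, z1, z2]) (by
      have z1 : f 1 T = 0 := hf.eq_zero 1 (by simp)
      have z0 : a 0 T = 0 := by simp [ha, two_mul]
      simp [z0, z1])
  rw [neg_eq_iff_eq_neg] at h
  rw [h]
  have key : ∀ t ∈ uIcc 0 T, wronskianJump Q k f (reflected T (waveRight k (pairPrimitive g)) 0)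
      (reflected T (waveLeft k (pairPrimitive g)) 0)
      (reflected T (slopeRight Q k (pairPrimitive g)) 0)
      (reflected T (slopeLeft Q k (pairPrimitive g)) 0) t
      = (deriv (f 1) t * (-(a 1) / 2 + n) t + f 1 t * ((-(-(g 1 (2 * T - t) + g 1 t) / 2)) / 2
          + -(pairScattered k g 0 (2 * T - t) + pairScattered k g 0 t) / 2)
          - (deriv (f 0) t * a 0 t + f 0 t * (-(g 0 (2 * T - t) + g 0 t) / 2)) / 2
          + (pairFlux Q k f 0 t * a 0 t + pairFlux Q k (pairPrimitive f) 0 t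
            * (-(g 0 (2 * T - t) + g 0 t) / 2)))
        - 1 / 2 * (f 0 t * g 0 t + f 1 t * g 1 t
        - f 1 t * (pairScattered k g 0 (2 * T - t) + pairScattered k g 0 t)
        - g 0 t * pairFlux Q k (pairPrimitive f) 0 t
        + f 0 t * (pairFlux Q k (pairPrimitive g) 0 (2 * T - t)
          - pairFlux Q k (pairPrimitive g) 0 t)
        - g 1 t * pairScattered k f 0 t) := by
    intro t ht
    rw [uIcc_of_le hT.le] at ht
    -- Reflected times lie beyond `T`, where the control is switched off; at these times only traces
    -- of the scattered wave survive in the jump.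
    have z : ∀ i, g i (2 * T - t) = 0 := fun i => hg.eq_zero i fun hm => by
      linarith [hm.2, ht.2]
    have d : ∀ i, deriv (pairPrimitive g i) = g i := fun i => (hgs i).deriv_primitive
    simp only [wronskianJump, reflected, waveRight, waveLeft, slopeRight, slopeLeft, d, z, ha, hn,
      sub_zero, add_zero, zero_add, Pi.add_apply, Pi.div_apply, Pi.neg_apply, Pi.ofNat_apply]
    ring
  rw [intervalIntegral.integral_congr key, intervalIntegral.integral_sub,
    intervalIntegral.integral_const_mul, neg_sub]
  · refine (sub_eq_iff_eq_add.2 ?_)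
    refine (add_zero _).symm.trans (congrArg _ ?_)
    exact iZ.symm
  all_goals
    refine Continuous.intervalIntegrable ?_ _ _
    try simp only [ha, hn, Pi.add_apply, Pi.div_apply, Pi.neg_apply, Pi.ofNat_apply]
    fun_prop

end InnerProduct

/-! ### Boundary values of waves as convolutions -/

/-- Bounded measurable convolution kernels which vanish on the negative half-line. -/
structure IsBoundedKernel (a : ℝ → ℝ) : Prop where
  measurable : Measurable a
  exists_bound : ∃ B, 0 ≤ B ∧ ∀ s, |a s| ≤ B
  causal : Causal a

/-- The second row of the response matrix, cut off at `2π`. -/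
def scatterKernel (Q : ℝ → ℝ) (k : Fin 2 → ℝ → ℝ → ℝ) (j : Fin 2) : ℝ → ℝ :=
  indicator (Ioo 0 (2 * π)) fun s => responseMatrix Q k s 1 j

/-- The primitive of the first row of the response matrix, cut off at `2π`. -/
def fluxPrimitive (Q : ℝ → ℝ) (k : Fin 2 → ℝ → ℝ → ℝ) (j : Fin 2) : ℝ → ℝ :=
  indicator (Ioo 0 (2 * π)) (primitive (responseMatrix Q k) 0 j)

theorem integral_conv_indicator {a g : ℝ → ℝ} (hg : Causal g) {t : ℝ} (ht : t ∈ Icc 0 (2 * π)) :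
    ∫ s, indicator (Ioo 0 (2 * π)) a (t - s) * g s = ∫ s in (0 : ℝ)..t, a (t - s) * g s := by
  rw [integral_eq_intervalIntegral_of_causal (t := t) ht.1,
    intervalIntegral.integral_of_le ht.1, intervalIntegral.integral_of_le ht.1,
    integral_Ioc_eq_integral_Ioo, integral_Ioc_eq_integral_Ioo]
  · refine setIntegral_congr_fun measurableSet_Ioo fun s hs => ?_
    have hm : t - s ∈ Ioo 0 (2 * π) := ⟨by linarith [hs.2], by linarith [hs.1, ht.2]⟩
    simp only [indicator_of_mem hm]
  · intro s hs
    rw [hg s hs, mul_zero]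
  · intro s hs
    rw [indicator_of_notMem, zero_mul]
    exact fun h => by linarith [h.1]

theorem continuousOn_primitive {a : ℝ → ℝ} {T : ℝ} (ha : IntegrableOn a (Ioo 0 T)) (hT : 0 < T) :
    ContinuousOn (fun s => ∫ α in (0 : ℝ)..s, a α) (Icc 0 T) := by
  have h : IntegrableOn a (uIcc 0 T) := by
    rwa [uIcc_of_le hT.le, integrableOn_Icc_iff_integrableOn_Ioo]
  simpa [uIcc_of_le hT.le] using intervalIntegral.continuousOn_primitive_interval h

theorem isBoundedKernel_indicator {a : ℝ → ℝ} {T : ℝ} {b : ℝ → ℝ} (hb : ContinuousOn b (Icc 0 T))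
    (hab : EqOn a b (Ioo 0 T)) : IsBoundedKernel (indicator (Ioo 0 T) a) := by
  have e : indicator (Ioo 0 T) a = indicator (Ioo 0 T) b := indicator_congr hab
  rw [e]
  obtain ⟨B, hB⟩ := isCompact_Icc.exists_bound_of_continuousOn hb
  refine ⟨?_, ⟨max B 0, le_max_right _ _, fun s => ?_⟩, fun s hs => ?_⟩
  · rw [← piecewise_eq_indicator]
    exact (hb.mono Ioo_subset_Icc_self).measurable_piecewise continuousOn_const measurableSet_Ioo
  · by_cases hs : s ∈ Ioo 0 T
    · rw [indicator_of_mem hs]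
      exact (hB s (Ioo_subset_Icc_self hs)).trans (le_max_left _ _)
    · rw [indicator_of_notMem hs, abs_zero]
      exact le_max_right _ _
  · exact indicator_of_notMem (fun h => by linarith [h.1]) _

namespace IsKernelPair

variable {Q : ℝ → ℝ} {k : Fin 2 → ℝ → ℝ → ℝ} {f g : Fin 2 → ℝ → ℝ}

theorem isBoundedKernel_scatterKernel (hk : IsKernelPair Q k) (j : Fin 2) :
    IsBoundedKernel (scatterKernel Q k j) := by
  obtain ⟨κ, hκ, he⟩ := (hk j).exists_continuous
  refine isBoundedKernel_indicator (b := fun s => -κ (0, s)) (by fun_prop) fun s hs => ?_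
  have := he 0 s (by simpa using hs.1.le)
  fin_cases j <;> simp [responseMatrix, ← this]

theorem isBoundedKernel_fluxPrimitive (hQ : Integrable Q) (hk : IsKernelPair Q k) (j : Fin 2) :
    IsBoundedKernel (fluxPrimitive Q k j) :=
  isBoundedKernel_indicator (continuousOn_primitive (hk.integrableOn_response hQ 0 j)
    (by positivity)) fun _ _ => rfl

theorem scattered_zero_eq_conv (hk : IsKernelPair Q k) (hg : ∀ i, SmoothCausal (g i)) {t : ℝ}
    (ht : t ∈ Icc 0 (2 * π)) :
    pairScattered k g 0 t = -∑ j, ∫ s, scatterKernel Q k j (t - s) * g j s := by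
  rw [hk.scattered_zero_eq hg ht.1, ← Finset.sum_neg_distrib]
  refine Finset.sum_congr rfl fun j _ => ?_
  rw [scatterKernel, integral_conv_indicator (hg j).causal ht, ← intervalIntegral.integral_neg]
  refine intervalIntegral.integral_congr fun s _ => ?_
  fin_cases j <;> simp [responseMatrix]

/-- The first row of the response matrix is only integrable. Moving the primitive from the control
to the kernel replaces it by the bounded kernel `fluxPrimitive`. -/
theorem flux_primitive_zero_eq_conv (hQ : Integrable Q) (hk : IsKernelPair Q k)
    (hg : ∀ i, SmoothCausal (g i)) {t : ℝ} (ht : t ∈ Icc 0 (2 * π)) :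
    pairFlux Q k (pairPrimitive g) 0 t = ∑ j, ∫ s, fluxPrimitive Q k j (t - s) * g j s := by
  have hpg := pairPrimitive_smooth hg
  have d : ∀ τ, HasDerivAt (fun τ => pairFlux Q k (pairPrimitive g) 0 τ) (pairFlux Q k g 0 τ) τ :=
    fun τ => by
      have := hk.hasDerivAt_flux_time hQ hpg 0 τ
      rwa [pairDeriv_pairPrimitive hg] at this
  have c : Continuous fun τ => pairFlux Q k g 0 τ :=
    (hk.continuous_flux hQ hg).comp (by fun_prop : Continuous fun t : ℝ => ((0 : ℝ), t))
  have h0 : pairFlux Q k (pairPrimitive g) 0 0 = 0 :=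
    hk.flux_eq_zero (fun i => (hpg i).causal) (by simp)
  have h := intervalIntegral.integral_eq_sub_of_hasDerivAt (fun τ _ => d τ)
    (c.intervalIntegrable 0 t)
  rw [h0, sub_zero] at h
  rw [← h]
  set a : Fin 2 → ℝ → ℝ := fun j => indicator (Ioo 0 (2 * π)) (fluxKernel Q (profile j) (k j))
    with ha
  have hai : ∀ j, Integrable (a j) := fun j =>
    (integrable_indicator_iff measurableSet_Ioo).2 (hk.integrableOn_fluxKernel hQ j)
  have ha0 : ∀ j, ∀ t < 0, a j t = 0 := fun j t ht =>
    indicator_of_notMem (fun h => by linarith [h.1]) _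
  have e : ∀ j, ∀ τ ∈ uIcc 0 t, flux Q (profile j) (k j) (g j) 0 τ
      = ∫ s, a j (τ - s) * g j s := fun j τ hτ => by
    rw [uIcc_of_le ht.1] at hτ
    rw [(hk j).flux_zero_eq hQ (measurable_profile j) (abs_profile_le j) (hg j).causal
      (hg j).continuous hτ.1, ha, integral_conv_indicator (hg j).causal ⟨hτ.1, hτ.2.trans ht.2⟩]
  have cc : ∀ j, Continuous fun τ => flux Q (profile j) (k j) (g j) 0 τ := fun j =>
    ((hk j).continuous_flux hQ (measurable_profile j) (abs_profile_le j) (hg j).causal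
      (hg j).continuous).comp (by fun_prop : Continuous fun t : ℝ => ((0 : ℝ), t))
  simp only [pairFlux]
  rw [intervalIntegral.integral_finsetSum fun j _ => (cc j).intervalIntegrable _ _]
  refine Finset.sum_congr rfl fun j _ => ?_
  rw [intervalIntegral.integral_congr (e j)]
  rw [integral_causal_conv (hai j).locallyIntegrable (hg j).locallyIntegrable (ha0 j)
    (hg j).causal]
  congr 1
  ext s
  rcases le_or_gt s 0 with hs | hs
  · rw [(hg j).causal s hs, mul_zero, mul_zero]
  congr 1
  rcases le_or_gt t s with hts | hts
  · rw [fluxPrimitive, indicator_of_notMem (fun h => by linarith [h.1]),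
      integral_zero_of_support le_rfl (ha0 j) (by linarith)]
  · have hm : t - s ∈ Ioo 0 (2 * π) := ⟨by linarith, by linarith [ht.2]⟩
    rw [fluxPrimitive, indicator_of_mem hm, primitive, intervalIntegral.integral_of_le hm.1.le,
      intervalIntegral.integral_of_le hm.1.le]
    refine setIntegral_congr_fun measurableSet_Ioc fun σ hσ => ?_
    have hσ' : σ ∈ Ioo 0 (2 * π) := ⟨hσ.1, hσ.2.trans_lt hm.2⟩
    refine (indicator_of_mem hσ' _).trans ?_
    fin_cases j <;> simp [responseMatrix]

end IsKernelPair

/-! ### Bilinear forms with bounded kernels -/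

/-- Bounded measurable kernels of integral operators. -/
structure IsIntegralKernel (A : ℝ → ℝ → ℝ) : Prop where
  measurable : Measurable fun p : ℝ × ℝ => A p.1 p.2
  exists_bound : ∃ B, 0 ≤ B ∧ ∀ t s, |A t s| ≤ B

/-- The integral operator with kernel `A`. -/
def integralOp (A : ℝ → ℝ → ℝ) (f : ℝ → ℝ) (t : ℝ) : ℝ := ∫ s, A t s * f s

/-- The bilinear form of an integral operator. -/
def kernelForm (A : ℝ → ℝ → ℝ) (f g : ℝ → ℝ) : ℝ := ∫ t, g t * integralOp A f t

theorem IsBoundedKernel.comp {a : ℝ → ℝ} (ha : IsBoundedKernel a) {φ : ℝ → ℝ → ℝ}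
    (hφ : Measurable fun p : ℝ × ℝ => φ p.1 p.2) : IsIntegralKernel fun t s => a (φ t s) where
  measurable := ha.measurable.comp hφ
  exists_bound := by
    obtain ⟨B, hB0, hB⟩ := ha.exists_bound
    exact ⟨B, hB0, fun t s => hB _⟩

namespace IsIntegralKernel

variable {A A' : ℝ → ℝ → ℝ} {f g : ℝ → ℝ}

theorem add (hA : IsIntegralKernel A) (hA' : IsIntegralKernel A') :
    IsIntegralKernel fun t s => A t s + A' t s where
  measurable := hA.measurable.add hA'.measurable
  exists_bound := by
    obtain ⟨B, hB0, hB⟩ := hA.exists_bound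
    obtain ⟨B', hB'0, hB'⟩ := hA'.exists_bound
    exact ⟨B + B', by positivity, fun t s => (abs_add_le _ _).trans (add_le_add (hB t s) (hB' t s))⟩

theorem neg (hA : IsIntegralKernel A) : IsIntegralKernel fun t s => -A t s where
  measurable := hA.measurable.neg
  exists_bound := by
    obtain ⟨B, hB0, hB⟩ := hA.exists_bound
    exact ⟨B, hB0, fun t s => by rw [abs_neg]; exact hB t s⟩

theorem sub (hA : IsIntegralKernel A) (hA' : IsIntegralKernel A') :
    IsIntegralKernel fun t s => A t s - A' t s := by
  simpa only [sub_eq_add_neg] using hA.add hA'.neg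

theorem flip (hA : IsIntegralKernel A) : IsIntegralKernel fun t s => A s t where
  measurable := hA.measurable.comp measurable_swap
  exists_bound := by
    obtain ⟨B, hB0, hB⟩ := hA.exists_bound
    exact ⟨B, hB0, fun t s => hB _ _⟩

theorem integrable_prod (hA : IsIntegralKernel A) (hf : Integrable f) (hg : Integrable g) :
    Integrable (fun p : ℝ × ℝ => A p.1 p.2 * (g p.1 * f p.2)) := by
  obtain ⟨B, hB0, hB⟩ := hA.exists_bound
  exact (hg.mul_prod hf).bdd_mul (c := B) hA.measurable.aestronglyMeasurable
    (Eventually.of_forall fun p => hB _ _)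

theorem integrable_apply (hA : IsIntegralKernel A) (hf : Integrable f) (t : ℝ) :
    Integrable fun s => A t s * f s := by
  obtain ⟨B, hB0, hB⟩ := hA.exists_bound
  exact hf.bdd_mul (c := B)
    (hA.measurable.comp (by fun_prop : Measurable fun s : ℝ => (t, s))).aestronglyMeasurable
    (Eventually.of_forall fun p => hB _ _)

theorem integrable_form (hA : IsIntegralKernel A) (hf : Integrable f) (hg : Integrable g) :
    Integrable fun t => g t * integralOp A f t := by
  refine (hA.integrable_prod hf hg).integral_prod_left.congr (Eventually.of_forall fun t => ?_)
  simp only [integralOp]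
  rw [← integral_const_mul]
  congr 1
  ext s
  ring

theorem kernelForm_swap (hA : IsIntegralKernel A) (hf : Integrable f) (hg : Integrable g) :
    kernelForm A f g = kernelForm (fun t s => A s t) g f := by
  have h := integral_integral_swap (f := fun t s => A t s * (g t * f s)) (hA.integrable_prod hf hg)
  refine Eq.trans (integral_congr_ae (Eventually.of_forall fun t => ?_))
    (h.trans (integral_congr_ae (Eventually.of_forall fun t => ?_)))
  all_goals
    simp only [integralOp]
    rw [← integral_const_mul]
    congr 1
    ext s
    ring

theorem integralOp_add (hA : IsIntegralKernel A) (hA' : IsIntegralKernel A') (hf : Integrable f)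
    (t : ℝ) : integralOp (fun t s => A t s + A' t s) f t = integralOp A f t + integralOp A' f t := by
  simp only [integralOp, add_mul]
  exact integral_add (hA.integrable_apply hf t) (hA'.integrable_apply hf t)

theorem integralOp_neg (A : ℝ → ℝ → ℝ) (f : ℝ → ℝ)
    (t : ℝ) : integralOp (fun t s => -A t s) f t = -integralOp A f t := by
  simp only [integralOp, neg_mul]
  exact integral_neg _

theorem kernelForm_add (hA : IsIntegralKernel A) (hA' : IsIntegralKernel A') (hf : Integrable f)
    (hg : Integrable g) :
    kernelForm (fun t s => A t s + A' t s) f g = kernelForm A f g + kernelForm A' f g := by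
  simp only [kernelForm, hA.integralOp_add hA' hf, mul_add]
  exact integral_add (hA.integrable_form hf hg) (hA'.integrable_form hf hg)

theorem kernelForm_neg (A : ℝ → ℝ → ℝ) (f g : ℝ → ℝ) :
    kernelForm (fun t s => -A t s) f g = -kernelForm A f g := by
  simp only [kernelForm, integralOp_neg, mul_neg]
  exact integral_neg _

theorem kernelForm_sub (hA : IsIntegralKernel A) (hA' : IsIntegralKernel A') (hf : Integrable f)
    (hg : Integrable g) :
    kernelForm (fun t s => A t s - A' t s) f g = kernelForm A f g - kernelForm A' f g := by
  simp only [sub_eq_add_neg, hA.kernelForm_add hA'.neg hf hg, kernelForm_neg]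

theorem abs_integralOp_le {B : ℝ} (hB : ∀ t s, |A t s| ≤ B) (hf : Integrable f) (t : ℝ) :
    |integralOp A f t| ≤ B * ∫ s, |f s| := by
  rw [← integral_const_mul]
  refine norm_integral_le_of_norm_le (f := fun s => A t s * f s) (hf.abs.const_mul B)
    (Eventually.of_forall fun s => ?_)
  rw [norm_mul]
  exact mul_le_mul_of_nonneg_right (hB t s) (abs_nonneg _)

end IsIntegralKernel

theorem IsTestControl.integrable_apply {T : ℝ} {f : Fin 2 → ℝ → ℝ} (hf : IsTestControl T f)
    (i : Fin 2) : Integrable (f i) :=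
  (hf i).1.continuous.integrable_of_hasCompactSupport (hf i).2.1

/-- `F` is integrable with integral `a`. -/
def HasLineIntegral (F : ℝ → ℝ) (a : ℝ) : Prop := Integrable F ∧ ∫ s, F s = a

namespace HasLineIntegral

variable {F G : ℝ → ℝ} {a b : ℝ}

theorem add (hF : HasLineIntegral F a) (hG : HasLineIntegral G b) :
    HasLineIntegral (fun s => F s + G s) (a + b) :=
  ⟨hF.1.add hG.1, by rw [integral_add hF.1 hG.1, hF.2, hG.2]⟩

theorem sub (hF : HasLineIntegral F a) (hG : HasLineIntegral G b) :
    HasLineIntegral (fun s => F s - G s) (a - b) :=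
  ⟨hF.1.sub hG.1, by rw [integral_sub hF.1 hG.1, hF.2, hG.2]⟩

end HasLineIntegral

/-! ### The kernel of the connecting operator -/

/-- The integral part of twice the connecting operator, in the form produced by Green's formula. -/
def greenKernel (Q : ℝ → ℝ) (k : Fin 2 → ℝ → ℝ → ℝ) (T : ℝ) : Fin 2 → Fin 2 → ℝ → ℝ → ℝ :=
  ![![fun t s => fluxPrimitive Q k 0 (2 * T - s - t) - fluxPrimitive Q k 0 (s - t)
        - fluxPrimitive Q k 0 (t - s),
      fun t s => scatterKernel Q k 0 (2 * T - s - t) + scatterKernel Q k 0 (s - t)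
        - fluxPrimitive Q k 1 (t - s)],
    ![fun t s => fluxPrimitive Q k 1 (2 * T - s - t) - fluxPrimitive Q k 1 (s - t)
        + scatterKernel Q k 0 (t - s),
      fun t s => scatterKernel Q k 1 (2 * T - s - t) + scatterKernel Q k 1 (s - t)
        + scatterKernel Q k 1 (t - s)]]

namespace IsKernelPair

variable {Q : ℝ → ℝ} {k : Fin 2 → ℝ → ℝ → ℝ} {f g : Fin 2 → ℝ → ℝ} {T : ℝ}

theorem isIntegralKernel_greenKernel (hQ : Integrable Q) (hk : IsKernelPair Q k) (T : ℝ)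
    (i j : Fin 2) : IsIntegralKernel (greenKernel Q k T i j) := by
  have P := hk.isBoundedKernel_fluxPrimitive hQ
  have S := hk.isBoundedKernel_scatterKernel
  have m1 : Measurable fun p : ℝ × ℝ => 2 * T - p.2 - p.1 := by fun_prop
  have m2 : Measurable fun p : ℝ × ℝ => p.2 - p.1 := by fun_prop
  have m3 : Measurable fun p : ℝ × ℝ => p.1 - p.2 := by fun_prop
  fin_cases i <;> fin_cases j
  · exact (((P 0).comp (φ := fun t s => 2 * T - s - t) m1).sub
      ((P 0).comp (φ := fun t s => s - t) m2)).sub ((P 0).comp (φ := fun t s => t - s) m3)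
  · exact (((S 0).comp (φ := fun t s => 2 * T - s - t) m1).add
      ((S 0).comp (φ := fun t s => s - t) m2)).sub ((P 1).comp (φ := fun t s => t - s) m3)
  · exact (((P 1).comp (φ := fun t s => 2 * T - s - t) m1).sub
      ((P 1).comp (φ := fun t s => s - t) m2)).add ((S 0).comp (φ := fun t s => t - s) m3)
  · exact (((S 1).comp (φ := fun t s => 2 * T - s - t) m1).add
      ((S 1).comp (φ := fun t s => s - t) m2)).add ((S 1).comp (φ := fun t s => t - s) m3)

/-- The traces in `inner_wave` are taken at the times `s` and `2T - s`, which lie in `[0, 2π]`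
because `T ≤ π`, so all are convolutions with the response kernels. Terms in which a kernel acts on
`g` are transposed, so that all kernels act on `f`. -/
theorem inner_wave_eq_kernelForm (hQ : Integrable Q) (hk : IsKernelPair Q k) (hT : 0 < T)
    (hTπ : T ≤ π) (hQc : ∀ x, x ≠ 0 → |x| < T → ContinuousAt Q x) (hf : IsTestControl T f)
    (hg : IsTestControl T g) :
    ∫ x in Ioo (-T) T, pairWave k f x T * pairWave k g x T
      = 1 / 2 * ((∫ s, f 0 s * g 0 s) + (∫ s, f 1 s * g 1 s)
        + ∑ i, ∑ j, kernelForm (greenKernel Q k T i j) (f j) (g i)) := by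
  have hfs := hf.smoothCausal
  have hgs := hg.smoothCausal
  have hfi : ∀ i, Integrable (f i) := fun i => hf.integrable_apply i
  have hgi : ∀ i, Integrable (g i) := fun i => hg.integrable_apply i
  have P := hk.isBoundedKernel_fluxPrimitive hQ
  have S := hk.isBoundedKernel_scatterKernel
  have m1 : Measurable fun p : ℝ × ℝ => 2 * T - p.2 - p.1 := by fun_prop
  have m2 : Measurable fun p : ℝ × ℝ => p.2 - p.1 := by fun_prop
  have m3 : Measurable fun p : ℝ × ℝ => p.1 - p.2 := by fun_prop
  have k1 : ∀ {a}, IsBoundedKernel a → IsIntegralKernel fun t s => a (2 * T - s - t) :=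
    fun ha => ha.comp m1
  have k2 : ∀ {a}, IsBoundedKernel a → IsIntegralKernel fun t s => a (s - t) :=
    fun ha => ha.comp m2
  have k3 : ∀ {a}, IsBoundedKernel a → IsIntegralKernel fun t s => a (t - s) :=
    fun ha => ha.comp m3
  rw [hk.inner_wave hQ hT hQc hf hg]
  congr 1
  -- the integrand, with all boundary values written as convolutions
  set H : ℝ → ℝ := fun s => f 0 s * g 0 s + f 1 s * g 1 s
    + (f 1 s * integralOp (fun t s => scatterKernel Q k 0 (2 * T - t - s)) (g 0) s
      + f 1 s * integralOp (fun t s => scatterKernel Q k 1 (2 * T - t - s)) (g 1) s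
      + f 1 s * integralOp (fun t s => scatterKernel Q k 0 (t - s)) (g 0) s
      + f 1 s * integralOp (fun t s => scatterKernel Q k 1 (t - s)) (g 1) s)
    - (g 0 s * integralOp (fun t s => fluxPrimitive Q k 0 (t - s)) (f 0) s
      + g 0 s * integralOp (fun t s => fluxPrimitive Q k 1 (t - s)) (f 1) s)
    + (f 0 s * integralOp (fun t s => fluxPrimitive Q k 0 (2 * T - t - s)) (g 0) s
      + f 0 s * integralOp (fun t s => fluxPrimitive Q k 1 (2 * T - t - s)) (g 1) s)
    - (f 0 s * integralOp (fun t s => fluxPrimitive Q k 0 (t - s)) (g 0) s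
      + f 0 s * integralOp (fun t s => fluxPrimitive Q k 1 (t - s)) (g 1) s)
    + (g 1 s * integralOp (fun t s => scatterKernel Q k 0 (t - s)) (f 0) s
      + g 1 s * integralOp (fun t s => scatterKernel Q k 1 (t - s)) (f 1) s) with hH
  have e1 : ∫ s in (0 : ℝ)..T, (f 0 s * g 0 s + f 1 s * g 1 s
        - f 1 s * (pairScattered k g 0 (2 * T - s) + pairScattered k g 0 s)
        - g 0 s * pairFlux Q k (pairPrimitive f) 0 s
        + f 0 s * (pairFlux Q k (pairPrimitive g) 0 (2 * T - s)
          - pairFlux Q k (pairPrimitive g) 0 s)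
        - g 1 s * pairScattered k f 0 s) = ∫ s, H s := by
    rw [intervalIntegral.integral_congr (g := H)]
    · rw [← integral_eq_intervalIntegral_of_causal hT.le]
      · intro s hs
        have z : ∀ i, f i s = 0 := fun i => hf.eq_zero i fun h => by linarith [h.1]
        have z' : ∀ i, g i s = 0 := fun i => hg.eq_zero i fun h => by linarith [h.1]
        simp [hH, z, z']
      · intro s hs
        have z : ∀ i, f i s = 0 := fun i => hf.eq_zero i fun h => by linarith [h.2]
        have z' : ∀ i, g i s = 0 := fun i => hg.eq_zero i fun h => by linarith [h.2]
        simp [hH, z, z']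
    · intro s hs
      rw [uIcc_of_le hT.le] at hs
      have hs1 : s ∈ Icc 0 (2 * π) := ⟨hs.1, by linarith [hs.2]⟩
      have hs2 : 2 * T - s ∈ Icc 0 (2 * π) := ⟨by linarith [hs.2], by linarith [hs.1]⟩
      simp only [hH, hk.scattered_zero_eq_conv hgs hs1, hk.scattered_zero_eq_conv hgs hs2,
        hk.scattered_zero_eq_conv hfs hs1, hk.flux_primitive_zero_eq_conv hQ hgs hs1,
        hk.flux_primitive_zero_eq_conv hQ hgs hs2, hk.flux_primitive_zero_eq_conv hQ hfs hs1,
        Fin.sum_univ_two, integralOp]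
      ring
  have hp : ∀ i, HasLineIntegral (fun s => f i s * g i s) (∫ s, f i s * g i s) := fun i =>
    ⟨((hf i).1.continuous.mul (hg i).1.continuous).integrable_of_hasCompactSupport
      (hf i).2.1.mul_right, rfl⟩
  have hl : ∀ {A : ℝ → ℝ → ℝ} {a b : ℝ → ℝ}, IsIntegralKernel A → Integrable a → Integrable b →
      HasLineIntegral (fun s => b s * integralOp A a s) (kernelForm A a b) :=
    fun hA ha hb => ⟨hA.integrable_form ha hb, rfl⟩
  have k1' : ∀ {a}, IsBoundedKernel a → IsIntegralKernel fun t s => a (2 * T - t - s) :=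
    fun ha => (k1 ha).flip
  have hI := ((((((hp 0).add (hp 1)).add
    ((((hl (k1' (S 0)) (hgi 0) (hfi 1)).add (hl (k1' (S 1)) (hgi 1) (hfi 1))).add
      (hl (k3 (S 0)) (hgi 0) (hfi 1))).add (hl (k3 (S 1)) (hgi 1) (hfi 1)))).sub
    ((hl (k3 (P 0)) (hfi 0) (hgi 0)).add (hl (k3 (P 1)) (hfi 1) (hgi 0)))).add
    ((hl (k1' (P 0)) (hgi 0) (hfi 0)).add (hl (k1' (P 1)) (hgi 1) (hfi 0)))).sub
    ((hl (k3 (P 0)) (hgi 0) (hfi 0)).add (hl (k3 (P 1)) (hgi 1) (hfi 0)))).add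
    ((hl (k3 (S 0)) (hfi 0) (hgi 1)).add (hl (k3 (S 1)) (hfi 1) (hgi 1)))
  rw [e1]
  refine hI.2.trans ?_
  rw [(k1' (S 0)).kernelForm_swap (hgi 0) (hfi 1), (k1' (S 1)).kernelForm_swap (hgi 1) (hfi 1),
    (k3 (S 0)).kernelForm_swap (hgi 0) (hfi 1), (k3 (S 1)).kernelForm_swap (hgi 1) (hfi 1),
    (k1' (P 0)).kernelForm_swap (hgi 0) (hfi 0), (k1' (P 1)).kernelForm_swap (hgi 1) (hfi 0),
    (k3 (P 0)).kernelForm_swap (hgi 0) (hfi 0), (k3 (P 1)).kernelForm_swap (hgi 1) (hfi 0)]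
  simp only [Fin.sum_univ_two, greenKernel, Matrix.cons_val_zero, Matrix.cons_val_one,
    Matrix.cons_val_fin_one]
  rw [((k1 (P 0)).sub (k2 (P 0))).kernelForm_sub (k3 (P 0)) (hfi 0) (hgi 0),
    (k1 (P 0)).kernelForm_sub (k2 (P 0)) (hfi 0) (hgi 0),
    ((k1 (S 0)).add (k2 (S 0))).kernelForm_sub (k3 (P 1)) (hfi 1) (hgi 0),
    (k1 (S 0)).kernelForm_add (k2 (S 0)) (hfi 1) (hgi 0),
    ((k1 (P 1)).sub (k2 (P 1))).kernelForm_add (k3 (S 0)) (hfi 0) (hgi 1),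
    (k1 (P 1)).kernelForm_sub (k2 (P 1)) (hfi 0) (hgi 1),
    ((k1 (S 1)).add (k2 (S 1))).kernelForm_add (k3 (S 1)) (hfi 1) (hgi 1),
    (k1 (S 1)).kernelForm_add (k2 (S 1)) (hfi 1) (hgi 1)]
  ring

end IsKernelPair

/-! ### Symmetry of the response matrix -/

theorem eq_zero_of_forall_integral_eq_zero {φ : ℝ → ℝ} {T : ℝ} (hφ : ContinuousOn φ (Ioo 0 T))
    (h : ∀ g : ℝ → ℝ, ContDiff ℝ ∞ g → HasCompactSupport g → tsupport g ⊆ Ioo 0 T →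
      ∫ s, g s * φ s = 0) : ∀ s ∈ Ioo 0 T, φ s = 0 := by
  have h0 := isOpen_Ioo.ae_eq_zero_of_integral_contDiff_smul_eq_zero
    (hφ.locallyIntegrableOn measurableSet_Ioo (μ := volume)) (by simpa only [smul_eq_mul] using h)
  exact Measure.eqOn_open_of_ae_eq (g := fun _ => 0) ((ae_restrict_iff' measurableSet_Ioo).2 h0)
    isOpen_Ioo hφ continuousOn_const

theorem kernelForm_zero_left (A : ℝ → ℝ → ℝ) (g : ℝ → ℝ) : kernelForm A 0 g = 0 := by
  simp [kernelForm, integralOp]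

theorem kernelForm_zero_right (A : ℝ → ℝ → ℝ) (f : ℝ → ℝ) : kernelForm A f 0 = 0 := by
  simp [kernelForm]

namespace IsKernelPair

variable {Q q : ℝ → ℝ} {k : Fin 2 → ℝ → ℝ → ℝ} {T : ℝ}

/-- The inner product of the waves of `(h, 0)` and `(0, g)` is computed in both orders. In the
difference of the two kernels all terms in `s - t` and `t - s` cancel, and only those in `2T - s -
t` remain. -/
theorem kernelForm_response_symm (hQ : Integrable Q) (hk : IsKernelPair Q k)
    (hT : 0 < T) (hTπ : T ≤ π) (hQc : ∀ x, x ≠ 0 → |x| < T → ContinuousAt Q x) {g h : ℝ → ℝ}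
    (hg : ContDiff ℝ ∞ g) (hg' : HasCompactSupport g) (hgT : tsupport g ⊆ Ioo 0 T)
    (hh : ContDiff ℝ ∞ h) (hh' : HasCompactSupport h) (hhT : tsupport h ⊆ Ioo 0 T) :
    kernelForm (fun t s => fluxPrimitive Q k 1 (2 * T - s - t)
      - scatterKernel Q k 0 (2 * T - s - t)) h g = 0 := by
  have t0 := isTestControl_single hh hh' hhT 0
  have t1 := isTestControl_single hg hg' hgT 1
  have e1 := hk.inner_wave_eq_kernelForm hQ hT hTπ hQc t0 t1
  have e2 := hk.inner_wave_eq_kernelForm hQ hT hTπ hQc t1 t0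
  simp only [Fin.sum_univ_two, one_ne_zero, zero_ne_one, if_true, if_false, kernelForm_zero_left,
    kernelForm_zero_right, Pi.zero_apply, mul_zero, zero_mul, integral_zero, add_zero,
    zero_add] at e1 e2
  have hgi := hg.continuous.integrable_of_hasCompactSupport (μ := volume) hg'
  have hhi := hh.continuous.integrable_of_hasCompactSupport (μ := volume) hh'
  have E := hk.isIntegralKernel_greenKernel hQ T
  rw [(E 0 1).kernelForm_swap hgi hhi] at e2
  have e3 := (E 1 0).kernelForm_sub (E 0 1).flip hhi hgi
  have e4 : ∀ x, pairWave k (fun j => if j = 0 then h else 0) x T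
      * pairWave k (fun j => if j = 1 then g else 0) x T
      = pairWave k (fun j => if j = 1 then g else 0) x T
      * pairWave k (fun j => if j = 0 then h else 0) x T := fun x => mul_comm _ _
  simp only [e4] at e1
  have e5 : kernelForm (fun t s => greenKernel Q k T 1 0 t s - greenKernel Q k T 0 1 s t) h g = 0 := by
    rw [e3]
    linarith
  refine Eq.trans ?_ e5
  congr 1
  ext t s
  simp only [greenKernel, Matrix.cons_val_zero, Matrix.cons_val_one, Matrix.cons_val_fin_one]
  rw [sub_right_comm (2 * T) t s]
  ring

/-- Take `T = π`, so that `2π - s - t` runs through all of `(0, 2π)`. The vanishing form gives a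
pointwise statement by two applications of the fundamental lemma, the kernel being continuous in
that range. -/
theorem response_symm (hq : ContinuousOn q (Ioo 0 (2 * π))) (hQ : Integrable (qTilde q))
    (hk : IsKernelPair (qTilde q) k) {u : ℝ} (hu : u ∈ Ioo 0 (2 * π)) :
    primitive (responseMatrix (qTilde q) k) 0 1 u = responseMatrix (qTilde q) k u 1 0 := by
  set d : ℝ → ℝ := fun s => fluxPrimitive (qTilde q) k 1 s - scatterKernel (qTilde q) k 0 s with hd
  have hI : Ioo (0 : ℝ) (2 * π) ∈ 𝓝 u := Ioo_mem_nhds hu.1 hu.2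
  have hdc : ContinuousOn d (Ioo 0 (2 * π)) := by
    refine ContinuousOn.sub ?_ ?_
    · exact ((continuousOn_primitive (hk.integrableOn_response hQ 0 1) (by positivity)).mono
        Ioo_subset_Icc_self).congr fun s hs => indicator_of_mem hs _
    · exact (hk.continuousOn_response hq hQ 1 0).congr fun s hs => indicator_of_mem hs _
  have dK : IsIntegralKernel fun t s => d (2 * π - s - t) := by
    have P := hk.isBoundedKernel_fluxPrimitive hQ
    have S := hk.isBoundedKernel_scatterKernel
    have m1 : Measurable fun p : ℝ × ℝ => 2 * π - p.2 - p.1 := by fun_prop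
    exact ((P 1).comp (φ := fun t s => 2 * π - s - t) m1).sub
      ((S 0).comp (φ := fun t s => 2 * π - s - t) m1)
  obtain ⟨B, hB0, hB⟩ := dK.exists_bound
  have hQc : ∀ x, x ≠ 0 → |x| < π → ContinuousAt (qTilde q) x := fun x hx hxπ =>
    continuousAt_qTilde hq hx (by linarith [Real.pi_pos])
  have key : ∀ t ∈ Ioo 0 π, ∀ s ∈ Ioo 0 π, d (2 * π - s - t) = 0 := by
    intro t ht
    refine eq_zero_of_forall_integral_eq_zero (hdc.comp (by fun_prop) fun s hs =>
      ⟨by linarith [hs.2, ht.2], by linarith [hs.1, ht.1]⟩) fun h hh hh' hhT => ?_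
    have hhi := hh.continuous.integrable_of_hasCompactSupport (μ := volume) hh'
    have hc : ContinuousOn (integralOp (fun t s => d (2 * π - s - t)) h) (Ioo 0 π) := by
      intro τ hτ
      refine ContinuousAt.continuousWithinAt ?_
      refine continuousAt_of_dominated (bound := fun s => B * |h s|) (Eventually.of_forall fun p =>
        (dK.integrable_apply hhi p).aestronglyMeasurable) (Eventually.of_forall fun p =>
        Eventually.of_forall fun s => ?_) (hhi.abs.const_mul B) (Eventually.of_forall fun s => ?_)
      · rw [norm_mul]
        exact mul_le_mul_of_nonneg_right (hB p s) (abs_nonneg _)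
      · by_cases hs : s ∈ Ioo 0 π
        · refine ContinuousAt.mul ?_ continuousAt_const
          refine ContinuousAt.comp (f := fun t : ℝ => 2 * π - s - t) (hdc.continuousAt
            (Ioo_mem_nhds ?_ ?_)) (by fun_prop)
          · linarith [hs.2, hτ.2]
          · linarith [hs.1, hτ.1]
        · have : h s = 0 := image_eq_zero_of_notMem_tsupport fun h => hs (hhT h)
          simp only [this, mul_zero]
          exact continuousAt_const
    have h0 := eq_zero_of_forall_integral_eq_zero hc (fun g hg hg' hgT =>
      hk.kernelForm_response_symm hQ Real.pi_pos le_rfl hQc hg hg' hgT hh hh' hhT) t ht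
    rw [← h0, integralOp]
    congr 1
    ext s
    ring
  -- The choice `s = t = π - u / 2` makes `2π - s - t` equal to `u`.
  have hm : π - u / 2 ∈ Ioo 0 π := ⟨by linarith [hu.2], by linarith [hu.1]⟩
  have h := key _ hm _ hm
  rw [show 2 * π - (π - u / 2) - (π - u / 2) = u by ring, hd] at h
  simp only [fluxPrimitive, scatterKernel, indicator_of_mem hu] at h
  linarith

/-- The kernel produced by Green's formula is the explicit kernel of the connecting operator. -/
theorem greenKernel_eq (hq : ContinuousOn q (Ioo 0 (2 * π))) (hQ : Integrable (qTilde q))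
    (hk : IsKernelPair (qTilde q) k) {r : ℝ → Matrix (Fin 2) (Fin 2) ℝ}
    (hr : EqOn r (responseMatrix (qTilde q) k) (Ioo 0 (2 * π))) (hTπ : T ≤ π) {t s : ℝ}
    (ht : t ∈ Ioo 0 T) (hs : s ∈ Ioo 0 T) (hts : t ≠ s) (i j : Fin 2) :
    greenKernel (qTilde q) k T i j t s / 2 = connectingKernel r T t s i j := by
  have hp : ∀ j, ∀ u ∈ Ioo 0 (2 * π), fluxPrimitive (qTilde q) k j u = primitive r 0 j u := by
    intro j u hu
    rw [fluxPrimitive, indicator_of_mem hu, primitive, primitive,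
      intervalIntegral.integral_of_le hu.1.le, intervalIntegral.integral_of_le hu.1.le]
    refine setIntegral_congr_fun measurableSet_Ioc fun σ hσ => ?_
    simp only [hr ⟨hσ.1, hσ.2.trans_lt hu.2⟩]
  have hs' : ∀ j, ∀ u ∈ Ioo 0 (2 * π), scatterKernel (qTilde q) k j u = r u 1 j := by
    intro j u hu
    rw [scatterKernel, indicator_of_mem hu, hr hu]
  -- The off-diagonal entries from Green's formula mix `r₂₁` and `p₁₂` in other places than the
  -- stated kernel; this identity, with the odd extensions, reconciles them.
  have hps : ∀ u ∈ Ioo 0 (2 * π), primitive r 0 1 u = r u 1 0 := by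
    intro u hu
    rw [← hp 1 u hu, hr hu, ← hk.response_symm hq hQ hu, fluxPrimitive, indicator_of_mem hu]
  have h1 : 2 * T - t - s ∈ Ioo 0 (2 * π) := ⟨by linarith [ht.2, hs.2], by linarith [ht.1, hs.1]⟩
  have hc : 2 * T - s - t = 2 * T - t - s := by ring
  rcases lt_or_gt_of_ne hts with h | h
  · have h2 : s - t ∈ Ioo 0 (2 * π) := ⟨by linarith, by linarith [hs.2, ht.1, Real.pi_pos]⟩
    have z1 : ∀ j, fluxPrimitive (qTilde q) k j (t - s) = 0 := fun j =>
      (hk.isBoundedKernel_fluxPrimitive hQ j).causal _ (by linarith)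
    have z2 : ∀ j, scatterKernel (qTilde q) k j (t - s) = 0 := fun j =>
      (hk.isBoundedKernel_scatterKernel j).causal _ (by linarith)
    have a1 : |t - s| = s - t := by rw [abs_of_neg (by linarith)]; ring
    fin_cases i <;> fin_cases j <;>
    simp [greenKernel, connectingKernel, hc, z1, z2, a1, oddExt, h1.1, hp _ _ h1, hp _ _ h2,
      hs' _ _ h1, hs' _ _ h2, hps _ h1, hps _ h2, h, not_lt.2 h.le] <;> ring
  · have h2 : t - s ∈ Ioo 0 (2 * π) := ⟨by linarith, by linarith [ht.2, hs.1, Real.pi_pos]⟩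
    have z1 : ∀ j, fluxPrimitive (qTilde q) k j (s - t) = 0 := fun j =>
      (hk.isBoundedKernel_fluxPrimitive hQ j).causal _ (by linarith)
    have z2 : ∀ j, scatterKernel (qTilde q) k j (s - t) = 0 := fun j =>
      (hk.isBoundedKernel_scatterKernel j).causal _ (by linarith)
    have a1 : |t - s| = t - s := abs_of_pos h2.1
    fin_cases i <;> fin_cases j <;>
    simp [greenKernel, connectingKernel, hc, z1, z2, a1, oddExt, h1.1, hp _ _ h1, hp _ _ h2,
      hs' _ _ h1, hs' _ _ h2, hps _ h1, hps _ h2, h] <;> ring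

end IsKernelPair

/-! ### The operator with a given matrix kernel -/

/-- The components of `½ (F + K F)`, where `K` is the integral operator with a matrix kernel. -/
def halfSum (K : Fin 2 → Fin 2 → ℝ → ℝ → ℝ) (f : Fin 2 → ℝ → ℝ) (i : Fin 2) (t : ℝ) : ℝ :=
  (f i t + ∑ j, integralOp (K i j) (f j) t) / 2

section KernelOperator

variable {T : ℝ} {K : Fin 2 → Fin 2 → ℝ → ℝ → ℝ}

theorem memLp_integralOp {A : ℝ → ℝ → ℝ} (hA : IsIntegralKernel A) {f : ℝ → ℝ} (hf : Integrable f)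
    (T : ℝ) : MemLp (integralOp A f) 2 (volume.restrict (Ioo 0 T)) := by
  obtain ⟨B, hB0, hB⟩ := hA.exists_bound
  have hm : AEStronglyMeasurable (fun p : ℝ × ℝ => A p.1 p.2 * f p.2)
      ((volume.restrict (Ioo 0 T)).prod volume) :=
    hA.measurable.aestronglyMeasurable.mul hf.1.comp_snd
  refine MemLp.of_bound hm.integral_prod_right' (B * ∫ s, |f s|) (Eventually.of_forall fun t => ?_)
  exact IsIntegralKernel.abs_integralOp_le hB hf t

theorem memLp_halfSum (hK : ∀ i j, IsIntegralKernel (K i j)) (F : Controls T) (i : Fin 2) :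
    MemLp (halfSum K (controlFun F) i) 2 (volume.restrict (Ioo 0 T)) := by
  have h1 : MemLp (controlFun F i) 2 (volume.restrict (Ioo 0 T)) := (memLp_controlFun F i).restrict _
  have h2 : MemLp (fun t => ∑ j, integralOp (K i j) (controlFun F j) t) 2
      (volume.restrict (Ioo 0 T)) :=
    memLp_finsetSum _ fun j _ => memLp_integralOp (hK i j) (integrable_controlFun F j) T
  have h3 := (h1.add h2).const_mul (1 / 2)
  refine h3.ae_eq (Eventually.of_forall fun t => ?_)
  simp only [halfSum, Pi.add_apply]
  ring

/-- The class of `½ (F + K F)`. -/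
def kernelControl (hK : ∀ i j, IsIntegralKernel (K i j)) (F : Controls T) : Controls T :=
  (memLp_pair (memLp_halfSum hK F)).toLp _

theorem inner_kernelControl (hK : ∀ i j, IsIntegralKernel (K i j)) (F G : Controls T) :
    ⟪kernelControl hK F, G⟫ = 1 / 2 * (⟪F, G⟫
      + ∑ i, ∑ j, kernelForm (K i j) (controlFun F j) (controlFun G i)) := by
  have e : ∀ i, controlFun (kernelControl hK F) i
      =ᵐ[volume] indicator (Ioo 0 T) (halfSum K (controlFun F) i) := fun i => by
    have h := (ae_restrict_iff' measurableSet_Ioo).1 (memLp_pair (memLp_halfSum hK F)).coeFn_toLp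
    filter_upwards [h] with t ht
    by_cases hm : t ∈ Ioo 0 T
    · rw [controlFun_eq_of_mem _ _ hm, indicator_of_mem hm, kernelControl, ht hm]
    · rw [controlFun, indicator_of_notMem hm, indicator_of_notMem hm]
  have hF := integrable_controlFun F
  have hG := integrable_controlFun G
  have hl : ∀ i j, HasLineIntegral
      (fun t => controlFun G i t * integralOp (K i j) (controlFun F j) t)
      (kernelForm (K i j) (controlFun F j) (controlFun G i)) :=
    fun i j => ⟨(hK i j).integrable_form (hF j) (hG i), rfl⟩
  have hp : ∀ i, HasLineIntegral (fun t => controlFun F i t * controlFun G i t)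
      (∫ t, controlFun F i t * controlFun G i t) := fun i =>
    ⟨(memLp_controlFun F i).integrable_mul (memLp_controlFun G i), rfl⟩
  have main : ∀ i, ∫ t, indicator (Ioo 0 T) (halfSum K (controlFun F) i) t * controlFun G i t
      = 1 / 2 * ((∫ t, controlFun F i t * controlFun G i t)
        + ∑ j, kernelForm (K i j) (controlFun F j) (controlFun G i)) := fun i => by
    rw [Fin.sum_univ_two, ← ((hp i).add ((hl i 0).add (hl i 1))).2, ← integral_const_mul]
    congr 1
    ext t
    by_cases hm : t ∈ Ioo 0 T
    · rw [indicator_of_mem hm, halfSum, Fin.sum_univ_two]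
      ring
    · rw [indicator_of_notMem hm]
      have : controlFun G i t = 0 := indicator_of_notMem hm _
      rw [this]
      ring
  rw [inner_controls_of_ae e, main, main, inner_controls, Fin.sum_univ_two (f := fun i => ∑ j, _)]
  ring

/-- Transposition moves `F` into a plain slot of an inner product. Continuity in `F` is then
evident, and no operator bound for `kernelControl` has to be proved. -/
theorem inner_kernelControl_flip (hK : ∀ i j, IsIntegralKernel (K i j)) (F G : Controls T) :
    ⟪kernelControl hK F, G⟫ = ⟪kernelControl (fun i j => (hK j i).flip) G, F⟫ := by
  have hF := integrable_controlFun F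
  have hG := integrable_controlFun G
  rw [inner_kernelControl, inner_kernelControl, real_inner_comm]
  simp only [Fin.sum_univ_two]
  rw [(hK 0 0).kernelForm_swap (hF 0) (hG 0), (hK 0 1).kernelForm_swap (hF 1) (hG 0),
    (hK 1 0).kernelForm_swap (hF 0) (hG 1), (hK 1 1).kernelForm_swap (hF 1) (hG 1)]
  ring

end KernelOperator

/-! ### The control operator -/

namespace IsKernelPair

variable {Q q : ℝ → ℝ} {k : Fin 2 → ℝ → ℝ → ℝ} {T : ℝ}

/-- The control operator in terms of the wave kernels. -/
def controlOp (hk : IsKernelPair Q k) (T : ℝ) : Controls T →L[ℝ] States T :=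
  LpToLpRestrictCLM ℝ ℝ ℝ volume 2 (Ioo (-T) T) ∘L hk.waveState T T

theorem coeFn_controlOp (hk : IsKernelPair Q k) (F : Controls T) :
    hk.controlOp T F =ᵐ[volume.restrict (Ioo (-T) T)] hk.waveState T T F :=
  LpToLpRestrictCLM_coeFn ℝ _ _

theorem coeFn_controlOp_of_ae (hk : IsKernelPair Q k) {F : Controls T} {f : Fin 2 → ℝ → ℝ}
    (hF : ∀ i, controlFun F i =ᵐ[volume] f i) :
    hk.controlOp T F =ᵐ[volume.restrict (Ioo (-T) T)] fun x => pairWave k f x T :=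
  (hk.coeFn_controlOp F).trans (ae_restrict_of_ae (hk.coeFn_waveState_of_ae T hF))

/-- Existence is the wave itself. Any other generalized solution coincides with it at time `T`, and
finite speed gives the support. -/
theorem isControlOperator (hq : ContinuousOn q (Ioo 0 (2 * π)))
    (hq2 : MemLp q 2 (volume.restrict (Ioo 0 (2 * π)))) (hk : IsKernelPair (qTilde q) k)
    (hT : 0 < T) (hTπ : T ≤ π) : IsControlOperator q T (hk.controlOp T) := by
  intro F
  have hs := hk.isGeneralizedSolution hq hq2 hT hTπ F
  refine ⟨⟨_, hs⟩, fun v hv => ?_⟩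
  rw [hv.unique hq2 hT hs ⟨hT.le, le_rfl⟩]
  filter_upwards [hk.waveState_eq_zero_of_abs_ge T F,
    (ae_restrict_iff' measurableSet_Ioo).1 (hk.coeFn_controlOp F)] with x h1 h2
  by_cases hx : x ∈ Ioo (-T) T
  · rw [indicator_of_mem hx, h2 hx]
  · rw [indicator_of_notMem hx, h1]
    by_contra hc
    exact hx (abs_lt.1 (not_le.1 hc))

/-- The identity is known for smooth controls and extends by density, first in `G` and then in `F`.
-/
theorem inner_controlOp (hq : ContinuousOn q (Ioo 0 (2 * π))) (hQ : Integrable (qTilde q))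
    (hk : IsKernelPair (qTilde q) k) (hT : 0 < T) (hTπ : T ≤ π) (F G : Controls T) :
    ⟪hk.controlOp T F, hk.controlOp T G⟫
      = ⟪kernelControl (hk.isIntegralKernel_greenKernel hQ T) F, G⟫ := by
  set E := hk.isIntegralKernel_greenKernel hQ T
  have hQc : ∀ x, x ≠ 0 → |x| < T → ContinuousAt (qTilde q) x := fun x hx hxT =>
    continuousAt_qTilde hq hx (by linarith [Real.pi_pos])
  have smooth : ∀ F ∈ smoothControls T, ∀ G ∈ smoothControls T,
      ⟪hk.controlOp T F, hk.controlOp T G⟫ = ⟪kernelControl E F, G⟫ := by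
    rintro F ⟨f, hf, hF⟩ G ⟨g, hg, hG⟩
    have e : ∀ i j, kernelForm (greenKernel (qTilde q) k T i j) (controlFun F j) (controlFun G i)
        = kernelForm (greenKernel (qTilde q) k T i j) (f j) (g i) := fun i j => by
      have e1 : integralOp (greenKernel (qTilde q) k T i j) (controlFun F j)
          = integralOp (greenKernel (qTilde q) k T i j) (f j) := funext fun t =>
        integral_congr_ae ((hF j).mono fun s hs => by simp only [hs])
      rw [kernelForm, kernelForm, e1]
      exact integral_congr_ae ((hG i).mono fun s hs => by simp only [hs])
    have e2 : ∀ i, ∫ t, f i t * controlFun G i t = ∫ t, f i t * g i t := fun i =>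
      integral_congr_ae ((hG i).mono fun s hs => by simp only [hs])
    rw [inner_kernelControl, inner_controls_of_ae hF, e2, e2]
    simp only [e]
    rw [← hk.inner_wave_eq_kernelForm hQ hT hTπ hQc hf hg, L2.inner_def]
    refine integral_congr_ae ?_
    filter_upwards [hk.coeFn_controlOp_of_ae hF, hk.coeFn_controlOp_of_ae hG] with x h1 h2
    rw [h1, h2]
    simp [mul_comm]
  have half : ∀ F ∈ smoothControls T, ∀ G,
      ⟪hk.controlOp T F, hk.controlOp T G⟫ = ⟪kernelControl E F, G⟫ := by
    intro F hF G
    refine (dense_smoothControls T).induction (P := fun G =>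
      ⟪hk.controlOp T F, hk.controlOp T G⟫ = ⟪kernelControl E F, G⟫) (fun G hG => smooth F hF G hG)
      ?_ G
    exact isClosed_eq (continuous_const.inner (hk.controlOp T).continuous)
      (continuous_const.inner continuous_id)
  refine (dense_smoothControls T).induction (P := fun F =>
    ⟪hk.controlOp T F, hk.controlOp T G⟫ = ⟪kernelControl E F, G⟫) (fun F hF => half F hF G) ?_ F
  simp only [inner_kernelControl_flip E]
  exact isClosed_eq ((hk.controlOp T).continuous.inner continuous_const)
    (continuous_const.inner continuous_id)

/-- The connecting operator is given by the response matrix. -/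
theorem connecting_eq_explicit (hq : ContinuousOn q (Ioo 0 (2 * π))) (hQ : Integrable (qTilde q))
    (hk : IsKernelPair (qTilde q) k) (hT : 0 < T) (hTπ : T ≤ π)
    {r : ℝ → Matrix (Fin 2) (Fin 2) ℝ}
    (hr : EqOn r (responseMatrix (qTilde q) k) (Ioo 0 (2 * π)))
    {C : Controls T →L[ℝ] Controls T} (hC : IsConnectingOperator (hk.controlOp T) C)
    (F : Controls T) : (C F : ℝ → EuclideanSpace ℝ (Fin 2))
      =ᵐ[volume.restrict (Ioo 0 T)] explicitConnecting r T F := by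
  set E := hk.isIntegralKernel_greenKernel hQ T
  have h : C F = kernelControl E F := ext_inner_right ℝ fun G => by
    rw [hC, hk.inner_controlOp hq hQ hT hTπ]
  rw [h]
  filter_upwards [(memLp_pair (memLp_halfSum E F)).coeFn_toLp, ae_restrict_mem measurableSet_Ioo]
    with t ht hm
  rw [kernelControl, ht, explicitConnecting]
  congr 1
  ext i
  have hi : ∀ j, Integrable fun s => greenKernel (qTilde q) k T i j t s * controlFun F j s :=
    fun j => (E i j).integrable_apply (integrable_controlFun F j) t
  rw [halfSum, Fin.sum_univ_two, controlFun_eq_of_mem _ _ hm, add_div]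
  congr 1
  rw [integralOp, integralOp, ← integral_add (hi 0) (hi 1), ← integral_div,
    intervalIntegral.integral_of_le hT.le, integral_Ioc_eq_integral_Ioo,
    ← integral_indicator measurableSet_Ioo]
  -- On the diagonal the two kernels need not agree, as the values at `0` of the extensions are
  -- conventions; the diagonal is negligible in the integral.
  have hne : ∀ᵐ s : ℝ, s ≠ t := by simp [ae_iff, measure_singleton]
  refine integral_congr_ae ?_
  filter_upwards [hne] with s hs
  by_cases hsm : s ∈ Ioo 0 T
  · rw [indicator_of_mem hsm, controlFun_eq_of_mem _ _ hsm, controlFun_eq_of_mem _ _ hsm,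
      ← hk.greenKernel_eq hq hQ hr hTπ hm hsm hs.symm, ← hk.greenKernel_eq hq hQ hr hTπ hm hsm hs.symm]
    ring
  · rw [indicator_of_notMem hsm, controlFun, controlFun, indicator_of_notMem hsm,
      indicator_of_notMem hsm]
    ring

end IsKernelPair

/-! ### The Cauchy problem -/

/-- The energy of a solution of `y'' = Q y` is controlled from both sides by its initial value. -/
theorem energy_bounds {Q y z : ℝ → ℝ} {a : ℝ} (hQ : Integrable Q)
    (hQc : ∀ x ∈ Ioo 0 a, ContinuousAt Q x) (hy : ContinuousOn y (Ico 0 a))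
    (hz : ContinuousOn z (Ico 0 a)) (dy : ∀ x ∈ Ioo 0 a, HasDerivAt y (z x) x)
    (dz : ∀ x ∈ Ioo 0 a, HasDerivAt z (Q x * y x) x) {x : ℝ} (hx : x ∈ Ico 0 a) :
    y x ^ 2 + z x ^ 2 ≤ (y 0 ^ 2 + z 0 ^ 2) * Real.exp (∫ s in (0 : ℝ)..x, (1 + |Q s|)) ∧
      y 0 ^ 2 + z 0 ^ 2 ≤ (y x ^ 2 + z x ^ 2) * Real.exp (∫ s in (0 : ℝ)..x, (1 + |Q s|)) := by
  set A : ℝ → ℝ := fun x => ∫ s in (0 : ℝ)..x, (1 + |Q s|) with hA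
  have hint : ∀ u v, IntervalIntegrable (fun s => 1 + |Q s|) volume u v := fun u v =>
    intervalIntegrable_const.add hQ.abs.intervalIntegrable
  have hAc : Continuous A := intervalIntegral.continuous_primitive hint 0
  have dA : ∀ x ∈ Ioo 0 a, HasDerivAt A (1 + |Q x|) x := fun x hx =>
    intervalIntegral.integral_hasDerivAt_right (hint 0 x)
      ((aestronglyMeasurable_const.add hQ.abs.1).stronglyMeasurableAtFilter)
      (continuousAt_const.add (hQc x hx).abs)
  have hsub : Icc 0 x ⊆ Ico 0 a := fun s hs => ⟨hs.1, hs.2.trans_lt hx.2⟩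
  have hsub' : interior (Icc 0 x) ⊆ Ioo 0 a := by
    rw [interior_Icc]
    exact Ioo_subset_Ioo_right hx.2.le
  have hE : ContinuousOn (fun x => y x ^ 2 + z x ^ 2) (Icc 0 x) :=
    ((hy.pow 2).add (hz.pow 2)).mono hsub
  have dE : ∀ x ∈ Ioo 0 a, HasDerivAt (fun x => y x ^ 2 + z x ^ 2)
      (2 * y x * z x + 2 * z x * (Q x * y x)) x := fun x hx =>
    (((dy x hx).pow 2).add ((dz x hx).pow 2)).congr_deriv (by simp)
  have bd : ∀ x, |2 * y x * z x + 2 * z x * (Q x * y x)|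
      ≤ (1 + |Q x|) * (y x ^ 2 + z x ^ 2) := fun x => by
    rw [show 2 * y x * z x + 2 * z x * (Q x * y x) = (1 + Q x) * (2 * (y x * z x)) by ring, abs_mul]
    refine mul_le_mul ((abs_add_le _ _).trans (by simp)) ?_ (abs_nonneg _) (by positivity)
    rw [abs_le]
    constructor <;> nlinarith [sq_nonneg (y x + z x), sq_nonneg (y x - z x)]
  -- The energy satisfies `|E'| ≤ (1 + |Q|) E`, so `E exp (-A)` decreases, giving the upper bound,
  -- while `E exp A` increases, giving the lower one.
  have m1 : AntitoneOn (fun x => (y x ^ 2 + z x ^ 2) * Real.exp (-A x)) (Icc 0 x) := by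
    have d : ∀ s ∈ interior (Icc 0 x), HasDerivAt (fun x => (y x ^ 2 + z x ^ 2) * Real.exp (-A x))
        ((2 * y s * z s + 2 * z s * (Q s * y s)) * Real.exp (-A s)
          + (y s ^ 2 + z s ^ 2) * (Real.exp (-A s) * -(1 + |Q s|))) s := fun s hs =>
      (dE s (hsub' hs)).mul (dA s (hsub' hs)).neg.exp
    refine antitoneOn_of_deriv_nonpos (convex_Icc 0 x)
      (hE.mul (by fun_prop : Continuous fun x => Real.exp (-A x)).continuousOn)
      (fun s hs => (d s hs).differentiableAt.differentiableWithinAt) fun s hs => ?_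
    rw [(d s hs).deriv]
    have := (le_abs_self _).trans (bd s)
    have e := Real.exp_pos (-A s)
    nlinarith
  have m2 : MonotoneOn (fun x => (y x ^ 2 + z x ^ 2) * Real.exp (A x)) (Icc 0 x) := by
    have d : ∀ s ∈ interior (Icc 0 x), HasDerivAt (fun x => (y x ^ 2 + z x ^ 2) * Real.exp (A x))
        ((2 * y s * z s + 2 * z s * (Q s * y s)) * Real.exp (A s)
          + (y s ^ 2 + z s ^ 2) * (Real.exp (A s) * (1 + |Q s|))) s := fun s hs =>
      (dE s (hsub' hs)).mul (dA s (hsub' hs)).exp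
    refine monotoneOn_of_deriv_nonneg (convex_Icc 0 x)
      (hE.mul (by fun_prop : Continuous fun x => Real.exp (A x)).continuousOn)
      (fun s hs => (d s hs).differentiableAt.differentiableWithinAt) fun s hs => ?_
    rw [(d s hs).deriv]
    have := (neg_abs_le _).trans' (neg_le_neg (bd s))
    have e := Real.exp_pos (A s)
    nlinarith
  have h1 := m1 (left_mem_Icc.2 hx.1) (right_mem_Icc.2 hx.1) hx.1
  have h2 := m2 (left_mem_Icc.2 hx.1) (right_mem_Icc.2 hx.1) hx.1
  have hA0 : A 0 = 0 := by simp [hA]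
  simp only [hA0, neg_zero, Real.exp_zero, mul_one] at h1 h2
  refine ⟨?_, h2⟩
  rw [Real.exp_neg, ← div_eq_mul_inv, div_le_iff₀ (Real.exp_pos _)] at h1
  exact h1

namespace IsCauchySolution

variable {q y : ℝ → ℝ}

theorem hasDerivAt (hy : IsCauchySolution q y) {x : ℝ} (hx : x ∈ Ioo (-π) π) :
    HasDerivAt y (deriv y x) x :=
  ((hy.contDiffOn.differentiableOn (by norm_num)).differentiableAt
    (Ioo_mem_nhds hx.1 hx.2)).hasDerivAt

theorem continuousOn_deriv (hy : IsCauchySolution q y) : ContinuousOn (deriv y) (Ioo (-π) π) :=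
  hy.contDiffOn.continuousOn_deriv_of_isOpen isOpen_Ioo le_rfl

/-- The upper bound makes `y` Lipschitz on the open interval; the lower bound excludes a common zero
of `y` and `y'`. The left half is reduced to the right one by reflection, with the potential
`q̃(-x)`. -/
theorem energy (hq : ContinuousOn q (Ioo 0 (2 * π))) (hQ : Integrable (qTilde q))
    (hy : IsCauchySolution q y) {x : ℝ} (hx : x ∈ Ioo (-π) π) :
    y x ^ 2 + deriv y x ^ 2 ≤ Real.exp (π + ∫ s, |qTilde q s|) ∧ 0 < y x ^ 2 + deriv y x ^ 2 := by
  have hexp : ∀ {Q : ℝ → ℝ} (_ : Integrable Q) {x : ℝ} (_ : x ∈ Ico 0 π),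
      Real.exp (∫ s in (0 : ℝ)..x, (1 + |Q s|)) ≤ Real.exp (π + ∫ s, |Q s|) := by
    intro Q hQ x hx
    refine Real.exp_le_exp.2 ?_
    rw [intervalIntegral.integral_add intervalIntegrable_const hQ.abs.intervalIntegrable]
    refine add_le_add (by simpa using hx.2.le) ?_
    rw [intervalIntegral.integral_of_le hx.1]
    exact setIntegral_le_integral hQ.abs (Eventually.of_forall fun s => abs_nonneg _)
  have hyc : ContinuousOn y (Ioo (-π) π) := hy.contDiffOn.continuousOn
  have hzc := hy.continuousOn_deriv
  have hQc : ∀ x ∈ Ioo (-π) π, x ≠ 0 → ContinuousAt (qTilde q) x := fun x hx h0 =>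
    continuousAt_qTilde hq h0 (by
      rw [abs_lt]
      constructor <;> linarith [hx.1, hx.2, Real.pi_pos])
  rcases le_or_gt 0 x with h0 | h0
  · have hsub : Ico 0 π ⊆ Ioo (-π) π := fun s hs => ⟨by linarith [hs.1, Real.pi_pos], hs.2⟩
    have hsub' : Ioo 0 π ⊆ Ioo (-π) π := Ioo_subset_Ico_self.trans hsub
    have h := energy_bounds hQ (fun x hx => hQc x (hsub' hx) hx.1.ne') (hyc.mono hsub)
      (hzc.mono hsub) (fun x hx => hy.hasDerivAt (hsub' hx))
      (fun x hx => hy.ode x (hsub' hx) hx.1.ne') ⟨h0, hx.2⟩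
    rw [hy.value_zero, hy.deriv_zero] at h
    norm_num at h
    refine ⟨h.1.trans (hexp hQ ⟨h0, hx.2⟩), ?_⟩
    exact pos_of_mul_pos_left (one_pos.trans_le h.2) (Real.exp_pos _).le
  · have hmaps : MapsTo (fun s : ℝ => -s) (Ico 0 π) (Ioo (-π) π) := fun s hs =>
      ⟨by linarith [hs.2], by linarith [hs.1, Real.pi_pos]⟩
    have hmem : ∀ s ∈ Ioo 0 π, -s ∈ Ioo (-π) π := fun s hs => hmaps (Ioo_subset_Ico_self hs)
    have hne : ∀ s ∈ Ioo 0 π, -s ≠ 0 := fun s hs => neg_ne_zero.2 hs.1.ne'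
    have h := energy_bounds (Q := fun s => qTilde q (-s)) (y := fun s => y (-s))
      (z := fun s => -deriv y (-s)) (a := π) hQ.comp_neg
      (fun x hx => ContinuousAt.comp (f := fun s : ℝ => -s) (hQc _ (hmem x hx) (hne x hx))
        continuousAt_neg)
      (hyc.comp continuousOn_neg hmaps) ((hzc.comp continuousOn_neg hmaps).neg)
      (fun x hx => ((hy.hasDerivAt (hmem x hx)).comp x (hasDerivAt_neg x)).congr_deriv (by ring))
      (fun x hx => ((hy.ode _ (hmem x hx) (hne x hx)).comp x (hasDerivAt_neg x)).neg.congr_deriv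
        (by ring)) (x := -x) ⟨by linarith, by linarith [hx.1]⟩
    have he := hexp hQ.comp_neg (x := -x) ⟨by linarith, by linarith [hx.1]⟩
    rw [integral_neg_eq_self (fun s => |qTilde q s|)] at he
    simp only [neg_zero, neg_neg, hy.value_zero, hy.deriv_zero] at h
    norm_num at h
    refine ⟨h.1.trans he, ?_⟩
    exact pos_of_mul_pos_left (one_pos.trans_le h.2) (Real.exp_pos _).le

/-- The zeros of `y` are isolated. -/
theorem eventually_ne_zero (hq : ContinuousOn q (Ioo 0 (2 * π))) (hQ : Integrable (qTilde q))
    (hy : IsCauchySolution q y) {x : ℝ} (hx : x ∈ Ioo (-π) π) : ∀ᶠ z in 𝓝[≠] x, y z ≠ 0 := by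
  have h := (hy.energy hq hQ hx).2
  by_cases h0 : y x = 0
  · refine (hy.hasDerivAt hx).eventually_ne fun h1 => ?_
    rw [h0, h1] at h
    norm_num at h
  · exact ((hy.hasDerivAt hx).continuousAt.eventually_ne h0).filter_mono nhdsWithin_le_nhds

/-- A continuous extension of `y` to the line. -/
theorem exists_continuous_extension (hq : ContinuousOn q (Ioo 0 (2 * π)))
    (hQ : Integrable (qTilde q)) (hy : IsCauchySolution q y) :
    ∃ Y : ℝ → ℝ, Continuous Y ∧ EqOn y Y (Ioo (-π) π) := by
  have h : LipschitzOnWith (Real.toNNReal (Real.exp (π + ∫ s, |qTilde q s|) + 1)) y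
      (Ioo (-π) π) := by
    refine Convex.lipschitzOnWith_of_nnnorm_hasDerivWithin_le (convex_Ioo _ _)
      (fun x hx => (hy.hasDerivAt hx).hasDerivWithinAt) fun x hx => ?_
    rw [← NNReal.coe_le_coe, Real.coe_toNNReal _ (by positivity), coe_nnnorm, Real.norm_eq_abs]
    have := (hy.energy hq hQ hx).1
    -- The bound used is `|y'| ≤ y'² + 1`.
    nlinarith [sq_nonneg (|deriv y x| - 1), sq_abs (deriv y x), sq_nonneg (y x)]
  obtain ⟨Y, hY, hE⟩ := h.extend_real
  exact ⟨Y, hY.continuous, hE⟩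

theorem tendsto_ratio (hq : ContinuousOn q (Ioo 0 (2 * π))) (hQ : Integrable (qTilde q))
    (hy : IsCauchySolution q y) {x : ℝ} (hx : x ∈ Ioo (-π) π) (h0 : x ≠ 0) :
    (y x ≠ 0 → qTilde q x = deriv (deriv y) x / y x) ∧
      Tendsto (fun z => deriv (deriv y) z / y z) (𝓝[≠] x) (𝓝 (qTilde q x)) := by
  constructor
  · intro h
    rw [(hy.ode x hx h0).deriv, mul_div_cancel_right₀ _ h]
  · have hc : ContinuousAt (qTilde q) x := continuousAt_qTilde hq h0 (by
      rw [abs_lt]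
      constructor <;> linarith [hx.1, hx.2, Real.pi_pos])
    refine (hc.mono_left nhdsWithin_le_nhds).congr' ?_
    filter_upwards [hy.eventually_ne_zero hq hQ hx,
      mem_nhdsWithin_of_mem_nhds (isOpen_ne.mem_nhds h0),
      mem_nhdsWithin_of_mem_nhds (Ioo_mem_nhds hx.1 hx.2)] with z h1 h2 h3
    rw [(hy.ode z h3 h2).deriv, mul_div_cancel_right₀ _ h1]

end IsCauchySolution

/-! ### The inner product of a wave and the solution of the Cauchy problem -/

variable {q y : ℝ → ℝ} {k : Fin 2 → ℝ → ℝ → ℝ} {f : Fin 2 → ℝ → ℝ} {T : ℝ}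

/-- `(T - t) y(x)` is linear in time and `-y'' + q̃ y = 0`, so it solves the wave equation off the
origin. It vanishes at `T` with velocity `-y`; its trace at the origin is `0` and its slope there is
`T - t`. The indicator is present because nothing is known about `y` outside `(-π, π)`. -/
theorem IsCauchySolution.isMultiplier (hQ : Integrable (qTilde q)) (hy : IsCauchySolution q y)
    (hTπ : T ≤ π) {Y : ℝ → ℝ} (hY : Continuous Y)
    (hE : EqOn y Y (Ioo (-π) π)) :
    IsMultiplier T (fun x t => (T - t) * indicator (Ioo (-π) π) y x)
      (fun x _ => -indicator (Ioo (-π) π) y x) (fun _ _ => 0) (fun x t => (T - t) * deriv y x)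
      (fun x t => (T - t) * (qTilde q x * indicator (Ioo (-π) π) y x)) (fun _ => 0) (fun _ => 0)
      (fun t => T - t) (fun t => T - t) := by
  have e : indicator (Ioo (-π) π) y = indicator (Ioo (-π) π) Y := indicator_congr hE
  have hm : Measurable (indicator (Ioo (-π) π) y) := by
    rw [e]
    exact hY.measurable.indicator measurableSet_Ioo
  obtain ⟨B, hB⟩ := isCompact_Icc.exists_bound_of_continuousOn (hY.continuousOn (s := Icc (-π) π))
  have hbd : ∀ x, |indicator (Ioo (-π) π) y x| ≤ max B 0 := fun x => by
    rw [e]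
    by_cases hx : x ∈ Ioo (-π) π
    · rw [indicator_of_mem hx]
      exact (hB x (Ioo_subset_Icc_self hx)).trans (le_max_left _ _)
    · rw [indicator_of_notMem hx, abs_zero]
      exact le_max_right _ _
  have hmem : ∀ {x}, |x| < T → x ∈ Ioo (-π) π := fun h => abs_lt.1 (h.trans_le hTπ)
  have h0 : (0 : ℝ) ∈ Ioo (-π) π := ⟨by linarith [Real.pi_pos], Real.pi_pos⟩
  have hev : ∀ {x}, x ∈ Ioo (-π) π → indicator (Ioo (-π) π) y =ᶠ[𝓝 x] y := fun hx => by
    filter_upwards [Ioo_mem_nhds hx.1 hx.2] with z hz using indicator_of_mem hz _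
  have hlim : ∀ t, Tendsto (fun x => (T - t) * indicator (Ioo (-π) π) y x) (𝓝 0) (𝓝 0) := by
    intro t
    have : ContinuousAt (indicator (Ioo (-π) π) y) 0 :=
      (hy.hasDerivAt h0).continuousAt.congr (hev h0).symm
    have h := this.tendsto.const_mul (T - t)
    rwa [indicator_of_mem h0, hy.value_zero, mul_zero] at h
  have hlim' : ∀ t, Tendsto (fun x => (T - t) * deriv y x) (𝓝 0) (𝓝 (T - t)) := by
    intro t
    have := (hy.continuousOn_deriv.continuousAt (Ioo_mem_nhds h0.1 h0.2)).tendsto.const_mul (T - t)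
    rwa [hy.deriv_zero, mul_one] at this
  exact
  { time := fun x t => (((hasDerivAt_id t).const_sub T).mul_const _).congr_deriv (by ring)
    time_two := fun x t => hasDerivAt_const _ _
    continuous := fun x => continuous_const
    measurable := (measurable_const.sub measurable_snd).mul (hm.comp measurable_fst)
    measurable_two := measurable_const
    bound := ⟨|T| * max B 0, by positivity, fun x t ht => ⟨by
      rw [abs_mul]
      refine mul_le_mul ?_ (hbd x) (abs_nonneg _) (abs_nonneg _)
      exact abs_le_abs_of_nonneg (by linarith [ht.2]) (by linarith [ht.1]), by
      rw [abs_zero]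
      positivity⟩⟩
    space := fun t _ x _ hxT => ((hy.hasDerivAt (hmem hxT)).congr_of_eventuallyEq
      (hev (hmem hxT))).const_mul _
    space_two := fun t _ x hx hxT => by
      rw [indicator_of_mem (hmem hxT)]
      exact (hy.ode x (hmem hxT) hx).const_mul _
    integrable := fun t _ => ((hQ.mul_bdd (c := max B 0) hm.aestronglyMeasurable
      (Eventually.of_forall hbd)).const_mul _).integrableOn
    right := fun t _ => (hlim t).mono_left nhdsWithin_le_nhds
    left := fun t _ => (hlim t).mono_left nhdsWithin_le_nhds
    slope_right := fun t _ => (hlim' t).mono_left nhdsWithin_le_nhds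
    slope_left := fun t _ => (hlim' t).mono_left nhdsWithin_le_nhds }

/-- In Green's identity with the multiplier `(T - t) y(x)` the volume term cancels. The conditions
`y(0) = 0` and `y'(0) = 1` reduce the jump term to `-f₁(t) (T - t)`, so `f₂` disappears. -/
theorem IsKernelPair.integral_wave_mul_cauchy (hq : ContinuousOn q (Ioo 0 (2 * π)))
    (hQ : Integrable (qTilde q)) (hk : IsKernelPair (qTilde q) k) (hT : 0 < T) (hTπ : T ≤ π)
    (hy : IsCauchySolution q y) (hf : ∀ i, SmoothCausal (f i)) :
    ∫ x in Ioo (-T) T, pairWave k f x T * y x = ∫ t in (0 : ℝ)..T, f 0 t * (T - t) := by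
  obtain ⟨Y, hY, hE⟩ := hy.exists_continuous_extension hq hQ
  have h := hk.green hQ hT (fun x hx hxT => continuousAt_qTilde hq hx (by
    linarith [Real.pi_pos])) hf (hy.isMultiplier hQ hTπ hY hE)
  have e : ∀ x t, pairWave k f x t * (0 - (T - t) * (qTilde q x * indicator (Ioo (-π) π) y x)
      + qTilde q x * ((T - t) * indicator (Ioo (-π) π) y x)) = 0 := fun x t => by ring
  simp only [e, wronskianJump_self, integral_zero] at h
  simp only [mul_zero, sub_self, zero_mul, zero_sub, zero_add, sub_zero, mul_neg,
    intervalIntegral.integral_neg, integral_neg, neg_inj] at h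
  rw [← h]
  refine setIntegral_congr_fun measurableSet_Ioo fun x hx => ?_
  rw [indicator_of_mem]
  exact ⟨by linarith [hx.1], by linarith [hx.2]⟩

/-! ### The control problem as a Volterra equation -/

/-- The Volterra operator of the control problem, in terms of the distance to the wave front. -/
def frontVolterra (k : Fin 2 → ℝ → ℝ → ℝ) (T : ℝ) (f : Fin 2 → ℝ → ℝ) : Fin 2 → ℝ → ℝ :=
  ![fun t => pairScattered k f (-(T - t)) T - pairScattered k f (T - t) T,
    fun t => pairScattered k f (-(T - t)) T + pairScattered k f (T - t) T]

/-- The values of a function to be reached, in terms of the distance to the wave front. -/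
def frontValue (T : ℝ) (w : ℝ → ℝ) : Fin 2 → ℝ → ℝ :=
  ![fun t => w (T - t) - w (-(T - t)), fun t => -w (T - t) - w (-(T - t))]

section Volterra

variable {Q : ℝ → ℝ} {k : Fin 2 → ℝ → ℝ → ℝ} {f g : Fin 2 → ℝ → ℝ} {T : ℝ}

/-- At the points `x = ±(T - t)` the incoming part of the wave at time `T` contains the controls at
time `t` only. The two equations there are solved for `f₁(t)` and `f₂(t)`. -/
theorem eq_frontValue_add_frontVolterra (k : Fin 2 → ℝ → ℝ → ℝ) (f : Fin 2 → ℝ → ℝ) {t : ℝ}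
    (ht : t < T) (i : Fin 2) :
    f i t = frontValue T (fun x => pairWave k f x T) i t + frontVolterra k T f i t := by
  have h1 := pairWave_pos k f (x := T - t) (by linarith) T
  have h2 := pairWave_neg k f (x := -(T - t)) (by linarith) T
  rw [sub_sub_cancel] at h1
  rw [← sub_eq_add_neg, sub_sub_cancel] at h2
  fin_cases i
  · simp only [frontValue, frontVolterra, Fin.zero_eta, Matrix.cons_val_zero, h1, h2]
    ring
  · simp only [frontValue, frontVolterra, Fin.mk_one, Matrix.cons_val_one, Matrix.cons_val_fin_one,
      h1, h2]
    ring

theorem pairWave_eq_of_frontVolterra {w : ℝ → ℝ}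
    (h : ∀ t ∈ Ioo 0 T, ∀ i, f i t = frontValue T w i t + frontVolterra k T f i t) {x : ℝ}
    (hx : x ∈ Ioo (-T) T) (hx0 : x ≠ 0) : pairWave k f x T = w x := by
  rcases lt_or_gt_of_ne hx0 with hx' | hx'
  · have ht : T + x ∈ Ioo 0 T := ⟨by linarith [hx.1], by linarith⟩
    have h0 := h _ ht 0
    have h1 := h _ ht 1
    rw [pairWave_neg k f hx', h0, h1]
    simp only [frontValue, frontVolterra, Matrix.cons_val_zero, Matrix.cons_val_one,
      Matrix.cons_val_fin_one, sub_add_cancel_left, neg_neg]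
    ring
  · have ht : T - x ∈ Ioo 0 T := ⟨by linarith [hx.2], by linarith⟩
    have h0 := h _ ht 0
    have h1 := h _ ht 1
    rw [pairWave_pos k f hx', h0, h1]
    simp only [frontValue, frontVolterra, Matrix.cons_val_zero, Matrix.cons_val_one,
      Matrix.cons_val_fin_one, sub_sub_cancel]
    ring

theorem frontVolterra_congr_ae (k : Fin 2 → ℝ → ℝ → ℝ) (T : ℝ) (h : ∀ i, f i =ᵐ[volume] g i) :
    frontVolterra k T f = frontVolterra k T g := by
  have e : ∀ x, pairScattered k f x T = pairScattered k g x T := fun x =>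
    Finset.sum_congr rfl fun i _ => integral_congr_ae ((h i).mono fun s hs => by simp only [hs])
  simp only [frontVolterra, e]

namespace IsKernelPair

theorem frontVolterra_sub (hk : IsKernelPair Q k) (hf : ∀ i, Causal (f i))
    (hfi : ∀ i, LocallyIntegrable (f i)) (hg : ∀ i, Causal (g i))
    (hgi : ∀ i, LocallyIntegrable (g i)) (i : Fin 2) (t : ℝ) :
    frontVolterra k T (fun i s => f i s - g i s) i t
      = frontVolterra k T f i t - frontVolterra k T g i t := by
  have e : ∀ x, pairScattered k (fun i s => f i s - g i s) x T
      = pairScattered k f x T - pairScattered k g x T := fun x => by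
    simp only [pairScattered, scattered, ← Finset.sum_sub_distrib, mul_sub]
    exact Finset.sum_congr rfl fun i _ => integral_sub
      ((hk i).integrable_conv (hf i) (hfi i) x T) ((hk i).integrable_conv (hg i) (hgi i) x T)
  fin_cases i
  · simp only [frontVolterra, Fin.zero_eta, Matrix.cons_val_zero, e]
    ring
  · simp only [frontVolterra, Fin.mk_one, Matrix.cons_val_one, Matrix.cons_val_fin_one, e]
    ring

theorem continuous_frontVolterra (hk : IsKernelPair Q k) (hf : ∀ i, Causal (f i))
    (hfi : ∀ i, LocallyIntegrable (f i)) (i : Fin 2) : Continuous (frontVolterra k T f i) := by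
  have c1 : Continuous fun t => pairScattered k f (T - t) T :=
    (hk.continuous_scattered hf hfi).comp (by fun_prop : Continuous fun t : ℝ => (T - t, T))
  have c2 : Continuous fun t => pairScattered k f (-(T - t)) T :=
    (hk.continuous_scattered hf hfi).comp (by fun_prop : Continuous fun t : ℝ => (-(T - t), T))
  fin_cases i
  · exact c2.sub c1
  · exact c2.add c1

/-- A point at distance `T - t` from the origin is reached at time `T` only by controls that acted
before `t`; this is the support of the kernels, and it makes the operator of Volterra type. Two
points and two kernels give the constant `2 (B₀ + B₁)`. -/
theorem exists_bound_frontVolterra (hk : IsKernelPair Q k) :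
    ∃ L, 0 ≤ L ∧ ∀ f : Fin 2 → ℝ → ℝ, (∀ i, Causal (f i)) → ∀ t ∈ Icc 0 T, ∀ m : ℝ → ℝ,
      Continuous m → (∀ i, ∀ s ∈ Ioc 0 t, |f i s| ≤ m s) → ∀ i,
      |frontVolterra k T f i t| ≤ L * ∫ s in (0 : ℝ)..t, m s := by
  obtain ⟨B₀, hB₀0, hB₀⟩ := (hk 0).exists_bound T
  obtain ⟨B₁, hB₁0, hB₁⟩ := (hk 1).exists_bound T
  have key : ∀ j B, (∀ x t, t ≤ T → |k j x t| ≤ B) → ∀ f : Fin 2 → ℝ → ℝ, (∀ i, Causal (f i)) →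
      ∀ t ∈ Icc 0 T, ∀ m : ℝ → ℝ, Continuous m → (∀ i, ∀ s ∈ Ioc 0 t, |f i s| ≤ m s) →
      ∀ x, |x| = T - t → |scattered (k j) (f j) x T| ≤ B * ∫ s in (0 : ℝ)..t, m s := by
    intro j B hB f hf t ht m hm hfm x hx
    have e : scattered (k j) (f j) x T = ∫ s in (0 : ℝ)..t, k j x (T - s) * f j s := by
      refine integral_eq_intervalIntegral_of_causal ht.1 (fun s hs => ?_) fun s hs => ?_
      · rw [hf j s hs, mul_zero]
      · rw [(hk j).support x _ (by linarith), zero_mul]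
    rw [e, ← intervalIntegral.integral_const_mul]
    refine intervalIntegral.norm_integral_le_of_norm_le (f := fun s => k j x (T - s) * f j s) ht.1
      (ae_of_all _ fun s hs => ?_) ((hm.const_mul B).intervalIntegrable (μ := volume) _ _)
    rw [norm_mul]
    exact mul_le_mul (hB x _ (by linarith [hs.1])) (hfm j s hs) (abs_nonneg _)
      ((abs_nonneg _).trans (hB x T le_rfl))
  refine ⟨2 * (B₀ + B₁), by positivity, fun f hf t ht m hm hfm i => ?_⟩
  have hx : |T - t| = T - t := abs_of_nonneg (by linarith [ht.2])
  have hx' : |-(T - t)| = T - t := by rw [abs_neg, hx]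
  have bd : ∀ x, |x| = T - t → |pairScattered k f x T| ≤ (B₀ + B₁) * ∫ s in (0 : ℝ)..t, m s := by
    intro x hx
    rw [pairScattered, Fin.sum_univ_two, add_mul]
    exact (abs_add_le _ _).trans (add_le_add (key 0 B₀ hB₀ f hf t ht m hm hfm x hx)
      (key 1 B₁ hB₁ f hf t ht m hm hfm x hx))
  have b1 := bd _ hx
  have b2 := bd _ hx'
  fin_cases i
  · refine (abs_sub _ _).trans ?_
    linarith
  · refine (abs_add_le _ _).trans ?_
    linarith

theorem frontVolterra_zero (hk : IsKernelPair Q k) (hT : 0 < T) (hf : ∀ i, Causal (f i))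
    (i : Fin 2) : frontVolterra k T f i 0 = 0 := by
  obtain ⟨L, hL, h⟩ := hk.exists_bound_frontVolterra (T := T)
  have := h f hf 0 ⟨le_rfl, hT.le⟩ (fun _ => 0) continuous_const
    (fun i s hs => by linarith [hs.1, hs.2]) i
  simpa using this

/-- The homogeneous Volterra equation has only the trivial solution. -/
theorem eq_zero_of_frontVolterra (hk : IsKernelPair Q k) (hf : ∀ i, Causal (f i))
    (hfi : ∀ i, LocallyIntegrable (f i))
    (h : ∀ t ∈ Ioc 0 T, ∀ i, f i t = frontVolterra k T f i t) : ∀ t ∈ Ioc 0 T, ∀ i, f i t = 0 := by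
  obtain ⟨L, hL, hb⟩ := hk.exists_bound_frontVolterra (T := T)
  have hc := fun i => hk.continuous_frontVolterra (T := T) hf hfi i
  obtain ⟨A₀, hA₀⟩ := isCompact_Icc.exists_bound_of_continuousOn ((hc 0).continuousOn (s := Icc 0 T))
  obtain ⟨A₁, hA₁⟩ := isCompact_Icc.exists_bound_of_continuousOn ((hc 1).continuousOn (s := Icc 0 T))
  intro t ht i
  rw [h t ht i]
  refine eq_zero_of_volterra_bound (φ := frontVolterra k T f) (T := T) (A := max A₀ A₁) hL ?_ ?_ i
    ⟨ht.1.le, ht.2⟩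
  · intro i t ht
    fin_cases i
    · exact (hA₀ t ht).trans (le_max_left _ _)
    · exact (hA₁ t ht).trans (le_max_right _ _)
  · intro m hm _ _ hφ i t ht
    refine hb f hf t ht m hm (fun j s hs => ?_) i
    rw [h s ⟨hs.1, hs.2.trans ht.2⟩ j]
    exact hφ j s ⟨hs.1.le, hs.2.trans ht.2⟩

/-- Solvability of the Volterra equation in continuous functions. -/
theorem exists_frontVolterra_solution (hk : IsKernelPair Q k) (hT : 0 < T) {h : Fin 2 → ℝ → ℝ}
    (hh : ∀ i, Continuous (h i)) : ∃ u : Fin 2 → ℝ → ℝ, (∀ i, Continuous (u i)) ∧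
      ∀ t ∈ Icc 0 T, ∀ i,
        u i t = h i t + frontVolterra k T (fun i => indicator (Ioc 0 T) (u i)) i t := by
  obtain ⟨L, hL, hb⟩ := hk.exists_bound_frontVolterra (T := T)
  -- In the sup norm weighted by `exp (-c t)` the operator has norm at most `L / c`, which is below
  -- `½` for this `c`.
  set c : ℝ := 2 * L + 1 with hc
  have hc0 : 0 < c := by positivity
  -- The fixed point is the weighted unknown `exp (-c t) u(t)` on `[0, T]`. `lift` removes the
  -- weight and extends continuously to the line, `ext` makes the result causal.
  let lift : C(Icc (0 : ℝ) T, Fin 2 → ℝ) → Fin 2 → ℝ → ℝ := fun u i s =>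
    Real.exp (c * s) * u (projIcc 0 T hT.le s) i
  have lift_cont : ∀ u i, Continuous (lift u i) := fun u i => by
    have h1 : Continuous fun s => u (projIcc 0 T hT.le s) i :=
      (continuous_apply i).comp (u.continuous.comp continuous_projIcc)
    exact (by fun_prop : Continuous fun s => Real.exp (c * s)).mul h1
  let ext : C(Icc (0 : ℝ) T, Fin 2 → ℝ) → Fin 2 → ℝ → ℝ := fun u i => indicator (Ioc 0 T) (lift u i)
  have ext_causal : ∀ u i, Causal (ext u i) := fun u i s hs =>
    indicator_of_notMem (fun h => by linarith [h.1]) _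
  have ext_int : ∀ u i, LocallyIntegrable (ext u i) := fun u i =>
    ((integrable_indicator_iff measurableSet_Ioc).2
      ((lift_cont u i).integrableOn_Ioc)).locallyIntegrable
  have vc : ∀ u i, Continuous (frontVolterra k T (ext u) i) := fun u i =>
    hk.continuous_frontVolterra (ext_causal u) (ext_int u) i
  let Φ : C(Icc (0 : ℝ) T, Fin 2 → ℝ) → C(Icc (0 : ℝ) T, Fin 2 → ℝ) := fun u =>
    ⟨fun t i => Real.exp (-(c * t)) * (h i t + frontVolterra k T (ext u) i t), by
      refine continuous_pi fun i => ?_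
      have := hh i
      have := vc u i
      fun_prop⟩
  have hΦ : ContractingWith (1 / 2) Φ := by
    refine ⟨by norm_num, LipschitzWith.of_dist_le_mul fun u v => ?_⟩
    have hD : 0 ≤ dist u v := dist_nonneg
    have h2 : ((1 / 2 : NNReal) : ℝ) = 1 / 2 := by norm_num
    rw [h2, ContinuousMap.dist_le (by positivity)]
    intro t
    rw [dist_pi_le_iff (by positivity)]
    intro i
    have ht := t.2
    have e : dist (Φ u t i) (Φ v t i)
        = Real.exp (-(c * t)) * |frontVolterra k T (fun i s => ext u i s - ext v i s) i t| := by
      rw [hk.frontVolterra_sub (ext_causal u) (ext_int u) (ext_causal v) (ext_int v), Real.dist_eq]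
      refine Eq.trans ?_ (by rw [abs_mul, abs_of_pos (Real.exp_pos (-(c * t)))] :
        |Real.exp (-(c * t)) * (frontVolterra k T (ext u) i t - frontVolterra k T (ext v) i t)| = _)
      congr 1
      change Real.exp (-(c * t)) * (h i t + frontVolterra k T (ext u) i t)
        - Real.exp (-(c * t)) * (h i t + frontVolterra k T (ext v) i t) = _
      ring
    have hbd := hb (fun i s => ext u i s - ext v i s)
      (fun i s hs => by simp only [ext_causal u i s hs, ext_causal v i s hs, sub_zero]) t ht
      (fun s => Real.exp (c * s) * dist u v) (by fun_prop) (fun j s hs => by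
        have hs' : s ∈ Ioc 0 T := ⟨hs.1, hs.2.trans ht.2⟩
        simp only [ext, indicator_of_mem hs', lift]
        rw [← mul_sub, abs_mul, abs_of_pos (Real.exp_pos _)]
        refine mul_le_mul_of_nonneg_left ?_ (Real.exp_pos _).le
        rw [← Real.dist_eq]
        exact (dist_le_pi_dist _ _ j).trans (ContinuousMap.dist_apply_le_dist _)) i
    have hI : ∫ s in (0 : ℝ)..t, Real.exp (c * s) * dist u v
        = (Real.exp (c * t) - 1) / c * dist u v := by
      rw [intervalIntegral.integral_mul_const,
        intervalIntegral.integral_comp_mul_left (fun s => Real.exp s) hc0.ne', integral_exp,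
        mul_zero, Real.exp_zero, smul_eq_mul, inv_mul_eq_div]
    rw [hI] at hbd
    rw [e]
    have he : Real.exp (-(c * t)) * Real.exp (c * t) = 1 := by
      rw [← Real.exp_add, neg_add_cancel, Real.exp_zero]
    calc Real.exp (-(c * t)) * |frontVolterra k T (fun i s => ext u i s - ext v i s) i t|
        ≤ Real.exp (-(c * t)) * (L * ((Real.exp (c * t) - 1) / c * dist u v)) :=
          mul_le_mul_of_nonneg_left hbd (Real.exp_pos _).le
      _ = L / c * dist u v * (Real.exp (-(c * t)) * Real.exp (c * t) - Real.exp (-(c * t))) := by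
          field_simp
      _ ≤ L / c * dist u v * 1 := by
          refine mul_le_mul_of_nonneg_left ?_ (by positivity)
          rw [he]
          linarith [Real.exp_pos (-(c * t))]
      _ ≤ 1 / 2 * dist u v := by
          rw [mul_one]
          refine mul_le_mul_of_nonneg_right ?_ hD
          rw [div_le_iff₀ hc0, hc]
          linarith
  have : Nonempty C(Icc (0 : ℝ) T, Fin 2 → ℝ) := ⟨0⟩
  set u := ContractingWith.fixedPoint Φ hΦ with hu
  have hfix : Φ u = u := hΦ.fixedPoint_isFixedPt
  refine ⟨lift u, lift_cont u, fun t ht i => ?_⟩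
  have h1 : u ⟨t, ht⟩ i = Real.exp (-(c * t)) * (h i t + frontVolterra k T (ext u) i t) := by
    conv_lhs => rw [← hfix]
    rfl
  simp only [lift, projIcc_of_mem hT.le ht]
  rw [h1, ← mul_assoc, ← Real.exp_add, add_neg_cancel, Real.exp_zero, one_mul]

end IsKernelPair

end Volterra

/-! ### The control problem -/

namespace IsKernelPair

variable {q y : ℝ → ℝ} {Q : ℝ → ℝ} {k : Fin 2 → ℝ → ℝ → ℝ} {T : ℝ}

/-- A control with vanishing final state satisfies the homogeneous Volterra equation almost
everywhere, so uniqueness for that equation gives zero. -/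
theorem injective_controlOp (hk : IsKernelPair Q k) (hT : 0 < T) {F : Controls T}
    (hF : hk.controlOp T F = 0) : F = 0 := by
  set f := controlFun F with hf
  have hfc : ∀ i, Causal (f i) := causal_controlFun F
  have hfi : ∀ i, LocallyIntegrable (f i) := fun i => (integrable_controlFun F i).locallyIntegrable
  have h0 : ∀ᵐ x, x ∈ Ioo (-T) T → pairWave k f x T = 0 := by
    have h1 := hk.coeFn_controlOp_of_ae (F := F) fun i => ae_eq_refl _
    rw [hF] at h1
    have h2 := Lp.coeFn_zero ℝ 2 (volume.restrict (Ioo (-T) T))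
    rw [← ae_restrict_iff' measurableSet_Ioo]
    filter_upwards [h1, h2] with x h1 h2
    rw [← h1, h2, Pi.zero_apply]
  have p1 : ∀ᵐ t, T - t ∈ Ioo (-T) T → pairWave k f (T - t) T = 0 :=
    (Measure.measurePreserving_sub_left volume T).quasiMeasurePreserving.ae h0
  have p2 : ∀ᵐ t, -(T - t) ∈ Ioo (-T) T → pairWave k f (-(T - t)) T = 0 :=
    ((Measure.measurePreserving_neg volume).comp
      (Measure.measurePreserving_sub_left volume T)).quasiMeasurePreserving.ae h0
  have hne : ∀ᵐ t : ℝ, t ≠ T := by simp [ae_iff, measure_singleton]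
  -- Since `frontVolterra` depends only on the class of the control, the representative `g`
  -- satisfies the equation at every time of `(0, T]`, not merely almost everywhere.
  set g : Fin 2 → ℝ → ℝ := fun i => indicator (Ioc 0 T) (frontVolterra k T f i) with hg
  have hfg : ∀ i, f i =ᵐ[volume] g i := fun i => by
    filter_upwards [p1, p2, hne] with t h1 h2 h3
    by_cases ht : t ∈ Ioc 0 T
    · have ht' : t < T := lt_of_le_of_ne ht.2 h3
      have a1 := h1 ⟨by linarith, by linarith [ht.1]⟩
      have a2 := h2 ⟨by linarith [ht.1], by linarith⟩
      rw [hg]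
      simp only [indicator_of_mem ht]
      rw [eq_frontValue_add_frontVolterra k f ht' i]
      rw [neg_sub] at a2
      fin_cases i <;> simp [frontValue, a1, a2]
    · rw [hg]
      simp only [indicator_of_notMem ht]
      exact indicator_of_notMem (fun h => ht (Ioo_subset_Ioc_self h)) _
  have hgc : ∀ i, Causal (g i) := fun i s hs => indicator_of_notMem (fun h => by linarith [h.1]) _
  have hgi : ∀ i, LocallyIntegrable (g i) := fun i =>
    ((integrable_indicator_iff measurableSet_Ioc).2
      (hk.continuous_frontVolterra hfc hfi i).integrableOn_Ioc).locallyIntegrable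
  have hz := hk.eq_zero_of_frontVolterra hgc hgi fun t ht i => by
    rw [← frontVolterra_congr_ae k T hfg, hg]
    exact indicator_of_mem ht _
  refine Lp.ext ?_
  filter_upwards [Lp.coeFn_zero (EuclideanSpace ℝ (Fin 2)) 2 (volume.restrict (Ioo 0 T)),
    ae_restrict_mem measurableSet_Ioo, ae_restrict_of_ae (hfg 0), ae_restrict_of_ae (hfg 1)]
    with t h1 ht h2 h3
  rw [h1]
  rw [hz t (Ioo_subset_Ioc_self ht), hf, controlFun_eq_of_mem _ _ ht] at h2 h3
  ext i
  fin_cases i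
  · exact h2
  · exact h3

/-- Every continuous function is reached by a continuous control. -/
theorem exists_control (hk : IsKernelPair Q k) (hT : 0 < T) {Y : ℝ → ℝ} (hY : Continuous Y) :
    ∃ (F : Controls T) (u : Fin 2 → ℝ → ℝ), (∀ i, Continuous (u i)) ∧
      (F : ℝ → EuclideanSpace ℝ (Fin 2)) =ᵐ[volume.restrict (Ioo 0 T)]
        (fun t => WithLp.toLp 2 fun i => u i t) ∧
      hk.controlOp T F =ᵐ[volume.restrict (Ioo (-T) T)] Y ∧
      ∀ i, u i 0 = frontValue T Y i 0 := by
  have hh : ∀ i, Continuous (frontValue T Y i) := fun i => by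
    fin_cases i
    · exact (by fun_prop : Continuous fun t => Y (T - t) - Y (-(T - t)))
    · exact (by fun_prop : Continuous fun t => -Y (T - t) - Y (-(T - t)))
  obtain ⟨u, hu, h⟩ := hk.exists_frontVolterra_solution hT hh
  have hum := memLp_pair fun i => memLp_of_continuousOn_Icc (T := T) (hu i).continuousOn
  set g : Fin 2 → ℝ → ℝ := fun i => indicator (Ioc 0 T) (u i) with hg
  have hgc : ∀ i, Causal (g i) := fun i s hs => indicator_of_notMem (fun h => by linarith [h.1]) _
  have hne : ∀ a : ℝ, ∀ᵐ t : ℝ, t ≠ a := fun a => by simp [ae_iff, measure_singleton]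
  have hFg : ∀ i, controlFun (hum.toLp _) i =ᵐ[volume] g i := fun i => by
    filter_upwards [(ae_restrict_iff' measurableSet_Ioo).1 hum.coeFn_toLp, hne T] with t h1 h2
    by_cases ht : t ∈ Ioo 0 T
    · rw [controlFun_eq_of_mem _ _ ht, h1 ht]
      exact (indicator_of_mem (Ioo_subset_Ioc_self ht) _).symm
    · rw [controlFun, indicator_of_notMem ht]
      exact (indicator_of_notMem (fun h => ht ⟨h.1, lt_of_le_of_ne h.2 h2⟩) _).symm
  refine ⟨hum.toLp _, u, hu, hum.coeFn_toLp, ?_, fun i => ?_⟩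
  · filter_upwards [hk.coeFn_controlOp_of_ae hFg, ae_restrict_of_ae (hne 0),
      ae_restrict_mem measurableSet_Ioo] with x h1 h2 h3
    rw [h1]
    refine pairWave_eq_of_frontVolterra (fun t ht i => ?_) h3 h2
    rw [← h t (Ioo_subset_Icc_self ht) i, hg]
    exact indicator_of_mem (Ioo_subset_Ioc_self ht) _
  -- At `t = 0`, the front `|x| = T`, there is no scattered wave yet; the initial value of the
  -- control is given by the target alone, which is the source of the recovery formulas.
  · rw [h 0 ⟨le_rfl, hT.le⟩, hk.frontVolterra_zero hT hgc, add_zero]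

/-- In terms of the adjoint this reads `W* y = (T - t, 0)`. It is the identity of
`integral_wave_mul_cauchy` for smooth controls, extended by density. -/
theorem inner_controlOp_cauchy (hq : ContinuousOn q (Ioo 0 (2 * π)))
    (hQ : Integrable (qTilde q)) (hk : IsKernelPair (qTilde q) k) (hT : 0 < T) (hTπ : T ≤ π)
    (hy : IsCauchySolution q y) {S : States T} (hS : S =ᵐ[volume.restrict (Ioo (-T) T)] y)
    {P : Controls T}
    (hP : (P : ℝ → EuclideanSpace ℝ (Fin 2)) =ᵐ[volume.restrict (Ioo 0 T)] fun t => !₂[T - t, 0])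
    (F : Controls T) : ⟪hk.controlOp T F, S⟫ = ⟪F, P⟫ := by
  refine (dense_smoothControls T).induction (P := fun F => ⟪hk.controlOp T F, S⟫ = ⟪F, P⟫) ?_ ?_ F
  · rintro F ⟨f, hf, hF⟩
    have h := hk.integral_wave_mul_cauchy hq hQ hT hTπ hy hf.smoothCausal
    have h1 : ⟪hk.controlOp T F, S⟫ = ∫ x in Ioo (-T) T, pairWave k f x T * y x := by
      rw [L2.inner_def]
      refine integral_congr_ae ?_
      filter_upwards [hk.coeFn_controlOp_of_ae hF, hS] with x h1 h2
      rw [h1, h2]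
      simp [mul_comm]
    rw [h1, h, L2.inner_def, intervalIntegral.integral_of_le hT.le, integral_Ioc_eq_integral_Ioo]
    refine integral_congr_ae ?_
    filter_upwards [hP, ae_restrict_mem measurableSet_Ioo, ae_restrict_of_ae (hF 0)] with t h1 h2 h3
    rw [controlFun_eq_of_mem _ _ h2] at h3
    rw [h1, ← h3]
    simp [PiLp.inner_apply, Fin.sum_univ_two, mul_comm]
  · exact isClosed_eq ((hk.controlOp T).continuous.inner continuous_const)
      (continuous_id.inner continuous_const)

/-- The Krein equation characterizes the control which reaches the solution of the Cauchy
problem. -/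
theorem krein_equation (hq : ContinuousOn q (Ioo 0 (2 * π)))
    (hQ : Integrable (qTilde q)) (hk : IsKernelPair (qTilde q) k) (hT : 0 < T) (hTπ : T ≤ π)
    (hy : IsCauchySolution q y) {C : Controls T →L[ℝ] Controls T}
    (hC : IsConnectingOperator (hk.controlOp T) C) {F : Controls T}
    (hF : hk.controlOp T F =ᵐ[volume.restrict (Ioo (-T) T)] y) (G : Controls T) :
    (C G : ℝ → EuclideanSpace ℝ (Fin 2)) =ᵐ[volume.restrict (Ioo 0 T)] (fun t => !₂[T - t, 0])
      ↔ G = F := by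
  have hm : ∀ i, MemLp ((![fun t => T - t, fun _ => 0] : Fin 2 → ℝ → ℝ) i) 2
      (volume.restrict (Ioo 0 T)) := fun i => by
    fin_cases i
    · exact memLp_of_continuousOn_Icc (by fun_prop : Continuous fun t => T - t).continuousOn
    · exact memLp_of_continuousOn_Icc continuousOn_const
  have hP : ((memLp_pair hm).toLp _ : ℝ → EuclideanSpace ℝ (Fin 2))
      =ᵐ[volume.restrict (Ioo 0 T)] fun t => !₂[T - t, 0] := by
    filter_upwards [(memLp_pair hm).coeFn_toLp] with t ht
    rw [ht]
    ext i
    fin_cases i <;> rfl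
  set P := (memLp_pair hm).toLp _ with hPdef
  have hCF : C F = P := ext_inner_right ℝ fun H => by
    rw [hC, real_inner_comm, hk.inner_controlOp_cauchy hq hQ hT hTπ hy hF hP, real_inner_comm]
  constructor
  · intro h
    have hCG : C G = P := Lp.ext (h.trans hP.symm)
    rw [← sub_eq_zero]
    refine hk.injective_controlOp hT ?_
    -- `C` is injective: `(C H, H) = ‖W H‖²`, so `C H = 0` forces `W H = 0`, and `W` is injective.
    have h0 : C (G - F) = 0 := by rw [map_sub, hCG, hCF, sub_self]
    have h1 := hC (G - F) (G - F)
    rw [h0, inner_zero_left] at h1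
    exact inner_self_eq_zero.1 h1.symm
  · rintro rfl
    rw [hCF]
    exact hP

end IsKernelPair

end KreinPeriodic

end

/-! ### The main theorem -/

open KreinPeriodic in
theorem theorem4 (q : ℝ → ℝ) (hq : ContDiffOn ℝ 2 q (Ioo 0 (2 * π)))
    (hq2 : MemLp q 2 (volume.restrict (Ioo 0 (2 * π)))) :
    (∃ r, IsResponseMatrix q r) ∧
    ∀ r, IsResponseMatrix q r → ∀ y, IsCauchySolution q y →
      (∀ T : ℝ, 0 < T → T ≤ π →
        ∃ (W : Controls T →L[ℝ] States T) (C : Controls T →L[ℝ] Controls T),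
          IsControlOperator q T W ∧
          IsConnectingOperator W C ∧
          (∀ F : Controls T, (C F : ℝ → EuclideanSpace ℝ (Fin 2))
            =ᵐ[volume.restrict (Ioo 0 T)] explicitConnecting r T F) ∧
          ∃ F : Controls T,
            (∀ G : Controls T,
              (W G : ℝ → ℝ) =ᵐ[volume.restrict (Ioo (-T) T)] y ↔ G = F) ∧
            (∀ G : Controls T,
              (C G : ℝ → EuclideanSpace ℝ (Fin 2))
                =ᵐ[volume.restrict (Ioo 0 T)] (fun t => !₂[T - t, 0]) ↔ G = F) ∧
            (T < π → ∃ f : ℝ → EuclideanSpace ℝ (Fin 2),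
              ContinuousOn f (Icc 0 T) ∧
              (F : ℝ → EuclideanSpace ℝ (Fin 2)) =ᵐ[volume.restrict (Ioo 0 T)] f ∧
              y T = f 0 0 / 2 - f 0 1 / 2 ∧
              y (-T) = -(f 0 0) / 2 - f 0 1 / 2)) ∧
      (∀ x ∈ Ioo (-π) π, ∀ᶠ z in 𝓝[≠] x, y z ≠ 0) ∧
      (∀ x ∈ Ioo (-π) π, x ≠ 0 →
        (y x ≠ 0 → qTilde q x = deriv (deriv y) x / y x) ∧
        Tendsto (fun z => deriv (deriv y) z / y z) (𝓝[≠] x) (𝓝 (qTilde q x))) ∧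
      (∀ x ∈ Ioo 0 π, q x = qTilde q x) ∧
      (∀ x ∈ Ioo π (2 * π), q x = qTilde q (x - 2 * π)) := by
  have hqc := hq.continuousOn
  have hqi : IntegrableOn q (Ioo 0 (2 * π)) := hq2.integrable (by norm_num)
  have hQ := integrable_qTilde hq2
  obtain ⟨k, hk⟩ := exists_isKernelPair hQ
  have hR := hk.isResponseMatrix hqc hqi hQ
  refine ⟨⟨_, hR⟩, fun r hr y hy => ⟨fun T hT hTπ => ?_, fun x hx => hy.eventually_ne_zero hqc hQ hx,
    fun x hx h0 => hy.tendsto_ratio hqc hQ hx h0, fun x hx => ?_, fun x hx => ?_⟩⟩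
  -- For `T = π` the state space reaches the ends of the interval on which `y` is controlled. The
  -- continuous extension serves as target instead and agrees with `y` on `(-T, T)`.
  · obtain ⟨Y, hY, hE⟩ := hy.exists_continuous_extension hqc hQ
    obtain ⟨F, u, hu, hFu, hWF, hu0⟩ := hk.exists_control hT hY
    have hWy : hk.controlOp T F =ᵐ[volume.restrict (Ioo (-T) T)] y := by
      filter_upwards [hWF, ae_restrict_mem measurableSet_Ioo] with x h1 h2
      rw [h1, hE ⟨by linarith [h2.1], by linarith [h2.2]⟩]
    -- The connecting operator is `W* W`.
    set C := (hk.controlOp T).adjoint ∘L hk.controlOp T with hCdef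
    have hC : IsConnectingOperator (hk.controlOp T) C := fun F G => by
      rw [hCdef, ContinuousLinearMap.comp_apply, ContinuousLinearMap.adjoint_inner_left]
    refine ⟨hk.controlOp T, C, hk.isControlOperator hqc hq2 hT hTπ, hC,
      hk.connecting_eq_explicit hqc hQ hT hTπ (hr.eqOn hR) hC, F, fun G => ⟨fun h => ?_, ?_⟩,
      hk.krein_equation hqc hQ hT hTπ hy hC hWy, fun hTlt => ?_⟩
    · rw [← sub_eq_zero]
      refine hk.injective_controlOp hT ?_
      rw [map_sub, sub_eq_zero]
      exact Lp.ext (h.trans hWy.symm)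
    · rintro rfl
      exact hWy
    -- The initial values of the continuous control are `Y(T) - Y(-T)` and `-Y(T) - Y(-T)`, and
    -- solving these for `Y(±T)` gives the two formulas. Since `T < π`, the points `±T` are
    -- interior, so `Y` may be replaced by `y`.
    · refine ⟨_, Continuous.continuousOn ?_, hFu, ?_, ?_⟩
      · exact (PiLp.continuous_toLp 2 _).comp (continuous_pi hu)
      · simp only [hu0]
        rw [hE ⟨by linarith, hTlt⟩]
        simp [frontValue]
        ring
      · simp only [hu0]
        rw [hE ⟨by linarith, by linarith⟩]
        simp [frontValue]
        ring
  · rw [qTilde, if_pos ⟨hx.1, by linarith [hx.2, Real.pi_pos]⟩]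
  · rw [qTilde, if_neg (fun h => by linarith [h.1, hx.2]),
      if_pos ⟨by linarith [hx.1, Real.pi_pos], by linarith [hx.2]⟩, sub_add_cancel]
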